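/- \textbf{Notation.} Let $d,n\in\mathbb N$, $\omega\in\mathbb R^d$, $\Lambda=\mathrm{diag}(\lambda_1,\dots,\lambda_n)$ with $\lambda_j\in\mathbb C$, and $S=\sum_{j=1}^d\omega_j\partial_{X_j}+\sum_{j=1}^n\lambda_jY_j\partial_{Y_j}$. For $r,\delta>0$ let $\mathcal V_r\times\mathcal W_\delta=\{(X,Y)\in(\mathbb C/2\pi\mathbb Z)^d\times\mathbb C^n:\ |\mathrm{Im}X_j|<r,\ |Y_j|<\delta\}$, a neighbourhood of $\mathbb T^d\times\{0\}$. For a (formal) series $f=\sum_{P\in\mathbb Z^d,Q\in\mathbb N^n}f_{P,Q}e^{i\langle P,X\rangle}Y^Q$ put $|f|_{r,\delta}=\sum|f_{P,Q}|e^{r|P|}\delta^{|Q|}$, where $|P|=\sum|P_j|$, $|Q|=\sum Q_j$; a formal series is required to satisfy $\sum_P|f_{P,Q}|^2<\infty$ for each $Q$; it has order $k$ if $f_{P,Q}=0$ for $|Q|<k$; its constant part is $f_{0,0}$. For a $(d+n)$-tuple of series, $T^k$ is the truncation to degree $\le k$ in $Y$ of the $X$-components and to degree $\le k+1$ in $Y$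 of the $Y$-components. A formal vector field $F$ is resonant if only monomials $e^{i\langle P,X\rangle}Y^Q$ with $i\langle P,\omega\rangle+\langle Q,\Lambda\rangle=0$ occur in its $X$-components, and only those with $i\langle P,\omega\rangle+\langle Q,\Lambda\rangle=\lambda_j$ in its $Y_j$-component. A formal diffeomorphism is $\Phi=\mathrm{Id}+\varphi$, $\varphi$ a $(d+n)$-tuple of series, such that for every $k$ the map $T^k\Phi=\mathrm{Id}+T^k\varphi$ is an analytic diffeomorphism of a neighbourhood of $\mathbb T^d\times\{0\}$ onto its image mapping $\mathbb T^d\times\{0\}$ into itself. An analytic vector field $G$ is formally conjugate to a formal vector field $F$ if $T^k(D(T^k\Phi)\cdot F)=T^k(G\circ T^k\Phi)$ for all $k\in\mathbb N$, for some formal diffeomorphism $\Phi$; if $F$ is resonant, it is called a formal normal form of $G$. \textbf{Brjuno's $\gamma$ and $\omega$ conditions.} Let $\mathcal E$ be the set of all $Q\in\mathbb Z^n$ such that either $Q\in\mathbb N^n$, or $|Q|:=\sum Q_j\ge1$, exactly one entry of $Q$ is $-1$ and the others are $\ge0$. $S$ satisfies the conditions if there are a positive increasing unbounded function $g$ on $[1,\infty)$,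 an increasing sequence of integers $(m_k)_{k\ge0}$ and sequences of positive reals $(\epsilon_k)_{k\ge0},(r_k)_{k\ge0}$ such that (1) $m_0=1$, $m_{k+1}\le2m_k+1$; (2) $\sum_{k\ge1}\frac{\ln g(m_k)}{m_k}<\infty$; (3) $(n+2)g(m_k)\ln g(m_k)\ge m_k$ for all $k\ge 0$; (4) for all $k$ and all $P\in\mathbb Z^d$, $Q\in\mathcal E$ with $|P|>m_k$, $|Q|\le m_k$ and $i\langle P,\omega\rangle+\langle Q,\Lambda\rangle\ne0$: $|i\langle P,\omega\rangle+\langle Q,\Lambda\rangle|^{-1}\le e^{\epsilon_k|P|}$; (5) for all $k$ and all $P\in\mathbb Z^d$, $Q\in\mathcal E$ with $|P|\le m_k$, $|Q|\le m_k$ and $i\langle P,\omega\rangle+\langle Q,\Lambda\rangle\ne0$: $|i\langle P,\omega\rangle+\langle Q,\Lambda\rangle|^{-1}\le g(m_k)$; (6) $r_k-r_{k+1}-\epsilon_k>0$ and $4^{4d+6}(r_k-r_{k+1}-\epsilon_k)^{-4d-6}\le g(m_k)$ for all $k$; (7) $r_k>\frac12$ for all $k$. (Here ``increasing'' is meant in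 the wide sense.) \textbf{Theorem.} Assume that $S$ satisfies Brjuno's $\gamma$ and $\omega$ conditions. Then there is $\zeta_0>0$, depending only on $\Lambda,\omega,n,d$, with the following property. Let $r,\delta>0$ and let $F=(F_1,\dots,F_d)$, $G=(G_1,\dots,G_n)$ be analytic on $\mathcal V_r\times\mathcal W_\delta$, the $F_j$ of order $1$ and the $G_j$ of order $2$ in $Y$ (that is, $F(X,0)=0$, $G(X,0)=0$, $\partial_YG(X,0)=0$), with $|F_j|_{r,\delta}\le\zeta_0$ and $|G_j|_{r,\delta}\le\zeta_0$ for all $j$. Assume that the system $$\dot X=\omega+F(X,Y),\qquad\dot Y=\Lambda Y+G(X,Y)$$ has a formal normal form equal to $a\cdot S$ for a formal series $a$ with constant part $1$ (Brjuno's $A$ condition). Then the system is holomorphically conjugate, on a neighbourhood of $\mathbb T^d\times\{0\}$, to a resonant vector field $b\cdot S$: there are $\rho>0$, a holomorphic function $b$ on $\mathcal V_\rho\times\mathcal W_\rho$ with constant part $1$ and $b\cdot S$ resonant, and a holomorphic diffeomorphism $\Psi$ of $\mathcal V_\rho\times\mathcal W_\rho$ onto its image in $\mathcal V_r\times\mathcal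 W_\delta$, mapping $\mathbb T^d\times\{0\}$ into itself, such that $D\Psi\cdot(bS)=(S+(F,G))\circ\Psi$. -/

import Mathlib

namespace TorusNF

noncomputable section

/-- The phase space `ℂ^d × ℂ^n`, with points `(X, Y)`. Objects on `(ℂ/2πℤ)^d × ℂ^n` are described
by objects on `ℂ^d × ℂ^n` that are `2π`-periodic (for maps: equivariant) in each `X_j`. -/
abbrev Phase (d n : ℕ) : Type := (Fin d → ℂ) × (Fin n → ℂ)

/-- The `d + n` components of a vector: `inl j` is the `X_j` one, `inr j` is the `Y_j` one. -/
def comp {d n : ℕ} (Z : Phase d n) : Fin d ⊕ Fin n → ℂ := Sum.elim Z.1 Z.2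

/-- The domain `V_r × W_δ`: `|Im X_j| < r` and `|Y_j| < δ` for all `j`. -/
def domain (d n : ℕ) (r δ : ℝ) : Set (Phase d n) :=
  {Z | (∀ j, |(Z.1 j).im| < r) ∧ ∀ j, ‖Z.2 j‖ < δ}

/-- The torus `𝕋^d × {0}` (lifted to `ℝ^d × {0}`). -/
def torus (d n : ℕ) : Set (Phase d n) := {Z | (∀ j, (Z.1 j).im = 0) ∧ Z.2 = 0}

/-- Translation of the `X` variables by the period `2πP`. -/
def shift {d n : ℕ} (P : Fin d → ℤ) (Z : Phase d n) : Phase d n :=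
  (fun j => Z.1 j + 2 * (Real.pi : ℂ) * (P j : ℂ), Z.2)

/-! ### Fourier-Taylor series -/

/-- Indices `(P, Q) ∈ ℤ^d × ℕ^n`. -/
abbrev Idx (d n : ℕ) : Type := (Fin d → ℤ) × (Fin n → ℕ)

/-- `|P| = ∑ |P_j|`. -/
def absP {d : ℕ} (P : Fin d → ℤ) : ℕ := ∑ j, (P j).natAbs

/-- `|Q| = ∑ Q_j`. -/
def degQ {n : ℕ} (Q : Fin n → ℕ) : ℕ := ∑ j, Q j

/-- The function `e^{i⟨P,X⟩} Y^Q`. -/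
def mono {d n : ℕ} (p : Idx d n) (Z : Phase d n) : ℂ :=
  Complex.exp (Complex.I * ∑ j, (p.1 j : ℂ) * Z.1 j) * ∏ j, Z.2 j ^ p.2 j

/-- The family of coefficients `f_{P,Q}` of a series `∑ f_{P,Q} e^{i⟨P,X⟩} Y^Q`. -/
abbrev Series (d n : ℕ) : Type := Idx d n → ℂ

/-- A formal Fourier-Taylor series: square summable in `P` for each `Q`. -/
def IsFormal {d n : ℕ} (f : Series d n) : Prop :=
  ∀ Q : Fin n → ℕ, Summable fun P : Fin d → ℤ => ‖f (P, Q)‖ ^ 2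

/-- `f` has order `k` (in `Y`). -/
def HasOrder {d n : ℕ} (k : ℕ) (f : Series d n) : Prop := ∀ p : Idx d n, degQ p.2 < k → f p = 0

/-- The weighted norm `∑ |f_{P,Q}| e^{r|P|} δ^{|Q|}`, with values in `[0, ∞]`. -/
def wnorm {d n : ℕ} (r δ : ℝ) (f : Series d n) : ENNReal :=
  ∑' p : Idx d n, ENNReal.ofReal (‖f p‖ * Real.exp (r * absP p.1) * δ ^ degQ p.2)

/-- `u` is a holomorphic function on `V_r × W_δ` of finite weighted norm whose Taylor-Fourier
development has coefficients `f`. -/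
def IsDevelopment {d n : ℕ} (r δ : ℝ) (u : Phase d n → ℂ) (f : Series d n) : Prop :=
  wnorm r δ f < ⊤ ∧ ∀ Z ∈ domain d n r δ, HasSum (fun p => f p * mono p Z) (u Z)

/-- The sum of a series. -/
def eval {d n : ℕ} (f : Series d n) (Z : Phase d n) : ℂ := ∑' p, f p * mono p Z

/-- The product of two formal series. -/
def mul {d n : ℕ} (f g : Series d n) : Series d n := fun p =>
  ∑ Q ∈ Finset.Iic p.2, ∑' P : Fin d → ℤ, f (P, Q) * g (p.1 - P, p.2 - Q)

/-- The formal derivative `∂/∂X_j`. -/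
def derivX {d n : ℕ} (j : Fin d) (f : Series d n) : Series d n := fun p =>
  Complex.I * (p.1 j : ℂ) * f p

/-- The formal derivative `∂/∂Y_j`. -/
def derivY {d n : ℕ} (j : Fin n) (f : Series d n) : Series d n := fun p =>
  ((p.2 j : ℂ) + 1) * f (p.1, p.2 + Pi.single j 1)

/-! ### Formal vector fields, formal diffeomorphisms, formal conjugacy -/

/-- The coefficients of the `d + n` components of a formal vector field. -/
abbrev FormalVF (d n : ℕ) : Type := Fin d ⊕ Fin n → Series d n

/-- The truncation `T^k`: degree `k` in `Y` for the `X` components, `k + 1` for the `Y` ones. -/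
def trunc {d n : ℕ} (k : ℕ) (F : FormalVF d n) : FormalVF d n :=
  Sum.elim (fun j p => if degQ p.2 ≤ k then F (Sum.inl j) p else 0)
    (fun j p => if degQ p.2 ≤ k + 1 then F (Sum.inr j) p else 0)

/-- The map `Id + φ`. -/
def idAdd {d n : ℕ} (φ : FormalVF d n) (Z : Phase d n) : Phase d n :=
  (fun j => Z.1 j + eval (φ (Sum.inl j)) Z, fun j => Z.2 j + eval (φ (Sum.inr j)) Z)

/-- The formal vector field `DΦ · F` for `Φ = Id + φ`. -/
def jacobianApply {d n : ℕ} (φ F : FormalVF d n) : FormalVF d n := fun L p =>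
  F L p + ∑ j, mul (derivX j (φ L)) (F (Sum.inl j)) p
    + ∑ j, mul (derivY j (φ L)) (F (Sum.inr j)) p

/-- `Φ` induces a holomorphic diffeomorphism of the neighbourhood `V_ρ × W_ρ` of `𝕋^d × {0}`
in `(ℂ/2πℤ)^d × ℂ^n` onto its image; it maps the torus `𝕋^d × {0}` to itself. -/
structure IsTorusDiffeo {d n : ℕ} (ρ : ℝ) (Φ : Phase d n → Phase d n) : Prop where
  holomorphic : DifferentiableOn ℂ Φ (domain d n ρ ρ)
  equivariant : ∀ Z ∈ domain d n ρ ρ, ∀ P : Fin d → ℤ, Φ (shift P Z) = shift P (Φ Z)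
  injective : ∀ Z ∈ domain d n ρ ρ, ∀ Z' ∈ domain d n ρ ρ, ∀ P : Fin d → ℤ,
    Φ Z' = shift P (Φ Z) → ∃ P' : Fin d → ℤ, Z' = shift P' Z
  deriv_bijective : ∀ Z ∈ domain d n ρ ρ, Function.Bijective (fderiv ℂ Φ Z)
  torus_mapsTo : Set.MapsTo Φ (torus d n) (torus d n)

/-- `Φ = Id + φ` is a formal diffeomorphism: each truncation `T^k Φ = Id + T^k φ` is an analytic
diffeomorphism on some neighbourhood (depending on `k`) of `𝕋^d × {0}`. -/
def IsFormalDiffeo {d n : ℕ} (φ : FormalVF d n) : Prop :=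
  ∀ k : ℕ, ∃ ρ : ℝ, 0 < ρ ∧ (∀ L, wnorm ρ ρ (trunc k φ L) < ⊤) ∧
    IsTorusDiffeo ρ (idAdd (trunc k φ))

/-- The vector field `G`, analytic on `V_r × W_δ`, is formally conjugate to the formal vector
field `F`: `T^k (D(T^k Φ) · F) = T^k (G ∘ T^k Φ)` for all `k`, for some formal diffeomorphism. The
series `c` below is the Taylor-Fourier development of `G ∘ T^k Φ` near `𝕋^d × {0}`. -/
def FormallyConjugate {d n : ℕ} (r δ : ℝ) (G : Phase d n → Phase d n) (F : FormalVF d n) : Prop :=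
  ∃ φ : FormalVF d n, IsFormalDiffeo φ ∧ ∀ k : ℕ, ∃ ρ : ℝ, 0 < ρ ∧
    Set.MapsTo (idAdd (trunc k φ)) (domain d n ρ ρ) (domain d n r δ) ∧
    ∃ c : FormalVF d n,
      (∀ L, IsDevelopment ρ ρ (fun Z => comp (G (idAdd (trunc k φ) Z)) L) (c L)) ∧
      trunc k (jacobianApply (trunc k φ) F) = trunc k c

/-! ### The quasilinear part, resonances, arithmetical and algebraic conditions -/

/-- `i⟨P,ω⟩ + ⟨Q,Λ⟩`, where the entries of `Q` may be negative. -/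
def divisor {d n : ℕ} (ω : Fin d → ℝ) (Λ : Fin n → ℂ) (P : Fin d → ℤ) (Q : Fin n → ℤ) : ℂ :=
  Complex.I * ∑ j, (P j : ℂ) * (ω j : ℂ) + ∑ j, (Q j : ℂ) * Λ j

/-- The vector field `S = ∑ ω_j ∂/∂X_j + ∑ λ_j Y_j ∂/∂Y_j`. -/
def quasilinear {d n : ℕ} (ω : Fin d → ℝ) (Λ : Fin n → ℂ) (Z : Phase d n) : Phase d n :=
  (fun j => (ω j : ℂ), fun j => Λ j * Z.2 j)

/-- The formal vector field `a · S`. -/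
def smulS {d n : ℕ} (ω : Fin d → ℝ) (Λ : Fin n → ℂ) (a : Series d n) : FormalVF d n :=
  Sum.elim (fun j p => (ω j : ℂ) * a p)
    (fun j p => if p.2 j = 0 then 0 else Λ j * a (p.1, p.2 - Pi.single j 1))

/-- A resonant vector field: the components `F_j` and `Y_j⁻¹ F_{d+j}` only contain monomials
`e^{i⟨P,X⟩} Y^Q` with `i⟨P,ω⟩ + ⟨Q,Λ⟩ = 0`. -/
def IsResonant {d n : ℕ} (ω : Fin d → ℝ) (Λ : Fin n → ℂ) (F : FormalVF d n) : Prop :=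
  (∀ j p, F (Sum.inl j) p ≠ 0 → divisor ω Λ p.1 (fun i => (p.2 i : ℤ)) = 0) ∧
  (∀ j p, F (Sum.inr j) p ≠ 0 → divisor ω Λ p.1 (fun i => (p.2 i : ℤ)) - Λ j = 0)

/-- The exponents `Q` that occur in the small divisors: those of monomials `Y^Q`, and those of
`Y_j⁻¹ Y^{Q'}` where `Y^{Q'}`, `|Q'| ≥ 2`, is a monomial of the `Y_j` component of a vector field
(so that one entry may be `-1`). -/
def IsExponent {n : ℕ} (Q : Fin n → ℤ) : Prop :=
  (∀ i, 0 ≤ Q i) ∨ (1 ≤ ∑ i, Q i ∧ ∃ j, Q j = -1 ∧ ∀ i, i ≠ j → 0 ≤ Q i)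

/-- Brjuno's `γ` and `ω` conditions on `S`. -/
def BrjunoGammaOmega {d n : ℕ} (ω : Fin d → ℝ) (Λ : Fin n → ℂ) : Prop :=
  ∃ (g : ℝ → ℝ) (m : ℕ → ℕ) (ε r : ℕ → ℝ),
    (∀ x, 1 ≤ x → 0 < g x) ∧ MonotoneOn g (Set.Ici 1) ∧ ¬ BddAbove (g '' Set.Ici 1) ∧
    Monotone m ∧ (∀ k, 0 < ε k) ∧
    (m 0 = 1 ∧ ∀ k, m (k + 1) ≤ 2 * m k + 1) ∧
    (Summable fun k : ℕ => Real.log (g (m (k + 1))) / (m (k + 1) : ℝ)) ∧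
    (∀ k, (m k : ℝ) ≤ ((n : ℝ) + 2) * g (m k) * Real.log (g (m k))) ∧
    (∀ k, ∀ (P : Fin d → ℤ) (Q : Fin n → ℤ), IsExponent Q →
      m k < absP P → ∑ i, Q i ≤ (m k : ℤ) → divisor ω Λ P Q ≠ 0 →
      ‖divisor ω Λ P Q‖⁻¹ ≤ Real.exp (ε k * absP P)) ∧
    (∀ k, ∀ (P : Fin d → ℤ) (Q : Fin n → ℤ), IsExponent Q →
      absP P ≤ m k → ∑ i, Q i ≤ (m k : ℤ) → divisor ω Λ P Q ≠ 0 →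
      ‖divisor ω Λ P Q‖⁻¹ ≤ g (m k)) ∧
    (∀ k, 0 < r k - r (k + 1) - ε k ∧
      (4 : ℝ) ^ (4 * d + 6) * ((r k - r (k + 1) - ε k) ^ (4 * d + 6))⁻¹ ≤ g (m k)) ∧
    (∀ k, 1 / 2 < r k)

/-- Brjuno's `A` condition on a vector field `G` that is analytic on `V_r × W_δ`: it has a formal
normal form `a · S`, where the formal series `a` has constant part `1`. -/
def BrjunoA {d n : ℕ} (ω : Fin d → ℝ) (Λ : Fin n → ℂ) (r δ : ℝ) (G : Phase d n → Phase d n) :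
    Prop :=
  ∃ a : Series d n, IsFormal a ∧ a 0 = 1 ∧ IsResonant ω Λ (smulS ω Λ a) ∧
    FormallyConjugate r δ G (smulS ω Λ a)

/-- The vector field `G` on `V_r × W_δ` is holomorphically conjugate, on a neighbourhood of
`𝕋^d × {0}`, to a resonant vector field `b · S` with `b` holomorphic of constant part `1`:
`DΨ · (b S) = G ∘ Ψ` for a holomorphic diffeomorphism `Ψ`. -/
def HolomorphicallyNormalizable {d n : ℕ} (ω : Fin d → ℝ) (Λ : Fin n → ℂ) (r δ : ℝ)
    (G : Phase d n → Phase d n) : Prop :=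
  ∃ ρ : ℝ, 0 < ρ ∧ ∃ (Ψ : Phase d n → Phase d n) (b : Phase d n → ℂ) (β : Series d n),
    IsTorusDiffeo ρ Ψ ∧ Set.MapsTo Ψ (domain d n ρ ρ) (domain d n r δ) ∧
    IsDevelopment ρ ρ b β ∧ β 0 = 1 ∧ IsResonant ω Λ (smulS ω Λ β) ∧
    ∀ Z ∈ domain d n ρ ρ, fderiv ℂ Ψ Z (b Z • quasilinear ω Λ Z) = G (Ψ Z)

end

end TorusNF

open MeasureTheory Filter Topology Set Asymptotics

namespace TorusNF

noncomputable section

set_option linter.unusedSectionVars false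

/-! ### Fourier coefficients of periodic holomorphic functions on a tube -/

section Tube

variable {ι : Type*} [Fintype ι]

local instance : MeasureSpace UnitAddCircle := ⟨AddCircle.haarAddCircle⟩

local instance : Measure.IsAddHaarMeasure (volume : Measure UnitAddCircle) :=
  inferInstanceAs (Measure.IsAddHaarMeasure AddCircle.haarAddCircle)

local instance : IsProbabilityMeasure (volume : Measure UnitAddCircle) :=
  inferInstanceAs (IsProbabilityMeasure AddCircle.haarAddCircle)

/-- A representative in `[0,1)^ι` of a point of the torus. -/
def torusRep (t : UnitAddTorus ι) : ι → ℝ := fun j => (AddCircle.equivIco (1 : ℝ) 0 (t j)).1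

lemma coe_torusRep (t : UnitAddTorus ι) (j : ι) : ((torusRep t j : ℝ) : UnitAddCircle) = t j :=
  AddCircle.coe_equivIco

/-- The tube over `Ω`. -/
def tube (Ω : Set (ι → ℝ)) : Set (ι → ℂ) := {ζ | (fun j => (ζ j).im) ∈ Ω}

/-- The restriction of a function on `ℂ^ι` to the translate by `ζ` of the real torus. -/
def torusSlice (U : (ι → ℂ) → ℂ) (ζ : ι → ℂ) (t : UnitAddTorus ι) : ℂ :=
  U (fun j => 2 * (Real.pi : ℂ) * (torusRep t j : ℂ) + ζ j)

/-- Periodicity on a tube. -/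
def TubePeriodic (Ω : Set (ι → ℝ)) (U : (ι → ℂ) → ℂ) : Prop :=
  ∀ ζ ∈ tube Ω, ∀ N : ι → ℤ, U (fun j => ζ j + 2 * (Real.pi : ℂ) * (N j : ℂ)) = U ζ

lemma real_add_mem_tube {Ω : Set (ι → ℝ)} {ζ : ι → ℂ} (hζ : ζ ∈ tube Ω) (x : ι → ℝ) :
    (fun j => 2 * (Real.pi : ℂ) * (x j : ℂ) + ζ j) ∈ tube Ω := by
  have : (fun j => (2 * (Real.pi : ℂ) * (x j : ℂ) + ζ j).im) = fun j => (ζ j).im := by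
    funext j
    have : (2 * (Real.pi : ℂ) * (x j : ℂ)) = ((2 * Real.pi * x j : ℝ) : ℂ) := by push_cast; ring
    rw [this, Complex.add_im, Complex.ofReal_im, zero_add]
  simpa only [tube, mem_ofPred_eq, this] using hζ

lemma torusSlice_coe {Ω : Set (ι → ℝ)} {U : (ι → ℂ) → ℂ} (hper : TubePeriodic Ω U)
    {ζ : ι → ℂ} (hζ : ζ ∈ tube Ω) (x : ι → ℝ) :
    torusSlice U ζ (fun j => (x j : UnitAddCircle)) =
      U (fun j => 2 * (Real.pi : ℂ) * (x j : ℂ) + ζ j) := by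
  have h : ∀ j, ∃ k : ℤ, x j = torusRep (fun j => (x j : UnitAddCircle)) j + k := by
    intro j
    have h1 := coe_torusRep (fun j => (x j : UnitAddCircle)) j
    rw [← sub_eq_zero, ← AddCircle.coe_sub, AddCircle.coe_eq_zero_iff] at h1
    obtain ⟨k, hk⟩ := h1
    refine ⟨-k, ?_⟩
    simp only [zsmul_eq_mul, mul_one] at hk
    push_cast
    linarith
  choose N hN using h
  have h2 := hper _ (real_add_mem_tube hζ (torusRep (fun j => (x j : UnitAddCircle)))) N
  rw [torusSlice, ← h2]
  congr 1
  funext j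
  have h3 : (x j : ℂ) = (torusRep (fun j => (x j : UnitAddCircle)) j : ℂ) + (N j : ℂ) := by
    exact_mod_cast congrArg (fun s : ℝ => (s : ℂ)) (hN j)
  rw [h3]
  ring

lemma torusSlice_translate {Ω : Set (ι → ℝ)} {U : (ι → ℂ) → ℂ} (hper : TubePeriodic Ω U)
    {ζ : ι → ℂ} (hζ : ζ ∈ tube Ω) (a : ι → ℝ) (t : UnitAddTorus ι) :
    torusSlice U (fun j => 2 * (Real.pi : ℂ) * (a j : ℂ) + ζ j) t =
      torusSlice U ζ (t + fun j => (a j : UnitAddCircle)) := by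
  have h : t + (fun j => (a j : UnitAddCircle)) =
      fun j => ((torusRep t j + a j : ℝ) : UnitAddCircle) := by
    funext j
    rw [AddCircle.coe_add, coe_torusRep]
    rfl
  rw [h, torusSlice_coe hper hζ, torusSlice]
  congr 1
  funext j
  push_cast
  ring

lemma continuous_torusSlice {Ω : Set (ι → ℝ)} {U : (ι → ℂ) → ℂ} (hper : TubePeriodic Ω U)
    (hU : ContinuousOn U (tube Ω)) {ζ : ι → ℂ} (hζ : ζ ∈ tube Ω) :
    Continuous (torusSlice U ζ) := by
  have hq : IsOpenQuotientMap
      (Pi.map (fun (_ : ι) (x : ℝ) => (x : UnitAddCircle))) :=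
    IsOpenQuotientMap.piMap fun _ => QuotientAddGroup.isOpenQuotientMap_mk
  rw [hq.isQuotientMap.continuous_iff]
  have : torusSlice U ζ ∘ Pi.map (fun (_ : ι) (x : ℝ) => (x : UnitAddCircle)) =
      fun x : ι → ℝ => U (fun j => 2 * (Real.pi : ℂ) * (x j : ℂ) + ζ j) := by
    funext x
    exact torusSlice_coe hper hζ x
  rw [this]
  refine hU.comp_continuous ?_ fun x => real_add_mem_tube hζ x
  fun_prop

/-- Fourier coefficient of a slice. -/
def tubeCoeff (U : (ι → ℂ) → ℂ) (ζ : ι → ℂ) (N : ι → ℤ) : ℂ :=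
  UnitAddTorus.mFourierCoeff (torusSlice U ζ) N

lemma tubeCoeff_eq (U : (ι → ℂ) → ℂ) (ζ : ι → ℂ) (N : ι → ℤ) :
    tubeCoeff U ζ N = ∫ t : UnitAddTorus ι, UnitAddTorus.mFourier (-N) t • torusSlice U ζ t := rfl

lemma norm_mFourier_apply (N : ι → ℤ) (t : UnitAddTorus ι) : ‖UnitAddTorus.mFourier N t‖ = 1 := by
  simp only [UnitAddTorus.mFourier, fourier_apply, ContinuousMap.coe_mk, norm_prod,
    Circle.norm_coe, Finset.prod_const_one]

lemma norm_mFourierCoeff_le {f : UnitAddTorus ι → ℂ} {C : ℝ} (hC : ∀ t, ‖f t‖ ≤ C) (N : ι → ℤ) :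
    ‖UnitAddTorus.mFourierCoeff f N‖ ≤ C := by
  have : ‖∫ t : UnitAddTorus ι, UnitAddTorus.mFourier (-N) t • f t‖ ≤ C *
      (volume : Measure (UnitAddTorus ι)).real univ := by
    refine norm_integral_le_of_norm_le_const (Eventually.of_forall fun t => ?_)
    rw [norm_smul, norm_mFourier_apply, one_mul]
    exact hC t
  simpa [UnitAddTorus.mFourierCoeff] using! this

lemma norm_tubeCoeff_le {Ω : Set (ι → ℝ)} {U : (ι → ℂ) → ℂ} {C : ℝ}
    (hC : ∀ ζ ∈ tube Ω, ‖U ζ‖ ≤ C) {ζ : ι → ℂ} (hζ : ζ ∈ tube Ω) (N : ι → ℤ) :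
    ‖tubeCoeff U ζ N‖ ≤ C :=
  norm_mFourierCoeff_le (fun _ => hC _ (real_add_mem_tube hζ _)) N

lemma mFourier_coe (N : ι → ℤ) (x : ι → ℝ) :
    UnitAddTorus.mFourier N (fun j => (x j : UnitAddCircle)) =
      Complex.exp (Complex.I * ∑ j, (N j : ℂ) * (2 * (Real.pi : ℂ) * (x j : ℂ))) := by
  rw [UnitAddTorus.mFourier, ContinuousMap.coe_mk, Finset.mul_sum, Complex.exp_sum]
  refine Finset.prod_congr rfl fun j _ => ?_
  rw [fourier_coe_apply]
  congr 1
  push_cast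
  ring

lemma tubeCoeff_translate {Ω : Set (ι → ℝ)} {U : (ι → ℂ) → ℂ} (hper : TubePeriodic Ω U)
    {ζ : ι → ℂ} (hζ : ζ ∈ tube Ω) (a : ι → ℝ) (N : ι → ℤ) :
    tubeCoeff U (fun j => 2 * (Real.pi : ℂ) * (a j : ℂ) + ζ j) N =
      Complex.exp (Complex.I * ∑ j, (N j : ℂ) * (2 * (Real.pi : ℂ) * (a j : ℂ))) *
        tubeCoeff U ζ N := by
  have h1 : ∀ t : UnitAddTorus ι, UnitAddTorus.mFourier (-N) t •
      torusSlice U (fun j => 2 * (Real.pi : ℂ) * (a j : ℂ) + ζ j) t =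
      Complex.exp (Complex.I * ∑ j, (N j : ℂ) * (2 * (Real.pi : ℂ) * (a j : ℂ))) *
      (fun s : UnitAddTorus ι => UnitAddTorus.mFourier (-N) s • torusSlice U ζ s)
        (t + fun j => (a j : UnitAddCircle)) := by
    intro t
    have h2 : UnitAddTorus.mFourier (-N) (t + fun j => (a j : UnitAddCircle)) =
        UnitAddTorus.mFourier (-N) t * UnitAddTorus.mFourier (-N) (fun j => (a j : UnitAddCircle)) := by
      simp only [UnitAddTorus.mFourier, ContinuousMap.coe_mk, ← Finset.prod_mul_distrib]
      refine Finset.prod_congr rfl fun j _ => ?_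
      simp only [Pi.add_apply, fourier_apply, smul_add, AddCircle.toCircle_add, Circle.coe_mul]
    have h3 : UnitAddTorus.mFourier N (fun j => (a j : UnitAddCircle)) *
        UnitAddTorus.mFourier (-N) (fun j => (a j : UnitAddCircle)) = 1 := by
      rw [← UnitAddTorus.mFourier_add, add_neg_cancel, UnitAddTorus.mFourier_zero]
      rfl
    rw [torusSlice_translate hper hζ, ← mFourier_coe]
    simp only [h2, smul_eq_mul]
    calc _ = (UnitAddTorus.mFourier N (fun j => (a j : UnitAddCircle)) *
        UnitAddTorus.mFourier (-N) (fun j => (a j : UnitAddCircle))) *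
        (UnitAddTorus.mFourier (-N) t * torusSlice U ζ (t + fun j => (a j : UnitAddCircle))) := by
          rw [h3, one_mul]
      _ = _ := by ring
  rw [tubeCoeff_eq, integral_congr_ae (Eventually.of_forall h1), integral_const_mul]
  congr 1
  exact integral_add_right_eq_self (μ := (volume : Measure (UnitAddTorus ι)))
    (fun s : UnitAddTorus ι => UnitAddTorus.mFourier (-N) s • torusSlice U ζ s) _

lemma differentiableAt_tubeCoeff_line {Ω : Set (ι → ℝ)} (hΩ : IsOpen Ω) {U : (ι → ℂ) → ℂ}
    (hper : TubePeriodic Ω U) (hU : DifferentiableOn ℂ U (tube Ω)) {C : ℝ}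
    (hC : ∀ ζ ∈ tube Ω, ‖U ζ‖ ≤ C) (ζ v : ι → ℂ) (N : ι → ℤ) {z₀ : ℂ}
    (hz₀ : ζ + z₀ • v ∈ tube Ω) :
    DifferentiableAt ℂ (fun z : ℂ => tubeCoeff U (ζ + z • v) N) z₀ := by
  have hopen : IsOpen (tube Ω) :=
    hΩ.preimage (continuous_pi fun j => Complex.continuous_im.comp (continuous_apply j))
  have hopen' : IsOpen {z : ℂ | ζ + z • v ∈ tube Ω} := hopen.preimage (by fun_prop)
  obtain ⟨ρ, hρ, hball⟩ := Metric.isOpen_iff.1 hopen' z₀ hz₀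
  have hmem : ∀ t : UnitAddTorus ι, ∀ z ∈ Metric.ball z₀ ρ,
      (fun j => 2 * (Real.pi : ℂ) * (torusRep t j : ℂ) + (ζ + z • v) j) ∈ tube Ω :=
    fun t z hz => real_add_mem_tube (hball hz) _
  set F : ℂ → UnitAddTorus ι → ℂ := fun z t =>
    UnitAddTorus.mFourier (-N) t • torusSlice U (ζ + z • v) t with hF
  have hFd : ∀ t : UnitAddTorus ι, DifferentiableOn ℂ (fun z => F z t) (Metric.ball z₀ ρ) := by
    intro t
    refine DifferentiableOn.const_smul (R := ℂ) (hU.comp ?_ (hmem t)) (UnitAddTorus.mFourier (-N) t)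
    have : Differentiable ℂ (fun z : ℂ =>
        (fun j => 2 * (Real.pi : ℂ) * (torusRep t j : ℂ) + (ζ + z • v) j)) := by
      rw [differentiable_pi]
      intro j
      simp only [Pi.add_apply, Pi.smul_apply, smul_eq_mul]
      fun_prop
    exact this.differentiableOn
  have hFc : ∀ z ∈ Metric.ball z₀ ρ, Continuous (F z) := fun z hz =>
    (UnitAddTorus.mFourier (-N)).continuous.smul
      (continuous_torusSlice hper hU.continuousOn (hball hz))
  have hFb : ∀ t : UnitAddTorus ι, ∀ z ∈ Metric.ball z₀ ρ, ‖F z t‖ ≤ C := by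
    intro t z hz
    rw [hF]
    simp only [norm_smul, norm_mFourier_apply, one_mul]
    exact hC _ (hmem t z hz)
  have hderiv : ∀ t : UnitAddTorus ι, ∀ z ∈ Metric.ball z₀ (ρ / 2),
      HasDerivAt (fun z => F z t) (deriv (fun z => F z t) z) z := by
    intro t z hz
    exact ((hFd t).differentiableAt (Metric.isOpen_ball.mem_nhds
      (Metric.ball_subset_ball (by linarith) hz))).hasDerivAt
  have key := hasDerivAt_integral_of_dominated_loc_of_deriv_le (μ := (volume : Measure (UnitAddTorus ι)))
    (F := F) (F' := fun z t => deriv (fun z => F z t) z) (x₀ := z₀)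
    (s := Metric.ball z₀ (ρ / 2)) (bound := fun _ => C / (ρ / 4))
    (Metric.ball_mem_nhds z₀ (by positivity))
    (by
      filter_upwards [Metric.ball_mem_nhds z₀ hρ] with z hz
      exact (hFc z hz).aestronglyMeasurable)
    (by
      refine Integrable.mono' (integrable_const C)
        (hFc z₀ (Metric.mem_ball_self hρ)).aestronglyMeasurable
        (Eventually.of_forall fun t => hFb t z₀ (Metric.mem_ball_self hρ)))
    (by
      have hseq : Tendsto (fun k : ℕ => ((ρ / 2 : ℝ) : ℂ) * (1 / ((k : ℂ) + 1))) atTop (𝓝[≠] 0) := by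
        rw [tendsto_nhdsWithin_iff]
        constructor
        · have := (tendsto_one_div_add_atTop_nhds_zero_nat (𝕜 := ℂ)).const_mul ((ρ / 2 : ℝ) : ℂ)
          simpa using this
        · refine Eventually.of_forall fun k => ?_
          have h1 : ((k : ℂ) + 1) ≠ 0 := Nat.cast_add_one_ne_zero k
          have h2 : ((ρ / 2 : ℝ) : ℂ) ≠ 0 := by exact_mod_cast (by positivity : (ρ / 2) ≠ 0)
          simp only [mem_compl_iff, mem_singleton_iff]
          exact mul_ne_zero h2 (one_div_ne_zero h1)
      refine aestronglyMeasurable_of_tendsto_ae atTop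
        (f := fun (k : ℕ) t => (((ρ / 2 : ℝ) : ℂ) * (1 / ((k : ℂ) + 1)))⁻¹ •
          (F (z₀ + ((ρ / 2 : ℝ) : ℂ) * (1 / ((k : ℂ) + 1))) t - F z₀ t)) ?_ ?_
      · intro k
        have hk : z₀ + ((ρ / 2 : ℝ) : ℂ) * (1 / ((k : ℂ) + 1)) ∈ Metric.ball z₀ ρ := by
          rw [mem_ball_iff_norm, add_sub_cancel_left, norm_mul, norm_div, norm_one,
            Complex.norm_real, Real.norm_of_nonneg (by positivity)]
          have h3 : (1 : ℝ) ≤ ‖(k : ℂ) + 1‖ := by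
            have : ((k : ℂ) + 1) = ((k + 1 : ℕ) : ℂ) := by push_cast; ring
            rw [this, Complex.norm_natCast]
            exact_mod_cast Nat.succ_le_succ (Nat.zero_le k)
          have h4 : 1 / ‖(k : ℂ) + 1‖ ≤ 1 := by
            rw [div_le_one (by linarith)]; exact h3
          nlinarith
        exact (((hFc _ hk).sub (hFc z₀ (Metric.mem_ball_self hρ))).const_smul
          (((ρ / 2 : ℝ) : ℂ) * (1 / ((k : ℂ) + 1)))⁻¹).aestronglyMeasurable
      · refine Eventually.of_forall fun t => ?_
        exact ((hderiv t z₀ (Metric.mem_ball_self (by positivity))).tendsto_slope_zero).comp hseq)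
    (by
      refine Eventually.of_forall fun t z hz => ?_
      refine Complex.norm_deriv_le_of_forall_mem_sphere_norm_le (by positivity) ?_ ?_
      · refine (DifferentiableOn.diffContOnCl ?_)
        refine (hFd t).mono ((closure_mono Metric.ball_subset_closedBall).trans ?_)
        rw [Metric.isClosed_closedBall.closure_eq]
        intro w hw
        have := Metric.mem_ball.1 hz
        have h2 := Metric.mem_closedBall.1 hw
        rw [Metric.mem_ball]
        linarith [dist_triangle w z z₀]
      · intro w hw
        refine hFb t w ?_
        have := Metric.mem_ball.1 hz
        have h2 := Metric.mem_sphere.1 hw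
        rw [Metric.mem_ball]
        linarith [dist_triangle w z z₀])
    (integrable_const _)
    (Eventually.of_forall hderiv)
  exact key.2.differentiableAt

theorem tubeCoeff_shift {Ω : Set (ι → ℝ)} (hΩ : IsOpen Ω) (hconv : Convex ℝ Ω) {U : (ι → ℂ) → ℂ}
    (hper : TubePeriodic Ω U) (hU : DifferentiableOn ℂ U (tube Ω)) {C : ℝ}
    (hC : ∀ ζ ∈ tube Ω, ‖U ζ‖ ≤ C) {y₀ y₁ : ι → ℝ} (h₀ : y₀ ∈ Ω) (h₁ : y₁ ∈ Ω) (N : ι → ℤ) :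
    tubeCoeff U (fun j => Complex.I * (y₁ j : ℂ)) N =
      Complex.exp (-∑ j, (N j : ℂ) * ((y₁ j : ℂ) - (y₀ j : ℂ))) *
        tubeCoeff U (fun j => Complex.I * (y₀ j : ℂ)) N := by
  set ζ : ι → ℂ := fun j => Complex.I * (y₀ j : ℂ) with hζ
  set v : ι → ℂ := fun j => (y₁ j : ℂ) - (y₀ j : ℂ) with hv
  set W : Set ℂ := {z | ζ + z • v ∈ tube Ω} with hW
  have hWeq : W = Complex.imCLM ⁻¹' ((fun s : ℝ => y₀ + s • (y₁ - y₀)) ⁻¹' Ω) := by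
    ext z
    have : (fun j => ((ζ + z • v) j).im) = y₀ + z.im • (y₁ - y₀) := by
      funext j
      simp [hζ, hv, Complex.mul_im]
    simp only [hW, tube, mem_ofPred_eq, this, mem_preimage, Complex.imCLM_apply]
  have hWconv : Convex ℝ W := by
    rw [hWeq]
    refine Convex.linear_preimage (E := ℂ) (F := ℝ) ?_ Complex.imLm
    have : (fun s : ℝ => y₀ + s • (y₁ - y₀)) = AffineMap.lineMap y₀ y₁ := by
      funext s
      rw [AffineMap.lineMap_apply_module']
      abel
    rw [this]
    exact hconv.affine_preimage _
  have hopen : IsOpen (tube Ω) :=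
    hΩ.preimage (continuous_pi fun j => Complex.continuous_im.comp (continuous_apply j))
  have hWopen : IsOpen W := hopen.preimage (by fun_prop)
  have h0W : (0 : ℂ) ∈ W := by
    rw [hWeq]
    simpa using h₀
  have hIW : Complex.I ∈ W := by
    rw [hWeq]
    simpa using h₁
  have hζmem : ζ ∈ tube Ω := by
    have := h0W
    simpa [hW] using this
  have hf : DifferentiableOn ℂ (fun z : ℂ => tubeCoeff U (ζ + z • v) N) W := fun z hz =>
    (differentiableAt_tubeCoeff_line hΩ hper hU hC ζ v N hz).differentiableWithinAt
  have hg : Differentiable ℂ (fun z : ℂ => Complex.exp (Complex.I * (z * ∑ j, (N j : ℂ) * v j)) *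
      tubeCoeff U ζ N) := by fun_prop
  have heq := (hf.analyticOnNhd hWopen).eqOn_of_preconnected_of_frequently_eq
    (hg.differentiableOn.analyticOnNhd hWopen) hWconv.isPreconnected h0W (by
      have hseq : Tendsto (fun k : ℕ => (1 / ((k : ℂ) + 1))) atTop (𝓝[≠] 0) := by
        rw [tendsto_nhdsWithin_iff]
        refine ⟨tendsto_one_div_add_atTop_nhds_zero_nat (𝕜 := ℂ), Eventually.of_forall fun k => ?_⟩
        simp only [mem_compl_iff, mem_singleton_iff]
        exact one_div_ne_zero (Nat.cast_add_one_ne_zero k)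
      refine hseq.frequently (Frequently.of_forall fun k => ?_)
      have h2 := tubeCoeff_translate hper hζmem
        (fun j => (1 / ((k : ℝ) + 1)) * (y₁ j - y₀ j) / (2 * Real.pi)) N
      have h3 : ∀ j, 2 * (Real.pi : ℂ) *
          (((1 / ((k : ℝ) + 1)) * (y₁ j - y₀ j) / (2 * Real.pi) : ℝ) : ℂ) =
          (1 / ((k : ℂ) + 1)) * v j := by
        intro j
        have : (Real.pi : ℂ) ≠ 0 := by exact_mod_cast Real.pi_ne_zero
        push_cast
        rw [hv]
        field_simp
      simp only [h3] at h2
      have h4 : ζ + (1 / ((k : ℂ) + 1)) • v = fun j => (1 / ((k : ℂ) + 1)) * v j + ζ j := by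
        funext j
        simp only [Pi.add_apply, Pi.smul_apply, smul_eq_mul]
        ring
      change tubeCoeff U (ζ + (1 / ((k : ℂ) + 1)) • v) N = _
      rw [h4, h2]
      congr 2
      rw [Finset.mul_sum (a := 1 / ((k : ℂ) + 1))]
      congr 1
      refine Finset.sum_congr rfl fun j _ => ?_
      ring)
  have h5 := heq hIW
  have h6 : ζ + Complex.I • v = fun j => Complex.I * (y₁ j : ℂ) := by
    funext j
    simp only [hζ, hv, Pi.add_apply, Pi.smul_apply, smul_eq_mul]
    ring
  simp only [h6] at h5
  rw [h5, ← mul_assoc, Complex.I_mul_I, neg_one_mul]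

theorem hasSum_tubeCoeff {Ω : Set (ι → ℝ)} {U : (ι → ℂ) → ℂ}
    (hper : TubePeriodic Ω U) (hU : ContinuousOn U (tube Ω)) {y : ι → ℝ} (hy : y ∈ Ω)
    (hs : Summable (tubeCoeff U (fun j => Complex.I * (y j : ℂ)))) (x : ι → ℝ) :
    HasSum (fun N : ι → ℤ => tubeCoeff U (fun j => Complex.I * (y j : ℂ)) N *
      Complex.exp (Complex.I * ∑ j, (N j : ℂ) * (x j : ℂ)))
      (U (fun j => (x j : ℂ) + Complex.I * (y j : ℂ))) := by
  have hζ : (fun j => Complex.I * (y j : ℂ)) ∈ tube Ω := by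
    simpa [tube] using hy
  have h1 := UnitAddTorus.hasSum_mFourier_series_apply_of_summable
    (f := ⟨torusSlice U (fun j => Complex.I * (y j : ℂ)), continuous_torusSlice hper hU hζ⟩) hs
    (fun j => ((x j / (2 * Real.pi) : ℝ) : UnitAddCircle))
  have hpi : (Real.pi : ℂ) ≠ 0 := by exact_mod_cast Real.pi_ne_zero
  have h2 : ∀ j, 2 * (Real.pi : ℂ) * ((x j / (2 * Real.pi) : ℝ) : ℂ) = (x j : ℂ) := by
    intro j
    push_cast
    field_simp
  simp only [ContinuousMap.coe_mk, torusSlice_coe hper hζ, mFourier_coe, h2, smul_eq_mul] at h1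
  exact h1

end Tube

/-! ### Series of holomorphic functions -/

section SeriesOfFunctions

variable {E F : Type*} [NormedAddCommGroup E] [NormedSpace ℂ E] [NormedAddCommGroup F]
  [NormedSpace ℂ F]

lemma norm_fderiv_le_of_norm_le_ball {f : E → F} {x : E} {ρ C : ℝ} (hρ : 0 < ρ)
    (hf : DifferentiableOn ℂ f (Metric.ball x ρ)) (hC : ∀ z ∈ Metric.ball x ρ, ‖f z‖ ≤ C) :
    ‖fderiv ℂ f x‖ ≤ 2 * C / ρ := by
  refine Complex.norm_fderiv_le_div_of_mapsTo_ball hf (fun z hz => ?_) hρ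
  rw [mem_closedBall_iff_norm]
  calc ‖f z - f x‖ ≤ ‖f z‖ + ‖f x‖ := norm_sub_le _ _
    _ ≤ 2 * C := by linarith [hC z hz, hC x (Metric.mem_ball_self hρ)]

lemma ball_half_subset {x z : E} {ρ : ℝ} (hz : z ∈ Metric.ball x (ρ / 2)) :
    Metric.ball z (ρ / 2) ⊆ Metric.ball x ρ := fun w hw => by
  rw [Metric.mem_ball] at *
  linarith [dist_triangle w z x]

theorem hasFDerivAt_tsum_of_norm_le {α : Type*} [CompleteSpace F] {f : α → E → F} {s : Set E}
    (hs : IsOpen s) {b : α → ℝ} (hb : Summable b) (hf : ∀ i, DifferentiableOn ℂ (f i) s)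
    (hfb : ∀ i, ∀ x ∈ s, ‖f i x‖ ≤ b i) {x : E} (hx : x ∈ s) :
    HasFDerivAt (fun y => ∑' i, f i y) (∑' i, fderiv ℂ (f i) x) x := by
  obtain ⟨ρ, hρ, hball⟩ := Metric.isOpen_iff.1 hs x hx
  let _ : NormedSpace ℝ E := NormedSpace.restrictScalars ℝ ℂ E
  refine hasFDerivAt_tsum_of_isPreconnected (u := fun i => 2 * b i / (ρ / 2))
    (s := Metric.ball x (ρ / 2)) (x₀ := x) ?_ Metric.isOpen_ball
    (convex_ball x (ρ / 2)).isPreconnected ?_ ?_ (Metric.mem_ball_self (by positivity)) ?_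
    (Metric.mem_ball_self (by positivity))
  · exact (hb.mul_left 2).div_const _
  · intro i z hz
    exact ((hf i).differentiableAt
      (hs.mem_nhds (hball (Metric.ball_subset_ball (by linarith) hz)))).hasFDerivAt
  · intro i z hz
    have hsub := (ball_half_subset hz).trans hball
    exact norm_fderiv_le_of_norm_le_ball (by positivity) ((hf i).mono hsub)
      fun w hw => hfb i w (hsub hw)
  · exact Summable.of_norm_bounded hb fun i => hfb i x hx

end SeriesOfFunctions

/-! ### Sums over multi-indices -/

lemma hasSum_mul_of_nonneg {α β : Type*} {f : α → ℝ} {g : β → ℝ} {A B : ℝ} (hf0 : ∀ x, 0 ≤ f x)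
    (hg0 : ∀ x, 0 ≤ g x) (hf : HasSum f A) (hg : HasSum g B) :
    HasSum (fun q : α × β => f q.1 * g q.2) (A * B) :=
  HasSum.mul hf hg (Summable.mul_of_nonneg hf.summable hg.summable hf0 hg0)

lemma hasSum_pi_prod {α : Type*} (a : α → ℝ) (ha : ∀ x, 0 ≤ a x) {A : ℝ} (h : HasSum a A) :
    ∀ k : ℕ, HasSum (fun P : Fin k → α => ∏ j, a (P j)) (A ^ k) := by
  intro k
  induction k with
  | zero =>
    simp only [Finset.univ_eq_empty, Finset.prod_empty, pow_zero]
    exact hasSum_unique (fun _ : Fin 0 → α => (1 : ℝ))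
  | succ k ih =>
    have h1 : HasSum (fun q : α × (Fin k → α) => a q.1 * ∏ j, a (q.2 j)) (A * A ^ k) :=
      hasSum_mul_of_nonneg (g := fun P : Fin k → α => ∏ j, a (P j)) ha
        (fun P => Finset.prod_nonneg fun j _ => ha _) h ih
    have h2 := (Equiv.hasSum_iff (Fin.consEquiv fun _ : Fin (k + 1) => α)
      (f := fun P : Fin (k + 1) → α => ∏ j, a (P j)) (a := A ^ (k + 1))).1
    refine h2 ?_
    rw [pow_succ']
    convert h1 using 1
    funext q
    simp [Fin.consEquiv, Fin.prod_univ_succ]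

variable {d n : ℕ}

lemma exp_absP (κ : ℝ) (P : Fin d → ℤ) :
    Real.exp (κ * absP P) = ∏ j, Real.exp (κ * ((P j).natAbs : ℝ)) := by
  rw [← Real.exp_sum, absP]
  push_cast
  rw [Finset.mul_sum]

lemma pow_degQ {M : Type*} [CommMonoid M] (θ : M) (Q : Fin n → ℕ) :
    θ ^ degQ Q = ∏ j, θ ^ Q j := by
  rw [degQ, Finset.prod_pow_eq_pow_sum]

lemma hasSum_int_exp {κ : ℝ} (h0 : 0 < κ) (h1 : κ ≤ 1) :
    ∃ A : ℝ, HasSum (fun k : ℤ => Real.exp (-κ * (k.natAbs : ℝ))) A ∧ 0 ≤ A ∧ A ≤ 4 / κ := by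
  set q := Real.exp (-κ) with hq
  have hq0 : 0 < q := Real.exp_pos _
  have hq1 : q ≤ 1 - κ / 2 := by
    have h2 := Real.add_one_le_exp κ
    have h3 : q * Real.exp κ = 1 := by rw [hq, ← Real.exp_add]; simp
    have h4 : q * (κ + 1) ≤ 1 := by nlinarith
    have h5 : (1 - κ / 2) * (κ + 1) ≥ 1 := by nlinarith
    nlinarith
  have hpow : ∀ m : ℕ, Real.exp (-κ * (m : ℝ)) = q ^ m := by
    intro m
    rw [hq, ← Real.exp_nat_mul]
    congr 1
    ring
  have hg := hasSum_geometric_of_lt_one hq0.le (by linarith : q < 1)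
  have hnn : HasSum (fun m : ℕ => Real.exp (-κ * (((m : ℤ)).natAbs : ℝ))) (1 - q)⁻¹ := by
    simp only [Int.natAbs_natCast, hpow]
    exact hg
  have hneg : HasSum (fun m : ℕ => Real.exp (-κ * ((-((m : ℤ) + 1)).natAbs : ℝ)))
      (q * (1 - q)⁻¹) := by
    have : ∀ m : ℕ, Real.exp (-κ * ((-((m : ℤ) + 1)).natAbs : ℝ)) = q * q ^ m := by
      intro m
      have h6 : (-((m : ℤ) + 1)).natAbs = m + 1 := by omega
      rw [h6, hpow, pow_succ']
    simp only [this]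
    exact hg.mul_left q
  have hsum := HasSum.of_nat_of_neg_add_one (f := fun k : ℤ => Real.exp (-κ * (k.natAbs : ℝ))) hnn hneg
  refine ⟨_, hsum, ?_, ?_⟩
  · have : 0 ≤ (1 - q)⁻¹ := inv_nonneg.2 (by linarith)
    positivity
  · have h7 : (1 - q)⁻¹ ≤ 2 / κ := by
      rw [inv_le_comm₀ (by linarith) (by positivity), inv_div]
      linarith
    have h8 : 0 ≤ (1 - q)⁻¹ := inv_nonneg.2 (by linarith)
    have h9 : q ≤ 1 := by linarith
    calc (1 - q)⁻¹ + q * (1 - q)⁻¹ ≤ 2 / κ + 2 / κ := by nlinarith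
      _ = 4 / κ := by ring

/-- The geometric majorant over all Fourier-Taylor indices. -/
lemma hasSum_geom_idx (d n : ℕ) {κ : ℝ} (h0 : 0 < κ) (h1 : κ ≤ 1) :
    ∃ A : ℝ, HasSum (fun p : Idx d n => Real.exp (-κ * absP p.1) * (1 - κ) ^ degQ p.2) A ∧
      A ≤ (4 / κ) ^ (d + n) := by
  obtain ⟨A, hA, hA0, hA4⟩ := hasSum_int_exp h0 h1
  have hX := hasSum_pi_prod _ (fun k => (Real.exp_pos _).le) hA d
  have hθ : HasSum (fun m : ℕ => (1 - κ) ^ m) κ⁻¹ := by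
    have := hasSum_geometric_of_lt_one (r := 1 - κ) (by linarith) (by linarith)
    simpa using this
  have hY := hasSum_pi_prod _ (fun k => pow_nonneg (by linarith : 0 ≤ 1 - κ) k) hθ n
  have hXY := hasSum_mul_of_nonneg
    (f := fun P : Fin d → ℤ => ∏ j, Real.exp (-κ * ((P j).natAbs : ℝ)))
    (g := fun Q : Fin n → ℕ => ∏ j, (1 - κ) ^ Q j)
    (fun P => Finset.prod_nonneg fun j _ => (Real.exp_pos _).le)
    (fun P => Finset.prod_nonneg fun j _ => pow_nonneg (by linarith) _) hX hY
  refine ⟨A ^ d * κ⁻¹ ^ n, ?_, ?_⟩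
  · convert hXY using 1
    funext p
    rw [exp_absP, pow_degQ]
  · rw [pow_add]
    have hκ : κ⁻¹ ≤ 4 / κ := by
      rw [inv_eq_one_div]
      gcongr
      norm_num
    have : 0 ≤ κ⁻¹ := by positivity
    gcongr

/-! ### Monomials -/

lemma differentiable_mono (p : Idx d n) : Differentiable ℂ (mono (d := d) (n := n) p) := by
  unfold mono
  fun_prop

lemma contDiff_mono (p : Idx d n) : ContDiff ℂ ⊤ (mono (d := d) (n := n) p) := by
  unfold mono
  refine ContDiff.mul ?_ ?_
  · refine Complex.contDiff_exp.comp (contDiff_const.mul ?_)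
    exact ContDiff.sum fun j _ => by fun_prop
  · exact contDiff_prod fun j _ => by fun_prop

lemma mono_shift (p : Idx d n) (P : Fin d → ℤ) (Z : Phase d n) : mono p (shift P Z) = mono p Z := by
  unfold mono shift
  simp only
  congr 1
  have : Complex.I * ∑ j, (p.1 j : ℂ) * (Z.1 j + 2 * (Real.pi : ℂ) * (P j : ℂ)) =
      Complex.I * ∑ j, (p.1 j : ℂ) * Z.1 j +
        ((∑ j, p.1 j * P j : ℤ) : ℂ) * (2 * Real.pi * Complex.I) := by
    push_cast
    rw [Finset.sum_mul, Finset.mul_sum, Finset.mul_sum, ← Finset.sum_add_distrib]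
    refine Finset.sum_congr rfl fun j _ => ?_
    ring
  rw [this, Complex.exp_add, Complex.exp_int_mul_two_pi_mul_I, mul_one]

lemma norm_mono_le (p : Idx d n) {Z : Phase d n} {s t : ℝ} (hs : ∀ j, |(Z.1 j).im| ≤ s)
    (ht : ∀ j, ‖Z.2 j‖ ≤ t) : ‖mono p Z‖ ≤ Real.exp (s * absP p.1) * t ^ degQ p.2 := by
  unfold mono
  rw [norm_mul, Complex.norm_exp, norm_prod, pow_degQ]
  refine mul_le_mul ?_ ?_ (Finset.prod_nonneg fun j _ => norm_nonneg _) (Real.exp_pos _).le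
  · rw [Real.exp_le_exp, absP]
    push_cast
    rw [Finset.mul_sum (a := s), Complex.I_mul_re, Complex.im_sum, ← Finset.sum_neg_distrib]
    refine Finset.sum_le_sum fun j _ => ?_
    have h1 : ((p.1 j : ℂ) * Z.1 j).im = (p.1 j : ℝ) * (Z.1 j).im := by
      simp [Complex.mul_im]
    rw [h1]
    have h2 : (((p.1 j).natAbs : ℕ) : ℝ) = |(p.1 j : ℝ)| := by
      rw [Nat.cast_natAbs]; push_cast; rfl
    rw [h2]
    calc -((p.1 j : ℝ) * (Z.1 j).im) ≤ |(p.1 j : ℝ) * (Z.1 j).im| := neg_le_abs _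
      _ = |(Z.1 j).im| * |(p.1 j : ℝ)| := by rw [abs_mul, mul_comm]
      _ ≤ s * |(p.1 j : ℝ)| := by gcongr; exact hs j
  · refine Finset.prod_le_prod (fun j _ => norm_nonneg _) fun j _ => ?_
    rw [norm_pow]
    gcongr
    exact ht j

/-! ### The domains -/

lemma isOpen_domain (r δ : ℝ) : IsOpen (domain d n r δ) := by
  have : domain d n r δ = (⋂ j, {Z | |(Z.1 j).im| < r}) ∩ ⋂ j, {Z | ‖Z.2 j‖ < δ} := by
    ext Z
    simp [domain]
  rw [this]
  refine IsOpen.inter (isOpen_iInter_of_finite fun j => ?_) (isOpen_iInter_of_finite fun j => ?_)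
  · exact isOpen_lt (by fun_prop) continuous_const
  · exact isOpen_lt (by fun_prop) continuous_const

lemma domain_mono {r δ r' δ' : ℝ} (hr : r ≤ r') (hδ : δ ≤ δ') :
    domain d n r δ ⊆ domain d n r' δ' :=
  fun _ hZ => ⟨fun j => (hZ.1 j).trans_le hr, fun j => (hZ.2 j).trans_le hδ⟩

lemma shift_mem_domain {r δ : ℝ} {Z : Phase d n} (hZ : Z ∈ domain d n r δ) (P : Fin d → ℤ) :
    shift P Z ∈ domain d n r δ := by
  refine ⟨fun j => ?_, hZ.2⟩
  have : ((shift P Z).1 j).im = (Z.1 j).im := by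
    have h : (2 * (Real.pi : ℂ) * (P j : ℂ)) = ((2 * Real.pi * P j : ℝ) : ℂ) := by push_cast; ring
    simp only [shift]
    rw [h, Complex.add_im, Complex.ofReal_im, add_zero]
  rw [this]
  exact hZ.1 j

lemma exists_pos_forall_add_lt {m : ℕ} {a : Fin m → ℝ} {b : ℝ} (h : ∀ j, a j < b) :
    ∃ κ > 0, ∀ j, a j < b - κ := by
  rcases Nat.eq_zero_or_pos m with rfl | hm
  · exact ⟨1, one_pos, fun j => j.elim0⟩
  · have : Nonempty (Fin m) := ⟨⟨0, hm⟩⟩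
    obtain ⟨j₀, hj₀⟩ := Finite.exists_max a
    refine ⟨(b - a j₀) / 2, by linarith [h j₀], fun j => ?_⟩
    linarith [hj₀ j, h j₀]

lemma exists_mem_domain_shrink {r δ : ℝ} (hδ : 0 < δ) {Z : Phase d n}
    (hZ : Z ∈ domain d n r δ) :
    ∃ κ, 0 < κ ∧ κ < 1 ∧ Z ∈ domain d n (r - κ) ((1 - κ) * δ) := by
  obtain ⟨κ₁, h1, h1'⟩ := exists_pos_forall_add_lt hZ.1
  obtain ⟨κ₂, h2, h2'⟩ := exists_pos_forall_add_lt hZ.2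
  refine ⟨min (min κ₁ (κ₂ / δ)) (1 / 2), by positivity, ?_, fun j => ?_, fun j => ?_⟩
  · exact (min_le_right _ _).trans_lt (by norm_num)
  · have := h1' j
    have h3 : min (min κ₁ (κ₂ / δ)) (1 / 2) ≤ κ₁ := (min_le_left _ _).trans (min_le_left _ _)
    linarith
  · have := h2' j
    have h3 : min (min κ₁ (κ₂ / δ)) (1 / 2) ≤ κ₂ / δ := (min_le_left _ _).trans (min_le_right _ _)
    have h4 : min (min κ₁ (κ₂ / δ)) (1 / 2) * δ ≤ κ₂ := by
      rwa [← le_div_iff₀ hδ]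
    linarith

/-! ### Series with geometric majorant -/

/-- `f` is dominated by a geometric series adapted to `V_r × W_δ`. -/
def Majorized (r δ C : ℝ) (f : Series d n) : Prop :=
  ∀ p, ‖f p‖ * Real.exp (r * absP p.1) * δ ^ degQ p.2 ≤ C

/-- Holomorphic and periodic on `V_r × W_δ`. -/
def Holo {E : Type*} [NormedAddCommGroup E] [NormedSpace ℂ E] (r δ : ℝ) (u : Phase d n → E) :
    Prop :=
  DifferentiableOn ℂ u (domain d n r δ) ∧ ∀ Z ∈ domain d n r δ, ∀ P, u (shift P Z) = u Z

lemma Majorized.norm_term_le {r δ C : ℝ} {f : Series d n} (hf : Majorized r δ C f)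
    {κ : ℝ} (h1 : κ ≤ 1) {Z : Phase d n} (hZ : Z ∈ domain d n (r - κ) ((1 - κ) * δ))
    (p : Idx d n) :
    ‖f p * mono p Z‖ ≤ C * (Real.exp (-κ * absP p.1) * (1 - κ) ^ degQ p.2) := by
  have hm := norm_mono_le p (fun j => (hZ.1 j).le) (fun j => (hZ.2 j).le)
  have h2 : Real.exp ((r - κ) * absP p.1) * ((1 - κ) * δ) ^ degQ p.2 =
      (Real.exp (r * absP p.1) * δ ^ degQ p.2) *
        (Real.exp (-κ * absP p.1) * (1 - κ) ^ degQ p.2) := by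
    rw [mul_pow, sub_mul, Real.exp_sub, neg_mul, Real.exp_neg]
    ring
  have h3 : 0 ≤ (1 - κ) ^ degQ p.2 := pow_nonneg (by linarith) _
  calc ‖f p * mono p Z‖ = ‖f p‖ * ‖mono p Z‖ := norm_mul _ _
    _ ≤ ‖f p‖ * (Real.exp ((r - κ) * absP p.1) * ((1 - κ) * δ) ^ degQ p.2) := by gcongr
    _ = (‖f p‖ * Real.exp (r * absP p.1) * δ ^ degQ p.2) *
        (Real.exp (-κ * absP p.1) * (1 - κ) ^ degQ p.2) := by rw [h2]; ring
    _ ≤ _ := by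
      have := hf p
      gcongr

lemma Majorized.nonneg {r δ C : ℝ} {f : Series d n} (hf : Majorized r δ C f) (hδ : 0 < δ) :
    0 ≤ C := le_trans (by positivity) (hf 0)

lemma Majorized.summable {r δ C : ℝ} {f : Series d n} (hf : Majorized r δ C f) (hδ : 0 < δ)
    {Z : Phase d n} (hZ : Z ∈ domain d n r δ) : Summable fun p => f p * mono p Z := by
  obtain ⟨κ, h0, h1, hκ⟩ := exists_mem_domain_shrink hδ hZ
  obtain ⟨A, hA, -⟩ := hasSum_geom_idx d n h0 h1.le
  exact Summable.of_norm_bounded (hA.summable.mul_left C) fun p => hf.norm_term_le h1.le hκ p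

lemma Majorized.hasSum {r δ C : ℝ} {f : Series d n} (hf : Majorized r δ C f) (hδ : 0 < δ)
    {Z : Phase d n} (hZ : Z ∈ domain d n r δ) : HasSum (fun p => f p * mono p Z) (eval f Z) :=
  (hf.summable hδ hZ).hasSum

lemma Majorized.norm_eval_le {r δ C : ℝ} {f : Series d n} (hf : Majorized r δ C f) (hδ : 0 < δ)
    {κ : ℝ} (h0 : 0 < κ) (h1 : κ ≤ 1) {Z : Phase d n}
    (hZ : Z ∈ domain d n (r - κ) ((1 - κ) * δ)) : ‖eval f Z‖ ≤ C * (4 / κ) ^ (d + n) := by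
  obtain ⟨A, hA, hA'⟩ := hasSum_geom_idx d n h0 h1
  exact (tsum_of_norm_bounded (hA.mul_left C) fun p => hf.norm_term_le h1 hZ p).trans
    (mul_le_mul_of_nonneg_left hA' (hf.nonneg hδ))

lemma Majorized.hasFDerivAt_eval {r δ C : ℝ} {f : Series d n} (hf : Majorized r δ C f)
    (hδ : 0 < δ) {Z : Phase d n} (hZ : Z ∈ domain d n r δ) :
    HasFDerivAt (eval f) (∑' p, fderiv ℂ (fun Z => f p * mono p Z) Z) Z := by
  obtain ⟨κ, h0, h1, hκ⟩ := exists_mem_domain_shrink hδ hZ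
  obtain ⟨A, hA, -⟩ := hasSum_geom_idx d n h0 h1.le
  exact hasFDerivAt_tsum_of_norm_le (isOpen_domain _ _) (hA.summable.mul_left C)
    (fun p => ((differentiable_mono p).const_mul _).differentiableOn)
    (fun p x hx => hf.norm_term_le h1.le hx p) hκ

lemma Majorized.holo {r δ C : ℝ} {f : Series d n} (hf : Majorized r δ C f) (hδ : 0 < δ) :
    Holo r δ (eval f) := by
  refine ⟨fun Z hZ => (hf.hasFDerivAt_eval hδ hZ).differentiableAt.differentiableWithinAt, ?_⟩
  intro Z _ P
  simp only [eval, mono_shift]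

lemma Majorized.differentiableOn_fderiv {r δ C : ℝ} {f : Series d n} (hf : Majorized r δ C f)
    (hδ : 0 < δ) : DifferentiableOn ℂ (fderiv ℂ (eval f)) (domain d n r δ) := by
  intro Z hZ
  obtain ⟨κ, h0, h1, hκ⟩ := exists_mem_domain_shrink hδ hZ
  obtain ⟨A, hA, -⟩ := hasSum_geom_idx d n h0 h1.le
  obtain ⟨ρ, hρ, hball⟩ := Metric.isOpen_iff.1 (isOpen_domain (d := d) (n := n) _ _) Z hκ
  set T : Idx d n → Phase d n → (Phase d n →L[ℂ] ℂ) := fun p W =>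
    fderiv ℂ (fun Z => f p * mono p Z) W with hT
  have hsmooth : ∀ p, Differentiable ℂ (T p) := by
    intro p
    have h3 : ContDiff ℂ 2 (fun Z : Phase d n => f p * mono p Z) :=
      contDiff_const.mul ((contDiff_mono p).of_le le_top)
    exact (h3.fderiv_right (m := 1) (by norm_num)).differentiable (by norm_num)
  have key := hasFDerivAt_tsum_of_norm_le (f := T) (s := Metric.ball Z (ρ / 2))
    Metric.isOpen_ball (b := fun p => 2 *
      (C * (Real.exp (-κ * absP p.1) * (1 - κ) ^ degQ p.2)) / (ρ / 2))
    (((hA.summable.mul_left C).mul_left 2).div_const _)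
    (fun p => (hsmooth p).differentiableOn)
    (fun p W hW => norm_fderiv_le_of_norm_le_ball (by positivity)
      (((differentiable_mono p).const_mul _).differentiableOn)
      fun x hx => hf.norm_term_le h1.le (hball (ball_half_subset hW hx)) p)
    (Metric.mem_ball_self (by positivity))
  refine (key.differentiableAt.congr_of_eventuallyEq ?_).differentiableWithinAt
  filter_upwards [(isOpen_domain r δ).mem_nhds hZ] with W hW
  exact (hf.hasFDerivAt_eval hδ hW).fderiv

/-! ### Fourier-Taylor development of periodic holomorphic functions -/

/-- A function on phase space as a function on a tube, with `Y = δ e^{iζ}`. -/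
def tubeLift (δ : ℝ) (u : Phase d n → ℂ) (ζ : Fin d ⊕ Fin n → ℂ) : ℂ :=
  u (fun j => ζ (Sum.inl j), fun j => (δ : ℂ) * Complex.exp (Complex.I * ζ (Sum.inr j)))

/-- The base of the tube. -/
def tubeBase (d n : ℕ) (r : ℝ) : Set (Fin d ⊕ Fin n → ℝ) :=
  {y | (∀ j, |y (Sum.inl j)| < r) ∧ ∀ j, 0 < y (Sum.inr j)}

lemma isOpen_tubeBase (r : ℝ) : IsOpen (tubeBase d n r) := by
  have : tubeBase d n r = (⋂ j, {y | |y (Sum.inl j)| < r}) ∩ ⋂ j, {y | 0 < y (Sum.inr j)} := by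
    ext y
    simp [tubeBase]
  rw [this]
  refine IsOpen.inter (isOpen_iInter_of_finite fun j => ?_) (isOpen_iInter_of_finite fun j => ?_)
  · exact isOpen_lt (by fun_prop) continuous_const
  · exact isOpen_lt continuous_const (by fun_prop)

lemma convex_tubeBase (r : ℝ) : Convex ℝ (tubeBase d n r) := by
  intro x hx y hy a b ha hb hab
  refine ⟨fun j => ?_, fun j => ?_⟩
  · have h1 := abs_lt.1 (hx.1 j)
    have h2 := abs_lt.1 (hy.1 j)
    have := (convex_Ioo (-r) r) (show x (Sum.inl j) ∈ Ioo (-r) r from h1)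
      (show y (Sum.inl j) ∈ Ioo (-r) r from h2) ha hb hab
    exact abs_lt.2 this
  · exact (convex_Ioi (0 : ℝ)) (hx.2 j) (hy.2 j) ha hb hab

lemma tubeLift_mem {r δ : ℝ} (hδ : 0 < δ) {ζ : Fin d ⊕ Fin n → ℂ}
    (hζ : ζ ∈ tube (tubeBase d n r)) :
    ((fun j => ζ (Sum.inl j), fun j => (δ : ℂ) * Complex.exp (Complex.I * ζ (Sum.inr j))) :
      Phase d n) ∈ domain d n r δ := by
  refine ⟨fun j => hζ.1 j, fun j => ?_⟩
  have h : 0 < (ζ (Sum.inr j)).im := hζ.2 j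
  rw [norm_mul, Complex.norm_exp, Complex.norm_real, Real.norm_of_nonneg hδ.le, Complex.I_mul_re]
  have : Real.exp (-(ζ (Sum.inr j)).im) < 1 := Real.exp_lt_one_iff.2 (by linarith)
  nlinarith

lemma tubeLift_periodic {r δ : ℝ} (hδ : 0 < δ) {u : Phase d n → ℂ} (hu : Holo r δ u) :
    TubePeriodic (tubeBase d n r) (tubeLift δ u) := by
  intro ζ hζ N
  have h := hu.2 _ (tubeLift_mem hδ hζ) (fun j => N (Sum.inl j))
  rw [tubeLift, tubeLift, ← h]
  congr 1
  refine Prod.ext rfl ?_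
  funext j
  simp only [shift]
  rw [mul_add, Complex.exp_add]
  have : Complex.I * (2 * (Real.pi : ℂ) * (N (Sum.inr j) : ℂ)) =
      (N (Sum.inr j) : ℂ) * (2 * Real.pi * Complex.I) := by ring
  rw [this, Complex.exp_int_mul_two_pi_mul_I, mul_one]

lemma tubeLift_differentiableOn {r δ : ℝ} (hδ : 0 < δ) {u : Phase d n → ℂ} (hu : Holo r δ u) :
    DifferentiableOn ℂ (tubeLift δ u) (tube (tubeBase d n r)) := by
  have h : Differentiable ℂ (fun ζ : Fin d ⊕ Fin n → ℂ => ((fun j => ζ (Sum.inl j),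
      fun j => (δ : ℂ) * Complex.exp (Complex.I * ζ (Sum.inr j))) : Phase d n)) := by
    refine Differentiable.prodMk ?_ ?_
    · rw [differentiable_pi]; intro j; fun_prop
    · rw [differentiable_pi]; intro j; fun_prop
  exact hu.1.comp h.differentiableOn fun ζ hζ => tubeLift_mem hδ hζ

/-- The exponents of the tube belonging to an index. -/
def idxToTube (p : Idx d n) : Fin d ⊕ Fin n → ℤ := Sum.elim p.1 (fun j => (p.2 j : ℤ))

lemma idxToTube_injective : Function.Injective (idxToTube (d := d) (n := n)) := by
  intro p q h
  refine Prod.ext (funext fun j => congrFun h (Sum.inl j)) (funext fun j => ?_)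
  have := congrFun h (Sum.inr j)
  simpa [idxToTube] using this

/-- The `y`-independent coefficient. -/
def tubeC (δ : ℝ) (u : Phase d n → ℂ) (N : Fin d ⊕ Fin n → ℤ) : ℂ :=
  Complex.exp (∑ j, (N j : ℂ) * ((Sum.elim (fun _ => 0) (fun _ => 1) : Fin d ⊕ Fin n → ℝ) j : ℂ)) *
    tubeCoeff (tubeLift δ u) (fun j => Complex.I *
      ((Sum.elim (fun _ => 0) (fun _ => 1) : Fin d ⊕ Fin n → ℝ) j : ℂ)) N

lemma tubeCoeff_eq_tubeC {r δ C : ℝ} (hr : 0 < r) (hδ : 0 < δ) {u : Phase d n → ℂ}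
    (hu : Holo r δ u) (hC : ∀ Z ∈ domain d n r δ, ‖u Z‖ ≤ C) {y : Fin d ⊕ Fin n → ℝ}
    (hy : y ∈ tubeBase d n r) (N : Fin d ⊕ Fin n → ℤ) :
    tubeCoeff (tubeLift δ u) (fun j => Complex.I * (y j : ℂ)) N =
      Complex.exp (-∑ j, (N j : ℂ) * (y j : ℂ)) * tubeC δ u N := by
  rw [tubeCoeff_shift (isOpen_tubeBase r) (convex_tubeBase r) (tubeLift_periodic hδ hu)
    (tubeLift_differentiableOn hδ hu) (fun ζ hζ => hC _ (tubeLift_mem hδ hζ))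
    (y₀ := Sum.elim (fun _ => 0) (fun _ => 1)) ⟨fun _ => by simpa using hr, by simp⟩ hy, tubeC, ← mul_assoc,
    ← Complex.exp_add]
  congr 2
  simp only [mul_sub, Finset.sum_sub_distrib]
  ring

lemma norm_tubeC_le {r δ C : ℝ} (hr : 0 < r) (hδ : 0 < δ) {u : Phase d n → ℂ}
    (hu : Holo r δ u) (hC : ∀ Z ∈ domain d n r δ, ‖u Z‖ ≤ C) {y : Fin d ⊕ Fin n → ℝ}
    (hy : y ∈ tubeBase d n r) (N : Fin d ⊕ Fin n → ℤ) :
    ‖tubeC δ u N‖ ≤ C * Real.exp (∑ j, (N j : ℝ) * y j) := by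
  have h1 := tubeCoeff_eq_tubeC hr hδ hu hC hy N
  have h2 : ‖tubeCoeff (tubeLift δ u) (fun j => Complex.I * (y j : ℂ)) N‖ ≤ C :=
    norm_tubeCoeff_le (Ω := tubeBase d n r) (fun ζ hζ => hC _ (tubeLift_mem hδ hζ))
      (by simpa [tube] using hy) N
  rw [h1, norm_mul, Complex.norm_exp] at h2
  have h3 : (-∑ j, (N j : ℂ) * (y j : ℂ)).re = -∑ j, (N j : ℝ) * y j := by
    rw [Complex.neg_re, Complex.re_sum]
    simp
  rw [h3, Real.exp_neg, inv_mul_le_iff₀ (Real.exp_pos _)] at h2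
  linarith

lemma tubeC_eq_zero {r δ C : ℝ} (hr : 0 < r) (hδ : 0 < δ) {u : Phase d n → ℂ}
    (hu : Holo r δ u) (hC : ∀ Z ∈ domain d n r δ, ‖u Z‖ ≤ C) {N : Fin d ⊕ Fin n → ℤ} {j₀ : Fin n}
    (hN : N (Sum.inr j₀) < 0) : tubeC δ u N = 0 := by
  have hmem : ∀ T : ℝ, 0 < T →
      (Sum.elim (fun _ => 0) (fun j => if j = j₀ then T else 1) : Fin d ⊕ Fin n → ℝ) ∈
        tubeBase d n r := by
    intro T hT
    refine ⟨fun _ => by simpa using hr, fun j => ?_⟩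
    simp only [Sum.elim_inr]
    split_ifs <;> linarith
  have hbound : ∀ T : ℝ, 0 < T → ‖tubeC δ u N‖ ≤
      C * Real.exp ((∑ j ∈ Finset.univ.erase j₀, (N (Sum.inr j) : ℝ)) - T) := by
    intro T hT
    refine (norm_tubeC_le hr hδ hu hC (hmem T hT) N).trans ?_
    have hC0 : 0 ≤ C := le_trans (norm_nonneg _) (hC 0 ⟨fun _ => by simpa using hr, fun _ => by simpa using hδ⟩)
    gcongr
    rw [Fintype.sum_sum_type]
    simp only [Sum.elim_inl, mul_zero, Finset.sum_const_zero, Sum.elim_inr, zero_add]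
    rw [← Finset.add_sum_erase _ _ (Finset.mem_univ j₀)]
    simp only [if_true]
    have h1 : ∑ j ∈ Finset.univ.erase j₀, (N (Sum.inr j) : ℝ) * (if j = j₀ then T else 1) =
        ∑ j ∈ Finset.univ.erase j₀, (N (Sum.inr j) : ℝ) := by
      refine Finset.sum_congr rfl fun j hj => ?_
      rw [if_neg (Finset.ne_of_mem_erase hj), mul_one]
    rw [h1]
    have h2 : (N (Sum.inr j₀) : ℝ) ≤ -1 := by exact_mod_cast Int.le_sub_one_of_lt hN
    nlinarith
  have hlim : Tendsto (fun T : ℝ => C * Real.exp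
      ((∑ j ∈ Finset.univ.erase j₀, (N (Sum.inr j) : ℝ)) - T)) atTop (𝓝 (C * 0)) := by
    refine Tendsto.const_mul C (Real.tendsto_exp_atBot.comp ?_)
    exact tendsto_atBot_add_const_left _ _ tendsto_neg_atTop_atBot
  have h0 : ‖tubeC δ u N‖ ≤ C * 0 := by
    refine ge_of_tendsto hlim ?_
    filter_upwards [eventually_gt_atTop 0] with T hT using hbound T hT
  simpa using h0

lemma norm_tubeC_idx_le {r δ C : ℝ} (hr : 0 < r) (hδ : 0 < δ) {u : Phase d n → ℂ}
    (hu : Holo r δ u) (hC : ∀ Z ∈ domain d n r δ, ‖u Z‖ ≤ C) (p : Idx d n) :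
    ‖tubeC δ u (idxToTube p)‖ ≤ C * Real.exp (-(r * absP p.1)) := by
  have hmem : ∀ x : ℝ, x ∈ Ioo 0 1 → (Sum.elim (fun j => -(SignType.sign (p.1 j) : ℝ) * (r * (1 - x)))
      (fun _ => x) : Fin d ⊕ Fin n → ℝ) ∈ tubeBase d n r := by
    intro x hx
    refine ⟨fun j => ?_, fun j => by simpa using hx.1⟩
    simp only [Sum.elim_inl, abs_mul, abs_neg]
    have h1 : |((SignType.sign (p.1 j) : ℝ))| ≤ 1 := by
      rcases lt_trichotomy (p.1 j) 0 with h | h | h <;> simp [h]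
    have h2 : 0 < 1 - x := by linarith [hx.2]
    rw [abs_of_pos hr, abs_of_pos h2]
    have h3 : r * (1 - x) < r := by nlinarith [hx.1]
    have h4 : 0 < r * (1 - x) := by positivity
    nlinarith
  have hbound : ∀ x : ℝ, x ∈ Ioo 0 1 → ‖tubeC δ u (idxToTube p)‖ ≤
      C * Real.exp (-(r * (1 - x) * absP p.1) + x * degQ p.2) := by
    intro x hx
    refine (norm_tubeC_le hr hδ hu hC (hmem x hx) _).trans (le_of_eq ?_)
    congr 2
    rw [Fintype.sum_sum_type]
    simp only [idxToTube, Sum.elim_inl, Sum.elim_inr, absP, degQ]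
    push_cast
    rw [Finset.mul_sum, Finset.mul_sum, ← Finset.sum_neg_distrib]
    congr 1
    · refine Finset.sum_congr rfl fun j _ => ?_
      have h1 : (p.1 j : ℝ) * (SignType.sign (p.1 j) : ℝ) = ((p.1 j).natAbs : ℝ) := by
        rw [Nat.cast_natAbs]
        rcases lt_trichotomy (p.1 j) 0 with h | h | h
        · simp [h, abs_of_neg h]
        · simp [h]
        · simp [h, abs_of_pos h]
      calc (p.1 j : ℝ) * (-(SignType.sign (p.1 j) : ℝ) * (r * (1 - x))) =
          -(r * (1 - x) * ((p.1 j : ℝ) * (SignType.sign (p.1 j) : ℝ))) := by ring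
        _ = _ := by rw [h1]
    · refine Finset.sum_congr rfl fun j _ => ?_
      ring
  have hlim : Tendsto (fun x : ℝ => C * Real.exp (-(r * (1 - x) * absP p.1) + x * degQ p.2))
      (𝓝[>] 0) (𝓝 (C * Real.exp (-(r * (1 - 0) * absP p.1) + 0 * degQ p.2))) := by
    refine tendsto_nhdsWithin_of_tendsto_nhds (Continuous.tendsto ?_ 0)
    fun_prop
  have h0 := ge_of_tendsto hlim (by
    filter_upwards [Ioo_mem_nhdsGT (zero_lt_one' ℝ)] with x hx using hbound x hx)
  simpa using h0

/-- The coefficients of the development on `V_r × W_δ`. -/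
def tubeSeries (δ : ℝ) (u : Phase d n → ℂ) : Series d n := fun p =>
  tubeC δ u (idxToTube p) * ((δ : ℂ) ^ degQ p.2)⁻¹

lemma majorized_tubeSeries {r δ C : ℝ} (hr : 0 < r) (hδ : 0 < δ) {u : Phase d n → ℂ}
    (hu : Holo r δ u) (hC : ∀ Z ∈ domain d n r δ, ‖u Z‖ ≤ C) :
    Majorized r δ C (tubeSeries δ u) := by
  intro p
  have h1 := norm_tubeC_idx_le hr hδ hu hC p
  rw [tubeSeries, norm_mul, norm_inv, norm_pow, Complex.norm_real, Real.norm_of_nonneg hδ.le]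
  have h2 : 0 < δ ^ degQ p.2 := by positivity
  rw [Real.exp_neg] at h1
  have h3 := Real.exp_pos (r * absP p.1)
  calc ‖tubeC δ u (idxToTube p)‖ * (δ ^ degQ p.2)⁻¹ * Real.exp (r * absP p.1) * δ ^ degQ p.2 =
      ‖tubeC δ u (idxToTube p)‖ * Real.exp (r * absP p.1) := by field_simp
    _ ≤ C * (Real.exp (r * absP p.1))⁻¹ * Real.exp (r * absP p.1) := by gcongr
    _ = C := by field_simp

lemma eval_tubeSeries_of_ne_zero {r δ C : ℝ} (hr : 0 < r) (hδ : 0 < δ) {u : Phase d n → ℂ}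
    (hu : Holo r δ u) (hC : ∀ Z ∈ domain d n r δ, ‖u Z‖ ≤ C) {Z : Phase d n}
    (hZ : Z ∈ domain d n r δ) (hne : ∀ j, Z.2 j ≠ 0) : eval (tubeSeries δ u) Z = u Z := by
  set y : Fin d ⊕ Fin n → ℝ := Sum.elim (fun j => (Z.1 j).im) (fun j => -Real.log (‖Z.2 j‖ / δ))
    with hydef
  set x : Fin d ⊕ Fin n → ℝ := Sum.elim (fun j => (Z.1 j).re) (fun j => (Z.2 j).arg) with hxdef
  have hy : y ∈ tubeBase d n r := by
    refine ⟨fun j => hZ.1 j, fun j => ?_⟩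
    simp only [hydef, Sum.elim_inr]
    have h1 : 0 < ‖Z.2 j‖ := norm_pos_iff.2 (hne j)
    rw [neg_pos]
    exact Real.log_neg (by positivity) ((div_lt_one hδ).2 (hZ.2 j))
  have hδ' : (δ : ℂ) ≠ 0 := by exact_mod_cast hδ.ne'
  have hexp : ∀ j, Complex.exp (Complex.I * ((x (Sum.inr j) : ℂ) + Complex.I * (y (Sum.inr j) : ℂ)))
      = Z.2 j / δ := by
    intro j
    have h1 : 0 < ‖Z.2 j‖ := norm_pos_iff.2 (hne j)
    have h2 : Complex.I * ((x (Sum.inr j) : ℂ) + Complex.I * (y (Sum.inr j) : ℂ)) =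
        ((Real.log (‖Z.2 j‖ / δ) : ℝ) : ℂ) + (Z.2 j).arg * Complex.I := by
      simp only [hxdef, hydef, Sum.elim_inr]
      push_cast
      rw [mul_add, ← mul_assoc, Complex.I_mul_I]
      ring
    rw [h2, Complex.exp_add, ← Complex.ofReal_exp, Real.exp_log (by positivity)]
    push_cast
    rw [div_mul_eq_mul_div, Complex.norm_mul_exp_arg_mul_I]
  have hpt : tubeLift δ u (fun j => (x j : ℂ) + Complex.I * (y j : ℂ)) = u Z := by
    rw [tubeLift]
    congr 1
    refine Prod.ext (funext fun j => ?_) (funext fun j => ?_)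
    · simp only [hxdef, hydef, Sum.elim_inl]
      rw [mul_comm]
      exact Complex.re_add_im _
    · simp only [hexp]
      field_simp
  have hterm : ∀ p : Idx d n, tubeCoeff (tubeLift δ u) (fun j => Complex.I * (y j : ℂ)) (idxToTube p) *
      Complex.exp (Complex.I * ∑ j, (idxToTube p j : ℂ) * (x j : ℂ)) =
      tubeSeries δ u p * mono p Z := by
    intro p
    rw [tubeCoeff_eq_tubeC hr hδ hu hC hy, tubeSeries, mono]
    have h1 : Complex.exp (-∑ j, (idxToTube p j : ℂ) * (y j : ℂ)) *
        Complex.exp (Complex.I * ∑ j, (idxToTube p j : ℂ) * (x j : ℂ)) =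
        Complex.exp (Complex.I * ∑ j, (p.1 j : ℂ) * Z.1 j) *
          ∏ j, (Z.2 j / δ) ^ p.2 j := by
      have h2 : ∀ j, (Z.2 j / δ) ^ p.2 j = Complex.exp ((p.2 j : ℂ) *
          (Complex.I * ((x (Sum.inr j) : ℂ) + Complex.I * (y (Sum.inr j) : ℂ)))) := by
        intro j
        rw [Complex.exp_nat_mul, hexp]
      simp only [h2]
      rw [← Complex.exp_sum, ← Complex.exp_add, ← Complex.exp_add, Fintype.sum_sum_type,
        Fintype.sum_sum_type]
      congr 1
      have h3 : ∀ j, Z.1 j = (x (Sum.inl j) : ℂ) + Complex.I * (y (Sum.inl j) : ℂ) := by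
        intro j
        simp only [hxdef, hydef, Sum.elim_inl]
        rw [mul_comm]
        exact (Complex.re_add_im _).symm
      simp only [h3, idxToTube, Sum.elim_inl, Sum.elim_inr, Int.cast_natCast, mul_add,
        Finset.mul_sum, Finset.sum_add_distrib]
      have h5 : ∀ a b : ℂ, a * (Complex.I * (Complex.I * b)) = -(a * b) := by
        intro a b
        linear_combination (a * b) * Complex.I_mul_I
      have h6 : ∀ a b : ℂ, a * (Complex.I * b) = Complex.I * (a * b) := by
        intro a b
        ring
      simp only [h5, h6, Finset.sum_neg_distrib]
      ring_nf
      have h7 : Complex.I ^ 2 = -1 := Complex.I_sq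
      simp only [h7]
      simp only [Finset.sum_neg_distrib, neg_mul, one_mul]
      ring
    rw [mul_right_comm, h1]
    simp only [div_pow, Finset.prod_div_distrib, pow_degQ]
    rw [div_eq_mul_inv]
    ring
  have hout : ∀ N ∉ Set.range (idxToTube (d := d) (n := n)), tubeC δ u N = 0 := by
    intro N hN
    by_contra hne'
    apply hN
    have hnn : ∀ j, 0 ≤ N (Sum.inr j) := fun j => by
      by_contra hlt
      exact hne' (tubeC_eq_zero hr hδ hu hC (not_le.1 hlt))
    refine ⟨(fun j => N (Sum.inl j), fun j => (N (Sum.inr j)).toNat), ?_⟩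
    funext j
    rcases j with j | j
    · rfl
    · simpa [idxToTube] using hnn j
  have hmaj := majorized_tubeSeries hr hδ hu hC
  have hsum : Summable (tubeCoeff (tubeLift δ u) (fun j => Complex.I * (y j : ℂ))) := by
    rw [← idxToTube_injective.summable_iff (fun N hN => by
      rw [tubeCoeff_eq_tubeC hr hδ hu hC hy, hout N hN, mul_zero])]
    rw [← summable_norm_iff]
    refine (hmaj.summable hδ hZ).norm.congr fun p => ?_
    rw [← hterm, norm_mul, Complex.norm_exp]
    have : (Complex.I * ∑ j, (idxToTube p j : ℂ) * (x j : ℂ)).re = 0 := by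
      rw [Complex.I_mul_re, Complex.im_sum]
      simp
    rw [this, Real.exp_zero, mul_one]
    rfl
  have h1 := hasSum_tubeCoeff (tubeLift_periodic hδ hu)
    (tubeLift_differentiableOn hδ hu).continuousOn hy hsum x
  rw [hpt, ← idxToTube_injective.hasSum_iff (fun N hN => by
      rw [tubeCoeff_eq_tubeC hr hδ hu hC hy, hout N hN, mul_zero, zero_mul])] at h1
  have h2 : HasSum (fun p => tubeSeries δ u p * mono p Z) (u Z) := by
    refine h1.congr_fun ?_ |> id
    intro p
    exact (hterm p).symm
  exact h2.tsum_eq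

theorem eval_tubeSeries {r δ C : ℝ} (hr : 0 < r) (hδ : 0 < δ) {u : Phase d n → ℂ}
    (hu : Holo r δ u) (hC : ∀ Z ∈ domain d n r δ, ‖u Z‖ ≤ C) {Z : Phase d n}
    (hZ : Z ∈ domain d n r δ) : eval (tubeSeries δ u) Z = u Z := by
  set γ : ℝ → Phase d n := fun s => (Z.1, fun j => if Z.2 j = 0 then (s : ℂ) else Z.2 j) with hγ
  have hγ0 : γ 0 = Z := by
    refine Prod.ext rfl (funext fun j => ?_)
    simp only [hγ]
    split_ifs with h
    · simp [h]
    · rfl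
  have hγc : Continuous γ := by
    refine Continuous.prodMk continuous_const (continuous_pi fun j => ?_)
    by_cases h : Z.2 j = 0
    · simp only [h, if_true]; fun_prop
    · simp only [h, if_false]; fun_prop
  have hlim : Tendsto γ (𝓝[>] 0) (𝓝 Z) := by
    rw [← hγ0]
    exact tendsto_nhdsWithin_of_tendsto_nhds (hγc.tendsto 0)
  have hmaj := majorized_tubeSeries hr hδ hu hC
  have hnhds := (isOpen_domain (d := d) (n := n) r δ).mem_nhds hZ
  have h1 := ((hmaj.holo hδ).1.continuousOn.continuousAt hnhds).tendsto.comp hlim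
  have h2 := (hu.1.continuousOn.continuousAt hnhds).tendsto.comp hlim
  refine tendsto_nhds_unique_of_eventuallyEq h1 h2 ?_
  filter_upwards [hlim hnhds, self_mem_nhdsWithin] with s hs hs0
  refine eval_tubeSeries_of_ne_zero hr hδ hu hC hs fun j => ?_
  simp only [hγ]
  split_ifs with h
  · exact_mod_cast (ne_of_gt hs0)
  · exact h

theorem Holo.exists_series {r δ C : ℝ} (hr : 0 < r) (hδ : 0 < δ) {u : Phase d n → ℂ}
    (hu : Holo r δ u) (hC : ∀ Z ∈ domain d n r δ, ‖u Z‖ ≤ C) :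
    ∃ f : Series d n, Majorized r δ C f ∧ ∀ Z ∈ domain d n r δ, eval f Z = u Z :=
  ⟨_, majorized_tubeSeries hr hδ hu hC, fun _ hZ => eval_tubeSeries hr hδ hu hC hZ⟩

theorem Holo.exists_bound {E : Type*} [NormedAddCommGroup E] [NormedSpace ℂ E] {r δ : ℝ}
    {u : Phase d n → E} (hu : Holo r δ u) {r' δ' : ℝ} (hr : r' < r) (hδ : δ' < δ) :
    ∃ C, ∀ Z ∈ domain d n r' δ', ‖u Z‖ ≤ C := by
  set K : Set (Phase d n) := (Set.pi univ fun _ => (Icc 0 (2 * Real.pi)) ×ℂ (Icc (-r') r')) ×ˢ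
    (Set.pi univ fun _ => Metric.closedBall 0 δ') with hK
  have hKc : IsCompact K := (isCompact_univ_pi fun _ =>
    (isCompact_Icc.reProdIm isCompact_Icc)).prod (isCompact_univ_pi fun _ => isCompact_closedBall _ _)
  have hKsub : K ⊆ domain d n r δ := by
    rintro Z ⟨h1, h2⟩
    refine ⟨fun j => ?_, fun j => ?_⟩
    · have := (h1 j (mem_univ j)).2
      exact (abs_le.2 this).trans_lt hr
    · have := h2 j (mem_univ j)
      rw [mem_closedBall_zero_iff] at this
      exact this.trans_lt hδ
  obtain ⟨C, hC⟩ := hKc.exists_bound_of_continuousOn (hu.1.continuousOn.mono hKsub)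
  refine ⟨C, fun Z hZ => ?_⟩
  have hZ' : Z ∈ domain d n r δ := domain_mono hr.le hδ.le hZ
  rw [← hu.2 Z hZ' (fun j => -⌊(Z.1 j).re / (2 * Real.pi)⌋)]
  refine hC _ ⟨fun j _ => ?_, fun j _ => ?_⟩
  · have hpi := Real.two_pi_pos
    have h1 := Int.floor_le ((Z.1 j).re / (2 * Real.pi))
    have h2 := Int.lt_floor_add_one ((Z.1 j).re / (2 * Real.pi))
    rw [le_div_iff₀ hpi] at h1
    rw [div_lt_iff₀ hpi] at h2
    have h3 : (shift (fun j => -⌊(Z.1 j).re / (2 * Real.pi)⌋) Z).1 j = Z.1 j +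
        ((2 * Real.pi * (-⌊(Z.1 j).re / (2 * Real.pi)⌋ : ℝ) : ℝ) : ℂ) := by
      simp only [shift]
      push_cast
      ring
    rw [h3, Complex.mem_reProdIm, Complex.add_re, Complex.add_im, Complex.ofReal_re,
      Complex.ofReal_im, add_zero]
    refine ⟨⟨by nlinarith, by nlinarith⟩, ?_⟩
    exact abs_le.1 (hZ.1 j).le
  · rw [mem_closedBall_zero_iff]
    exact (hZ.2 j).le

/-! ### Cauchy estimates for coefficients and uniqueness -/

section Cauchy

local instance : MeasureSpace UnitAddCircle := ⟨AddCircle.haarAddCircle⟩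

local instance : IsProbabilityMeasure (volume : Measure UnitAddCircle) :=
  inferInstanceAs (IsProbabilityMeasure AddCircle.haarAddCircle)

lemma mFourierCoeff_mFourier {ι : Type*} [Fintype ι] (M N : ι → ℤ) :
    UnitAddTorus.mFourierCoeff (UnitAddTorus.mFourier M) N = if N = M then 1 else 0 := by
  have h := (orthonormal_iff_ite.1 (UnitAddTorus.orthonormal_mFourier (d := ι))) N M
  simp only [ContinuousMap.inner_toLp] at h
  rw [← h, UnitAddTorus.mFourierCoeff]
  refine integral_congr_ae (Eventually.of_forall fun t => ?_)
  simp only [UnitAddTorus.mFourier_neg, smul_eq_mul]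
  ring

lemma norm_coeff_le_of_hasSum {ι α : Type*} [Fintype ι] [Countable α] {e : α → ι → ℤ}
    (he : Function.Injective e) {a : α → ℂ} (ha : Summable fun p => ‖a p‖) {M : ℝ}
    (hM : ∀ t : UnitAddTorus ι, ‖∑' p, a p * UnitAddTorus.mFourier (e p) t‖ ≤ M) (p : α) :
    ‖a p‖ ≤ M := by
  classical
  have h1 := norm_mFourierCoeff_le hM (e p)
  have h2 : UnitAddTorus.mFourierCoeff
      (fun t : UnitAddTorus ι => ∑' q, a q * UnitAddTorus.mFourier (e q) t) (e p) = a p := by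
    have h3 : HasSum (fun q => ∫ t : UnitAddTorus ι,
        UnitAddTorus.mFourier (-(e p)) t • (a q * UnitAddTorus.mFourier (e q) t))
        (∫ t : UnitAddTorus ι, ∑' q,
          UnitAddTorus.mFourier (-(e p)) t • (a q * UnitAddTorus.mFourier (e q) t)) := by
      refine hasSum_integral_of_summable_integral_norm (fun q => ?_) ?_
      · refine Integrable.mono' (integrable_const ‖a q‖) ?_ (Eventually.of_forall fun t => ?_)
        · exact Continuous.aestronglyMeasurable (by fun_prop)
        · simp [norm_mFourier_apply]
      · refine ha.congr fun q => ?_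
        simp [norm_mFourier_apply]
    have h4 : ∀ q, (∫ t : UnitAddTorus ι,
        UnitAddTorus.mFourier (-(e p)) t • (a q * UnitAddTorus.mFourier (e q) t)) =
        if q = p then a p else 0 := by
      intro q
      have h5 : (∫ t : UnitAddTorus ι,
          UnitAddTorus.mFourier (-(e p)) t • (a q * UnitAddTorus.mFourier (e q) t)) =
          a q * UnitAddTorus.mFourierCoeff (UnitAddTorus.mFourier (e q)) (e p) := by
        rw [UnitAddTorus.mFourierCoeff, ← integral_const_mul]
        refine integral_congr_ae (Eventually.of_forall fun t => ?_)
        simp only [smul_eq_mul]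
        ring
      rw [h5, mFourierCoeff_mFourier]
      by_cases h : q = p
      · simp [h]
      · have : ¬ e p = e q := fun h' => h (he h'.symm)
        simp [h, this]
    simp only [h4] at h3
    have h6 := h3.unique (hasSum_ite_eq p (a p))
    rw [UnitAddTorus.mFourierCoeff, ← h6]
    refine integral_congr_ae (Eventually.of_forall fun t => ?_)
    simp only [smul_eq_mul]
    rw [tsum_mul_left]
  rwa [h2] at h1

lemma Majorized.norm_coeff_le {r δ C : ℝ} {f : Series d n} (hf : Majorized r δ C f)
    (hr : 0 < r) {s M : ℝ} (hs : 0 < s) (hsδ : s < δ)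
    (hM : ∀ Z : Phase d n, (∀ j, (Z.1 j).im = 0) → (∀ j, ‖Z.2 j‖ = s) → ‖eval f Z‖ ≤ M)
    (p : Idx d n) : ‖f p‖ * s ^ degQ p.2 ≤ M := by
  have hδ : 0 < δ := hs.trans hsδ
  have hpt : ∀ t : UnitAddTorus (Fin d ⊕ Fin n), ∀ p : Idx d n,
      f p * mono p ((fun j => ((2 * Real.pi * torusRep t (Sum.inl j) : ℝ) : ℂ),
        fun j => (s : ℂ) * Complex.exp (Complex.I * ((2 * Real.pi * torusRep t (Sum.inr j) : ℝ) : ℂ))) :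
          Phase d n) =
      (f p * (s : ℂ) ^ degQ p.2) * UnitAddTorus.mFourier (idxToTube p) t := by
    intro t p
    have h1 : UnitAddTorus.mFourier (idxToTube p) t = UnitAddTorus.mFourier (idxToTube p)
        (fun j => ((torusRep t j : ℝ) : UnitAddCircle)) := by
      congr 1
      funext j
      exact (coe_torusRep t j).symm
    rw [h1, mFourier_coe, mono, Fintype.sum_sum_type, mul_add, Complex.exp_add]
    simp only [idxToTube, Sum.elim_inl, Sum.elim_inr, mul_pow, Finset.prod_mul_distrib]
    rw [← pow_degQ]
    have h2 : ∏ j, Complex.exp (Complex.I * ((2 * Real.pi * torusRep t (Sum.inr j) : ℝ) : ℂ)) ^ p.2 j =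
        Complex.exp (Complex.I * ∑ j, (((p.2 j : ℤ)) : ℂ) * (2 * (Real.pi : ℂ) *
          (torusRep t (Sum.inr j) : ℂ))) := by
      rw [Finset.mul_sum, Complex.exp_sum]
      refine Finset.prod_congr rfl fun j _ => ?_
      rw [← Complex.exp_nat_mul]
      congr 1
      push_cast
      ring
    rw [h2]
    push_cast
    ring
  have hmem : ∀ t : UnitAddTorus (Fin d ⊕ Fin n),
      (∀ j : Fin n, ‖(s : ℂ) * Complex.exp (Complex.I *
        ((2 * Real.pi * torusRep t (Sum.inr j) : ℝ) : ℂ))‖ = s) := by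
    intro t j
    rw [norm_mul, Complex.norm_exp, Complex.I_mul_re, Complex.ofReal_im, neg_zero, Real.exp_zero,
      mul_one, Complex.norm_real, Real.norm_of_nonneg hs.le]
  have hsum : Summable fun p : Idx d n => ‖f p * (s : ℂ) ^ degQ p.2‖ := by
    have hZ : ((fun j => ((2 * Real.pi * torusRep (0 : UnitAddTorus (Fin d ⊕ Fin n)) (Sum.inl j) : ℝ) : ℂ),
        fun j => (s : ℂ) * Complex.exp (Complex.I *
          ((2 * Real.pi * torusRep (0 : UnitAddTorus (Fin d ⊕ Fin n)) (Sum.inr j) : ℝ) : ℂ))) :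
          Phase d n) ∈ domain d n r δ :=
      ⟨fun j => by simpa only [Complex.ofReal_im, abs_zero] using hr,
        fun j => by simpa only [hmem] using hsδ⟩
    refine (hf.summable hδ hZ).norm.congr fun p => ?_
    rw [hpt, norm_mul _ (UnitAddTorus.mFourier _ _), norm_mFourier_apply, mul_one]
  have key := norm_coeff_le_of_hasSum (idxToTube_injective (d := d) (n := n)) hsum (M := M) (by
    intro t
    have h := hM ((fun j => ((2 * Real.pi * torusRep t (Sum.inl j) : ℝ) : ℂ),
        fun j => (s : ℂ) * Complex.exp (Complex.I * ((2 * Real.pi * torusRep t (Sum.inr j) : ℝ) : ℂ))))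
      (fun j => Complex.ofReal_im _) (hmem t)
    simpa only [eval, hpt] using h) p
  rwa [norm_mul, norm_pow, Complex.norm_real, Real.norm_of_nonneg hs.le] at key

end Cauchy

/-! ### Germs along the torus -/

/-- The imaginary parts of `X`, and `Y`. -/
def transverse (Z : Phase d n) : (Fin d → ℝ) × (Fin n → ℂ) := (fun j => (Z.1 j).im, Z.2)

/-- The filter of neighbourhoods `V_ρ × W_ρ` of the torus. -/
def nT (d n : ℕ) : Filter (Phase d n) := comap transverse (𝓝 0)

lemma ball_transverse {ρ : ℝ} (hρ : 0 < ρ) :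
    transverse ⁻¹' (Metric.ball (0 : (Fin d → ℝ) × (Fin n → ℂ)) ρ) = domain d n ρ ρ := by
  ext Z
  simp only [mem_preimage, mem_ball_zero_iff, Prod.norm_def, sup_lt_iff, transverse,
    pi_norm_lt_iff hρ, Real.norm_eq_abs, domain, mem_ofPred_eq]

lemma nT_basis : (nT d n).HasBasis (fun ρ : ℝ => 0 < ρ) (fun ρ => domain d n ρ ρ) := by
  have h := (Metric.nhds_basis_ball (x := (0 : (Fin d → ℝ) × (Fin n → ℂ)))).comap
    (transverse (d := d) (n := n))
  refine h.to_hasBasis' (fun ρ hρ => ⟨ρ, hρ, (ball_transverse hρ).ge⟩) (fun ρ hρ => ?_)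
  rw [← ball_transverse hρ]
  exact preimage_mem_comap (Metric.ball_mem_nhds _ hρ)

lemma domain_mem_nT {r δ : ℝ} (hr : 0 < r) (hδ : 0 < δ) : domain d n r δ ∈ nT d n :=
  mem_of_superset (nT_basis.mem_of_mem (lt_min hr hδ))
    (domain_mono (min_le_left _ _) (min_le_right _ _))

lemma eventually_nT {p : Phase d n → Prop} :
    (∀ᶠ Z in nT d n, p Z) ↔ ∃ ρ > 0, ∀ Z ∈ domain d n ρ ρ, p Z :=
  nT_basis.eventually_iff

lemma tendsto_norm_snd : Tendsto (fun Z : Phase d n => ‖Z.2‖) (nT d n) (𝓝 0) := by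
  rw [Metric.tendsto_nhds]
  intro ε hε
  filter_upwards [domain_mem_nT hε hε] with Z hZ
  rw [dist_zero_right, norm_norm, pi_norm_lt_iff hε]
  exact hZ.2

section Germs

variable {E F : Type*} [NormedAddCommGroup E] [NormedSpace ℂ E] [NormedAddCommGroup F]
  [NormedSpace ℂ F]

/-- Vanishing to order `k` in `Y` along the torus. -/
def Ord (k : ℕ) (u : Phase d n → E) : Prop := u =O[nT d n] fun Z => ‖Z.2‖ ^ k

/-- Germs along the torus of holomorphic functions on `(ℂ/2πℤ)^d × ℂ^n`. -/
def Germ (u : Phase d n → E) : Prop := ∃ ρ > 0, Holo ρ ρ u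

lemma Holo.mono {r δ r' δ' : ℝ} {u : Phase d n → E} (hu : Holo r δ u) (hr : r' ≤ r)
    (hδ : δ' ≤ δ) : Holo r' δ' u :=
  ⟨hu.1.mono (domain_mono hr hδ), fun Z hZ => hu.2 Z (domain_mono hr hδ hZ)⟩

lemma Holo.germ {r δ : ℝ} {u : Phase d n → E} (hr : 0 < r) (hδ : 0 < δ) (hu : Holo r δ u) :
    Germ u := ⟨min r δ, lt_min hr hδ, hu.mono (min_le_left _ _) (min_le_right _ _)⟩

lemma Holo.congr {r δ : ℝ} {u v : Phase d n → E} (hu : Holo r δ u)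
    (h : ∀ Z ∈ domain d n r δ, v Z = u Z) : Holo r δ v :=
  ⟨hu.1.congr h, fun Z hZ P => by rw [h _ (shift_mem_domain hZ P), h Z hZ, hu.2 Z hZ]⟩

lemma Germ.congr {u v : Phase d n → E} (hu : Germ u) (h : v =ᶠ[nT d n] u) : Germ v := by
  obtain ⟨ρ, hρ, hu⟩ := hu
  obtain ⟨ρ', hρ', h⟩ := eventually_nT.1 h
  exact ⟨min ρ ρ', lt_min hρ hρ', (hu.mono (min_le_left _ _) (min_le_left _ _)).congr
    fun Z hZ => h Z (domain_mono (min_le_right _ _) (min_le_right _ _) hZ)⟩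

/-- Combination of two periodic holomorphic functions. -/
lemma Holo.comp₂ {G : Type*} [NormedAddCommGroup G] [NormedSpace ℂ G] {r δ : ℝ}
    {u : Phase d n → E} {v : Phase d n → F} (hu : Holo r δ u) (hv : Holo r δ v) {g : E × F → G}
    (hg : Differentiable ℂ g) : Holo r δ fun Z => g (u Z, v Z) :=
  ⟨hg.comp_differentiableOn (hu.1.prodMk hv.1), fun Z hZ P => by simp only [hu.2 Z hZ, hv.2 Z hZ]⟩

lemma Holo.comp₁ {r δ : ℝ} {u : Phase d n → E} (hu : Holo r δ u) {g : E → F}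
    (hg : Differentiable ℂ g) : Holo r δ fun Z => g (u Z) :=
  ⟨hg.comp_differentiableOn hu.1, fun Z hZ P => by simp only [hu.2 Z hZ]⟩

lemma Holo.const {r δ : ℝ} (c : E) : Holo r δ (fun _ : Phase d n => c) :=
  ⟨differentiableOn_const c, fun _ _ _ => rfl⟩

lemma Holo.add {r δ : ℝ} {u v : Phase d n → E} (hu : Holo r δ u) (hv : Holo r δ v) :
    Holo r δ fun Z => u Z + v Z := hu.comp₂ hv (g := fun q => q.1 + q.2) (by fun_prop)

lemma Holo.sub {r δ : ℝ} {u v : Phase d n → E} (hu : Holo r δ u) (hv : Holo r δ v) :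
    Holo r δ fun Z => u Z - v Z := hu.comp₂ hv (g := fun q => q.1 - q.2) (by fun_prop)

lemma Holo.smul {r δ : ℝ} {u : Phase d n → ℂ} {v : Phase d n → E} (hu : Holo r δ u)
    (hv : Holo r δ v) : Holo r δ fun Z => u Z • v Z :=
  hu.comp₂ hv (g := fun q => q.1 • q.2) (by fun_prop)

lemma Holo.clm_apply {r δ : ℝ} {A : Phase d n → E →L[ℂ] F} {v : Phase d n → E} (hA : Holo r δ A)
    (hv : Holo r δ v) : Holo r δ fun Z => A Z (v Z) :=
  ⟨hA.1.clm_apply hv.1, fun Z hZ P => by simp only [hA.2 Z hZ, hv.2 Z hZ]⟩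

lemma Holo.prodMk {r δ : ℝ} {u : Phase d n → E} {v : Phase d n → F} (hu : Holo r δ u)
    (hv : Holo r δ v) : Holo r δ fun Z => (u Z, v Z) := hu.comp₂ hv (g := id) differentiable_id

lemma holo_pi {m : ℕ} {r δ : ℝ} {u : Phase d n → Fin m → ℂ} :
    Holo r δ u ↔ ∀ j, Holo r δ fun Z => u Z j := by
  refine ⟨fun h j => h.comp₁ (g := fun v => v j) (by fun_prop), fun h => ⟨?_, ?_⟩⟩
  · rw [differentiableOn_pi]
    exact fun j => (h j).1
  · exact fun Z hZ P => funext fun j => (h j).2 Z hZ P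

lemma Germ.common {u : Phase d n → E} {v : Phase d n → F} (hu : Germ u) (hv : Germ v) :
    ∃ ρ > 0, Holo ρ ρ u ∧ Holo ρ ρ v := by
  obtain ⟨ρ, hρ, hu⟩ := hu
  obtain ⟨ρ', hρ', hv⟩ := hv
  exact ⟨min ρ ρ', lt_min hρ hρ', hu.mono (min_le_left _ _) (min_le_left _ _),
    hv.mono (min_le_right _ _) (min_le_right _ _)⟩

lemma Germ.comp₁ {u : Phase d n → E} (hu : Germ u) {g : E → F} (hg : Differentiable ℂ g) :
    Germ fun Z => g (u Z) := let ⟨ρ, hρ, hu⟩ := hu; ⟨ρ, hρ, hu.comp₁ hg⟩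

lemma Germ.const (c : E) : Germ (fun _ : Phase d n => c) := ⟨1, one_pos, Holo.const c⟩

lemma Germ.add {u v : Phase d n → E} (hu : Germ u) (hv : Germ v) : Germ fun Z => u Z + v Z :=
  let ⟨ρ, hρ, hu, hv⟩ := hu.common hv; ⟨ρ, hρ, hu.add hv⟩

lemma Germ.sub {u v : Phase d n → E} (hu : Germ u) (hv : Germ v) : Germ fun Z => u Z - v Z :=
  let ⟨ρ, hρ, hu, hv⟩ := hu.common hv; ⟨ρ, hρ, hu.sub hv⟩

lemma Germ.smul {u : Phase d n → ℂ} {v : Phase d n → E} (hu : Germ u) (hv : Germ v) :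
    Germ fun Z => u Z • v Z :=
  let ⟨ρ, hρ, hu, hv⟩ := hu.common hv; ⟨ρ, hρ, hu.smul hv⟩

lemma Germ.clm_apply {A : Phase d n → E →L[ℂ] F} {v : Phase d n → E} (hA : Germ A)
    (hv : Germ v) : Germ fun Z => A Z (v Z) :=
  let ⟨ρ, hρ, hA, hv⟩ := hA.common hv; ⟨ρ, hρ, hA.clm_apply hv⟩

lemma Germ.ord_zero {u : Phase d n → E} (hu : Germ u) : Ord 0 u := by
  obtain ⟨ρ, hρ, hu⟩ := hu
  obtain ⟨C, hC⟩ := hu.exists_bound (half_lt_self hρ) (half_lt_self hρ)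
  refine IsBigO.of_bound C ?_
  filter_upwards [domain_mem_nT (half_pos hρ) (half_pos hρ)] with Z hZ
  simpa using hC Z hZ

lemma Ord.exists_bound {k : ℕ} {u : Phase d n → E} (hu : Ord k u) :
    ∃ C > 0, ∃ ρ > 0, ∀ Z ∈ domain d n ρ ρ, ‖u Z‖ ≤ C * ‖Z.2‖ ^ k := by
  obtain ⟨C, hC0, hC⟩ := hu.exists_pos
  obtain ⟨ρ, hρ, h⟩ := eventually_nT.1 hC.bound
  exact ⟨C, hC0, ρ, hρ, fun Z hZ => by simpa using h Z hZ⟩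

lemma Ord.of_bound {k : ℕ} {u : Phase d n → E} {C : ℝ}
    (h : ∀ᶠ Z in nT d n, ‖u Z‖ ≤ C * ‖Z.2‖ ^ k) : Ord k u :=
  IsBigO.of_bound C (h.mono fun Z hZ => by simpa using hZ)

lemma ord_snd : Ord 1 (fun Z : Phase d n => Z.2) :=
  IsBigO.of_bound 1 (Eventually.of_forall fun Z => by simp)

lemma Ord.mono {k l : ℕ} {u : Phase d n → E} (hu : Ord l u) (h : k ≤ l) : Ord k u := by
  refine hu.trans (IsBigO.of_bound 1 ?_)
  filter_upwards [tendsto_norm_snd.eventually (Iio_mem_nhds one_pos)] with Z hZ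
  have hZ' : ‖Z.2‖ < 1 := hZ
  simp only [norm_pow, norm_norm, one_mul]
  exact pow_le_pow_of_le_one (norm_nonneg _) hZ'.le h

lemma Ord.add {k : ℕ} {u v : Phase d n → E} (hu : Ord k u) (hv : Ord k v) :
    Ord k fun Z => u Z + v Z := IsBigO.add hu hv

lemma Ord.sub {k : ℕ} {u v : Phase d n → E} (hu : Ord k u) (hv : Ord k v) :
    Ord k fun Z => u Z - v Z := IsBigO.sub hu hv

lemma Ord.neg {k : ℕ} {u : Phase d n → E} (hu : Ord k u) : Ord k fun Z => -u Z :=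
  IsBigO.neg_left hu

lemma Ord.smul {k l : ℕ} {u : Phase d n → ℂ} {v : Phase d n → E} (hu : Ord k u) (hv : Ord l v) :
    Ord (k + l) fun Z => u Z • v Z := by
  have := IsBigO.smul hu hv
  unfold Ord
  simpa only [smul_eq_mul, pow_add] using this

lemma Ord.mul {k l : ℕ} {u v : Phase d n → ℂ} (hu : Ord k u) (hv : Ord l v) :
    Ord (k + l) fun Z => u Z * v Z := hu.smul hv

lemma Ord.clm_apply {k l : ℕ} {A : Phase d n → E →L[ℂ] F} {v : Phase d n → E} (hA : Ord k A)
    (hv : Ord l v) : Ord (k + l) fun Z => A Z (v Z) := by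
  obtain ⟨C, hC, ρ, hρ, h⟩ := hA.exists_bound
  obtain ⟨C', hC', ρ', hρ', h'⟩ := hv.exists_bound
  refine Ord.of_bound (C := C * C') ?_
  filter_upwards [domain_mem_nT hρ hρ, domain_mem_nT hρ' hρ'] with Z hZ hZ'
  calc ‖A Z (v Z)‖ ≤ ‖A Z‖ * ‖v Z‖ := (A Z).le_opNorm _
    _ ≤ (C * ‖Z.2‖ ^ k) * (C' * ‖Z.2‖ ^ l) := by
      gcongr
      · exact h Z hZ
      · exact h' Z hZ'
    _ = _ := by rw [pow_add]; ring

lemma Ord.congr {k : ℕ} {u v : Phase d n → E} (hu : Ord k u) (h : v =ᶠ[nT d n] u) : Ord k v :=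
  IsBigO.congr' hu h.symm EventuallyEq.rfl

lemma Ord.prodMk {k : ℕ} {u : Phase d n → E} {v : Phase d n → F} (hu : Ord k u) (hv : Ord k v) :
    Ord k fun Z => (u Z, v Z) := isBigO_prod_left.2 ⟨hu, hv⟩

lemma Ord.snd {k : ℕ} {u : Phase d n → E × F} (hu : Ord k u) : Ord k fun Z => (u Z).2 :=
  (isBigO_prod_left.1 hu).2

lemma Ord.fst {k : ℕ} {u : Phase d n → E × F} (hu : Ord k u) : Ord k fun Z => (u Z).1 :=
  (isBigO_prod_left.1 hu).1

lemma Ord.tendsto_zero {k : ℕ} {u : Phase d n → E} (hu : Ord k u) (hk : 1 ≤ k) :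
    Tendsto u (nT d n) (𝓝 0) := by
  refine IsBigO.trans_tendsto hu ?_
  have := tendsto_norm_snd (d := d) (n := n) |>.pow k
  rwa [zero_pow (by omega)] at this

end Germs

/-! ### Differentiating germs -/

section Derivative

variable {E F : Type*} [NormedAddCommGroup E] [NormedSpace ℂ E] [NormedAddCommGroup F]
  [NormedSpace ℂ F]

lemma shift_eq_add (P : Fin d → ℤ) (Z : Phase d n) :
    shift P Z = Z + ((fun j => 2 * (Real.pi : ℂ) * (P j : ℂ)), 0) := by
  refine Prod.ext rfl ?_
  simp [shift]

lemma Holo.fderiv_shift {r δ : ℝ} {u : Phase d n → E} (hu : Holo r δ u) {Z : Phase d n}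
    (hZ : Z ∈ domain d n r δ) (P : Fin d → ℤ) : fderiv ℂ u (shift P Z) = fderiv ℂ u Z := by
  have h1 : fderiv ℂ (fun W => u (W + ((fun j => 2 * (Real.pi : ℂ) * (P j : ℂ)), 0))) Z =
      fderiv ℂ u (shift P Z) := by
    rw [fderiv_comp_add_right, shift_eq_add]
  rw [← h1]
  refine EventuallyEq.fderiv_eq ?_
  filter_upwards [(isOpen_domain r δ).mem_nhds hZ] with W hW
  rw [← shift_eq_add]
  exact hu.2 W hW P

lemma exists_mem_domain_inter {r δ : ℝ} (hr : 0 < r) (hδ : 0 < δ) {Z : Phase d n}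
    (hZ : Z ∈ domain d n r δ) :
    ∃ r' δ', 0 < r' ∧ r' < r ∧ 0 < δ' ∧ δ' < δ ∧ Z ∈ domain d n r' δ' := by
  obtain ⟨κ, h0, h1, hκ⟩ := exists_mem_domain_shrink hδ hZ
  refine ⟨max (r - κ) (r / 2), (1 - κ) * δ, ?_, ?_, ?_, ?_, domain_mono (le_max_left _ _) le_rfl hκ⟩
  · exact lt_max_of_lt_right (by linarith)
  · exact max_lt (by linarith) (by linarith)
  · have : 0 < 1 - κ := by linarith
    positivity
  · nlinarith

lemma Holo.fderiv_scalar {r δ : ℝ} (hr : 0 < r) (hδ : 0 < δ) {u : Phase d n → ℂ}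
    (hu : Holo r δ u) : Holo r δ (fderiv ℂ u) := by
  refine ⟨fun Z hZ => ?_, fun Z hZ P => hu.fderiv_shift hZ P⟩
  obtain ⟨r', δ', hr'0, hr', hδ'0, hδ', hZ'⟩ := exists_mem_domain_inter hr hδ hZ
  obtain ⟨C, hC⟩ := hu.exists_bound hr' hδ'
  obtain ⟨f, hf, hfu⟩ := (hu.mono hr'.le hδ'.le).exists_series hr'0 hδ'0 hC
  have hopen := isOpen_domain (d := d) (n := n) r' δ'
  have h1 := ((hf.differentiableOn_fderiv hδ'0) Z hZ').differentiableAt (hopen.mem_nhds hZ')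
  refine (h1.congr_of_eventuallyEq ?_).differentiableWithinAt
  filter_upwards [hopen.mem_nhds hZ'] with W hW
  refine EventuallyEq.fderiv_eq ?_
  filter_upwards [hopen.mem_nhds hW] with V hV
  exact (hfu V hV).symm

lemma Holo.fderiv [FiniteDimensional ℂ E] {r δ : ℝ} (hr : 0 < r) (hδ : 0 < δ)
    {u : Phase d n → E} (hu : Holo r δ u) : Holo r δ (fderiv ℂ u) := by
  refine ⟨?_, fun Z hZ P => hu.fderiv_shift hZ P⟩
  set b := Module.finBasis ℂ E
  set c : Fin (Module.finrank ℂ E) → E →L[ℂ] ℂ := fun i => LinearMap.toContinuousLinearMap (b.coord i)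
  have hc : ∀ x : E, x = ∑ i, c i x • b i := fun x => (b.sum_repr x).symm
  have h1 : ∀ i, DifferentiableOn ℂ (_root_.fderiv ℂ fun Z => c i (u Z)) (domain d n r δ) := fun i =>
    ((hu.comp₁ (c i).differentiable).fderiv_scalar hr hδ).1
  have h2 : DifferentiableOn ℂ (fun Z => ∑ i, (_root_.fderiv ℂ (fun Z => c i (u Z)) Z).smulRight (b i))
      (domain d n r δ) := by
    refine DifferentiableOn.fun_sum fun i _ => ?_
    exact ((ContinuousLinearMap.smulRightL ℂ (Phase d n) E).flip (b i)).differentiable.comp_differentiableOn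
      (h1 i)
  refine h2.congr fun Z hZ => ?_
  have hd := hu.1.differentiableAt ((isOpen_domain r δ).mem_nhds hZ)
  refine ContinuousLinearMap.ext fun v => ?_
  rw [hc (_root_.fderiv ℂ u Z v), _root_.sum_apply]
  refine Finset.sum_congr rfl fun i _ => ?_
  have h3 : HasFDerivAt (fun Z => c i (u Z)) ((c i).comp (_root_.fderiv ℂ u Z)) Z :=
    (c i).hasFDerivAt.comp Z hd.hasFDerivAt
  rw [h3.fderiv]
  rfl

lemma Germ.fderiv [FiniteDimensional ℂ E] {u : Phase d n → E} (hu : Germ u) :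
    Germ (fderiv ℂ u) := let ⟨ρ, hρ, hu⟩ := hu; ⟨ρ, hρ, hu.fderiv hρ hρ⟩

lemma Germ.eventually_differentiableAt {u : Phase d n → E} (hu : Germ u) :
    ∀ᶠ Z in nT d n, DifferentiableAt ℂ u Z := by
  obtain ⟨ρ, hρ, hu⟩ := hu
  filter_upwards [domain_mem_nT hρ hρ] with Z hZ
  exact hu.1.differentiableAt ((isOpen_domain ρ ρ).mem_nhds hZ)

end Derivative

/-! ### Increments of germs -/

section Increments

variable {E : Type*} [NormedAddCommGroup E] [NormedSpace ℂ E]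

lemma ball_subset_domain {ρ R : ℝ} {Z : Phase d n} (hZ : Z ∈ domain d n (ρ - R) (ρ - R)) :
    Metric.ball Z R ⊆ domain d n ρ ρ := by
  intro W hW
  rw [mem_ball_iff_norm, Prod.norm_def, sup_lt_iff] at hW
  refine ⟨fun j => ?_, fun j => ?_⟩
  · have h1 : |(W.1 j - Z.1 j).im| ≤ ‖(W - Z).1‖ :=
      (Complex.abs_im_le_norm _).trans (norm_le_pi_norm (W - Z).1 j)
    have h2 := hZ.1 j
    have h3 : (W.1 j).im = (Z.1 j).im + (W.1 j - Z.1 j).im := by simp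
    rw [h3]
    linarith [abs_add_le (Z.1 j).im (W.1 j - Z.1 j).im, hW.1]
  · have h1 : ‖W.2 j - Z.2 j‖ ≤ ‖(W - Z).2‖ := norm_le_pi_norm (W - Z).2 j
    have h2 := hZ.2 j
    have h3 : W.2 j = Z.2 j + (W.2 j - Z.2 j) := by ring
    rw [h3]
    linarith [norm_add_le (Z.2 j) (W.2 j - Z.2 j), hW.2]

lemma norm_sub_le_of_bound_ball {u : Phase d n → E} {Z w : Phase d n} {R C : ℝ}
    (hd : DifferentiableOn ℂ u (Metric.ball Z R)) (hC : ∀ W ∈ Metric.ball Z R, ‖u W‖ ≤ C)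
    (hw : ‖w‖ < R) : ‖u (Z + w) - u Z‖ ≤ 2 * C / R * ‖w‖ := by
  have hR : 0 < R := (norm_nonneg w).trans_lt hw
  have h := Complex.dist_le_div_mul_dist_of_mapsTo_ball (R₂ := 2 * C) (z := Z + w) hd (fun W hW => by
    rw [mem_closedBall_iff_norm]
    linarith [norm_sub_le (u W) (u Z), hC W hW, hC Z (Metric.mem_ball_self hR)])
    (by simpa using hw)
  simpa [dist_eq_norm] using h

/-- First order increments along a displacement of order `m ≥ 2`. -/
lemma Ord.increment {k m : ℕ} {u : Phase d n → E} (hu : Germ u) (hk : Ord k u)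
    {w : Phase d n → Phase d n} (hw : Ord m w) (hm : 2 ≤ m) :
    Ord (k - 1 + m) fun Z => u (Z + w Z) - u Z := by
  obtain ⟨ρ₁, hρ₁, hu⟩ := hu
  obtain ⟨C, hC, ρ₂, hρ₂, hk⟩ := hk.exists_bound
  obtain ⟨C', hC', ρ₃, hρ₃, hw⟩ := hw.exists_bound
  set ρ := min ρ₁ ρ₂ with hρdef
  have hρ : 0 < ρ := lt_min hρ₁ hρ₂
  have hd : DifferentiableOn ℂ u (domain d n ρ ρ) :=
    hu.1.mono (domain_mono (min_le_left _ _) (min_le_left _ _))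
  have hb : ∀ Z ∈ domain d n ρ ρ, ‖u Z‖ ≤ C * ‖Z.2‖ ^ k := fun Z hZ =>
    hk Z (domain_mono (min_le_right _ _) (min_le_right _ _) hZ)
  have hsmall : ∀ᶠ Z in nT d n, ‖Z.2‖ < min (min 1 (1 / C')) (min (ρ / 4) (ρ / (4 * C'))) :=
    tendsto_norm_snd.eventually (Iio_mem_nhds (by positivity))
  refine Ord.of_bound (C := max (2 * C * 2 ^ k * C') (2 * C / (ρ / 2) * C')) ?_
  filter_upwards [domain_mem_nT hρ₃ hρ₃, domain_mem_nT (half_pos hρ) (half_pos hρ), hsmall]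
    with Z hZ hZ2 hy
  set y := ‖Z.2‖ with hydef
  have hy1 : y < 1 := hy.trans_le ((min_le_left _ _).trans (min_le_left _ _))
  have hy2 : y < 1 / C' := hy.trans_le ((min_le_left _ _).trans (min_le_right _ _))
  have hy3 : y < ρ / 4 := hy.trans_le ((min_le_right _ _).trans (min_le_left _ _))
  have hy4 : y < ρ / (4 * C') := hy.trans_le ((min_le_right _ _).trans (min_le_right _ _))
  have hy0 : 0 ≤ y := norm_nonneg _
  rw [lt_div_iff₀ hC'] at hy2
  rw [lt_div_iff₀ (by positivity)] at hy4
  have hwZ := hw Z hZ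
  rcases hy0.eq_or_lt with h0 | hpos
  · have : w Z = 0 := by
      rw [← hydef, ← h0, zero_pow (by omega), mul_zero] at hwZ
      exact norm_le_zero_iff.1 hwZ
    rw [this, add_zero, sub_self, norm_zero]
    positivity
  have hpow : y ^ m ≤ y ^ 2 := pow_le_pow_of_le_one hy0 hy1.le hm
  rcases Nat.eq_zero_or_pos k with rfl | hkpos
  · have hwR : ‖w Z‖ < ρ / 2 := by nlinarith
    have h := norm_sub_le_of_bound_ball (C := C) (R := ρ / 2) (w := w Z)
      (hd.mono (ball_subset_domain (by rwa [sub_half])))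
      (fun W hW => by simpa using hb W (ball_subset_domain (by rwa [sub_half]) hW)) hwR
    calc ‖u (Z + w Z) - u Z‖ ≤ 2 * C / (ρ / 2) * ‖w Z‖ := h
      _ ≤ 2 * C / (ρ / 2) * (C' * y ^ m) := by gcongr
      _ = (2 * C / (ρ / 2) * C') * y ^ m := by ring
      _ ≤ _ := by
        simp only [zero_tsub, zero_add]
        gcongr
        exact le_max_right _ _
  · have hwR : ‖w Z‖ < y := by nlinarith
    have hsub : Metric.ball Z y ⊆ domain d n ρ ρ := by
      refine ball_subset_domain (domain_mono ?_ ?_ hZ2) <;> linarith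
    have hball : ∀ W ∈ Metric.ball Z y, ‖u W‖ ≤ C * (2 * y) ^ k := by
      intro W hW
      refine (hb W (hsub hW)).trans ?_
      have h1 : ‖W.2 - Z.2‖ ≤ y := by
        rw [mem_ball_iff_norm, Prod.norm_def, sup_lt_iff] at hW
        exact hW.2.le
      have h2 : ‖W.2‖ ≤ 2 * y := by
        have h3 : W.2 = Z.2 + (W.2 - Z.2) := by abel
        rw [h3]
        linarith [norm_add_le Z.2 (W.2 - Z.2)]
      gcongr
    have h := norm_sub_le_of_bound_ball (w := w Z) (hd.mono hsub) hball hwR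
    obtain ⟨k', rfl⟩ : ∃ k', k = k' + 1 := ⟨k - 1, by omega⟩
    calc ‖u (Z + w Z) - u Z‖ ≤ 2 * (C * (2 * y) ^ (k' + 1)) / y * ‖w Z‖ := h
      _ ≤ 2 * (C * (2 * y) ^ (k' + 1)) / y * (C' * y ^ m) := by gcongr
      _ = (2 * C * 2 ^ (k' + 1) * C') * y ^ (k' + m) := by
        rw [mul_pow, pow_succ y]
        field_simp
        rw [pow_add]
      _ ≤ _ := by
        simp only [Nat.add_sub_cancel]
        gcongr
        exact le_max_left _ _

/-- Second order increments. -/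
lemma Ord.increment₂ {m : ℕ} {u : Phase d n → E} (hu : Germ u)
    {w : Phase d n → Phase d n} (hw : Ord m w) (hm : 1 ≤ m) :
    Ord (2 * m) fun Z => u (Z + w Z) - u Z - fderiv ℂ u Z (w Z) := by
  obtain ⟨C, hC, ρ₂, hρ₂, hk⟩ := hu.ord_zero.exists_bound
  obtain ⟨ρ₁, hρ₁, hu⟩ := hu
  obtain ⟨C', hC', ρ₃, hρ₃, hw'⟩ := hw.exists_bound
  set ρ := min ρ₁ ρ₂ with hρdef
  have hρ : 0 < ρ := lt_min hρ₁ hρ₂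
  have hd : DifferentiableOn ℂ u (domain d n ρ ρ) :=
    hu.1.mono (domain_mono (min_le_left _ _) (min_le_left _ _))
  have hb : ∀ Z ∈ domain d n ρ ρ, ‖u Z‖ ≤ C := fun Z hZ => by
    simpa using hk Z (domain_mono (min_le_right _ _) (min_le_right _ _) hZ)
  have hsmall : ∀ᶠ Z in nT d n, ‖w Z‖ < ρ / 2 := by
    have := (hw.tendsto_zero hm).norm
    rw [norm_zero] at this
    exact this.eventually (Iio_mem_nhds (by positivity))
  refine Ord.of_bound (C := 4 * C * (C' / (ρ / 2)) ^ 2) ?_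
  filter_upwards [domain_mem_nT hρ₃ hρ₃, domain_mem_nT (half_pos hρ) (half_pos hρ), hsmall]
    with Z hZ hZ2 hwR
  have hsub : Metric.ball Z (ρ / 2) ⊆ domain d n ρ ρ := ball_subset_domain (by rwa [sub_half])
  have hdZ : DifferentiableAt ℂ u Z := hd.differentiableAt
    ((isOpen_domain ρ ρ).mem_nhds (hsub (Metric.mem_ball_self (by positivity))))
  have hf1 : ‖fderiv ℂ u Z‖ ≤ 2 * C / (ρ / 2) :=
    norm_fderiv_le_of_norm_le_ball (by positivity) (hd.mono hsub) fun W hW => hb W (hsub hW)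
  have key := Complex.dist_le_mul_div_pow_of_mapsTo_ball_of_isLittleO (n := 1)
    (f := fun W => u W - fderiv ℂ u Z (W - Z)) (c := Z) (z := Z + w Z) (R₁ := ρ / 2) (R₂ := 4 * C)
    ((hd.mono hsub).sub (by fun_prop)) (by
      intro W hW
      rw [mem_closedBall_iff_norm]
      simp only [sub_self, map_zero, sub_zero]
      have h1 : ‖fderiv ℂ u Z (W - Z)‖ ≤ 2 * C := by
        calc ‖fderiv ℂ u Z (W - Z)‖ ≤ ‖fderiv ℂ u Z‖ * ‖W - Z‖ := ContinuousLinearMap.le_opNorm _ _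
          _ ≤ 2 * C / (ρ / 2) * (ρ / 2) := by
            gcongr
            exact (mem_ball_iff_norm.1 hW).le
          _ = 2 * C := by field_simp
      have h2 := hb W (hsub hW)
      have h3 := hb Z (hsub (Metric.mem_ball_self (by positivity)))
      calc ‖u W - fderiv ℂ u Z (W - Z) - u Z‖ ≤ ‖u W‖ + ‖fderiv ℂ u Z (W - Z)‖ + ‖u Z‖ :=
            (norm_sub_le _ _).trans (by gcongr; exact norm_sub_le _ _)
        _ ≤ 4 * C := by linarith)
    (by
      have h1 := hdZ.hasFDerivAt.isLittleO
      have h2 : (fun W => u W - fderiv ℂ u Z (W - Z) - (u Z - fderiv ℂ u Z (Z - Z))) =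
          fun W => u W - u Z - fderiv ℂ u Z (W - Z) := by
        funext W
        simp only [sub_self, map_zero, sub_zero]
        abel
      rw [h2]
      simpa using h1.norm_right)
    (by simpa using hwR)
  simp only [add_sub_cancel_left, sub_self, map_zero, sub_zero, dist_eq_norm] at key
  have hw3 := hw' Z hZ
  calc ‖u (Z + w Z) - u Z - fderiv ℂ u Z (w Z)‖ = ‖u (Z + w Z) - fderiv ℂ u Z (w Z) - u Z‖ := by
        congr 1; abel
    _ ≤ 4 * C * (‖w Z‖ / (ρ / 2)) ^ 2 := key
    _ ≤ 4 * C * (C' * ‖Z.2‖ ^ m / (ρ / 2)) ^ 2 := by gcongr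
    _ = 4 * C * (C' / (ρ / 2)) ^ 2 * ‖Z.2‖ ^ (2 * m) := by rw [pow_mul']; ring

/-- Lipschitz dependence of a composition. -/
lemma Ord.comp_sub {m : ℕ} {u : Phase d n → E} (hu : Germ u) {Φ Φ' : Phase d n → Phase d n}
    (hΦ : Tendsto Φ (nT d n) (nT d n)) (hm : 1 ≤ m) (h : Ord m fun Z => Φ' Z - Φ Z) :
    Ord m fun Z => u (Φ' Z) - u (Φ Z) := by
  obtain ⟨C, hC, ρ₂, hρ₂, hk⟩ := hu.ord_zero.exists_bound
  obtain ⟨ρ₁, hρ₁, hu⟩ := hu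
  obtain ⟨C', hC', ρ₃, hρ₃, hw'⟩ := h.exists_bound
  set ρ := min ρ₁ ρ₂ with hρdef
  have hρ : 0 < ρ := lt_min hρ₁ hρ₂
  have hd : DifferentiableOn ℂ u (domain d n ρ ρ) :=
    hu.1.mono (domain_mono (min_le_left _ _) (min_le_left _ _))
  have hb : ∀ Z ∈ domain d n ρ ρ, ‖u Z‖ ≤ C := fun Z hZ => by
    simpa using hk Z (domain_mono (min_le_right _ _) (min_le_right _ _) hZ)
  have hsmall : ∀ᶠ Z in nT d n, ‖Φ' Z - Φ Z‖ < ρ / 2 := by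
    have := (h.tendsto_zero hm).norm
    rw [norm_zero] at this
    exact this.eventually (Iio_mem_nhds (by positivity))
  refine Ord.of_bound (C := 2 * C / (ρ / 2) * C') ?_
  filter_upwards [domain_mem_nT hρ₃ hρ₃, hΦ.eventually (domain_mem_nT (half_pos hρ) (half_pos hρ)),
    hsmall] with Z hZ hZ2 hwR
  have hsub : Metric.ball (Φ Z) (ρ / 2) ⊆ domain d n ρ ρ :=
    ball_subset_domain (by rwa [sub_half])
  have h1 := norm_sub_le_of_bound_ball (hd.mono hsub) (fun W hW => hb W (hsub hW)) hwR
  rw [add_sub_cancel] at h1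
  calc ‖u (Φ' Z) - u (Φ Z)‖ ≤ 2 * C / (ρ / 2) * ‖Φ' Z - Φ Z‖ := h1
    _ ≤ 2 * C / (ρ / 2) * (C' * ‖Z.2‖ ^ m) := by gcongr; exact hw' Z hZ
    _ = _ := by ring

lemma tendsto_nT_iff {Φ : Phase d n → Phase d n} :
    Tendsto Φ (nT d n) (nT d n) ↔ Tendsto (fun Z => transverse (Φ Z)) (nT d n) (𝓝 0) :=
  tendsto_comap_iff

lemma norm_transverse_le (Z : Phase d n) : ‖transverse Z‖ ≤ ‖Z‖ := by
  rw [Prod.norm_def, Prod.norm_def]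
  refine max_le_max ((pi_norm_le_iff_of_nonneg (norm_nonneg _)).2 fun j => ?_) le_rfl
  exact (Complex.abs_im_le_norm _).trans (norm_le_pi_norm Z.1 j)

lemma transverse_add (Z W : Phase d n) : transverse (Z + W) = transverse Z + transverse W := by
  refine Prod.ext (funext fun j => ?_) rfl
  simp [transverse]

lemma tendsto_id_add {w : Phase d n → Phase d n} (hw : Tendsto w (nT d n) (𝓝 0)) :
    Tendsto (fun Z => Z + w Z) (nT d n) (nT d n) := by
  rw [tendsto_nT_iff]
  simp only [transverse_add]
  have h1 : Tendsto (transverse (d := d) (n := n)) (nT d n) (𝓝 0) := tendsto_comap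
  have h2 : Tendsto (fun Z => transverse (w Z)) (nT d n) (𝓝 0) :=
    squeeze_zero_norm (fun Z => norm_transverse_le _) (by simpa using hw.norm)
  simpa using h1.add h2

/-- Equivariance of a map near the torus. -/
lemma Germ.comp_map {u : Phase d n → E} (hu : Germ u) {Φ : Phase d n → Phase d n}
    (hΦ : Tendsto Φ (nT d n) (nT d n)) (hg : Germ fun Z => Φ Z - Z) : Germ fun Z => u (Φ Z) := by
  obtain ⟨ρ₁, hρ₁, hu⟩ := hu
  obtain ⟨ρ₂, hρ₂, hg⟩ := hg
  obtain ⟨ρ₃, hρ₃, h3⟩ := eventually_nT.1 (hΦ.eventually (domain_mem_nT hρ₁ hρ₁))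
  set ρ := min ρ₂ ρ₃
  have hg' := hg.mono (min_le_left ρ₂ ρ₃) (min_le_left ρ₂ ρ₃)
  have hsub : domain d n ρ ρ ⊆ domain d n ρ₃ ρ₃ := domain_mono (min_le_right _ _) (min_le_right _ _)
  refine ⟨ρ, lt_min hρ₂ hρ₃, ?_, fun Z hZ P => ?_⟩
  · refine hu.1.comp ?_ fun Z hZ => h3 Z (hsub hZ)
    have : Φ = fun Z => (Φ Z - Z) + Z := by funext Z; abel
    rw [this]
    exact hg'.1.add differentiableOn_id
  · have h1 : Φ (shift P Z) - shift P Z = Φ Z - Z := hg'.2 Z hZ P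
    have h2 : Φ (shift P Z) = shift P (Φ Z) := by
      rw [sub_eq_iff_eq_add] at h1
      rw [h1, shift_eq_add, shift_eq_add]
      abel
    simp only
    rw [h2, hu.2 _ (h3 Z (hsub hZ))]

lemma Ord.comp_map {k : ℕ} {u : Phase d n → E} (hu : Ord k u) {Φ : Phase d n → Phase d n}
    (hΦ : Tendsto Φ (nT d n) (nT d n)) (hY : Ord 1 fun Z => (Φ Z).2) :
    Ord k fun Z => u (Φ Z) := by
  refine (IsBigO.comp_tendsto hu hΦ).trans ?_
  have h1 : (fun Z => ‖(Φ Z).2‖) =O[nT d n] fun Z : Phase d n => ‖Z.2‖ := by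
    have := hY.norm_left
    simpa [Ord] using this
  simpa [Function.comp_def] using h1.pow k

end Increments

/-! ### Coefficients of germs -/

lemma Majorized.mono {r δ r' δ' C : ℝ} {f : Series d n} (hf : Majorized r δ C f) (hr : r' ≤ r)
    (h0 : 0 ≤ δ') (hδ : δ' ≤ δ) : Majorized r' δ' C f := fun p => by
  refine le_trans ?_ (hf p)
  gcongr

lemma Majorized.of_norm_le {r δ C : ℝ} {f g : Series d n} (hf : Majorized r δ C f)
    (hδ : 0 ≤ δ) (h : ∀ p, ‖g p‖ ≤ ‖f p‖) : Majorized r δ C g := fun p => by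
  refine le_trans ?_ (hf p)
  gcongr
  exact h p

lemma Majorized.add {r δ C C' : ℝ} {f g : Series d n} (hf : Majorized r δ C f)
    (hg : Majorized r δ C' g) (hδ : 0 ≤ δ) : Majorized r δ (C + C') (fun p => f p + g p) := fun p => by
  calc ‖f p + g p‖ * Real.exp (r * absP p.1) * δ ^ degQ p.2
      ≤ (‖f p‖ + ‖g p‖) * Real.exp (r * absP p.1) * δ ^ degQ p.2 := by gcongr; exact norm_add_le _ _
    _ = ‖f p‖ * Real.exp (r * absP p.1) * δ ^ degQ p.2
        + ‖g p‖ * Real.exp (r * absP p.1) * δ ^ degQ p.2 := by ring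
    _ ≤ _ := add_le_add (hf p) (hg p)

lemma Majorized.const_mul {r δ C : ℝ} {f : Series d n} (hf : Majorized r δ C f) (c : ℂ) :
    Majorized r δ (‖c‖ * C) (fun p => c * f p) := fun p => by
  calc ‖c * f p‖ * Real.exp (r * absP p.1) * δ ^ degQ p.2
      = ‖c‖ * (‖f p‖ * Real.exp (r * absP p.1) * δ ^ degQ p.2) := by rw [norm_mul]; ring
    _ ≤ _ := by gcongr; exact hf p

/-- The germ `u` is the sum of the convergent series `f`. -/
def HasCoef (u : Phase d n → ℂ) (f : Series d n) : Prop :=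
  ∃ ρ > 0, ∃ C, Majorized ρ ρ C f ∧ ∀ Z ∈ domain d n ρ ρ, eval f Z = u Z

lemma Holo.hasCoef {r δ C : ℝ} (hr : 0 < r) (hδ : 0 < δ) {u : Phase d n → ℂ} {f : Series d n}
    (hf : Majorized r δ C f) (h : ∀ Z ∈ domain d n r δ, eval f Z = u Z) : HasCoef u f :=
  ⟨min r δ, lt_min hr hδ, C, hf.mono (min_le_left _ _) (lt_min hr hδ).le (min_le_right _ _),
    fun Z hZ => h Z (domain_mono (min_le_left _ _) (min_le_right _ _) hZ)⟩

lemma Majorized.hasCoef {r δ C : ℝ} (hr : 0 < r) (hδ : 0 < δ) {f : Series d n}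
    (hf : Majorized r δ C f) : HasCoef (eval f) f := Holo.hasCoef hr hδ hf fun _ _ => rfl

lemma HasCoef.germ {u : Phase d n → ℂ} {f : Series d n} (h : HasCoef u f) : Germ u := by
  obtain ⟨ρ, hρ, C, hf, h⟩ := h
  exact ⟨ρ, hρ, (hf.holo hρ).congr fun Z hZ => (h Z hZ).symm⟩

lemma Germ.exists_hasCoef {u : Phase d n → ℂ} (hu : Germ u) : ∃ f, HasCoef u f := by
  obtain ⟨ρ, hρ, hu⟩ := hu
  obtain ⟨C, hC⟩ := hu.exists_bound (half_lt_self hρ) (half_lt_self hρ)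
  obtain ⟨f, hf, h⟩ := (hu.mono (half_le_self hρ.le) (half_le_self hρ.le)).exists_series
    (half_pos hρ) (half_pos hρ) hC
  exact ⟨f, ρ / 2, half_pos hρ, C, hf, h⟩

lemma HasCoef.congr {u v : Phase d n → ℂ} {f : Series d n} (h : HasCoef u f)
    (huv : v =ᶠ[nT d n] u) : HasCoef v f := by
  obtain ⟨ρ, hρ, C, hf, h⟩ := h
  obtain ⟨ρ', hρ', h'⟩ := eventually_nT.1 huv
  refine ⟨min ρ ρ', lt_min hρ hρ', C, hf.mono (min_le_left _ _) (lt_min hρ hρ').le (min_le_left _ _),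
    fun Z hZ => ?_⟩
  rw [h Z (domain_mono (min_le_left _ _) (min_le_left _ _) hZ),
    h' Z (domain_mono (min_le_right _ _) (min_le_right _ _) hZ)]

lemma HasCoef.eventually_eval {u : Phase d n → ℂ} {f : Series d n} (h : HasCoef u f) :
    ∀ᶠ Z in nT d n, HasSum (fun p => f p * TorusNF.mono p Z) (u Z) := by
  obtain ⟨ρ, hρ, C, hf, h⟩ := h
  filter_upwards [domain_mem_nT hρ hρ] with Z hZ
  rw [← h Z hZ]
  exact hf.hasSum hρ hZ

lemma HasCoef.common {u v : Phase d n → ℂ} {f g : Series d n} (hu : HasCoef u f)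
    (hv : HasCoef v g) : ∃ ρ > 0, ∃ C C', Majorized ρ ρ C f ∧ Majorized ρ ρ C' g ∧
      (∀ Z ∈ domain d n ρ ρ, eval f Z = u Z) ∧ ∀ Z ∈ domain d n ρ ρ, eval g Z = v Z := by
  obtain ⟨ρ, hρ, C, hf, h⟩ := hu
  obtain ⟨ρ', hρ', C', hg, h'⟩ := hv
  have h0 := lt_min hρ hρ'
  exact ⟨min ρ ρ', h0, C, C', hf.mono (min_le_left _ _) h0.le (min_le_left _ _),
    hg.mono (min_le_right _ _) h0.le (min_le_right _ _),
    fun Z hZ => h Z (domain_mono (min_le_left _ _) (min_le_left _ _) hZ),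
    fun Z hZ => h' Z (domain_mono (min_le_right _ _) (min_le_right _ _) hZ)⟩

lemma HasCoef.add {u v : Phase d n → ℂ} {f g : Series d n} (hu : HasCoef u f)
    (hv : HasCoef v g) : HasCoef (fun Z => u Z + v Z) (fun p => f p + g p) := by
  obtain ⟨ρ, hρ, C, C', hf, hg, h, h'⟩ := hu.common hv
  refine ⟨ρ, hρ, C + C', hf.add hg hρ.le, fun Z hZ => ?_⟩
  simp only [← h Z hZ, ← h' Z hZ, eval, add_mul]
  exact (hf.summable hρ hZ).tsum_add (hg.summable hρ hZ)

lemma HasCoef.const_mul {u : Phase d n → ℂ} {f : Series d n} (hu : HasCoef u f) (c : ℂ) :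
    HasCoef (fun Z => c * u Z) (fun p => c * f p) := by
  obtain ⟨ρ, hρ, C, hf, h⟩ := hu
  refine ⟨ρ, hρ, _, hf.const_mul c, fun Z hZ => ?_⟩
  simp only [← h Z hZ, eval, mul_assoc]
  exact tsum_mul_left

lemma HasCoef.sub {u v : Phase d n → ℂ} {f g : Series d n} (hu : HasCoef u f)
    (hv : HasCoef v g) : HasCoef (fun Z => u Z - v Z) (fun p => f p - g p) := by
  have := hu.add (hv.const_mul (-1))
  simpa only [neg_one_mul, ← sub_eq_add_neg] using this

lemma hasCoef_zero : HasCoef (fun _ : Phase d n => 0) (fun _ => 0) :=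
  ⟨1, one_pos, 0, fun p => by simp, fun Z _ => by simp [eval]⟩

lemma HasCoef.sum {ι : Type*} (s : Finset ι) {u : ι → Phase d n → ℂ} {f : ι → Series d n}
    (h : ∀ i, HasCoef (u i) (f i)) : HasCoef (fun Z => ∑ i ∈ s, u i Z) (fun p => ∑ i ∈ s, f i p) := by
  classical
  induction s using Finset.induction_on with
  | empty => simpa using hasCoef_zero
  | insert i s hi ih => simpa only [Finset.sum_insert hi] using (h i).add ih

lemma norm_snd_le_of_norm_eq {Z : Phase d n} {s : ℝ} (hs : 0 ≤ s) (h : ∀ j, ‖Z.2 j‖ = s) :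
    ‖Z.2‖ ≤ s := (pi_norm_le_iff_of_nonneg hs).2 fun j => (h j).le

lemma eq_zero_of_forall_mul_pow_le {x C : ℝ} {k l : ℕ} (hx : 0 ≤ x) (hkl : k < l)
    (h : ∀ᶠ s in 𝓝[>] (0 : ℝ), x * s ^ k ≤ C * s ^ l) : x = 0 := by
  have h1 : ∀ᶠ s in 𝓝[>] (0 : ℝ), x ≤ C * s ^ (l - k) := by
    filter_upwards [h, self_mem_nhdsWithin] with s hs hs0
    have hs0' : 0 < s ^ k := pow_pos hs0 k
    refine le_of_mul_le_mul_right ?_ hs0'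
    rw [mul_assoc, ← pow_add]
    rwa [Nat.sub_add_cancel hkl.le]
  have h2 : Tendsto (fun s : ℝ => C * s ^ (l - k)) (𝓝[>] 0) (𝓝 0) := by
    have : Tendsto (fun s : ℝ => C * s ^ (l - k)) (𝓝 0) (𝓝 (C * 0 ^ (l - k))) := by
      exact ((continuous_const.mul (continuous_pow _)).tendsto 0)
    rw [zero_pow (by omega), mul_zero] at this
    exact this.mono_left nhdsWithin_le_nhds
  exact le_antisymm (ge_of_tendsto h2 h1) hx

lemma HasCoef.hasOrder {u : Phase d n → ℂ} {f : Series d n} (hu : HasCoef u f) {k : ℕ}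
    (hk : Ord k u) : HasOrder k f := by
  intro p hp
  obtain ⟨ρ, hρ, C, hf, h⟩ := hu
  obtain ⟨C', hC', ρ', hρ', h'⟩ := hk.exists_bound
  refine norm_eq_zero.1 (eq_zero_of_forall_mul_pow_le (C := C') (norm_nonneg _) hp ?_)
  filter_upwards [Ioo_mem_nhdsGT (lt_min hρ hρ')] with s hs
  refine hf.norm_coeff_le hρ hs.1 (hs.2.trans_le (min_le_left _ _)) (fun Z hX hY => ?_) p
  have hd : Z ∈ domain d n (min ρ ρ') (min ρ ρ') :=
    ⟨fun j => by rw [hX, abs_zero]; exact lt_min hρ hρ', fun j => by rw [hY]; exact hs.2⟩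
  rw [h Z (domain_mono (min_le_left _ _) (min_le_left _ _) hd)]
  refine (h' Z (domain_mono (min_le_right _ _) (min_le_right _ _) hd)).trans ?_
  gcongr
  exact norm_snd_le_of_norm_eq hs.1.le hY

lemma HasCoef.ord {u : Phase d n → ℂ} {f : Series d n} (hu : HasCoef u f) {k : ℕ}
    (hk : HasOrder k f) : Ord k u := by
  obtain ⟨ρ₀, hρ₀, C, hf, h⟩ := hu
  set ρ := min ρ₀ 1 with hρdef
  have hρ : 0 < ρ := lt_min hρ₀ one_pos
  have hρ1 : ρ ≤ 1 := min_le_right _ _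
  replace hf := hf.mono (min_le_left ρ₀ 1) hρ.le (min_le_left _ _)
  obtain ⟨A, hA, -⟩ := hasSum_geom_idx d n (κ := ρ / 2) (by positivity) (by linarith)
  refine Ord.of_bound (C := C * A / (ρ / 2) ^ k) ?_
  filter_upwards [domain_mem_nT (half_pos hρ) (half_pos hρ)] with Z hZ
  rw [← h Z (domain_mono (by linarith [min_le_left ρ₀ 1]) (by linarith [min_le_left ρ₀ 1]) hZ)]
  have hy : ‖Z.2‖ ≤ ρ / 2 := (pi_norm_le_iff_of_nonneg (by positivity)).2 fun j => (hZ.2 j).le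
  have key : ∀ p : Idx d n, ‖f p * TorusNF.mono p Z‖ ≤ C * (‖Z.2‖ / (ρ / 2)) ^ k *
      (Real.exp (-(ρ / 2) * absP p.1) * (1 - ρ / 2) ^ degQ p.2) := by
    intro p
    by_cases hp : degQ p.2 < k
    · rw [hk p hp, zero_mul, norm_zero]
      have := hf.nonneg hρ
      have : 0 ≤ 1 - ρ / 2 := by linarith
      positivity
    · push Not at hp
      have hm := norm_mono_le p (Z := Z) (s := ρ / 2) (t := ‖Z.2‖) (fun j => (hZ.1 j).le)
        (fun j => norm_le_pi_norm Z.2 j)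
      have hpow : ‖Z.2‖ ^ degQ p.2 ≤ (‖Z.2‖ / (ρ / 2)) ^ k * (ρ / 2) ^ degQ p.2 := by
        obtain ⟨e, he⟩ := Nat.exists_eq_add_of_le hp
        rw [he, pow_add, pow_add, div_pow, div_mul_eq_mul_div]
        calc ‖Z.2‖ ^ k * ‖Z.2‖ ^ e ≤ ‖Z.2‖ ^ k * (ρ / 2) ^ e := by gcongr
          _ = _ := by field_simp
      have hhalf : (ρ / 2) ^ degQ p.2 ≤ (1 - ρ / 2) ^ degQ p.2 * ρ ^ degQ p.2 := by
        rw [← mul_pow]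
        gcongr
        nlinarith
      calc ‖f p * TorusNF.mono p Z‖ ≤ ‖f p‖ * (Real.exp (ρ / 2 * absP p.1) * ‖Z.2‖ ^ degQ p.2) := by
            rw [norm_mul]; gcongr
        _ ≤ ‖f p‖ * (Real.exp (ρ / 2 * absP p.1) * ((‖Z.2‖ / (ρ / 2)) ^ k *
            ((1 - ρ / 2) ^ degQ p.2 * ρ ^ degQ p.2))) := by
            gcongr
            exact hpow.trans (by gcongr)
        _ = (‖f p‖ * Real.exp (ρ * absP p.1) * ρ ^ degQ p.2) * (‖Z.2‖ / (ρ / 2)) ^ k *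
            (Real.exp (-(ρ / 2) * absP p.1) * (1 - ρ / 2) ^ degQ p.2) := by
            have : Real.exp (ρ / 2 * absP p.1) =
                Real.exp (ρ * absP p.1) * Real.exp (-(ρ / 2) * absP p.1) := by
              rw [← Real.exp_add]; congr 1; ring
            rw [this]; ring
        _ ≤ _ := by
            have : 0 ≤ 1 - ρ / 2 := by linarith
            gcongr
            exact hf p
  calc ‖eval f Z‖ ≤ C * (‖Z.2‖ / (ρ / 2)) ^ k * A := tsum_of_norm_bounded (hA.mul_left _) key
    _ = C * A / (ρ / 2) ^ k * ‖Z.2‖ ^ k := by rw [div_pow]; ring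

lemma HasCoef.eq_zero {f : Series d n} {u : Phase d n → ℂ} (hu : HasCoef u f)
    (h : ∀ k, Ord k u) : f = 0 := funext fun p => hu.hasOrder (h (degQ p.2 + 1)) p (Nat.lt_succ_self _)

lemma HasCoef.unique {u : Phase d n → ℂ} {f g : Series d n} (hf : HasCoef u f)
    (hg : HasCoef u g) : f = g := by
  have h := (hf.sub hg).eq_zero (fun k => Ord.of_bound (C := 0) (Eventually.of_forall fun Z => by
    simp))
  funext p
  exact sub_eq_zero.1 (congrFun h p)

/-- The Fourier-Taylor coefficients of a germ. -/
def coef (u : Phase d n → ℂ) : Series d n :=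
  Classical.epsilon (HasCoef u)

lemma Germ.hasCoef {u : Phase d n → ℂ} (hu : Germ u) : HasCoef u (coef u) :=
  Classical.epsilon_spec hu.exists_hasCoef

lemma HasCoef.coef_eq {u : Phase d n → ℂ} {f : Series d n} (h : HasCoef u f) : coef u = f :=
  h.germ.hasCoef.unique h

lemma Germ.ord_iff {u : Phase d n → ℂ} (hu : Germ u) {k : ℕ} : Ord k u ↔ HasOrder k (coef u) :=
  ⟨fun h => hu.hasCoef.hasOrder h, fun h => hu.hasCoef.ord h⟩

lemma HasCoef.holo_eval {u : Phase d n → ℂ} {f : Series d n} (h : HasCoef u f) :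
    u =ᶠ[nT d n] eval f := by
  obtain ⟨ρ, hρ, C, hf, h⟩ := h
  filter_upwards [domain_mem_nT hρ hρ] with Z hZ using (h Z hZ).symm

/-! ### Multiplication by a coordinate -/

/-- The coefficients of `Y_j f`. -/
def shiftY (j : Fin n) (f : Series d n) : Series d n := fun p =>
  if p.2 j = 0 then 0 else f (p.1, p.2 - Pi.single j 1)

lemma mono_add_single (p : Idx d n) (j : Fin n) (Z : Phase d n) :
    TorusNF.mono (p.1, p.2 + Pi.single j 1) Z = Z.2 j * TorusNF.mono p Z := by
  unfold TorusNF.mono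
  have : ∏ i, Z.2 i ^ (p.2 + Pi.single j 1 : Fin n → ℕ) i = (∏ i, Z.2 i ^ p.2 i) * Z.2 j := by
    simp only [Pi.add_apply, pow_add, Finset.prod_mul_distrib]
    congr 1
    rw [Finset.prod_eq_single j]
    · simp
    · intro i _ hi
      simp [hi]
    · simp
  simp only [this]
  ring

lemma degQ_add_single (Q : Fin n → ℕ) (j : Fin n) : degQ (Q + Pi.single j 1) = degQ Q + 1 := by
  simp [degQ, Finset.sum_add_distrib]

lemma sub_single_add {Q : Fin n → ℕ} {j : Fin n} (h : Q j ≠ 0) :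
    Q - Pi.single j 1 + Pi.single j 1 = Q := by
  funext i
  rcases eq_or_ne i j with rfl | hi
  · simp; omega
  · simp [hi]

lemma shiftY_add_single (j : Fin n) (f : Series d n) (p : Idx d n) :
    shiftY j f (p.1, p.2 + Pi.single j 1) = f p := by
  simp [shiftY]

lemma hasSum_shiftY (j : Fin n) {f : Series d n} {Z : Phase d n} {S : ℂ}
    (h : HasSum (fun p => f p * TorusNF.mono p Z) S) :
    HasSum (fun p => shiftY j f p * TorusNF.mono p Z) (Z.2 j * S) := by
  have hinj : Function.Injective fun p : Idx d n => ((p.1, p.2 + Pi.single j 1) : Idx d n) := by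
    intro p q hpq
    simp only [Prod.mk.injEq, add_left_inj] at hpq
    exact Prod.ext hpq.1 hpq.2
  rw [← hinj.hasSum_iff]
  · refine (h.mul_left (Z.2 j)).congr_fun fun p => ?_
    simp only [Function.comp_def, shiftY_add_single, mono_add_single]
    ring
  · intro p hp
    by_cases h0 : p.2 j = 0
    · simp [shiftY, h0]
    · exact absurd ⟨(p.1, p.2 - Pi.single j 1), Prod.ext rfl (sub_single_add h0)⟩ hp

lemma Majorized.shiftY {r δ C : ℝ} {f : Series d n} (hf : Majorized r δ C f) (hδ : 0 < δ)
    (j : Fin n) : Majorized r δ (δ * C) (shiftY j f) := fun p => by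
  have hC := hf.nonneg hδ
  by_cases h0 : p.2 j = 0
  · simp only [TorusNF.shiftY, h0, if_true, norm_zero, zero_mul]
    positivity
  · have h1 := hf (p.1, p.2 - Pi.single j 1)
    have h2 : degQ p.2 = degQ (p.2 - Pi.single j 1) + 1 := by
      rw [← degQ_add_single, sub_single_add h0]
    simp only [TorusNF.shiftY, h0, if_false, h2, pow_succ]
    simp only at h1
    nlinarith

lemma HasCoef.mul_snd {u : Phase d n → ℂ} {f : Series d n} (hu : HasCoef u f) (j : Fin n) :
    HasCoef (fun Z => Z.2 j * u Z) (shiftY j f) := by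
  obtain ⟨ρ, hρ, C, hf, h⟩ := hu
  refine ⟨ρ, hρ, _, hf.shiftY hρ j, fun Z hZ => ?_⟩
  simp only [← h Z hZ]
  exact (hasSum_shiftY j (hf.hasSum hρ hZ)).tsum_eq

/-! ### The derivation along the quasilinear field -/

section LieDerivative

variable (ω : Fin d → ℝ) (Λ : Fin n → ℂ)

/-- The divisor of a monomial. -/
def div (p : Idx d n) : ℂ := divisor ω Λ p.1 fun i => (p.2 i : ℤ)

/-- The derivative along `S`. -/
def LS {E : Type*} [NormedAddCommGroup E] [NormedSpace ℂ E] (u : Phase d n → E) (Z : Phase d n) : E :=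
  fderiv ℂ u Z (quasilinear ω Λ Z)

lemma div_add_single (p : Idx d n) (j : Fin n) :
    div ω Λ (p.1, p.2 + Pi.single j 1) = div ω Λ p + Λ j := by
  simp only [div, divisor, Pi.add_apply, Nat.cast_add, Int.cast_add, add_mul, Finset.sum_add_distrib]
  rw [add_assoc]
  congr 2
  rw [Finset.sum_eq_single j]
  · simp
  · intro i _ hi
    simp [hi]
  · simp

lemma fderiv_mono_quasilinear (p : Idx d n) (Z : Phase d n) :
    fderiv ℂ (TorusNF.mono p) Z (quasilinear ω Λ Z) = div ω Λ p * TorusNF.mono p Z := by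
  set γ : ℂ → Phase d n := fun t => (fun j => Z.1 j + t * ω j, fun j => Complex.exp (t * Λ j) * Z.2 j)
  have hγ0 : γ 0 = Z := by simp [γ]
  have hγ : HasDerivAt γ (quasilinear ω Λ Z) 0 := by
    refine HasDerivAt.prodMk (hasDerivAt_pi.2 fun j => ?_) (hasDerivAt_pi.2 fun j => ?_)
    · simpa using ((hasDerivAt_id (0 : ℂ)).mul_const (ω j : ℂ)).const_add (Z.1 j)
    · have := (((hasDerivAt_id (0 : ℂ)).mul_const (Λ j)).cexp).mul_const (Z.2 j)
      simpa using this
  have h1 : HasDerivAt (fun t => TorusNF.mono p (γ t))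
      (fderiv ℂ (TorusNF.mono p) Z (quasilinear ω Λ Z)) 0 := by
    have h2 : HasFDerivAt (TorusNF.mono p) (fderiv ℂ (TorusNF.mono p) Z) (γ 0) := by
      rw [hγ0]
      exact (differentiable_mono p Z).hasFDerivAt
    exact h2.comp_hasDerivAt 0 hγ
  have h3 : (fun t => TorusNF.mono p (γ t)) = fun t => Complex.exp (t * div ω Λ p) * TorusNF.mono p Z := by
    funext t
    simp only [TorusNF.mono, γ, div, divisor, mul_pow, Finset.prod_mul_distrib]
    have h4 : ∏ j, Complex.exp (t * Λ j) ^ p.2 j = Complex.exp (t * ∑ j, (p.2 j : ℂ) * Λ j) := by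
      rw [Finset.mul_sum, Complex.exp_sum]
      refine Finset.prod_congr rfl fun j _ => ?_
      rw [← Complex.exp_nat_mul]
      congr 1
      ring
    rw [h4]
    have h5 : Complex.I * ∑ j, (p.1 j : ℂ) * (Z.1 j + t * ω j) =
        Complex.I * ∑ j, (p.1 j : ℂ) * Z.1 j + t * (Complex.I * ∑ j, (p.1 j : ℂ) * ω j) := by
      simp only [mul_add, Finset.sum_add_distrib, Finset.mul_sum]
      congr 1
      refine Finset.sum_congr rfl fun j _ => ?_
      ring
    rw [h5, mul_add, Complex.exp_add, Complex.exp_add]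
    simp only [Int.cast_natCast]
    ring
  rw [h3] at h1
  have h6 : HasDerivAt (fun t : ℂ => Complex.exp (t * div ω Λ p) * TorusNF.mono p Z)
      (div ω Λ p * TorusNF.mono p Z) 0 := by
    simpa using (((hasDerivAt_id (0 : ℂ)).mul_const (div ω Λ p)).cexp).mul_const (TorusNF.mono p Z)
  exact h1.unique h6

lemma norm_div_le (p : Idx d n) :
    ‖div ω Λ p‖ ≤ (‖ω‖ + ‖Λ‖) * ((absP p.1 : ℝ) + degQ p.2) := by
  have h1 : ‖∑ j, (p.1 j : ℂ) * (ω j : ℂ)‖ ≤ ‖ω‖ * absP p.1 := by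
    refine (norm_sum_le _ _).trans ?_
    rw [absP, Nat.cast_sum, Finset.mul_sum]
    refine Finset.sum_le_sum fun j _ => ?_
    rw [norm_mul, Complex.norm_intCast, Complex.norm_real, Nat.cast_natAbs, Int.cast_abs, mul_comm]
    gcongr
    exact norm_le_pi_norm ω j
  have h2 : ‖∑ j, ((p.2 j : ℤ) : ℂ) * Λ j‖ ≤ ‖Λ‖ * degQ p.2 := by
    refine (norm_sum_le _ _).trans ?_
    rw [degQ, Nat.cast_sum, Finset.mul_sum]
    refine Finset.sum_le_sum fun j _ => ?_
    rw [norm_mul, Int.cast_natCast, Complex.norm_natCast, mul_comm]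
    gcongr
    exact norm_le_pi_norm Λ j
  calc ‖div ω Λ p‖ ≤ ‖Complex.I * ∑ j, (p.1 j : ℂ) * (ω j : ℂ)‖ + ‖∑ j, ((p.2 j : ℤ) : ℂ) * Λ j‖ :=
        norm_add_le _ _
    _ ≤ ‖ω‖ * absP p.1 + ‖Λ‖ * degQ p.2 := by
        rw [norm_mul, Complex.norm_I, one_mul]
        gcongr
    _ ≤ _ := by
        have : 0 ≤ ‖ω‖ * degQ p.2 := by positivity
        have : 0 ≤ ‖Λ‖ * absP p.1 := by positivity
        nlinarith

lemma Majorized.summable_fderiv {r δ C : ℝ} {f : Series d n} (hf : Majorized r δ C f) (hδ : 0 < δ)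
    {Z : Phase d n} (hZ : Z ∈ domain d n r δ) :
    Summable fun p => fderiv ℂ (fun Z => f p * TorusNF.mono p Z) Z := by
  obtain ⟨κ, h0, h1, hκ⟩ := exists_mem_domain_shrink hδ hZ
  obtain ⟨A, hA, -⟩ := hasSum_geom_idx d n h0 h1.le
  obtain ⟨ρ, hρ, hball⟩ := Metric.isOpen_iff.1 (isOpen_domain (r - κ) ((1 - κ) * δ)) Z hκ
  refine Summable.of_norm_bounded (((hA.summable.mul_left C).mul_left 2).div_const ρ) fun p => ?_
  exact norm_fderiv_le_of_norm_le_ball hρ ((differentiable_mono p).const_mul (f p)).differentiableOn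
    fun W hW => hf.norm_term_le h1.le (hball hW) p

lemma exists_exp_bound {κ : ℝ} (hκ : 0 < κ) : ∃ C, ∀ k : ℕ, (k : ℝ) ≤ C * Real.exp (κ * k) := by
  refine ⟨1 / κ, fun k => ?_⟩
  have := Real.add_one_le_exp (κ * k)
  rw [div_mul_eq_mul_div, one_mul, le_div_iff₀ hκ]
  linarith

lemma Majorized.div_mul {ρ C : ℝ} {f : Series d n} (hf : Majorized ρ ρ C f) (hρ : 0 < ρ) :
    ∃ C', Majorized (ρ / 2) (ρ / 2) C' (fun p => div ω Λ p * f p) := by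
  obtain ⟨A, hA⟩ := exists_exp_bound (half_pos hρ)
  obtain ⟨B, hB⟩ := exists_exp_bound (Real.log_pos (one_lt_two))
  refine ⟨(‖ω‖ + ‖Λ‖) * (A + B) * C, fun p => ?_⟩
  have hA0 : 0 ≤ A := by
    have := hA 1
    by_contra h
    push Not at h
    have := Real.exp_pos (ρ / 2 * (1 : ℕ))
    push_cast at *
    nlinarith
  have hB0 : 0 ≤ B := by
    have := hB 1
    by_contra h
    push Not at h
    have := Real.exp_pos (Real.log 2 * (1 : ℕ))
    push_cast at *
    nlinarith
  have e1 : 1 ≤ Real.exp (ρ / 2 * absP p.1) := Real.one_le_exp (by positivity)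
  have e2 : 1 ≤ (2 : ℝ) ^ degQ p.2 := one_le_pow₀ (by norm_num)
  have h2 : ((degQ p.2 : ℕ) : ℝ) ≤ B * 2 ^ degQ p.2 := by
    have := hB (degQ p.2)
    rwa [mul_comm (Real.log 2), Real.exp_nat_mul, Real.exp_log (by norm_num)] at this
  have h3 : (absP p.1 : ℝ) + degQ p.2 ≤ (A + B) * (Real.exp (ρ / 2 * absP p.1) * 2 ^ degQ p.2) := by
    have := hA (absP p.1)
    have i1 : A * Real.exp (ρ / 2 * absP p.1) ≤ A * (Real.exp (ρ / 2 * absP p.1) * 2 ^ degQ p.2) := by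
      gcongr
      exact le_mul_of_one_le_right (by positivity) e2
    have i2 : B * 2 ^ degQ p.2 ≤ B * (Real.exp (ρ / 2 * absP p.1) * 2 ^ degQ p.2) := by
      gcongr
      exact le_mul_of_one_le_left (by positivity) e1
    linarith
  calc ‖div ω Λ p * f p‖ * Real.exp (ρ / 2 * absP p.1) * (ρ / 2) ^ degQ p.2
      ≤ ((‖ω‖ + ‖Λ‖) * ((A + B) * (Real.exp (ρ / 2 * absP p.1) * 2 ^ degQ p.2)) * ‖f p‖) *
        Real.exp (ρ / 2 * absP p.1) * (ρ / 2) ^ degQ p.2 := by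
        rw [norm_mul]
        gcongr
        exact (norm_div_le ω Λ p).trans (by gcongr)
    _ = (‖ω‖ + ‖Λ‖) * (A + B) * (‖f p‖ * Real.exp (ρ * absP p.1) * ρ ^ degQ p.2) := by
        have : Real.exp (ρ * absP p.1) = Real.exp (ρ / 2 * absP p.1) * Real.exp (ρ / 2 * absP p.1) := by
          rw [← Real.exp_add]; congr 1; ring
        rw [this, div_pow]
        field_simp
    _ ≤ _ := by gcongr; exact hf p

lemma Majorized.LS_eval {r δ C : ℝ} {f : Series d n} (hf : Majorized r δ C f) (hδ : 0 < δ)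
    {Z : Phase d n} (hZ : Z ∈ domain d n r δ) :
    LS ω Λ (eval f) Z = eval (fun p => div ω Λ p * f p) Z := by
  rw [LS, (hf.hasFDerivAt_eval hδ hZ).fderiv, eval]
  have h3 := (ContinuousLinearMap.apply ℂ ℂ (quasilinear ω Λ Z)).hasSum
    (hf.summable_fderiv hδ hZ).hasSum
  rw [ContinuousLinearMap.apply_apply] at h3
  rw [← h3.tsum_eq]
  refine tsum_congr fun p => ?_
  simp only [ContinuousLinearMap.apply_apply]
  rw [fderiv_const_mul (differentiable_mono p Z)]
  simp only [FunLike.coe_smul, Pi.smul_apply, smul_eq_mul, fderiv_mono_quasilinear]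
  ring

lemma HasCoef.LS {u : Phase d n → ℂ} {f : Series d n} (hu : HasCoef u f) :
    HasCoef (LS ω Λ u) (fun p => div ω Λ p * f p) := by
  obtain ⟨ρ, hρ, C, hf, h⟩ := hu
  obtain ⟨C', hC'⟩ := hf.div_mul ω Λ hρ
  refine ⟨ρ / 2, half_pos hρ, C', hC', fun Z hZ => ?_⟩
  have hZ' : Z ∈ domain d n ρ ρ := domain_mono (half_le_self hρ.le) (half_le_self hρ.le) hZ
  have h1 : u =ᶠ[𝓝 Z] eval f := by
    filter_upwards [(isOpen_domain ρ ρ).mem_nhds hZ'] with W hW using (h W hW).symm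
  rw [← hf.LS_eval ω Λ hρ hZ', TorusNF.LS, TorusNF.LS, h1.fderiv_eq]

end LieDerivative

/-! ### Small divisors at dyadic scales -/

lemma tendsto_of_brjuno {m : ℕ → ℕ} {g : ℝ → ℝ} {η r ε : ℕ → ℝ} {N : ℕ} (hN : N ≠ 0)
    (hg0 : ∀ x, 1 ≤ x → 0 < g x) (hg : MonotoneOn g (Ici 1)) (hm1 : ∀ k, 1 ≤ m k)
    (hη : ∀ k, η k = r k - r (k + 1) - ε k) (hε : ∀ k, 0 < ε k)
    (h : ∀ k, 0 < η k ∧ (4 : ℝ) ^ N * ((η k) ^ N)⁻¹ ≤ g (m k)) (hr : ∀ k, 1 / 2 < r k) (M : ℕ) :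
    ∃ k, M ≤ m k := by
  by_contra! hM
  have hMpos : 1 ≤ M := (hm1 0).trans (hM 0).le
  have hM' : (1 : ℝ) ≤ M := by exact_mod_cast hMpos
  set B := g M
  have hB : 0 < B := hg0 M hM'
  set c := min 1 ((4 : ℝ) ^ N / B) with hc
  have hcpos : 0 < c := lt_min one_pos (by positivity)
  have hηc : ∀ k, c ≤ η k := by
    intro k
    obtain ⟨h1, h2⟩ := h k
    have h3 : g (m k) ≤ B := hg (by simpa using hm1 k) hM' (by exact_mod_cast (hM k).le)
    rcases le_total 1 (η k) with h4 | h4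
    · exact (min_le_left _ _).trans h4
    · refine (min_le_right _ _).trans ?_
      have h5 : η k ^ N ≤ η k := pow_le_of_le_one h1.le h4 hN
      have h6 : (4 : ℝ) ^ N ≤ B * η k ^ N := by
        have := h2.trans h3
        rwa [← div_eq_mul_inv, div_le_iff₀ (by positivity)] at this
      rw [div_le_iff₀ hB]
      nlinarith
  have hr' : ∀ k : ℕ, r k ≤ r 0 - k * c := by
    intro k
    induction k with
    | zero => simp
    | succ k ih =>
      have := hηc k
      rw [hη k] at this
      push_cast
      linarith [hε k]
  obtain ⟨k, hk⟩ := exists_nat_gt (r 0 / c)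
  rw [div_lt_iff₀ hcpos] at hk
  linarith [hr' k, hr k]

/-- Brjuno's conditions, at the scales `2^(l+1)`, with an arbitrarily small total loss `∑ ε_l`. -/
lemma exists_divisor_bounds {ω : Fin d → ℝ} {Λ : Fin n → ℂ} (h : BrjunoGammaOmega ω Λ) {τ : ℝ}
    (hτ : 0 < τ) : ∃ G ε : ℕ → ℝ, (∀ l, 1 ≤ G l) ∧ (∀ l, 0 ≤ ε l) ∧
      (∀ l, ∀ (P : Fin d → ℤ) (Q : Fin n → ℤ), IsExponent Q → ∑ i, Q i ≤ 2 ^ (l + 1) →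
        divisor ω Λ P Q ≠ 0 → ‖divisor ω Λ P Q‖⁻¹ ≤ G l * Real.exp (ε l * absP P)) ∧
      (Summable fun l => Real.log (G l) / 2 ^ l) ∧ ∀ L, ∑ l ∈ Finset.range L, ε l ≤ τ := by
  obtain ⟨g, m, ε, r, hg0, hg, -, hmono, hε, ⟨hm0, hm⟩, hsum, h3, h4, h5, h6, h7⟩ := h
  have hm1 : ∀ k, 1 ≤ m k := fun k => hm0 ▸ hmono (Nat.zero_le k)
  have hm1' : ∀ k, (1 : ℝ) ≤ m k := fun k => by exact_mod_cast hm1 k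
  have hg1 : ∀ k, 1 < g (m k) := by
    intro k
    have hpos := hg0 _ (hm1' k)
    have h := (hm1' k).trans (h3 k)
    by_contra hle
    push Not at hle
    have hlog : Real.log (g (m k)) ≤ 0 := Real.log_nonpos hpos.le hle
    have : 0 ≤ ((n : ℝ) + 2) * g (m k) := by positivity
    nlinarith
  have hunb : ∀ l : ℕ, ∃ k, 2 ^ (l + 1) ≤ m k := fun l =>
    tendsto_of_brjuno (N := 4 * d + 6) (by omega) hg0 hg hm1 (fun k => rfl) hε h6 h7 _
  set K : ℕ → ℕ := fun l => Nat.find (hunb l) with hK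
  have hK1 : ∀ l, 2 ^ (l + 1) ≤ m (K l) := fun l => Nat.find_spec (hunb l)
  have hKpos : ∀ l, K l ≠ 0 := by
    intro l h0
    have := hK1 l
    rw [h0, hm0, pow_succ] at this
    have := Nat.one_le_two_pow (n := l)
    omega
  have hK2 : ∀ l, m (K l) < 2 ^ (l + 2) := by
    intro l
    obtain ⟨k, hk⟩ := Nat.exists_eq_succ_of_ne_zero (hKpos l)
    have h1 : m k < 2 ^ (l + 1) := not_le.1 (Nat.find_min (hunb l) (by
      change k < K l; omega))
    have h2 := hm k
    rw [hk]
    have : 2 ^ (l + 2) = 2 * 2 ^ (l + 1) := by ring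
    simp only [Nat.succ_eq_add_one]
    omega
  have hKmono : StrictMono K := by
    refine strictMono_nat_of_lt_succ fun l => ?_
    by_contra hle
    push Not at hle
    have := (hK1 (l + 1)).trans (hmono hle)
    exact absurd (hK2 l) (not_lt.2 this)
  have hεsum : Summable ε := by
    refine summable_of_sum_range_le (c := r 0 - 1 / 2) (fun k => (hε k).le) fun k => ?_
    have : ∑ i ∈ Finset.range k, ε i ≤ r 0 - r k := by
      induction k with
      | zero => simp
      | succ k ih =>
        rw [Finset.sum_range_succ]
        linarith [(h6 k).1]
    linarith [h7 k]
  have hεK : Summable fun l => ε (K l) := hεsum.comp_injective hKmono.injective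
  obtain ⟨L, hL⟩ := ((tendsto_sum_nat_add fun l => ε (K l)).eventually (gt_mem_nhds hτ)).exists
  refine ⟨fun l => g (m (K (l + L))), fun l => ε (K (l + L)), fun l => (hg1 _).le,
    fun l => (hε _).le, ?_, ?_, ?_⟩
  · intro l P Q hQ hle hne
    have hQ' : ∑ i, Q i ≤ (m (K (l + L)) : ℤ) := by
      have h1 := hK1 (l + L)
      have h2 : 2 ^ (l + 1) ≤ 2 ^ (l + L + 1) := Nat.pow_le_pow_right (by norm_num) (by omega)
      have h3 : ((2 : ℤ) ^ (l + 1)) ≤ (m (K (l + L)) : ℤ) := by exact_mod_cast h2.trans h1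
      exact hle.trans h3
    have he : 1 ≤ Real.exp (ε (K (l + L)) * absP P) :=
      Real.one_le_exp (mul_nonneg (hε _).le (Nat.cast_nonneg _))
    have hG := (hg1 (K (l + L))).le
    rcases lt_or_ge (m (K (l + L))) (absP P) with hP | hP
    · exact (h4 _ P Q hQ hP hQ' hne).trans (le_mul_of_one_le_left (by positivity) hG)
    · exact (h5 _ P Q hQ hP hQ' hne).trans (le_mul_of_one_le_right (by linarith) he)
  · have hs1 : Summable fun l => Real.log (g (m (K (l + L)))) / (m (K (l + L)) : ℝ) := by
      have hinj : Function.Injective fun l => K (l + L) - 1 := by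
        intro a b hab
        have h1 := hKpos (a + L)
        have h2 := hKpos (b + L)
        have : K (a + L) = K (b + L) := by
          simp only at hab
          omega
        have := hKmono.injective this
        omega
      refine (hsum.comp_injective hinj).congr fun l => ?_
      simp only [Function.comp_def]
      rw [Nat.sub_add_cancel (Nat.one_le_iff_ne_zero.2 (hKpos _))]
    refine Summable.of_nonneg_of_le (fun l => ?_) (fun l => ?_) (hs1.mul_left (2 ^ (L + 2)))
    · exact div_nonneg (Real.log_nonneg (hg1 _).le) (by positivity)
    · have hlog := Real.log_nonneg (hg1 (K (l + L))).le
      have hmK : (m (K (l + L)) : ℝ) ≤ 2 ^ (L + 2) * 2 ^ l := by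
        have := (hK2 (l + L)).le
        have h' : (m (K (l + L)) : ℝ) ≤ 2 ^ (l + L + 2) := by exact_mod_cast this
        refine h'.trans (le_of_eq ?_)
        ring
      rw [mul_div_assoc', div_le_div_iff₀ (by positivity) (by linarith [hm1' (K (l + L))])]
      nlinarith
  · intro M
    refine (Summable.sum_le_tsum _ (fun l _ => (hε _).le) ?_).trans hL.le
    exact (summable_nat_add_iff L).2 hεK

/-! ### Congruence of germs modulo a power of `Y` -/

section Congruence

variable {E F : Type*} [NormedAddCommGroup E] [NormedSpace ℂ E] [NormedAddCommGroup F]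
  [NormedSpace ℂ F] {k l : ℕ}

/-- Equality up to terms of order `k`. -/
def OEq (k : ℕ) (u v : Phase d n → E) : Prop := Ord k fun Z => u Z - v Z

lemma ord_zero_fun : Ord k (fun _ : Phase d n => (0 : E)) :=
  Ord.of_bound (C := 0) (Eventually.of_forall fun Z => by simp)

lemma OEq.of_eventuallyEq {u v : Phase d n → E} (h : u =ᶠ[nT d n] v) : OEq k u v :=
  ord_zero_fun.congr (h.mono fun Z hZ => by simp only [hZ, sub_self])

lemma OEq.symm {u v : Phase d n → E} (h : OEq k u v) : OEq k v u := by
  have := Ord.neg h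
  unfold OEq
  simpa only [neg_sub] using this

lemma OEq.trans {u v w : Phase d n → E} (h : OEq k u v) (h' : OEq k v w) : OEq k u w := by
  have := Ord.add h h'
  unfold OEq
  simpa only [sub_add_sub_cancel] using this

lemma OEq.mono {u v : Phase d n → E} (h : OEq l u v) (hkl : k ≤ l) : OEq k u v := Ord.mono h hkl

lemma OEq.sub {u v u' v' : Phase d n → E} (h : OEq k u v) (h' : OEq k u' v') :
    OEq k (fun Z => u Z - u' Z) (fun Z => v Z - v' Z) := by
  have := Ord.sub h h'
  unfold OEq
  simpa only [sub_sub_sub_comm] using this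

lemma OEq.ord {u v : Phase d n → E} (h : OEq k u v) (hv : Ord k v) : Ord k u := by
  have := Ord.add h hv
  simpa only [sub_add_cancel] using this

lemma Germ.smul_ord {a : Phase d n → ℂ} {v : Phase d n → E} (ha : Germ a) (hv : Ord k v) :
    Ord k fun Z => a Z • v Z := by simpa using ha.ord_zero.smul hv

lemma Germ.clm_ord {A : Phase d n → E →L[ℂ] F} {v : Phase d n → E} (hA : Germ A) (hv : Ord k v) :
    Ord k fun Z => A Z (v Z) := by simpa using hA.ord_zero.clm_apply hv

lemma OEq.smul_left {u v : Phase d n → E} {a : Phase d n → ℂ} (ha : Germ a) (h : OEq k u v) :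
    OEq k (fun Z => a Z • u Z) (fun Z => a Z • v Z) := by
  have := ha.smul_ord h
  unfold OEq
  simpa only [smul_sub] using this

lemma OEq.clm_left {u v : Phase d n → E} {A : Phase d n → E →L[ℂ] F} (hA : Germ A)
    (h : OEq k u v) : OEq k (fun Z => A Z (u Z)) (fun Z => A Z (v Z)) := by
  have := hA.clm_ord h
  unfold OEq
  simpa only [map_sub] using this

lemma Ord.clm_const {u : Phase d n → E} (A : E →L[ℂ] F) (h : Ord k u) : Ord k fun Z => A (u Z) := by
  refine IsBigO.trans ?_ h
  exact A.isBigO_comp _ _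

lemma Germ.clm_const {u : Phase d n → E} (A : E →L[ℂ] F) (h : Germ u) : Germ fun Z => A (u Z) :=
  h.comp₁ A.differentiable

lemma Germ.neg {u : Phase d n → E} (h : Germ u) : Germ fun Z => -u Z := by
  simpa using (Germ.const (0 : E)).sub h

end Congruence

/-! ### Components -/

/-- The projection to a component. -/
def compCLM (L : Fin d ⊕ Fin n) : Phase d n →L[ℂ] ℂ :=
  Sum.elim (fun j => (ContinuousLinearMap.proj j).comp (ContinuousLinearMap.fst ℂ _ _))
    (fun j => (ContinuousLinearMap.proj j).comp (ContinuousLinearMap.snd ℂ _ _)) L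

lemma compCLM_apply (L : Fin d ⊕ Fin n) (Z : Phase d n) : compCLM L Z = comp Z L := by
  cases L <;> rfl

lemma Germ.comp_of {u : Phase d n → Phase d n} (hu : Germ u) (L : Fin d ⊕ Fin n) :
    Germ fun Z => comp (u Z) L := by
  simpa only [compCLM_apply] using hu.clm_const (compCLM L)

lemma holo_of_comp {r δ : ℝ} {u : Phase d n → Phase d n} (h : ∀ L, Holo r δ fun Z => comp (u Z) L) :
    Holo r δ u :=
  Holo.prodMk (u := fun Z => (u Z).1) (v := fun Z => (u Z).2)
    (holo_pi.2 fun j => h (Sum.inl j)) (holo_pi.2 fun j => h (Sum.inr j))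

lemma exists_common_pos {ι : Type*} [Finite ι] {p : ι → ℝ → Prop}
    (hp : ∀ i, ∀ ρ ρ', 0 < ρ' → ρ' ≤ ρ → p i ρ → p i ρ') (h : ∀ i, ∃ ρ > 0, p i ρ) :
    ∃ ρ > 0, ∀ i, p i ρ := by
  have := Fintype.ofFinite ι
  choose ρ hρ hpρ using h
  rcases isEmpty_or_nonempty ι with hι | hι
  · exact ⟨1, one_pos, fun i => hι.elim i⟩
  · refine ⟨Finset.univ.inf' Finset.univ_nonempty ρ, ?_, fun i => ?_⟩
    · exact (Finset.lt_inf'_iff _).2 fun i _ => hρ i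
    · exact hp i _ _ ((Finset.lt_inf'_iff _).2 fun i _ => hρ i)
        (Finset.inf'_le _ (Finset.mem_univ i)) (hpρ i)

lemma germ_of_comp {u : Phase d n → Phase d n} (h : ∀ L, Germ fun Z => comp (u Z) L) : Germ u := by
  obtain ⟨ρ, hρ, h⟩ := exists_common_pos
    (p := fun L ρ => Holo ρ ρ fun Z => comp (u Z) L) (fun L ρ ρ' _ hρ' hh => Holo.mono hh hρ' hρ') h
  exact ⟨ρ, hρ, holo_of_comp h⟩

lemma ord_of_comp {k : ℕ} {u : Phase d n → Phase d n} (h : ∀ L, Ord k fun Z => comp (u Z) L) :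
    Ord k u := by
  refine isBigO_prod_left.2 ⟨isBigO_pi.2 fun j => h (Sum.inl j), isBigO_pi.2 fun j => h (Sum.inr j)⟩

lemma Ord.comp_of {k : ℕ} {u : Phase d n → Phase d n} (hu : Ord k u) (L : Fin d ⊕ Fin n) :
    Ord k fun Z => comp (u Z) L := by
  simpa only [compCLM_apply] using hu.clm_const (compCLM L)

/-! ### Derivatives and orders -/

section Derivatives

variable {E : Type*} [NormedAddCommGroup E] [NormedSpace ℂ E]

lemma Ord.fderiv {k : ℕ} {u : Phase d n → E} (hu : Germ u) (hk : Ord k u) :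
    Ord (k - 1) (fderiv ℂ u) := by
  obtain ⟨ρ₁, hρ₁, hu⟩ := hu
  obtain ⟨C, hC, ρ₂, hρ₂, hk⟩ := hk.exists_bound
  set ρ := min ρ₁ ρ₂ with hρdef
  have hρ : 0 < ρ := lt_min hρ₁ hρ₂
  have hd : DifferentiableOn ℂ u (domain d n ρ ρ) :=
    hu.1.mono (domain_mono (min_le_left _ _) (min_le_left _ _))
  have hb : ∀ Z ∈ domain d n ρ ρ, ‖u Z‖ ≤ C * ‖Z.2‖ ^ k := fun Z hZ =>
    hk Z (domain_mono (min_le_right _ _) (min_le_right _ _) hZ)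
  have hsmall : ∀ᶠ Z in nT d n, ‖Z.2‖ < ρ / 2 :=
    tendsto_norm_snd.eventually (Iio_mem_nhds (by positivity))
  rcases Nat.eq_zero_or_pos k with rfl | hkpos
  · refine Ord.of_bound (C := 2 * C / (ρ / 2)) ?_
    filter_upwards [domain_mem_nT (half_pos hρ) (half_pos hρ)] with Z hZ
    have hsub : Metric.ball Z (ρ / 2) ⊆ domain d n ρ ρ := ball_subset_domain (by rwa [sub_half])
    simpa using norm_fderiv_le_of_norm_le_ball (half_pos hρ) (hd.mono hsub) fun W hW => by
      simpa using hb W (hsub hW)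
  obtain ⟨k, rfl⟩ : ∃ k', k = k' + 1 := ⟨k - 1, by omega⟩
  refine Ord.of_bound (C := 2 * C * 2 ^ (k + 1)) ?_
  filter_upwards [domain_mem_nT (half_pos hρ) (half_pos hρ), hsmall] with Z hZ hy
  have key : ∀ R ∈ Ioo ‖Z.2‖ (ρ / 2), ‖_root_.fderiv ℂ u Z‖ ≤ 2 * C * 2 ^ (k + 1) * R ^ k := by
    intro R hR
    have hR0 : 0 < R := (norm_nonneg _).trans_lt hR.1
    have hsub : Metric.ball Z R ⊆ domain d n ρ ρ := by
      refine ball_subset_domain (domain_mono ?_ ?_ hZ) <;> linarith [hR.2]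
    have h := norm_fderiv_le_of_norm_le_ball hR0 (hd.mono hsub) (C := C * (2 * R) ^ (k + 1))
      fun W hW => by
        refine (hb W (hsub hW)).trans ?_
        have h1 : ‖W.2 - Z.2‖ ≤ R := by
          rw [mem_ball_iff_norm, Prod.norm_def, sup_lt_iff] at hW
          exact hW.2.le
        have h2 : ‖W.2‖ ≤ 2 * R := by
          have h3 : W.2 = Z.2 + (W.2 - Z.2) := by abel
          rw [h3]
          linarith [norm_add_le Z.2 (W.2 - Z.2), hR.1]
        gcongr
    refine h.trans (le_of_eq ?_)
    rw [mul_pow, pow_succ R]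
    field_simp
  have hlim : Tendsto (fun R : ℝ => 2 * C * 2 ^ (k + 1) * R ^ k) (𝓝[>] ‖Z.2‖)
      (𝓝 (2 * C * 2 ^ (k + 1) * ‖Z.2‖ ^ k)) :=
    ((continuous_const.mul (continuous_pow k)).tendsto _).mono_left nhdsWithin_le_nhds
  refine ge_of_tendsto hlim ?_
  filter_upwards [Ioo_mem_nhdsGT hy] with R hR using key R hR

variable (ω : Fin d → ℝ) (Λ : Fin n → ℂ)

lemma holo_quasilinear (r δ : ℝ) : Holo r δ (quasilinear ω Λ) := by
  refine ⟨Differentiable.differentiableOn ?_, fun Z _ P => rfl⟩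
  unfold quasilinear
  fun_prop

lemma germ_quasilinear : Germ (quasilinear ω Λ) := ⟨1, one_pos, holo_quasilinear ω Λ 1 1⟩

/-- The derivative of `S`. -/
def linPart : Phase d n →L[ℂ] Phase d n :=
  (0 : Phase d n →L[ℂ] (Fin d → ℂ)).prod
    (ContinuousLinearMap.pi fun j => Λ j •
      (ContinuousLinearMap.proj j).comp (ContinuousLinearMap.snd ℂ (Fin d → ℂ) (Fin n → ℂ)))

lemma linPart_apply (v : Phase d n) : linPart Λ v = (0, fun j => Λ j * v.2 j) := rfl

lemma quasilinear_add (Z w : Phase d n) :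
    quasilinear ω Λ (Z + w) = quasilinear ω Λ Z + linPart Λ w := by
  refine Prod.ext (funext fun j => ?_) (funext fun j => ?_)
  · simp [quasilinear, linPart_apply]
  · simp [quasilinear, linPart_apply, mul_add]

lemma comp_LS {u : Phase d n → Phase d n} {Z : Phase d n} (hu : DifferentiableAt ℂ u Z)
    (L : Fin d ⊕ Fin n) : comp (LS ω Λ u Z) L = LS ω Λ (fun W => comp (u W) L) Z := by
  have h : HasFDerivAt (fun W => comp (u W) L) ((compCLM L).comp (_root_.fderiv ℂ u Z)) Z := by
    have := (compCLM L).hasFDerivAt.comp Z hu.hasFDerivAt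
    simpa only [Function.comp_def, compCLM_apply] using this
  rw [LS, LS, h.fderiv, ContinuousLinearMap.comp_apply, compCLM_apply]

lemma Ord.LS {k : ℕ} {u : Phase d n → ℂ} (hu : Germ u) (hk : Ord k u) : Ord k (LS ω Λ u) := by
  refine (hu.hasCoef.LS ω Λ).ord fun p hp => ?_
  simp only [hu.hasCoef.hasOrder hk p hp, mul_zero]

lemma Ord.LS_phase {k : ℕ} {u : Phase d n → Phase d n} (hu : Germ u) (hk : Ord k u) :
    Ord k (TorusNF.LS ω Λ u) := by
  refine ord_of_comp fun L => ?_
  refine (Ord.LS ω Λ (hu.comp_of L) (hk.comp_of L)).congr ?_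
  filter_upwards [hu.eventually_differentiableAt] with Z hZ using comp_LS ω Λ hZ L

end Derivatives

/-! ### Maps close to the identity -/

/-- Germs of maps tangent to the identity along the torus. -/
structure NearId (Φ : Phase d n → Phase d n) : Prop where
  germ : Germ fun Z => Φ Z - Z
  ord : Ord 2 fun Z => Φ Z - Z

namespace NearId

variable {Φ Ψ : Phase d n → Phase d n}

lemma id_add {w : Phase d n → Phase d n} (hw : Germ w) (h : Ord 2 w) : NearId fun Z => Z + w Z :=
  ⟨by simpa using hw, by simpa using h⟩

lemma tendsto (h : NearId Φ) : Tendsto Φ (nT d n) (nT d n) := by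
  have := tendsto_id_add (h.ord.tendsto_zero (by norm_num))
  simpa using this

lemma ord_snd (h : NearId Φ) : Ord 1 fun Z => (Φ Z).2 := by
  have h1 := (h.ord.snd.mono (by norm_num : 1 ≤ 2)).add TorusNF.ord_snd
  simpa using h1

lemma eventually_hasFDerivAt (h : NearId Φ) : ∀ᶠ Z in nT d n, HasFDerivAt Φ
    (ContinuousLinearMap.id ℂ _ + fderiv ℂ (fun Z => Φ Z - Z) Z) Z := by
  filter_upwards [h.germ.eventually_differentiableAt] with Z hZ
  have := (hasFDerivAt_id Z).add hZ.hasFDerivAt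
  simpa [Pi.add_def] using this

lemma fderiv_eq (h : NearId Φ) : fderiv ℂ Φ =ᶠ[nT d n]
    fun Z => ContinuousLinearMap.id ℂ _ + fderiv ℂ (fun Z => Φ Z - Z) Z :=
  h.eventually_hasFDerivAt.mono fun _ hZ => hZ.fderiv

lemma germ_fderiv (h : NearId Φ) : Germ (fderiv ℂ Φ) :=
  ((Germ.const _).add h.germ.fderiv).congr h.fderiv_eq

lemma oEq_fderiv (h : NearId Φ) : OEq 1 (fderiv ℂ Φ) fun _ => ContinuousLinearMap.id ℂ _ := by
  have h1 := Ord.fderiv h.germ h.ord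
  refine h1.congr ?_
  filter_upwards [h.fderiv_eq] with Z hZ
  rw [hZ, add_sub_cancel_left]

lemma eventually_isUnit (h : NearId Φ) : ∀ᶠ Z in nT d n, IsUnit (fderiv ℂ Φ Z) := by
  have h1 := Ord.tendsto_zero h.oEq_fderiv le_rfl
  rw [tendsto_zero_iff_norm_tendsto_zero] at h1
  filter_upwards [h1.eventually (gt_mem_nhds one_pos)] with Z hZ
  have h2 := isUnit_one_sub_of_norm_lt_one (x := 1 - fderiv ℂ Φ Z) (by rwa [norm_sub_rev])
  simpa using h2

lemma comp (hΦ : NearId Φ) (hΨ : NearId Ψ) : NearId fun Z => Φ (Ψ Z) := by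
  have h1 := hΦ.germ.comp_map hΨ.tendsto hΨ.germ
  have h2 := hΦ.ord.comp_map hΨ.tendsto hΨ.ord_snd
  exact ⟨by simpa using h1.add hΨ.germ, by simpa using h2.add hΨ.ord⟩

end NearId

lemma Holo.inverse {E : Type*} [NormedAddCommGroup E] [NormedSpace ℂ E] [CompleteSpace E]
    {r δ : ℝ} {A : Phase d n → E →L[ℂ] E} (hA : Holo r δ A)
    (h : ∀ Z ∈ domain d n r δ, IsUnit (A Z)) : Holo r δ fun Z => Ring.inverse (A Z) := by
  refine ⟨fun Z hZ => ?_, fun Z hZ P => by simp only [hA.2 Z hZ]⟩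
  obtain ⟨a, ha⟩ := h Z hZ
  have h1 : DifferentiableAt ℂ Ring.inverse (A Z) := by
    rw [← ha]
    exact differentiableAt_inverse a.isUnit
  exact h1.comp_differentiableWithinAt Z (hA.1 Z hZ)

lemma Germ.inverse {E : Type*} [NormedAddCommGroup E] [NormedSpace ℂ E] [CompleteSpace E]
    {A : Phase d n → E →L[ℂ] E} (hA : Germ A) (h : ∀ᶠ Z in nT d n, IsUnit (A Z)) :
    Germ fun Z => Ring.inverse (A Z) := by
  obtain ⟨ρ, hρ, hA⟩ := hA
  obtain ⟨ρ', hρ', h⟩ := eventually_nT.1 h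
  exact ⟨min ρ ρ', lt_min hρ hρ', (hA.mono (min_le_left _ _) (min_le_left _ _)).inverse
    fun Z hZ => h Z (domain_mono (min_le_right _ _) (min_le_right _ _) hZ)⟩

lemma inverse_apply_apply {E : Type*} [NormedAddCommGroup E] [NormedSpace ℂ E] {A : E →L[ℂ] E}
    (h : IsUnit A) (v : E) : Ring.inverse A (A v) = v := by
  have := Ring.inverse_mul_cancel A h
  exact DFunLike.congr_fun this v

lemma apply_inverse_apply {E : Type*} [NormedAddCommGroup E] [NormedSpace ℂ E] {A : E →L[ℂ] E}
    (h : IsUnit A) (v : E) : A (Ring.inverse A v) = v := by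
  have := Ring.mul_inverse_cancel A h
  exact DFunLike.congr_fun this v

/-! ### Approximate conjugacies -/

section Exp

variable {E : Type*} [NormedAddCommGroup E] [NormedSpace ℂ E] {j m : ℕ}

lemma Ord.exp_sub_one_smul {κ : Phase d n → ℂ} {v : Phase d n → E} (hκ : Tendsto κ (nT d n) (𝓝 0))
    (h : Ord m fun Z => κ Z • v Z) : Ord m fun Z => (Complex.exp (κ Z) - 1) • v Z := by
  refine IsBigO.trans (IsBigO.of_bound 2 ?_) h
  rw [tendsto_zero_iff_norm_tendsto_zero] at hκ
  filter_upwards [hκ.eventually (gt_mem_nhds one_pos)] with Z hZ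
  rw [norm_smul, norm_smul, ← mul_assoc]
  gcongr
  exact Complex.norm_exp_sub_one_le hZ.le

lemma Ord.exp_remainder_smul {κ : Phase d n → ℂ} {v : Phase d n → E} (hj : 1 ≤ j) (hκ : Ord j κ)
    (h : Ord m fun Z => κ Z • v Z) :
    Ord (j + m) fun Z => (Complex.exp (κ Z) - 1 - κ Z) • v Z := by
  refine IsBigO.trans (IsBigO.of_bound 1 ?_) (hκ.smul h)
  have h0 := hκ.tendsto_zero hj
  rw [tendsto_zero_iff_norm_tendsto_zero] at h0
  filter_upwards [h0.eventually (gt_mem_nhds one_pos)] with Z hZ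
  rw [norm_smul, norm_smul, norm_smul, one_mul, ← mul_assoc, ← sq]
  gcongr
  exact Complex.norm_exp_sub_one_sub_id_le hZ.le

lemma Germ.exp {k : Phase d n → ℂ} (hk : Germ k) : Germ fun Z => Complex.exp (k Z) :=
  hk.comp₁ Complex.differentiable_exp

end Exp

section Conjugacy

variable (ω : Fin d → ℝ) (Λ : Fin n → ℂ)

lemma LS_add {E : Type*} [NormedAddCommGroup E] [NormedSpace ℂ E] {u v : Phase d n → E}
    {Z : Phase d n} (hu : DifferentiableAt ℂ u Z) (hv : DifferentiableAt ℂ v Z) :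
    LS ω Λ (fun W => u W + v W) Z = LS ω Λ u Z + LS ω Λ v Z := by
  unfold LS
  rw [fderiv_fun_add hu hv]
  rfl

lemma LS_sub {E : Type*} [NormedAddCommGroup E] [NormedSpace ℂ E] {u v : Phase d n → E}
    {Z : Phase d n} (hu : DifferentiableAt ℂ u Z) (hv : DifferentiableAt ℂ v Z) :
    LS ω Λ (fun W => u W - v W) Z = LS ω Λ u Z - LS ω Λ v Z := by
  unfold LS
  rw [fderiv_fun_sub hu hv]
  rfl

lemma LS_id (Z : Phase d n) : LS ω Λ (fun W => W) Z = quasilinear ω Λ Z := by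
  simp [LS]

namespace NearId

variable {Φ Ψ : Phase d n → Phase d n}

lemma eventually_differentiableAt (h : NearId Φ) : ∀ᶠ Z in nT d n, DifferentiableAt ℂ Φ Z :=
  h.eventually_hasFDerivAt.mono fun _ hZ => hZ.differentiableAt

lemma germ_sub (hΦ : NearId Φ) (hΨ : NearId Ψ) : Germ fun Z => Φ Z - Ψ Z := by
  simpa using hΦ.germ.sub hΨ.germ

lemma germ_LS (hΦ : NearId Φ) : Germ (LS ω Λ Φ) := hΦ.germ_fderiv.clm_apply (germ_quasilinear ω Λ)

lemma oEq_LS {m : ℕ} (hΦ : NearId Φ) (hΨ : NearId Ψ) (h : OEq m Φ Ψ) :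
    OEq m (LS ω Λ Φ) (LS ω Λ Ψ) := by
  refine (Ord.LS_phase ω Λ (hΦ.germ_sub hΨ) h).congr ?_
  filter_upwards [hΦ.eventually_differentiableAt, hΨ.eventually_differentiableAt] with Z h1 h2
  exact (LS_sub ω Λ h1 h2).symm

lemma germ_comp {E : Type*} [NormedAddCommGroup E] [NormedSpace ℂ E] {V : Phase d n → E}
    (hV : Germ V) (hΦ : NearId Φ) : Germ fun Z => V (Φ Z) := hV.comp_map hΦ.tendsto hΦ.germ

end NearId

/-- `Φ` conjugates `e^{-k} S` to `V` up to terms of order `K`, where `k` is constant along `S`. -/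
structure FormalConj (V : Phase d n → Phase d n) (K : ℕ) (Φ : Phase d n → Phase d n)
    (k : Phase d n → ℂ) : Prop where
  near : NearId Φ
  germ : Germ k
  LS_eq : LS ω Λ k =ᶠ[nT d n] 0
  conj : OEq K (LS ω Λ Φ) fun Z => Complex.exp (k Z) • V (Φ Z)

/-- The error of an approximate conjugacy. -/
def err (V Ψ : Phase d n → Phase d n) (h : Phase d n → ℂ) (Z : Phase d n) : Phase d n :=
  Complex.exp (h Z) • V (Ψ Z) - LS ω Λ Ψ Z

variable {ω Λ} {V Φ Ψ : Phase d n → Phase d n} {k h : Phase d n → ℂ} {m K : ℕ}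

lemma germ_err (hV : Germ V) (hΨ : NearId Ψ) (hh : Germ h) : Germ (err ω Λ V Ψ h) :=
  (hh.exp.smul (hΨ.germ_comp hV)).sub (hΨ.germ_LS ω Λ)

lemma FormalConj.ord_err (hc : FormalConj ω Λ V K Φ k) (hV : Germ V) (hΨ : NearId Ψ) (hh : Germ h)
    (hm : 1 ≤ m) (hK : m ≤ K) (hΦΨ : OEq m Φ Ψ)
    (hκ : Ord m fun Z => (k Z - h Z) • quasilinear ω Λ Z)
    (ht : Tendsto (fun Z => k Z - h Z) (nT d n) (𝓝 0)) : Ord m (err ω Λ V Ψ h) := by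
  have e1 : OEq m (fun Z => Complex.exp (h Z) • V (Ψ Z)) (fun Z => Complex.exp (h Z) • V (Φ Z)) :=
    (OEq.smul_left hh.exp (Ord.comp_sub hV hΨ.tendsto hm hΦΨ)).symm
  have e2 : OEq m (fun Z => Complex.exp (h Z) • V (Φ Z))
      (fun Z => Complex.exp (h Z - k Z) • LS ω Λ Φ Z) := by
    have := OEq.smul_left (hh.sub hc.germ).exp (hc.conj.mono hK)
    simp only [smul_smul, ← Complex.exp_add, sub_add_cancel] at this
    exact this.symm
  have e3 : OEq m (fun Z => Complex.exp (h Z - k Z) • LS ω Λ Φ Z) (LS ω Λ Φ) := by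
    have h1 : Ord m fun Z => (h Z - k Z) • quasilinear ω Λ Z := by
      have := hκ.neg
      simpa only [← neg_smul, neg_sub] using this
    have h2 : Tendsto (fun Z => h Z - k Z) (nT d n) (𝓝 0) := by simpa using ht.neg
    have h3 := hc.near.germ_fderiv.clm_ord (h1.exp_sub_one_smul h2)
    refine h3.congr (Eventually.of_forall fun Z => ?_)
    simp only [map_smul, map_sub, sub_smul, one_smul, LS]
  exact ((e1.trans e2).trans e3).trans (hc.near.oEq_LS ω Λ hΨ hΦΨ)

/-- The displacement from `Ψ` to `Φ` read in the source of `Ψ`. -/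
def disp (Ψ Φ : Phase d n → Phase d n) (Z : Phase d n) : Phase d n :=
  Ring.inverse (fderiv ℂ Ψ Z) (Φ Z - Ψ Z)

lemma NearId.germ_inverse (hΨ : NearId Ψ) : Germ fun Z => Ring.inverse (fderiv ℂ Ψ Z) :=
  hΨ.germ_fderiv.inverse hΨ.eventually_isUnit

lemma germ_disp (hΨ : NearId Ψ) (hΦ : NearId Φ) : Germ (disp Ψ Φ) :=
  hΨ.germ_inverse.clm_apply (hΦ.germ_sub hΨ)

lemma ord_disp (hΨ : NearId Ψ) (h : OEq m Φ Ψ) : Ord m (disp Ψ Φ) := hΨ.germ_inverse.clm_ord h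

lemma fderiv_disp (hΨ : NearId Ψ) : ∀ᶠ Z in nT d n, fderiv ℂ Ψ Z (disp Ψ Φ Z) = Φ Z - Ψ Z := by
  filter_upwards [hΨ.eventually_isUnit] with Z hZ using apply_inverse_apply hZ _

/-- Second order expansion of a map close to the identity. -/
lemma NearId.increment₂ (hΨ : NearId Ψ) {w : Phase d n → Phase d n} (hw : Ord m w) (hm : 1 ≤ m) :
    OEq (2 * m) (fun Z => Ψ (Z + w Z)) (fun Z => Ψ Z + fderiv ℂ Ψ Z (w Z)) := by
  refine (Ord.increment₂ hΨ.germ hw hm).congr ?_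
  filter_upwards [hΨ.fderiv_eq] with Z hZ
  rw [hZ]
  simp only [FunLike.coe_add, Pi.add_apply, ContinuousLinearMap.coe_id', id_eq]
  abel

lemma FormalConj.linearized (hc : FormalConj ω Λ V K Φ k) (hV : Germ V) (hΨ : NearId Ψ)
    (hh : Germ h) (hm : 2 ≤ m) (hK : 2 * m - 1 ≤ K) (hΦΨ : OEq m Φ Ψ)
    (hκ : Ord m fun Z => (k Z - h Z) • quasilinear ω Λ Z) (hκ' : Ord (m - 1) fun Z => k Z - h Z) :
    OEq (2 * m - 1) (fun Z => LS ω Λ (disp Ψ Φ) Z - linPart Λ (disp Ψ Φ Z)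
        - (k Z - h Z - fderiv ℂ h Z (disp Ψ Φ Z)) • quasilinear ω Λ Z)
      (fun Z => Ring.inverse (fderiv ℂ Ψ Z) (err ω Λ V Ψ h Z)) := by
  set S := quasilinear ω Λ with hS
  set u := disp Ψ Φ with hu
  set N := 2 * m - 1 with hN
  have hm1 : 1 ≤ m := by omega
  have hN2 : N ≤ 2 * m := by omega
  have hNm : m - 1 + m = N := by omega
  have hug : Germ u := germ_disp hΨ hc.near
  have huo : Ord m u := ord_disp hΨ hΦΨ
  have hE : Ord m (err ω Λ V Ψ h) := hc.ord_err hV hΨ hh hm1 (by omega) hΦΨ hκ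
    (hκ'.tendsto_zero (by omega))
  have hT : NearId fun Z => Z + u Z := NearId.id_add hug (huo.mono hm)
  set q : Phase d n → Phase d n := fun Z => LS ω Λ u Z - linPart Λ (u Z) with hq
  have hqo : Ord m q := (Ord.LS_phase ω Λ hug huo).sub (huo.clm_const _)
  set W : Phase d n → Phase d n := fun Z => Complex.exp (h Z) • V (Ψ Z) with hW
  have hWg : Germ W := hh.exp.smul (hΨ.germ_comp hV)
  set κ₁ : Phase d n → ℂ := fun Z => k Z - h (Z + u Z) with hκ₁
  have hhT : OEq (2 * m) (fun Z => h (Z + u Z)) (fun Z => h Z + fderiv ℂ h Z (u Z)) := by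
    refine (Ord.increment₂ hh huo hm1).congr (Eventually.of_forall fun Z => ?_)
    simp only
    abel
  have hκ₁eq : OEq (2 * m) κ₁ (fun Z => k Z - h Z - fderiv ℂ h Z (u Z)) := by
    refine hhT.neg.congr (Eventually.of_forall fun Z => ?_)
    simp only [hκ₁]
    ring
  have hDhu : Ord m fun Z => fderiv ℂ h Z (u Z) := hh.fderiv.clm_ord huo
  have hκ₁o : Ord (m - 1) κ₁ := (hκ₁eq.mono (by omega)).ord (hκ'.sub (hDhu.mono (by omega)))
  have hSg : Germ S := germ_quasilinear ω Λ
  have hκ₁S : OEq (2 * m) (fun Z => κ₁ Z • S Z)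
      (fun Z => (k Z - h Z - fderiv ℂ h Z (u Z)) • S Z) := by
    have := Ord.smul hκ₁eq hSg.ord_zero
    refine this.congr (Eventually.of_forall fun Z => ?_)
    simp only [sub_smul]
  have hκ₁So : Ord m fun Z => κ₁ Z • S Z := by
    refine (hκ₁S.mono (by omega)).ord ?_
    have := hκ.sub (hDhu.smul hSg.ord_zero)
    refine this.congr (Eventually.of_forall fun Z => ?_)
    simp only [sub_smul]
  -- the two sides of the conjugacy equation along `Ψ ∘ (id + u)`
  have hcomp : OEq (2 * m) (fun Z => Ψ (Z + u Z)) Φ := by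
    refine (hΨ.increment₂ huo hm1).trans (OEq.of_eventuallyEq ?_)
    filter_upwards [fderiv_disp (Φ := Φ) hΨ] with Z hZ
    rw [hu, hZ, add_sub_cancel]
  have hΨT : NearId fun Z => Ψ (Z + u Z) := hΨ.comp hT
  have hLS : OEq (2 * m) (LS ω Λ Φ) (LS ω Λ fun Z => Ψ (Z + u Z)) :=
    hc.near.oEq_LS ω Λ hΨT hcomp.symm
  have hchain : LS ω Λ (fun Z => Ψ (Z + u Z)) =ᶠ[nT d n]
      fun Z => LS ω Λ Ψ (Z + u Z) + fderiv ℂ Ψ (Z + u Z) (q Z) := by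
    filter_upwards [hT.tendsto.eventually hΨ.eventually_differentiableAt,
      hug.eventually_differentiableAt] with Z h1 h2
    have h3 : HasFDerivAt (fun Z => Ψ (Z + u Z))
        ((fderiv ℂ Ψ (Z + u Z)).comp (ContinuousLinearMap.id ℂ _ + fderiv ℂ u Z)) Z :=
      h1.hasFDerivAt.comp Z ((hasFDerivAt_id Z).add h2.hasFDerivAt)
    simp only [LS, h3.fderiv, hq, quasilinear_add, ContinuousLinearMap.comp_apply, FunLike.coe_add,
      Pi.add_apply, ContinuousLinearMap.coe_id', id_eq, map_add, map_sub]
    abel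
  have hEinc : OEq N (fun Z => err ω Λ V Ψ h (Z + u Z)) (err ω Λ V Ψ h) := by
    have := Ord.increment (germ_err hV hΨ hh) hE huo hm
    rwa [hNm] at this
  have hDinc : OEq N (fun Z => fderiv ℂ Ψ (Z + u Z) (q Z)) (fun Z => fderiv ℂ Ψ Z (q Z)) := by
    have h1 := Ord.increment hΨ.germ_fderiv hΨ.germ_fderiv.ord_zero huo hm
    have h2 := (h1.clm_apply hqo).mono (k := N) (by omega)
    refine h2.congr (Eventually.of_forall fun Z => ?_)
    simp
  have hRHS : OEq (2 * m) (fun Z => Complex.exp (k Z) • V (Φ Z))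
      (fun Z => Complex.exp (κ₁ Z) • W (Z + u Z)) := by
    have h1 := OEq.smul_left hc.germ.exp (Ord.comp_sub hV hΨT.tendsto (by omega) hcomp.symm)
    refine h1.trans (OEq.of_eventuallyEq (Eventually.of_forall fun Z => ?_))
    simp only [hW, hκ₁, smul_smul, ← Complex.exp_add, sub_add_cancel]
  have hWT : OEq m (fun Z => W (Z + u Z)) W :=
    Ord.comp_sub hWg (Φ := fun Z => Z) tendsto_id hm1 (by simpa using huo)
  have hκW : OEq N (fun Z => κ₁ Z • W (Z + u Z))
      (fun Z => fderiv ℂ Ψ Z ((k Z - h Z - fderiv ℂ h Z (u Z)) • S Z)) := by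
    have h1 : OEq N (fun Z => κ₁ Z • W (Z + u Z)) (fun Z => κ₁ Z • W Z) := by
      have := hκ₁o.smul hWT
      rw [hNm] at this
      refine this.congr (Eventually.of_forall fun Z => ?_)
      simp only [smul_sub]
    have h2 : OEq N (fun Z => κ₁ Z • W Z) (fun Z => fderiv ℂ Ψ Z (κ₁ Z • S Z)) := by
      have := hκ₁o.smul hE
      rw [hNm] at this
      refine this.congr (Eventually.of_forall fun Z => ?_)
      simp only [err, hW, LS, map_smul, smul_sub, hS]
    exact (h1.trans h2).trans (OEq.clm_left hΨ.germ_fderiv (hκ₁S.mono hN2))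
  have hκWo : Ord m fun Z => κ₁ Z • W (Z + u Z) := by
    refine (hκW.mono (by omega)).ord (hΨ.germ_fderiv.clm_ord ?_)
    exact (hκ₁S.symm.mono (by omega)).ord hκ₁So
  have hexp : OEq N (fun Z => Complex.exp (κ₁ Z) • W (Z + u Z))
      (fun Z => W (Z + u Z) + κ₁ Z • W (Z + u Z)) := by
    have := Ord.exp_remainder_smul (by omega) hκ₁o hκWo
    rw [hNm] at this
    refine this.congr (Eventually.of_forall fun Z => ?_)
    simp only [sub_smul, one_smul]
    abel
  have hfin : OEq N (fun Z => fderiv ℂ Ψ Z (q Z - (k Z - h Z - fderiv ℂ h Z (u Z)) • S Z))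
      (err ω Λ V Ψ h) := by
    have s1 : OEq N (fun Z => LS ω Λ Ψ (Z + u Z) + fderiv ℂ Ψ (Z + u Z) (q Z))
        (fun Z => W (Z + u Z) + κ₁ Z • W (Z + u Z)) :=
      ((((hLS.mono hN2).trans (OEq.of_eventuallyEq hchain)).symm.trans (hc.conj.mono hK)).trans
        (hRHS.mono hN2)).trans hexp
    have s2 := ((Ord.sub s1 hDinc).add hκW).add hEinc
    refine s2.congr (Eventually.of_forall fun Z => ?_)
    simp only [map_sub, err, hW]
    abel
  have := OEq.clm_left hΨ.germ_inverse hfin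
  refine (OEq.of_eventuallyEq ?_).trans this
  filter_upwards [hΨ.eventually_isUnit] with Z hZ
  rw [inverse_apply_apply hZ]

end Conjugacy

/-! ### Vector fields and their coefficients -/

/-- The sum of a formal vector field. -/
def evalV (F : FormalVF d n) (Z : Phase d n) : Phase d n :=
  (fun j => eval (F (Sum.inl j)) Z, fun j => eval (F (Sum.inr j)) Z)

lemma comp_evalV (F : FormalVF d n) (Z : Phase d n) (L : Fin d ⊕ Fin n) :
    comp (evalV F Z) L = eval (F L) Z := by cases L <;> rfl

lemma germ_evalV {F : FormalVF d n} (h : ∀ L, ∃ ρ > 0, ∃ C, Majorized ρ ρ C (F L)) :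
    Germ (evalV F) := by
  refine germ_of_comp fun L => ?_
  obtain ⟨ρ, hρ, C, hF⟩ := h L
  simp only [comp_evalV]
  exact ⟨ρ, hρ, hF.holo hρ⟩

/-- The coefficients of the components of a germ of vector field. -/
def coefV (u : Phase d n → Phase d n) : FormalVF d n := fun L => coef fun Z => comp (u Z) L

lemma Germ.hasCoefV {u : Phase d n → Phase d n} (hu : Germ u) (L : Fin d ⊕ Fin n) :
    HasCoef (fun Z => comp (u Z) L) (coefV u L) := (hu.comp_of L).hasCoef

lemma Germ.ord_iffV {u : Phase d n → Phase d n} (hu : Germ u) {k : ℕ} :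
    Ord k u ↔ ∀ L, HasOrder k (coefV u L) :=
  ⟨fun h L => (hu.hasCoefV L).hasOrder (h.comp_of L),
    fun h => ord_of_comp fun L => (hu.hasCoefV L).ord (h L)⟩

lemma HasCoef.eventuallyEq_zero {u : Phase d n → ℂ} {f : Series d n} (h : HasCoef u f)
    (hf : ∀ p, f p = 0) : u =ᶠ[nT d n] 0 := by
  filter_upwards [h.holo_eval] with Z hZ
  simp [hZ, eval, hf]

lemma eventuallyEq_of_comp {u v : Phase d n → Phase d n}
    (h : ∀ L, (fun Z => comp (u Z) L) =ᶠ[nT d n] fun Z => comp (v Z) L) : u =ᶠ[nT d n] v := by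
  have := eventually_all.2 h
  filter_upwards [this] with Z hZ
  exact Prod.ext (funext fun j => hZ (Sum.inl j)) (funext fun j => hZ (Sum.inr j))

/-- Keeping some of the coefficients of a germ. -/
lemma Germ.exists_filter {u : Phase d n → Phase d n} (hu : Germ u)
    (χ : Fin d ⊕ Fin n → Idx d n → Prop) [∀ L p, Decidable (χ L p)] :
    ∃ w : Phase d n → Phase d n, Germ w ∧ ∀ L p, coefV w L p = if χ L p then coefV u L p else 0 := by
  have h1 : ∀ L, ∃ ρ > 0, ∃ C, Majorized ρ ρ C (fun p => if χ L p then coefV u L p else 0) := by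
    intro L
    obtain ⟨ρ, hρ, C, hf, -⟩ := hu.hasCoefV L
    refine ⟨ρ, hρ, C, hf.of_norm_le hρ.le fun p => ?_⟩
    split_ifs <;> simp
  refine ⟨evalV fun L p => if χ L p then coefV u L p else 0, germ_evalV h1, fun L p => ?_⟩
  obtain ⟨ρ, hρ, C, hf⟩ := h1 L
  have := (hf.hasCoef hρ hρ).coef_eq
  simp only [coefV, comp_evalV]
  exact congrFun this p

section Resonances

variable (ω : Fin d → ℝ) (Λ : Fin n → ℂ)

/-- The divisor of a monomial in a component of a vector field. -/
def divL (L : Fin d ⊕ Fin n) (p : Idx d n) : ℂ := div ω Λ p - Sum.elim (fun _ => 0) Λ L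

/-- The coefficients of the components of `S`. -/
def sCoef (L : Fin d ⊕ Fin n) : ℂ := Sum.elim (fun j => (ω j : ℂ)) Λ L

/-- The exponent of the product of a monomial with the monomial of a component of `S`. -/
def addE (L : Fin d ⊕ Fin n) (p : Idx d n) : Idx d n :=
  Sum.elim (fun _ => p) (fun j => (p.1, p.2 + Pi.single j 1)) L

lemma divL_addE (L : Fin d ⊕ Fin n) (p : Idx d n) : divL ω Λ L (addE L p) = div ω Λ p := by
  cases L <;> simp [divL, addE, div_add_single]

lemma degQ_addE_le (L : Fin d ⊕ Fin n) (p : Idx d n) : degQ (addE L p).2 ≤ degQ p.2 + 1 := by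
  cases L <;> simp [addE, degQ_add_single]

lemma le_degQ_addE (L : Fin d ⊕ Fin n) (p : Idx d n) : degQ p.2 ≤ degQ (addE L p).2 := by
  cases L <;> simp [addE, degQ_add_single]

lemma smulS_addE (f : Series d n) (L : Fin d ⊕ Fin n) (p : Idx d n) :
    smulS ω Λ f L (addE L p) = sCoef ω Λ L * f p := by
  cases L <;> simp [smulS, addE, sCoef]

lemma smulS_cases (L : Fin d ⊕ Fin n) (p : Idx d n) :
    (∃ p', addE L p' = p) ∨ ∀ f : Series d n, smulS ω Λ f L p = 0 := by
  cases L with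
  | inl j => exact Or.inl ⟨p, rfl⟩
  | inr j =>
    by_cases h : p.2 j = 0
    · exact Or.inr fun f => by simp [smulS, h]
    · exact Or.inl ⟨(p.1, p.2 - Pi.single j 1), Prod.ext rfl (sub_single_add h)⟩

lemma hasCoef_smulS {a : Phase d n → ℂ} {f : Series d n} (ha : HasCoef a f) (L : Fin d ⊕ Fin n) :
    HasCoef (fun Z => comp (a Z • quasilinear ω Λ Z) L) (smulS ω Λ f L) := by
  cases L with
  | inl j =>
    refine (ha.const_mul (ω j)).congr (Eventually.of_forall fun Z => ?_)
    simp [comp, quasilinear, mul_comm]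
  | inr j =>
    have h := (ha.mul_snd j).const_mul (Λ j)
    have h2 : smulS ω Λ f (Sum.inr j) = fun p => Λ j * shiftY j f p := by
      funext p
      simp [smulS, shiftY]
    rw [h2]
    refine h.congr (Eventually.of_forall fun Z => ?_)
    simp only [comp, quasilinear, Sum.elim_inr, Prod.smul_snd, Pi.smul_apply, smul_eq_mul]
    ring

lemma hasCoef_lie {u : Phase d n → Phase d n} (hu : Germ u) (L : Fin d ⊕ Fin n) :
    HasCoef (fun Z => comp (LS ω Λ u Z - linPart Λ (u Z)) L)
      (fun p => divL ω Λ L p * coefV u L p) := by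
  have h1 := ((hu.hasCoefV L).LS ω Λ).sub
    ((hu.hasCoefV L).const_mul (Sum.elim (fun _ => 0) Λ L))
  have h2 : (fun p => divL ω Λ L p * coefV u L p) = fun p => div ω Λ p * coefV u L p -
      Sum.elim (fun _ => 0) Λ L * coefV u L p := by
    funext p
    rw [divL, sub_mul]
  rw [h2]
  refine h1.congr ?_
  filter_upwards [hu.eventually_differentiableAt] with Z hZ
  rw [← comp_LS ω Λ hZ L]
  cases L <;> simp [comp, linPart_apply]

lemma coef_mul_div_eq_zero {k : Phase d n → ℂ} (hk : Germ k) (h : LS ω Λ k =ᶠ[nT d n] 0)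
    (p : Idx d n) : div ω Λ p * coef k p = 0 := by
  have h1 := hk.hasCoef.LS ω Λ
  have h2 : HasCoef (LS ω Λ k) (fun _ => 0) := hasCoef_zero.congr h
  exact congrFun (h1.unique h2) p

lemma ord_of_smul_quasilinear {κ : Phase d n → ℂ} (hκ : Germ κ) {L : Fin d ⊕ Fin n}
    (hL : sCoef ω Λ L ≠ 0) {m : ℕ} (h : Ord m fun Z => κ Z • quasilinear ω Λ Z) :
    Ord (m - 1) κ := by
  refine hκ.hasCoef.ord fun p hp => ?_
  have h1 := (hasCoef_smulS ω Λ hκ.hasCoef L).hasOrder (h.comp_of L) (addE L p)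
    (by have := degQ_addE_le L p; omega)
  rw [smulS_addE] at h1
  exact (mul_eq_zero.1 h1).resolve_left hL

lemma ord_fderiv_fst {k : ℕ} {h : Phase d n → ℂ} (hg : Germ h) (hk : Ord k h) {l : ℕ}
    {v : Phase d n → Fin d → ℂ} (hv : Ord l v) : Ord (k + l) fun Z => fderiv ℂ h Z (v Z, 0) := by
  have h1 : ∀ j, Ord (k + l) fun Z => TorusNF.LS (Pi.single j 1) (0 : Fin n → ℂ) h Z * v Z j :=
    fun j => (Ord.LS _ _ hg hk).mul ((isBigO_pi.1 hv) j)
  have h2 : Ord (k + l) fun Z => ∑ j, TorusNF.LS (Pi.single j 1) (0 : Fin n → ℂ) h Z * v Z j :=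
    IsBigO.fun_sum fun j _ => h1 j
  refine h2.congr (Eventually.of_forall fun Z => ?_)
  have h3 : ((v Z, 0) : Phase d n) = ∑ j, v Z j • quasilinear (Pi.single j 1) (0 : Fin n → ℂ) Z := by
    refine Prod.ext (funext fun i => ?_) (funext fun i => ?_)
    · simp [Prod.fst_sum, quasilinear, Pi.single_apply, apply_ite Complex.ofReal]
    · simp [Prod.snd_sum, quasilinear]
  simp only
  rw [h3, map_sum]
  refine Finset.sum_congr rfl fun j _ => ?_
  rw [map_smul, LS, smul_eq_mul, mul_comm]

end Resonances

/-! ### Change of gauge -/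

section Gauge

variable {ω : Fin d → ℝ} {Λ : Fin n → ℂ} {V Φ Ψ : Phase d n → Phase d n} {k h : Phase d n → ℂ}
  {m K : ℕ}

lemma LS_comp_gauge {E : Type*} [NormedAddCommGroup E] [NormedSpace ℂ E] {u : Phase d n → E}
    {w : Phase d n → Phase d n} {Z : Phase d n} (hu : DifferentiableAt ℂ u (Z + w Z))
    (hw : DifferentiableAt ℂ w Z) (hLS : LS ω Λ w Z = linPart Λ (w Z)) :
    LS ω Λ (fun Z => u (Z + w Z)) Z = LS ω Λ u (Z + w Z) := by
  have h3 : HasFDerivAt (fun Z => u (Z + w Z))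
      ((fderiv ℂ u (Z + w Z)).comp (ContinuousLinearMap.id ℂ _ + fderiv ℂ w Z)) Z :=
    hu.hasFDerivAt.comp Z ((hasFDerivAt_id Z).add hw.hasFDerivAt)
  rw [LS] at hLS
  simp only [LS, h3.fderiv, quasilinear_add, ← hLS, ContinuousLinearMap.comp_apply, FunLike.coe_add,
    Pi.add_apply, ContinuousLinearMap.coe_id', id_eq]

lemma FormalConj.gauge (hc : FormalConj ω Λ V K Φ k) {w : Phase d n → Phase d n} (hw : Germ w)
    (hw2 : Ord 2 w) (hLS : ∀ᶠ Z in nT d n, LS ω Λ w Z = linPart Λ (w Z)) :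
    FormalConj ω Λ V K (fun Z => Φ (Z + w Z)) (fun Z => k (Z + w Z)) := by
  have hT := NearId.id_add hw hw2
  refine ⟨hc.near.comp hT, hT.germ_comp hc.germ, ?_, ?_⟩
  · filter_upwards [hT.tendsto.eventually hc.germ.eventually_differentiableAt,
      hT.tendsto.eventually hc.LS_eq, hw.eventually_differentiableAt, hLS] with Z h1 h2 h3 h4
    rw [LS_comp_gauge h1 h3 h4, h2]
    rfl
  · refine (OEq.of_eventuallyEq ?_).trans (Ord.comp_map hc.conj hT.tendsto hT.ord_snd)
    filter_upwards [hT.tendsto.eventually hc.near.eventually_differentiableAt,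
      hw.eventually_differentiableAt, hLS] with Z h1 h3 h4
    exact LS_comp_gauge h1 h3 h4

lemma NearId.oEq_comp (hΦ : NearId Φ) {w : Phase d n → Phase d n} (hw : Ord m w) (hm : 1 ≤ m) :
    OEq m (fun Z => Φ (Z + w Z)) Φ := by
  refine ((hΦ.increment₂ hw hm).mono (by omega)).trans ?_
  have := hΦ.germ_fderiv.clm_ord hw
  refine this.congr (Eventually.of_forall fun Z => ?_)
  simp

/-- The gauge can be chosen so that the displacement has no resonant terms of low order. -/
lemma FormalConj.exists_gauge (hc : FormalConj ω Λ V K Φ k) (hΨ : NearId Ψ)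
    (hm : 2 ≤ m) (hΦΨ : OEq m Φ Ψ) (hκ : Ord m fun Z => (k Z - h Z) • quasilinear ω Λ Z) :
    ∃ Φ' k', FormalConj ω Λ V K Φ' k' ∧ OEq m Φ' Ψ ∧
      (Ord m fun Z => (k' Z - h Z) • quasilinear ω Λ Z) ∧
      ∀ L p, degQ p.2 < 2 * m - 1 → divL ω Λ L p = 0 → coefV (disp Ψ Φ') L p = 0 := by
  classical
  have hug := germ_disp hΨ hc.near
  have huo := ord_disp hΨ hΦΨ
  obtain ⟨w, hwg, hw⟩ := hug.neg.exists_filter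
    fun L p => degQ p.2 < 2 * m - 1 ∧ divL ω Λ L p = 0
  have hwo : Ord m w := by
    rw [hwg.ord_iffV]
    intro L p hp
    rw [hw]
    split_ifs
    · exact (hug.neg.ord_iffV.1 huo.neg) L p hp
    · rfl
  have hLS : ∀ᶠ Z in nT d n, LS ω Λ w Z = linPart Λ (w Z) := by
    have : (fun Z => LS ω Λ w Z - linPart Λ (w Z)) =ᶠ[nT d n] fun _ => 0 := by
      refine eventuallyEq_of_comp fun L => ?_
      have h1 := (hasCoef_lie ω Λ hwg L).eventuallyEq_zero (fun p => by
        rw [hw]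
        split_ifs with h
        · rw [h.2, zero_mul]
        · rw [mul_zero])
      refine h1.trans (Eventually.of_forall fun Z => ?_)
      cases L <;> rfl
    filter_upwards [this] with Z hZ using sub_eq_zero.1 hZ
  have hwo2 := hwo.mono hm
  have hm1 : 1 ≤ m := by omega
  have hc' := hc.gauge hwg hwo2 hLS
  have hΦ'Φ := hc.near.oEq_comp hwo hm1
  refine ⟨_, _, hc', hΦ'Φ.trans hΦΨ, ?_, ?_⟩
  · have h1 : Ord m fun Z => k (Z + w Z) - k Z :=
      Ord.comp_sub hc.germ (Φ := fun Z => Z) tendsto_id hm1 (by simpa using hwo)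
    have h2 := (h1.smul (germ_quasilinear ω Λ).ord_zero).add hκ
    refine h2.congr (Eventually.of_forall fun Z => ?_)
    simp only [sub_smul]
    abel
  · intro L p hp hdiv
    have hN : m - 1 + m = 2 * m - 1 := by omega
    have h1 : OEq (2 * m - 1) (disp Ψ fun Z => Φ (Z + w Z)) (fun Z => disp Ψ Φ Z + w Z) := by
      have e1 := (hc.near.increment₂ hwo hm1).mono (by omega : 2 * m - 1 ≤ 2 * m)
      have e2 : OEq (2 * m - 1) (fun Z => Φ Z + fderiv ℂ Φ Z (w Z))
          (fun Z => Φ Z + fderiv ℂ Ψ Z (w Z)) := by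
        have := (Ord.fderiv (hc.near.germ_sub hΨ) hΦΨ).clm_apply hwo
        rw [hN] at this
        refine this.congr ?_
        filter_upwards [hc.near.eventually_differentiableAt, hΨ.eventually_differentiableAt]
          with Z h1 h2
        rw [fderiv_fun_sub h1 h2]
        simp
      have e3 := OEq.clm_left hΨ.germ_inverse ((e1.trans e2).sub
        (OEq.of_eventuallyEq (EventuallyEq.refl _ Ψ)))
      refine e3.trans (OEq.of_eventuallyEq ?_)
      filter_upwards [hΨ.eventually_isUnit] with Z hZ
      rw [disp, add_sub_right_comm, map_add, inverse_apply_apply hZ]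
    have h2 := ((germ_disp hΨ hc'.near).sub (hug.add hwg)).ord_iffV.1 h1 L p hp
    have h3 : HasCoef (fun Z => comp (disp Ψ (fun Z => Φ (Z + w Z)) Z - (disp Ψ Φ Z + w Z)) L)
        (fun p => coefV (disp Ψ fun Z => Φ (Z + w Z)) L p - (coefV (disp Ψ Φ) L p + coefV w L p)) := by
      refine (((germ_disp hΨ hc'.near).hasCoefV L).sub ((hug.hasCoefV L).add
        (hwg.hasCoefV L))).congr (Eventually.of_forall fun Z => ?_)
      cases L <;> rfl
    have h4 : coefV (fun Z => -disp Ψ Φ Z) L = fun p => -1 * coefV (disp Ψ Φ) L p := by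
      refine HasCoef.coef_eq (((hug.hasCoefV L).const_mul (-1)).congr (Eventually.of_forall fun Z => ?_))
      cases L <;> simp [comp]
    rw [coefV, h3.coef_eq] at h2
    simp only [hw, if_pos (And.intro hp hdiv), h4] at h2
    linear_combination h2

end Gauge

/-! ### The correction step -/

section Step

variable (ω : Fin d → ℝ) (Λ : Fin n → ℂ)

/-- The error pulled back to the source. -/
def pullErr (V Ψ : Phase d n → Phase d n) (h : Phase d n → ℂ) (Z : Phase d n) : Phase d n :=
  Ring.inverse (fderiv ℂ Ψ Z) (err ω Λ V Ψ h Z)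

/-- `V` is formally conjugate to `e^{-k} S` by maps that agree with `Ψ`, where `k` agrees with `h`,
up to order `m`. -/
def Conjugable (V : Phase d n → Phase d n) (m : ℕ) (Ψ : Phase d n → Phase d n)
    (h : Phase d n → ℂ) : Prop :=
  ∀ K, ∃ Φ k, FormalConj ω Λ V K Φ k ∧ OEq m Φ Ψ ∧
    Ord m fun Z => (k Z - h Z) • quasilinear ω Λ Z

/-- The solution of the linearized equation, truncated: `w₀` inverts the bracket with `S` on the
error, `f` corrects it along `S`, and `β` is the correction of `h`. -/
structure Correction (V : Phase d n → Phase d n) (m : ℕ) (Ψ : Phase d n → Phase d n)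
    (h : Phase d n → ℂ) (L₀ : Fin d ⊕ Fin n) (w₀ : Phase d n → Phase d n) (f β : Phase d n → ℂ) :
    Prop where
  germ_w : Germ w₀
  coef_w : ∀ L p, coefV w₀ L p = if degQ p.2 < 2 * m - 1 ∧ divL ω Λ L p ≠ 0 then
    coefV (pullErr ω Λ V Ψ h) L p / divL ω Λ L p else 0
  germ_f : Germ f
  coef_f : ∀ p, coef f p = if degQ p.2 < 2 * m - 1 ∧ div ω Λ p ≠ 0 then
    -coef (fun Z => fderiv ℂ h Z (w₀ Z)) p / div ω Λ p else 0
  germ_β : Germ β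
  coef_β : ∀ p, coef β p = if degQ (addE L₀ p).2 < 2 * m - 1 ∧ div ω Λ p = 0 then
    coef (fun Z => fderiv ℂ h Z (w₀ Z)) p
      - coefV (pullErr ω Λ V Ψ h) L₀ (addE L₀ p) / sCoef ω Λ L₀ else 0

variable {ω Λ} {V Ψ : Phase d n → Phase d n} {h : Phase d n → ℂ} {m : ℕ} {L₀ : Fin d ⊕ Fin n}
  {w₀ : Phase d n → Phase d n} {f β : Phase d n → ℂ}

lemma germ_pullErr (hV : Germ V) (hΨ : NearId Ψ) (hh : Germ h) : Germ (pullErr ω Λ V Ψ h) :=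
  hΨ.germ_inverse.clm_apply (germ_err hV hΨ hh)

lemma Conjugable.ord_err (hP : Conjugable ω Λ V m Ψ h) (hV : Germ V) (hΨ : NearId Ψ)
    (hh : Germ h) (hm : 2 ≤ m) (hL : sCoef ω Λ L₀ ≠ 0) : Ord m (err ω Λ V Ψ h) := by
  obtain ⟨Φ, k, hc, h1, h2⟩ := hP m
  have h3 := ord_of_smul_quasilinear ω Λ (hc.germ.sub hh) hL h2
  exact hc.ord_err hV hΨ hh (by omega) le_rfl h1 h2 (h3.tendsto_zero (by omega))

lemma Conjugable.ord_pullErr (hP : Conjugable ω Λ V m Ψ h) (hV : Germ V) (hΨ : NearId Ψ)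
    (hh : Germ h) (hm : 2 ≤ m) (hL : sCoef ω Λ L₀ ≠ 0) : Ord m (pullErr ω Λ V Ψ h) :=
  hΨ.germ_inverse.clm_ord (hP.ord_err hV hΨ hh hm hL)

namespace Correction

lemma ord_w (hC : Correction ω Λ V m Ψ h L₀ w₀ f β) (hR : Germ (pullErr ω Λ V Ψ h))
    (hRo : Ord m (pullErr ω Λ V Ψ h)) : Ord m w₀ := by
  rw [hC.germ_w.ord_iffV]
  intro L p hp
  rw [hC.coef_w, hR.ord_iffV.1 hRo L p hp]
  simp

lemma ord_f (hC : Correction ω Λ V m Ψ h L₀ w₀ f β) (hh : Germ h) (hw : Ord m w₀) : Ord m f := by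
  rw [hC.germ_f.ord_iff]
  intro p hp
  have hη := (hh.fderiv.clm_apply hC.germ_w).ord_iff.1 (hh.fderiv.clm_ord hw) p hp
  rw [hC.coef_f, hη]
  simp

lemma ord_β (hC : Correction ω Λ V m Ψ h L₀ w₀ f β) (hh : Germ h) (hw : Ord m w₀)
    (hR : Germ (pullErr ω Λ V Ψ h)) (hRo : Ord m (pullErr ω Λ V Ψ h)) : Ord (m - 1) β := by
  rw [hC.germ_β.ord_iff]
  intro p hp
  have hη := (hh.fderiv.clm_apply hC.germ_w).ord_iff.1 (hh.fderiv.clm_ord hw) p (by omega)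
  rw [hC.coef_β, hη, hR.ord_iffV.1 hRo L₀ (addE L₀ p) (by have := degQ_addE_le L₀ p; omega)]
  simp

end Correction

lemma coef_smulS_eq_zero_of_res {κ : Series d n} (hκ : ∀ p, div ω Λ p * κ p = 0)
    {L : Fin d ⊕ Fin n} {p : Idx d n} (hp : divL ω Λ L p ≠ 0) : smulS ω Λ κ L p = 0 := by
  rcases smulS_cases ω Λ L p with ⟨p', rfl⟩ | h0
  · rw [smulS_addE]
    rw [divL_addE] at hp
    rw [(mul_eq_zero.1 (hκ p')).resolve_left hp, mul_zero]
  · exact h0 κ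

/-- A displacement without resonant terms that solves the homogeneous linearized equation is
trivial. -/
lemma ord_of_homogeneous {v : Phase d n → Phase d n} (hv : Germ v) (hh : Germ h) (hh1 : Ord 1 h)
    {N : ℕ} (hv0 : ∀ L p, degQ p.2 < N → divL ω Λ L p = 0 → coefV v L p = 0)
    (hv1 : ∀ L p, degQ p.2 < N → divL ω Λ L p ≠ 0 → divL ω Λ L p * coefV v L p =
      -smulS ω Λ (coef fun Z => fderiv ℂ h Z (v Z)) L p) : Ord N v := by
  have hθ : Germ fun Z => fderiv ℂ h Z (v Z) := hh.fderiv.clm_apply hv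
  have key : ∀ j ≤ N, Ord j v := by
    intro j
    induction j with
    | zero => exact fun _ => hv.ord_zero
    | succ j ih =>
      intro hj
      have hjv := ih (by omega)
      have hY : Ord (j + 1) fun Z => (v Z).2 := by
        refine isBigO_pi.2 fun i => ?_
        refine (hv.hasCoefV (Sum.inr i)).ord fun p hp => ?_
        by_cases hdiv : divL ω Λ (Sum.inr i) p = 0
        · exact hv0 _ p (by omega) hdiv
        · have h1 := hv1 (Sum.inr i) p (by omega) hdiv
          have h2 : smulS ω Λ (coef fun Z => fderiv ℂ h Z (v Z)) (Sum.inr i) p = 0 := by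
            rcases smulS_cases ω Λ (Sum.inr i) p with ⟨p', rfl⟩ | h0
            · rw [smulS_addE, hθ.ord_iff.1 (hh.fderiv.clm_ord hjv) p' ?_, mul_zero]
              simp only [addE, Sum.elim_inr, degQ_add_single] at hp
              omega
            · exact h0 _
          rw [h2, neg_zero] at h1
          exact (mul_eq_zero.1 h1).resolve_left hdiv
      have hθo : Ord (j + 1) fun Z => fderiv ℂ h Z (v Z) := by
        have h1 : Ord (1 + j) fun Z => fderiv ℂ h Z ((v Z).1, 0) := ord_fderiv_fst hh hh1 hjv.fst
        have h2 : Ord (j + 1) fun Z => fderiv ℂ h Z (0, (v Z).2) :=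
          hh.fderiv.clm_ord (Ord.prodMk ord_zero_fun hY)
        rw [add_comm] at h1
        refine (h1.add h2).congr (Eventually.of_forall fun Z => ?_)
        simp only
        rw [← map_add]
        simp
      rw [hv.ord_iffV]
      intro L p hp
      by_cases hdiv : divL ω Λ L p = 0
      · exact hv0 _ p (by omega) hdiv
      · have h1 := hv1 L p (by omega) hdiv
        have h2 : smulS ω Λ (coef fun Z => fderiv ℂ h Z (v Z)) L p = 0 := by
          rcases smulS_cases ω Λ L p with ⟨p', rfl⟩ | h0
          · rw [smulS_addE, hθ.ord_iff.1 hθo p' ((le_degQ_addE L p').trans_lt hp), mul_zero]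
          · exact h0 _
        rw [h2, neg_zero] at h1
        exact (mul_eq_zero.1 h1).resolve_left hdiv
  exact key N le_rfl

lemma ord_smul_quasilinear {γ : Phase d n → ℂ} (hγ : Germ γ) {N : ℕ} (hN : 1 ≤ N)
    (hL : ∀ j, L₀ = Sum.inr j → ω = 0) (h : ∀ p, degQ (addE L₀ p).2 < N → coef γ p = 0) :
    Ord N fun Z => γ Z • quasilinear ω Λ Z := by
  cases L₀ with
  | inl j =>
    have h1 : Ord N γ := hγ.ord_iff.2 fun p hp => h p hp
    simpa using h1.smul (germ_quasilinear ω Λ).ord_zero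
  | inr j =>
    have h1 : Ord (N - 1) γ := hγ.ord_iff.2 fun p hp => h p (by
      simp only [addE, Sum.elim_inr, degQ_add_single]; omega)
    have h2 : Ord 1 (quasilinear ω Λ) := by
      have : Ord 1 fun Z : Phase d n => linPart Λ Z :=
        Ord.prodMk (ord_zero_fun (E := Fin d → ℂ)) (isBigO_pi.2 fun j => by
          have := IsBigO.const_mul_left ((isBigO_pi.1 (ord_snd (d := d) (n := n))) j) (Λ j)
          exact this)
      refine this.congr (Eventually.of_forall fun Z => ?_)
      simp [quasilinear, linPart_apply, hL j rfl]
      rfl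
    have h3 := h1.smul h2
    rwa [Nat.sub_add_cancel hN] at h3

/-- The correction step doubles the order of contact. -/
lemma Conjugable.step (hP : Conjugable ω Λ V m Ψ h) (hV : Germ V) (hΨ : NearId Ψ) (hh : Germ h)
    (hh1 : Ord 1 h) (hhS : LS ω Λ h =ᶠ[nT d n] 0) (hm : 2 ≤ m) (hL : sCoef ω Λ L₀ ≠ 0)
    (hL' : ∀ j, L₀ = Sum.inr j → ω = 0) (hC : Correction ω Λ V m Ψ h L₀ w₀ f β) :
    Conjugable ω Λ V (2 * m - 1)
      (fun Z => Ψ Z + fderiv ℂ Ψ Z (w₀ Z + f Z • quasilinear ω Λ Z)) (fun Z => h Z + β Z) := by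
  intro K
  set N := 2 * m - 1 with hN
  set S := quasilinear ω Λ with hS
  have hSg : Germ S := germ_quasilinear ω Λ
  obtain ⟨Φ₀, k₀, hc₀, hΦ₀, hκ₀⟩ := hP (max K N)
  obtain ⟨Φ, k, hc, hΦ, hκ, hres⟩ := hc₀.exists_gauge hΨ hm hΦ₀ hκ₀
  have hκg : Germ fun Z => k Z - h Z := hc.germ.sub hh
  have hlin := hc.linearized hV hΨ hh hm (le_max_right _ _) hΦ hκ
    (ord_of_smul_quasilinear ω Λ hκg hL hκ)
  set u := disp Ψ Φ with hu
  have hug : Germ u := germ_disp hΨ hc.near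
  have hRg : Germ (pullErr ω Λ V Ψ h) := germ_pullErr hV hΨ hh
  have hθug : Germ fun Z => fderiv ℂ h Z (u Z) := hh.fderiv.clm_apply hug
  have hηg : Germ fun Z => fderiv ℂ h Z (w₀ Z) := hh.fderiv.clm_apply hC.germ_w
  set θu := coef fun Z => fderiv ℂ h Z (u Z) with hθu
  set η := coef fun Z => fderiv ℂ h Z (w₀ Z) with hη
  set κ := coef fun Z => k Z - h Z with hκdef
  -- the linearized equation on coefficients
  have heq : ∀ L p, degQ p.2 < N → divL ω Λ L p * coefV u L p
      - smulS ω Λ (fun p => κ p - θu p) L p = coefV (pullErr ω Λ V Ψ h) L p := by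
    intro L p hp
    have h1 := ((hasCoef_lie ω Λ hug L).sub (hasCoef_smulS ω Λ
      (hκg.hasCoef.sub hθug.hasCoef) L)).sub (hRg.hasCoefV L)
    have h2 := h1.hasOrder (k := N) ((Ord.comp_of hlin L).congr (Eventually.of_forall fun Z => by
      cases L <;> rfl)) p hp
    exact sub_eq_zero.1 h2
  have hκres : ∀ p, div ω Λ p * κ p = 0 := by
    refine coef_mul_div_eq_zero ω Λ hκg ?_
    filter_upwards [hc.germ.eventually_differentiableAt, hh.eventually_differentiableAt, hc.LS_eq,
      hhS] with Z h1 h2 h3 h4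
    rw [LS_sub ω Λ h1 h2, h3, h4]
    exact sub_self _
  have hsub : ∀ (a b : Series d n) L p, smulS ω Λ (fun p => a p - b p) L p =
      smulS ω Λ a L p - smulS ω Λ b L p := by
    intro a b L p
    rcases smulS_cases ω Λ L p with ⟨p', rfl⟩ | h0
    · simp only [smulS_addE, mul_sub]
    · simp only [h0, sub_zero]
  set w : Phase d n → Phase d n := fun Z => w₀ Z + f Z • S Z with hw
  have hwg : Germ w := hC.germ_w.add (hC.germ_f.smul hSg)
  have hwcoef : ∀ L p, coefV w L p = coefV w₀ L p + smulS ω Λ (coef f) L p := by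
    intro L p
    refine congrFun (HasCoef.coef_eq (((hC.germ_w.hasCoefV L).add
      (hasCoef_smulS ω Λ hC.germ_f.hasCoef L)).congr (Eventually.of_forall fun Z => ?_))) p
    cases L <;> rfl
  set v : Phase d n → Phase d n := fun Z => u Z - w Z with hv
  have hvg : Germ v := hug.sub hwg
  have hvcoef : ∀ L p, coefV v L p = coefV u L p - coefV w L p := by
    intro L p
    refine congrFun (HasCoef.coef_eq (((hug.hasCoefV L).sub (hwg.hasCoefV L)).congr
      (Eventually.of_forall fun Z => ?_))) p
    cases L <;> rfl
  have hθvg : Germ fun Z => fderiv ℂ h Z (v Z) := hh.fderiv.clm_apply hvg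
  have hθv : ∀ p, θu p = η p + coef (fun Z => fderiv ℂ h Z (v Z)) p := by
    intro p
    refine congrFun (HasCoef.coef_eq ((hηg.hasCoef.add hθvg.hasCoef).congr ?_)) p
    filter_upwards [hhS] with Z hZ
    have hZ' : fderiv ℂ h Z (S Z) = 0 := hZ
    simp only [hv, hw, map_sub, map_add, map_smul, hZ', smul_zero, add_zero]
    ring
  have hvN : Ord N v := by
    refine ord_of_homogeneous (ω := ω) (Λ := Λ) hvg hh hh1 (fun L p hp hdiv => ?_) (fun L p hp hdiv => ?_)
    · rw [hvcoef, hwcoef, hres L p hp hdiv, hC.coef_w, if_neg (by simp [hdiv])]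
      rcases smulS_cases ω Λ L p with ⟨p', rfl⟩ | h0
      · rw [divL_addE] at hdiv
        rw [smulS_addE, hC.coef_f, if_neg (by simp [hdiv])]
        simp
      · rw [h0]
        simp
    · have h1 := heq L p hp
      rw [hsub, coef_smulS_eq_zero_of_res hκres hdiv] at h1
      rw [hvcoef, hwcoef, hC.coef_w, if_pos ⟨hp, hdiv⟩, mul_sub, mul_add, mul_div_cancel₀ _ hdiv]
      rcases smulS_cases ω Λ L p with ⟨p', rfl⟩ | h0
      · have hp' : degQ p'.2 < N := (le_degQ_addE L p').trans_lt hp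
        simp only [smulS_addE, hθv] at h1 ⊢
        rw [divL_addE] at hdiv h1 ⊢
        rw [hC.coef_f, if_pos ⟨hp', hdiv⟩]
        have h3 : div ω Λ p' * (sCoef ω Λ L * (-η p' / div ω Λ p')) = -(sCoef ω Λ L * η p') := by
          field_simp
        rw [h3]
        linear_combination h1
      · simp only [h0] at h1 ⊢
        linear_combination h1
  refine ⟨Φ, k, ⟨hc.near, hc.germ, hc.LS_eq, hc.conj.mono (le_max_left _ _)⟩, ?_, ?_⟩
  · refine (hΨ.germ_fderiv.clm_ord hvN).congr ?_
    filter_upwards [fderiv_disp (Φ := Φ) hΨ] with Z hZ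
    simp only [hv, map_sub, hu]
    rw [hZ]
    abel
  · have hγg : Germ fun Z => k Z - (h Z + β Z) := hc.germ.sub (hh.add hC.germ_β)
    refine ord_smul_quasilinear (L₀ := L₀) hγg (by omega) hL' fun p hp => ?_
    have h1 : coef (fun Z => k Z - (h Z + β Z)) p = κ p - coef β p := by
      refine congrFun (HasCoef.coef_eq ((hκg.hasCoef.sub hC.germ_β.hasCoef).congr
        (Eventually.of_forall fun Z => ?_))) p
      simp only
      ring
    rw [h1, hC.coef_β]
    by_cases hdiv : div ω Λ p = 0
    · rw [if_pos ⟨hp, hdiv⟩]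
      have h2 := heq L₀ (addE L₀ p) hp
      have hvp : coef (fun Z => fderiv ℂ h Z (v Z)) p = 0 :=
        hθvg.ord_iff.1 (hh.fderiv.clm_ord hvN) p ((le_degQ_addE L₀ p).trans_lt hp)
      rw [divL_addE, hdiv, zero_mul, smulS_addE, hθv, hvp, add_zero] at h2
      rw [← h2]
      field_simp
      ring
    · rw [if_neg (by simp [hdiv]), sub_zero]
      exact (mul_eq_zero.1 (hκres p)).resolve_left hdiv

end Step

/-! ### Norms adapted to the domains -/

/-- The norm on vectors for which `Y` is measured in the unit `δ`. -/
def gn (δ : ℝ) (v : Phase d n) : ℝ := max ‖v.1‖ (‖v.2‖ / δ)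

/-- The unit in which a component is measured. -/
def wt (δ : ℝ) (L : Fin d ⊕ Fin n) : ℝ := Sum.elim (fun _ => 1) (fun _ => δ) L

lemma wt_pos {δ : ℝ} (hδ : 0 < δ) (L : Fin d ⊕ Fin n) : 0 < wt δ L := by
  cases L <;> simp [wt, hδ]

lemma gn_nonneg (δ : ℝ) (v : Phase d n) : 0 ≤ gn δ v := (norm_nonneg _).trans (le_max_left _ _)

lemma gn_le_iff {δ c : ℝ} (hδ : 0 < δ) {v : Phase d n} :
    gn δ v ≤ c ↔ ‖v.1‖ ≤ c ∧ ‖v.2‖ ≤ c * δ := by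
  rw [gn, max_le_iff, div_le_iff₀ hδ]

lemma gn_le_iff_comp {δ c : ℝ} (hδ : 0 < δ) (hc : 0 ≤ c) {v : Phase d n} :
    gn δ v ≤ c ↔ ∀ L, ‖comp v L‖ ≤ c * wt δ L := by
  rw [gn_le_iff hδ, pi_norm_le_iff_of_nonneg hc, pi_norm_le_iff_of_nonneg (by positivity)]
  simp [Sum.forall, comp, wt]

lemma gn_add_le {δ : ℝ} (hδ : 0 < δ) (v w : Phase d n) : gn δ (v + w) ≤ gn δ v + gn δ w := by
  have h1 := (gn_le_iff hδ).1 (le_refl (gn δ v))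
  have h2 := (gn_le_iff hδ).1 (le_refl (gn δ w))
  rw [gn_le_iff hδ]
  refine ⟨(norm_add_le _ _).trans (add_le_add h1.1 h2.1), (norm_add_le _ _).trans ?_⟩
  rw [add_mul]
  exact add_le_add h1.2 h2.2

lemma gn_neg (δ : ℝ) (v : Phase d n) : gn δ (-v) = gn δ v := by simp [gn]

lemma gn_sub_le {δ : ℝ} (hδ : 0 < δ) (v w : Phase d n) : gn δ (v - w) ≤ gn δ v + gn δ w := by
  rw [sub_eq_add_neg, ← gn_neg δ w]
  exact gn_add_le hδ v (-w)

lemma gn_smul (δ : ℝ) (c : ℂ) (v : Phase d n) : gn δ (c • v) = ‖c‖ * gn δ v := by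
  simp only [gn, Prod.smul_fst, Prod.smul_snd, norm_smul, mul_div_assoc]
  rw [mul_max_of_nonneg _ _ (norm_nonneg c)]

lemma gn_anti {δ δ' : ℝ} (h0 : 0 < δ') (h : δ' ≤ δ) (v : Phase d n) : gn δ v ≤ gn δ' v :=
  max_le_max le_rfl (by gcongr)

lemma gn_le_mul {δ δ' c : ℝ} (h0 : 0 < δ') (h : δ ≤ c * δ') (hc : 1 ≤ c) (hδ : 0 < δ)
    (v : Phase d n) : gn δ' v ≤ c * gn δ v := by
  have h1 := (gn_le_iff hδ).1 (le_refl (gn δ v))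
  have h2 := gn_nonneg δ v
  rw [gn_le_iff h0]
  refine ⟨h1.1.trans (le_mul_of_one_le_left h2 hc), h1.2.trans ?_⟩
  calc gn δ v * δ ≤ gn δ v * (c * δ') := by gcongr
    _ = c * gn δ v * δ' := by ring

lemma eq_zero_of_gn_le {δ : ℝ} (hδ : 0 < δ) {v : Phase d n} (h : gn δ v ≤ 0) : v = 0 := by
  rw [gn_le_iff hδ, zero_mul] at h
  exact Prod.ext (norm_le_zero_iff.1 h.1) (norm_le_zero_iff.1 h.2)

lemma norm_le_gn {δ : ℝ} (hδ : 0 < δ) (v : Phase d n) : ‖v‖ ≤ gn δ v * (1 + δ) := by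
  have h1 := (gn_le_iff hδ).1 (le_refl (gn δ v))
  have h2 := gn_nonneg δ v
  refine max_le (h1.1.trans ?_) (h1.2.trans ?_) <;> nlinarith

/-! ### Cauchy estimates -/

/-- Bound of the derivative in adapted norms, at all smaller scales. -/
def DBound (r δ b : ℝ) (u : Phase d n → Phase d n) : Prop :=
  ∀ δ', 0 < δ' → δ' ≤ δ → ∀ Z ∈ domain d n r δ', ∀ v, gn δ' (fderiv ℂ u Z v) ≤ b * gn δ' v

/-- Bound of the derivative of a function in adapted norms, at all smaller scales. -/
def SBound (r δ b : ℝ) (u : Phase d n → ℂ) : Prop :=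
  ∀ δ', 0 < δ' → δ' ≤ δ → ∀ Z ∈ domain d n r δ', ∀ v, ‖fderiv ℂ u Z v‖ ≤ b * gn δ' v

lemma DBound.mono {r δ b r' δ' b' : ℝ} {u : Phase d n → Phase d n} (h : DBound r δ b u)
    (hr : r' ≤ r) (hδ : δ' ≤ δ) (hb : b ≤ b') : DBound r' δ' b' u :=
  fun s h0 h1 Z hZ v => (h s h0 (h1.trans hδ) Z (domain_mono hr le_rfl hZ) v).trans
    (mul_le_mul_of_nonneg_right hb (gn_nonneg _ _))

lemma SBound.mono {r δ b r' δ' b' : ℝ} {u : Phase d n → ℂ} (h : SBound r δ b u)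
    (hr : r' ≤ r) (hδ : δ' ≤ δ) (hb : b ≤ b') : SBound r' δ' b' u :=
  fun s h0 h1 Z hZ v => (h s h0 (h1.trans hδ) Z (domain_mono hr le_rfl hZ) v).trans
    (mul_le_mul_of_nonneg_right hb (gn_nonneg _ _))

lemma add_smul_mem_domain {r δ κ : ℝ} (hδ : 0 < δ) {Z v : Phase d n}
    (hZ : Z ∈ domain d n (r - κ) ((1 - κ) * δ)) {t : ℂ} (ht : ‖t‖ * gn δ v ≤ κ) :
    Z + t • v ∈ domain d n r δ := by
  have hv := (gn_le_iff hδ).1 (le_refl (gn δ v))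
  refine ⟨fun j => ?_, fun j => ?_⟩
  · have h1 : |(t * v.1 j).im| ≤ κ := by
      refine (Complex.abs_im_le_norm _).trans ?_
      rw [norm_mul]
      calc ‖t‖ * ‖v.1 j‖ ≤ ‖t‖ * gn δ v := by
            gcongr
            exact (norm_le_pi_norm _ j).trans hv.1
        _ ≤ κ := ht
    have h2 := hZ.1 j
    have h3 : ((Z + t • v).1 j).im = (Z.1 j).im + (t * v.1 j).im := by simp
    rw [h3]
    linarith [abs_add_le (Z.1 j).im (t * v.1 j).im]
  · have h1 : ‖t * v.2 j‖ ≤ κ * δ := by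
      rw [norm_mul]
      calc ‖t‖ * ‖v.2 j‖ ≤ ‖t‖ * (gn δ v * δ) := by
            gcongr
            exact (norm_le_pi_norm _ j).trans hv.2
        _ = (‖t‖ * gn δ v) * δ := by ring
        _ ≤ κ * δ := by gcongr
    have h2 := hZ.2 j
    have h3 : (Z + t • v).2 j = Z.2 j + t * v.2 j := by simp
    rw [h3]
    linarith [norm_add_le (Z.2 j) (t * v.2 j)]

lemma norm_fderiv_apply_le_gn {r δ κ M : ℝ} (hδ : 0 < δ) (hκ : 0 < κ) {g : Phase d n → ℂ}
    (hg : DifferentiableOn ℂ g (domain d n r δ)) (hM : ∀ Z ∈ domain d n r δ, ‖g Z‖ ≤ M)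
    {Z : Phase d n} (hZ : Z ∈ domain d n (r - κ) ((1 - κ) * δ)) (v : Phase d n) :
    ‖fderiv ℂ g Z v‖ ≤ 2 * M / κ * gn δ v := by
  rcases (gn_nonneg δ v).eq_or_lt with h0 | hpos
  · rw [eq_zero_of_gn_le hδ h0.ge]
    simp [gn]
  have hmem : ∀ t ∈ Metric.ball (0 : ℂ) (κ / gn δ v), Z + t • v ∈ domain d n r δ := by
    intro t ht
    refine add_smul_mem_domain hδ hZ ?_
    rw [mem_ball_zero_iff, lt_div_iff₀ hpos] at ht
    exact ht.le
  have hline : ∀ t : ℂ, HasFDerivAt (fun t : ℂ => Z + t • v)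
      ((ContinuousLinearMap.id ℂ ℂ).smulRight v) t := fun t =>
    ((hasFDerivAt_id t).smul_const v).const_add Z
  have h1 : DifferentiableOn ℂ (fun t : ℂ => g (Z + t • v)) (Metric.ball 0 (κ / gn δ v)) :=
    hg.comp (fun t _ => (hline t).differentiableAt.differentiableWithinAt) hmem
  have h2 := norm_fderiv_le_of_norm_le_ball (div_pos hκ hpos) h1 fun t ht => hM _ (hmem t ht)
  have hZ' : Z ∈ domain d n r δ := by
    simpa using hmem 0 (Metric.mem_ball_self (div_pos hκ hpos))
  have h3 : HasFDerivAt (fun t : ℂ => g (Z + t • v))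
      ((fderiv ℂ g Z).comp ((ContinuousLinearMap.id ℂ ℂ).smulRight v)) 0 := by
    have hd : HasFDerivAt g (fderiv ℂ g Z) (Z + (0 : ℂ) • v) := by
      rw [zero_smul, add_zero]
      exact (hg.differentiableAt ((isOpen_domain r δ).mem_nhds hZ')).hasFDerivAt
    exact hd.comp 0 (hline 0)
  rw [h3.fderiv] at h2
  have h4 := ((fderiv ℂ g Z).comp ((ContinuousLinearMap.id ℂ ℂ).smulRight v)).le_opNorm 1
  simp only [ContinuousLinearMap.comp_apply, ContinuousLinearMap.smulRight_apply,
    ContinuousLinearMap.coe_id', id_eq, one_smul, norm_one, mul_one] at h4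
  refine (h4.trans h2).trans (le_of_eq ?_)
  field_simp

lemma Majorized.shrink {r δ C σ : ℝ} {f : Series d n} {m : ℕ} (hf : Majorized r δ C f)
    (hδ : 0 < δ) (hm : HasOrder m f) (h0 : 0 < σ) (h1 : σ ≤ 1) :
    Majorized r (σ * δ) (C * σ ^ m) f := fun p => by
  by_cases hp : degQ p.2 < m
  · rw [hm p hp]
    have := hf.nonneg hδ
    simp only [norm_zero, zero_mul]
    positivity
  · push Not at hp
    have h2 : σ ^ degQ p.2 ≤ σ ^ m := pow_le_pow_of_le_one h0.le h1 hp
    calc ‖f p‖ * Real.exp (r * absP p.1) * (σ * δ) ^ degQ p.2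
        = (‖f p‖ * Real.exp (r * absP p.1) * δ ^ degQ p.2) * σ ^ degQ p.2 := by rw [mul_pow]; ring
      _ ≤ C * σ ^ m := mul_le_mul (hf p) h2 (by positivity) (hf.nonneg hδ)

/-- The series of a bounded function, with the bounds of its coefficients. -/
lemma Holo.majorized_coef {r δ C : ℝ} (hr : 0 < r) (hδ : 0 < δ) {u : Phase d n → ℂ}
    (hu : Holo r δ u) (hC : ∀ Z ∈ domain d n r δ, ‖u Z‖ ≤ C) :
    Majorized r δ C (coef u) ∧ ∀ Z ∈ domain d n r δ, eval (coef u) Z = u Z := by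
  obtain ⟨f, hf, h⟩ := hu.exists_series hr hδ hC
  rw [(Holo.hasCoef hr hδ hf h).coef_eq]
  exact ⟨hf, h⟩

lemma Holo.norm_le_of_ord {r δ C κ σ : ℝ} {m : ℕ} (hr : 0 < r) (hδ : 0 < δ) {u : Phase d n → ℂ}
    (hu : Holo r δ u) (hC : ∀ Z ∈ domain d n r δ, ‖u Z‖ ≤ C) (hm : Ord m u) (h0 : 0 < κ)
    (h1 : κ ≤ 1) (hσ0 : 0 < σ) (hσ1 : σ ≤ 1) {Z : Phase d n}
    (hZ : Z ∈ domain d n (r - κ) ((1 - κ) * (σ * δ))) :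
    ‖u Z‖ ≤ C * σ ^ m * (4 / κ) ^ (d + n) := by
  obtain ⟨hf, h⟩ := hu.majorized_coef hr hδ hC
  have hg := ((hu.germ hr hδ).ord_iff).1 hm
  have hZ' : Z ∈ domain d n r δ := by
    refine domain_mono (by linarith) ?_ hZ
    calc (1 - κ) * (σ * δ) ≤ 1 * (1 * δ) := by
          gcongr
          linarith
      _ = δ := by ring
  rw [← h Z hZ']
  exact (hf.shrink hδ hg hσ0 hσ1).norm_eval_le (by positivity) h0 h1 hZ

lemma Holo.eq_zero_of_snd {r δ : ℝ} (hr : 0 < r) (hδ : 0 < δ) {u : Phase d n → ℂ}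
    (hu : Holo r δ u) (ho : Ord 1 u) {Z : Phase d n} (hZ : Z ∈ domain d n r δ) (h0 : Z.2 = 0) :
    u Z = 0 := by
  obtain ⟨r', δ', hr'0, hr', hδ'0, hδ', hZ'⟩ := exists_mem_domain_inter hr hδ hZ
  obtain ⟨C, hC⟩ := hu.exists_bound hr' hδ'
  have hu' := hu.mono hr'.le hδ'.le
  obtain ⟨-, h⟩ := hu'.majorized_coef hr'0 hδ'0 hC
  have hord := ((hu'.germ hr'0 hδ'0).ord_iff).1 ho
  rw [← h Z hZ', eval]
  refine (tsum_congr fun p => ?_).trans tsum_zero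
  by_cases hp : degQ p.2 = 0
  · rw [hord p (by omega), zero_mul]
  · have : ∃ j, p.2 j ≠ 0 := by
      by_contra! hall
      exact hp (by simp [degQ, hall])
    obtain ⟨j, hj⟩ := this
    have : ∏ i, Z.2 i ^ p.2 i = 0 := Finset.prod_eq_zero (Finset.mem_univ j) (by simp [h0, hj])
    rw [TorusNF.mono, this, mul_zero, mul_zero]

lemma fderiv_comp_apply {u : Phase d n → Phase d n} {Z : Phase d n} (hu : DifferentiableAt ℂ u Z)
    (L : Fin d ⊕ Fin n) (v : Phase d n) :
    comp (fderiv ℂ u Z v) L = fderiv ℂ (fun W => comp (u W) L) Z v := by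
  have h : HasFDerivAt (fun W => comp (u W) L) ((compCLM L).comp (fderiv ℂ u Z)) Z := by
    have := (compCLM L).hasFDerivAt.comp Z hu.hasFDerivAt
    simpa only [Function.comp_def, compCLM_apply] using this
  rw [h.fderiv, ContinuousLinearMap.comp_apply, compCLM_apply]

lemma Holo.comp_of {r δ : ℝ} {u : Phase d n → Phase d n} (hu : Holo r δ u) (L : Fin d ⊕ Fin n) :
    Holo r δ fun Z => comp (u Z) L := by
  have := hu.comp₁ (compCLM L).differentiable
  simpa only [compCLM_apply] using this

lemma exists_scale {δ δ'' κ : ℝ} (h1 : κ ≤ 1 / 2) (hδ : 0 < δ) (h0 : 0 < δ'')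
    (h : δ'' ≤ (1 - κ) * ((1 - κ) * δ)) :
    ∃ σ, 0 < σ ∧ σ ≤ 1 ∧ δ'' = (1 - κ) * ((1 - κ) * (σ * δ)) := by
  have hk : 0 < 1 - κ := by linarith
  refine ⟨δ'' / ((1 - κ) * ((1 - κ) * δ)), by positivity, (div_le_one (by positivity)).2 h, ?_⟩
  field_simp

/-- Derivative bounds for a small scalar increment. -/
lemma Holo.sBound {r δ M κ : ℝ} (hr : 0 < r) (hδ : 0 < δ) {g : Phase d n → ℂ} (hg : Holo r δ g)
    (ho : Ord 1 g) (hM : ∀ Z ∈ domain d n r δ, ‖g Z‖ ≤ M) (hκ : 0 < κ) (hκ1 : κ ≤ 1 / 2) :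
    SBound (r - 2 * κ) ((1 - κ) * ((1 - κ) * δ)) (8 * M * (4 / κ) ^ (d + n) / κ) g := by
  intro δ'' h0 hle Z hZ v
  obtain ⟨σ, hσ0, hσ1, rfl⟩ := exists_scale hκ1 hδ h0 hle
  have hk : 0 < 1 - κ := by linarith
  have hM0 : 0 ≤ M := (norm_nonneg _).trans (hM 0 ⟨fun j => by simpa using hr, fun j => by simpa using hδ⟩)
  have hsub : domain d n (r - κ) ((1 - κ) * (σ * δ)) ⊆ domain d n r δ := by
    refine domain_mono (by linarith) ?_
    calc (1 - κ) * (σ * δ) ≤ 1 * (1 * δ) := by gcongr; linarith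
      _ = δ := by ring
  have h1 := norm_fderiv_apply_le_gn (r := r - κ) (δ := (1 - κ) * (σ * δ)) (by positivity) hκ
    (hg.1.mono hsub) (M := M * (4 / κ) ^ (d + n)) (fun W hW => by
      refine (hg.norm_le_of_ord hr hδ hM ho hκ (by linarith) hσ0 hσ1 hW).trans ?_
      have : M * σ ^ 1 ≤ M := by rw [pow_one]; exact mul_le_of_le_one_right hM0 hσ1
      gcongr) (Z := Z) (domain_mono (by linarith) le_rfl hZ) v
  refine h1.trans ?_
  have h2 := gn_anti (δ := (1 - κ) * (σ * δ)) h0 (by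
    have : 0 < (1 - κ) * (σ * δ) := by positivity
    nlinarith) v
  have h3 : 2 * (M * (4 / κ) ^ (d + n)) / κ ≤ 8 * M * (4 / κ) ^ (d + n) / κ := by
    refine div_le_div_of_nonneg_right ?_ hκ.le
    have : 0 ≤ M * (4 / κ) ^ (d + n) := by positivity
    linarith
  exact mul_le_mul h3 h2 (gn_nonneg _ _) (by positivity)

/-- Derivative bounds for a small increment. -/
lemma Holo.dBound {r δ M κ : ℝ} (hr : 0 < r) (hδ : 0 < δ) {g : Phase d n → Phase d n}
    (hg : Holo r δ g) (ho : Ord 1 g) (hM : ∀ Z ∈ domain d n r δ, gn δ (g Z) ≤ M) (hκ : 0 < κ)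
    (hκ1 : κ ≤ 1 / 2) :
    DBound (r - 2 * κ) ((1 - κ) * ((1 - κ) * δ)) (8 * M * (4 / κ) ^ (d + n) / κ) g := by
  intro δ'' h0 hle Z hZ v
  obtain ⟨σ, hσ0, hσ1, rfl⟩ := exists_scale hκ1 hδ h0 hle
  have hk : 0 < 1 - κ := by linarith
  have hM0 : 0 ≤ M := (gn_nonneg _ _).trans (hM 0 ⟨fun j => by simpa using hr, fun j => by simpa using hδ⟩)
  have hsub : domain d n (r - κ) ((1 - κ) * (σ * δ)) ⊆ domain d n r δ := by
    refine domain_mono (by linarith) ?_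
    calc (1 - κ) * (σ * δ) ≤ 1 * (1 * δ) := by gcongr; linarith
      _ = δ := by ring
  have hZ' : Z ∈ domain d n r δ := by
    refine hsub (domain_mono (by linarith) ?_ hZ)
    have : 0 < (1 - κ) * (σ * δ) := by positivity
    nlinarith
  rw [gn_le_iff_comp h0 (mul_nonneg (by positivity) (gn_nonneg _ _))]
  intro L
  rw [fderiv_comp_apply (hg.1.differentiableAt ((isOpen_domain r δ).mem_nhds hZ'))]
  have h1 := norm_fderiv_apply_le_gn (r := r - κ) (δ := (1 - κ) * (σ * δ)) (by positivity) hκ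
    ((hg.comp_of L).1.mono hsub) (M := M * wt δ L * σ * (4 / κ) ^ (d + n)) (fun W hW => by
      have := (hg.comp_of L).norm_le_of_ord hr hδ (C := M * wt δ L)
        (fun Z hZ => (gn_le_iff_comp hδ hM0).1 (hM Z hZ) L) (ho.comp_of L) hκ (by linarith) hσ0 hσ1 hW
      rwa [pow_one] at this) (Z := Z) (domain_mono (by linarith) le_rfl hZ) v
  refine h1.trans ?_
  have h2 := gn_anti (δ := (1 - κ) * (σ * δ)) h0 (by
    have : 0 < (1 - κ) * (σ * δ) := by positivity
    nlinarith) v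
  have hwt : wt δ L * σ ≤ 4 * wt ((1 - κ) * ((1 - κ) * (σ * δ))) L := by
    cases L with
    | inl j => simp only [wt, Sum.elim_inl]; linarith
    | inr j =>
      simp only [wt, Sum.elim_inr]
      have : 0 < σ * δ := by positivity
      have h4 : 1 ≤ 4 * ((1 - κ) * (1 - κ)) := by nlinarith
      nlinarith
  have hA : 0 ≤ 2 * M * (4 / κ) ^ (d + n) / κ := by positivity
  calc 2 * (M * wt δ L * σ * (4 / κ) ^ (d + n)) / κ * gn ((1 - κ) * (σ * δ)) v
      = (2 * M * (4 / κ) ^ (d + n) / κ) * (wt δ L * σ) * gn ((1 - κ) * (σ * δ)) v := by ring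
    _ ≤ (2 * M * (4 / κ) ^ (d + n) / κ) * (4 * wt ((1 - κ) * ((1 - κ) * (σ * δ))) L) *
        gn ((1 - κ) * ((1 - κ) * (σ * δ))) v := by
        refine mul_le_mul (mul_le_mul_of_nonneg_left hwt hA) h2 (gn_nonneg _ _) ?_
        have := wt_pos h0 L
        positivity
    _ = _ := by ring

/-! ### Mean value estimates -/

lemma convex_domain (r δ : ℝ) : Convex ℝ (domain d n r δ) := by
  intro Z hZ W hW a b ha hb hab
  refine ⟨fun j => ?_, fun j => ?_⟩
  · have h1 := hZ.1 j
    have h2 := hW.1 j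
    have h3 : ((a • Z + b • W).1 j).im = a * (Z.1 j).im + b * (W.1 j).im := by simp
    rw [h3]
    calc |a * (Z.1 j).im + b * (W.1 j).im| ≤ a * |(Z.1 j).im| + b * |(W.1 j).im| := by
          refine (abs_add_le _ _).trans ?_
          rw [abs_mul, abs_mul, abs_of_nonneg ha, abs_of_nonneg hb]
      _ < r := by
          rcases ha.eq_or_lt with rfl | ha'
          · have : b = 1 := by linarith
            subst this
            linarith
          · have e1 := mul_lt_mul_of_pos_left h1 ha'
            have e2 := mul_le_mul_of_nonneg_left h2.le hb
            have e3 : a * r + b * r = r := by rw [← add_mul, hab, one_mul]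
            linarith
  · have h1 := hZ.2 j
    have h2 := hW.2 j
    have h3 : (a • Z + b • W).2 j = a • Z.2 j + b • W.2 j := by simp
    rw [h3]
    calc ‖a • Z.2 j + b • W.2 j‖ ≤ a * ‖Z.2 j‖ + b * ‖W.2 j‖ := by
          refine (norm_add_le _ _).trans ?_
          rw [norm_smul, norm_smul, Real.norm_of_nonneg ha, Real.norm_of_nonneg hb]
      _ < δ := by
          rcases ha.eq_or_lt with rfl | ha'
          · have : b = 1 := by linarith
            subst this
            linarith
          · have e1 := mul_lt_mul_of_pos_left h1 ha'
            have e2 := mul_le_mul_of_nonneg_left h2.le hb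
            have e3 : a * δ + b * δ = δ := by rw [← add_mul, hab, one_mul]
            linarith

lemma norm_sub_le_of_fderiv {r δ C : ℝ} {g : Phase d n → ℂ}
    (hg : DifferentiableOn ℂ g (domain d n r δ)) {Z W : Phase d n} (hZ : Z ∈ domain d n r δ)
    (hW : W ∈ domain d n r δ) (hC : ∀ U ∈ domain d n r δ, ‖fderiv ℂ g U (W - Z)‖ ≤ C) :
    ‖g W - g Z‖ ≤ C := by
  have hmem : ∀ t ∈ Icc (0 : ℝ) 1, Z + t • (W - Z) ∈ domain d n r δ := by
    intro t ht
    have := convex_domain r δ hZ hW (sub_nonneg.2 ht.2) ht.1 (by ring)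
    convert this using 1
    module
  have hd : ∀ t ∈ Icc (0 : ℝ) 1, HasDerivWithinAt (fun t : ℝ => g (Z + t • (W - Z)))
      (fderiv ℂ g (Z + t • (W - Z)) (W - Z)) (Icc 0 1) t := by
    intro t ht
    have h1 : HasFDerivAt g ((fderiv ℂ g (Z + t • (W - Z))).restrictScalars ℝ) (Z + t • (W - Z)) :=
      (hg.differentiableAt ((isOpen_domain r δ).mem_nhds (hmem t ht))).hasFDerivAt.restrictScalars ℝ
    have h2 : HasDerivAt (fun t : ℝ => Z + t • (W - Z)) (W - Z) t := by
      simpa using ((hasDerivAt_id t).smul_const (W - Z)).const_add Z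
    exact (h1.comp_hasDerivAt t h2).hasDerivWithinAt
  have := norm_image_sub_le_of_norm_deriv_le_segment_01' hd fun t ht => hC _ (hmem t (Ico_subset_Icc_self ht))
  simpa using this

lemma DBound.gn_sub_le {r δ b δ' : ℝ} {u : Phase d n → Phase d n} (h : DBound r δ b u)
    (hb : 0 ≤ b) (hu : DifferentiableOn ℂ u (domain d n r δ)) (h0 : 0 < δ') (h1 : δ' ≤ δ)
    {Z W : Phase d n} (hZ : Z ∈ domain d n r δ') (hW : W ∈ domain d n r δ') :
    gn δ' (u W - u Z) ≤ b * gn δ' (W - Z) := by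
  have hsub : domain d n r δ' ⊆ domain d n r δ := domain_mono le_rfl h1
  have hbg : 0 ≤ b * gn δ' (W - Z) := mul_nonneg hb (gn_nonneg _ _)
  rw [gn_le_iff_comp h0 hbg]
  intro L
  have hd : ∀ U ∈ domain d n r δ', DifferentiableAt ℂ u U := fun U hU =>
    hu.differentiableAt ((isOpen_domain r δ).mem_nhds (hsub hU))
  have hcomp : comp (u W - u Z) L = comp (u W) L - comp (u Z) L := by cases L <;> rfl
  rw [hcomp]
  refine norm_sub_le_of_fderiv (g := fun Z => comp (u Z) L) (fun U hU => ?_) hZ hW fun U hU => ?_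
  · have := ((compCLM L).differentiableAt (x := u U)).comp U (hd U hU)
    simp only [Function.comp_def, compCLM_apply] at this
    exact this.differentiableWithinAt
  · rw [← fderiv_comp_apply (hd U hU)]
    exact (gn_le_iff_comp h0 hbg).1 (h δ' h0 h1 U hU _) L

lemma gn_zero_snd_le {δ : ℝ} (hδ : 0 < δ) {r : ℝ} {Z : Phase d n} (hZ : Z ∈ domain d n r δ) :
    gn δ (Z - (Z.1, 0)) ≤ 1 := by
  rw [gn_le_iff hδ]
  refine ⟨by simp, ?_⟩
  simp only [Prod.snd_sub, sub_zero, one_mul]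
  exact (pi_norm_le_iff_of_nonneg hδ.le).2 fun j => (hZ.2 j).le

lemma fst_mem_domain {r δ : ℝ} (hδ : 0 < δ) {Z : Phase d n} (hZ : Z ∈ domain d n r δ) :
    ((Z.1, 0) : Phase d n) ∈ domain d n r δ := ⟨hZ.1, fun j => by simpa using hδ⟩

lemma DBound.gn_le {r δ b δ' : ℝ} {u : Phase d n → Phase d n} (h : DBound r δ b u) (hr : 0 < r)
    (hb : 0 ≤ b) (hu : Holo r δ u) (ho : Ord 1 u) (h0 : 0 < δ') (h1 : δ' ≤ δ) {Z : Phase d n}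
    (hZ : Z ∈ domain d n r δ') : gn δ' (u Z) ≤ b := by
  have hδ : 0 < δ := h0.trans_le h1
  have hZ0 := fst_mem_domain h0 hZ
  have h2 : u (Z.1, 0) = 0 := by
    have : ∀ L, comp (u (Z.1, 0)) L = 0 := fun L =>
      (hu.comp_of L).eq_zero_of_snd hr hδ (ho.comp_of L) (domain_mono le_rfl h1 hZ0) rfl
    exact Prod.ext (funext fun j => this (Sum.inl j)) (funext fun j => this (Sum.inr j))
  have h3 := h.gn_sub_le hb hu.1 h0 h1 hZ0 hZ
  rw [h2, sub_zero] at h3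
  exact h3.trans (mul_le_of_le_one_right hb (gn_zero_snd_le h0 hZ))

lemma SBound.norm_le {r δ b : ℝ} {u : Phase d n → ℂ} (h : SBound r δ b u) (hr : 0 < r)
    (hb : 0 ≤ b) (hu : Holo r δ u) (ho : Ord 1 u) (h0 : 0 < δ) {Z : Phase d n}
    (hZ : Z ∈ domain d n r δ) : ‖u Z‖ ≤ b := by
  have hZ0 := fst_mem_domain h0 hZ
  have h2 : u (Z.1, 0) = 0 := hu.eq_zero_of_snd hr h0 ho hZ0 rfl
  have h3 := norm_sub_le_of_fderiv hu.1 hZ0 hZ fun U hU => h δ h0 le_rfl U hU _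
  rw [h2, sub_zero] at h3
  exact h3.trans (mul_le_of_le_one_right hb (gn_zero_snd_le h0 hZ))

/-! ### Estimates for the correction step -/

lemma Majorized.mul_exp {r δ C ε G : ℝ} {f g : Series d n} (hf : Majorized r δ C f) (hδ : 0 ≤ δ)
    (hG : 0 ≤ G) (h : ∀ p, ‖g p‖ ≤ ‖f p‖ * (G * Real.exp (ε * absP p.1))) :
    Majorized (r - ε) δ (C * G) g := fun p => by
  calc ‖g p‖ * Real.exp ((r - ε) * absP p.1) * δ ^ degQ p.2
      ≤ (‖f p‖ * (G * Real.exp (ε * absP p.1))) * Real.exp ((r - ε) * absP p.1) * δ ^ degQ p.2 := by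
        gcongr
        exact h p
    _ = (‖f p‖ * Real.exp (r * absP p.1) * δ ^ degQ p.2) * G := by
        have : Real.exp (r * absP p.1) =
            Real.exp (ε * absP p.1) * Real.exp ((r - ε) * absP p.1) := by
          rw [← Real.exp_add]; congr 1; ring
        rw [this]; ring
    _ ≤ C * G := by gcongr; exact hf p

lemma Holo.comp_map {E : Type*} [NormedAddCommGroup E] [NormedSpace ℂ E] {r δ r₀ δ₀ : ℝ}
    {V : Phase d n → E} {Ψ : Phase d n → Phase d n} (hV : Holo r₀ δ₀ V)
    (hΨ : Holo r δ fun Z => Ψ Z - Z) (hm : MapsTo Ψ (domain d n r δ) (domain d n r₀ δ₀)) :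
    Holo r δ fun Z => V (Ψ Z) := by
  refine ⟨hV.1.comp ?_ hm, fun Z hZ P => ?_⟩
  · have : Ψ = fun Z => (Ψ Z - Z) + Z := by funext Z; abel
    rw [this]
    exact hΨ.1.add differentiableOn_id
  · have h1 : Ψ (shift P Z) - shift P Z = Ψ Z - Z := hΨ.2 Z hZ P
    have h2 : Ψ (shift P Z) = shift P (Ψ Z) := by
      rw [sub_eq_iff_eq_add] at h1
      rw [h1, shift_eq_add, shift_eq_add]
      abel
    simp only
    rw [h2, hV.2 _ (hm hZ)]

section Divisors

variable {ω : Fin d → ℝ} {Λ : Fin n → ℂ} {G ε : ℝ} {m : ℕ}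

lemma sum_degQ (Q : Fin n → ℕ) : ∑ i, (Q i : ℤ) = degQ Q := by simp [degQ]

/-- The bounds of small divisors up to order `2 m - 2`. -/
def DivBound (ω : Fin d → ℝ) (Λ : Fin n → ℂ) (m : ℕ) (G ε : ℝ) : Prop :=
  ∀ (P : Fin d → ℤ) (Q : Fin n → ℤ), IsExponent Q → ∑ i, Q i ≤ 2 * (m : ℤ) - 2 →
    divisor ω Λ P Q ≠ 0 → ‖divisor ω Λ P Q‖⁻¹ ≤ G * Real.exp (ε * absP P)

lemma DivBound.div_le (h : DivBound ω Λ m G ε) {p : Idx d n} (hp : degQ p.2 < 2 * m - 1)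
    (hne : div ω Λ p ≠ 0) : ‖div ω Λ p‖⁻¹ ≤ G * Real.exp (ε * absP p.1) := by
  refine h p.1 _ (Or.inl fun i => Int.natCast_nonneg _) ?_ hne
  rw [sum_degQ]
  omega

lemma DivBound.divL_le (h : DivBound ω Λ m G ε) (hm : 2 ≤ m) {L : Fin d ⊕ Fin n} {p : Idx d n}
    (hp' : m ≤ degQ p.2) (hp : degQ p.2 < 2 * m - 1) (hne : divL ω Λ L p ≠ 0) :
    ‖divL ω Λ L p‖⁻¹ ≤ G * Real.exp (ε * absP p.1) := by
  cases L with
  | inl j =>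
    have h0 : divL ω Λ (Sum.inl j) p = div ω Λ p := by simp [divL]
    rw [h0] at hne ⊢
    exact h.div_le hp hne
  | inr j =>
    have h0 : divL ω Λ (Sum.inr j) p =
        divisor ω Λ p.1 fun i => (p.2 i : ℤ) - (Pi.single j 1 : Fin n → ℤ) i := by
      simp only [divL, div, divisor, Sum.elim_inr, Int.cast_sub, sub_mul, Finset.sum_sub_distrib]
      rw [add_sub_assoc]
      congr 2
      rw [Finset.sum_eq_single j]
      · simp
      · intro i _ hi
        simp [hi]
      · simp
    have hsum : ∑ i, ((p.2 i : ℤ) - (Pi.single j 1 : Fin n → ℤ) i) = degQ p.2 - 1 := by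
      rw [Finset.sum_sub_distrib, sum_degQ, Finset.sum_pi_single']
      simp
    rw [h0] at hne ⊢
    refine h p.1 _ ?_ (by rw [hsum]; omega) hne
    by_cases hj : p.2 j = 0
    · refine Or.inr ⟨by rw [hsum]; omega, j, by simp [hj], fun i hi => by simp [hi]⟩
    · refine Or.inl fun i => ?_
      rcases eq_or_ne i j with rfl | hi
      · simp; omega
      · simp [hi]

end Divisors

section Analytic

variable (ω : Fin d → ℝ) (Λ : Fin n → ℂ)

/-- A holomorphic vector field tangent to `Y = 0`, with a bound in adapted norms. -/
structure FieldBound (V : Phase d n → Phase d n) (r δ C : ℝ) : Prop where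
  holo : Holo r δ V
  bound : ∀ δ', 0 < δ' → δ' ≤ δ → ∀ Z ∈ domain d n r δ', gn δ' (V Z) ≤ C

/-- An approximate conjugacy with bounds on a domain. -/
structure BState (V : Phase d n → Phase d n) (r δ b : ℝ) (m : ℕ) (Ψ : Phase d n → Phase d n)
    (h : Phase d n → ℂ) : Prop where
  holo_map : Holo r δ fun Z => Ψ Z - Z
  ord_map : Ord 2 fun Z => Ψ Z - Z
  bound_map : DBound r δ b fun Z => Ψ Z - Z
  holo_fun : Holo r δ h
  ord_fun : Ord 1 h
  bound_fun : SBound r δ b h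
  LS_fun : ∀ Z ∈ domain d n r δ, LS ω Λ h Z = 0
  conj : Conjugable ω Λ V m Ψ h

lemma gn_quasilinear_le {r δ : ℝ} (hδ : 0 < δ) {Z : Phase d n} (hZ : Z ∈ domain d n r δ) :
    gn δ (quasilinear ω Λ Z) ≤ ‖ω‖ + ‖Λ‖ := by
  rw [gn_le_iff_comp hδ (by positivity)]
  rintro (j | j)
  · simp only [comp, quasilinear, Sum.elim_inl, wt, mul_one, Complex.norm_real]
    linarith [norm_le_pi_norm ω j, norm_nonneg Λ]
  · simp only [comp, quasilinear, Sum.elim_inr, wt, norm_mul]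
    have h1 := norm_le_pi_norm Λ j
    have h2 := (hZ.2 j).le
    calc ‖Λ j‖ * ‖Z.2 j‖ ≤ ‖Λ‖ * δ := by gcongr
      _ ≤ (‖ω‖ + ‖Λ‖) * δ := by gcongr; linarith [norm_nonneg ω]

namespace BState

variable {ω Λ} {V Ψ : Phase d n → Phase d n} {h : Phase d n → ℂ} {r δ b r₀ δ₀ CV : ℝ} {m : ℕ}

lemma near (hs : BState ω Λ V r δ b m Ψ h) (hr : 0 < r) (hδ : 0 < δ) : NearId Ψ :=
  ⟨hs.holo_map.germ hr hδ, hs.ord_map⟩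

lemma hasFDerivAt (hs : BState ω Λ V r δ b m Ψ h) {Z : Phase d n} (hZ : Z ∈ domain d n r δ) :
    HasFDerivAt Ψ (ContinuousLinearMap.id ℂ _ + fderiv ℂ (fun Z => Ψ Z - Z) Z) Z := by
  have := (hasFDerivAt_id Z).add
    (hs.holo_map.1.differentiableAt ((isOpen_domain r δ).mem_nhds hZ)).hasFDerivAt
  simpa [Pi.add_def] using this

lemma fderiv_apply (hs : BState ω Λ V r δ b m Ψ h) {Z : Phase d n} (hZ : Z ∈ domain d n r δ)
    (v : Phase d n) : fderiv ℂ Ψ Z v = v + fderiv ℂ (fun Z => Ψ Z - Z) Z v := by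
  rw [(hs.hasFDerivAt hZ).fderiv]
  rfl

lemma gn_fderiv_le (hs : BState ω Λ V r δ b m Ψ h) {δ' : ℝ} (hb : b ≤ 1 / 2) (h0 : 0 < δ')
    (h1 : δ' ≤ δ) {Z : Phase d n} (hZ : Z ∈ domain d n r δ') (v : Phase d n) :
    gn δ' (fderiv ℂ Ψ Z v) ≤ 2 * gn δ' v := by
  rw [hs.fderiv_apply (domain_mono le_rfl h1 hZ)]
  have h2 := hs.bound_map δ' h0 h1 Z hZ v
  have h3 := gn_nonneg δ' v
  refine (gn_add_le h0 _ _).trans ?_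
  nlinarith

lemma gn_le_fderiv (hs : BState ω Λ V r δ b m Ψ h) {δ' : ℝ} (hb : b ≤ 1 / 2) (h0 : 0 < δ')
    (h1 : δ' ≤ δ) {Z : Phase d n} (hZ : Z ∈ domain d n r δ') (v : Phase d n) :
    gn δ' v ≤ 2 * gn δ' (fderiv ℂ Ψ Z v) := by
  have h2 := hs.bound_map δ' h0 h1 Z hZ v
  have h3 := gn_nonneg δ' v
  have h4 := gn_sub_le h0 (fderiv ℂ Ψ Z v) (fderiv ℂ (fun Z => Ψ Z - Z) Z v)
  rw [hs.fderiv_apply (domain_mono le_rfl h1 hZ), add_sub_cancel_right] at h4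
  rw [hs.fderiv_apply (domain_mono le_rfl h1 hZ)]
  nlinarith

lemma isUnit_fderiv (hs : BState ω Λ V r δ b m Ψ h) (hb : b ≤ 1 / 2) (hδ : 0 < δ) {Z : Phase d n}
    (hZ : Z ∈ domain d n r δ) : IsUnit (fderiv ℂ Ψ Z) := by
  rw [ContinuousLinearMap.isUnit_iff_bijective]
  have hinj : Function.Injective (fderiv ℂ Ψ Z) := by
    rw [injective_iff_map_eq_zero]
    intro v hv
    have := hs.gn_le_fderiv hb hδ le_rfl hZ v
    rw [hv] at this
    exact eq_zero_of_gn_le hδ (by simpa [gn] using this)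
  exact ⟨hinj, (LinearMap.injective_iff_surjective (f := (fderiv ℂ Ψ Z : Phase d n →ₗ[ℂ] Phase d n))).1 hinj⟩

lemma holo_fderiv (hs : BState ω Λ V r δ b m Ψ h) (hr : 0 < r) (hδ : 0 < δ) :
    Holo r δ (fderiv ℂ Ψ) :=
  ((Holo.const _).add (hs.holo_map.fderiv hr hδ)).congr fun _ hZ => (hs.hasFDerivAt hZ).fderiv

lemma mapsTo (hs : BState ω Λ V r δ b m Ψ h) (hr : 0 < r) (hb0 : 0 ≤ b) (hb : b ≤ 1 / 2)
    {δ' : ℝ} (h0 : 0 < δ') (h1 : δ' ≤ δ) (hr₀ : r + b ≤ r₀) :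
    MapsTo Ψ (domain d n r δ') (domain d n r₀ (2 * δ')) := by
  intro Z hZ
  have hg := (gn_le_iff h0).1 (hs.bound_map.gn_le hr hb0 hs.holo_map (hs.ord_map.mono (by norm_num))
    h0 h1 hZ)
  refine ⟨fun j => ?_, fun j => ?_⟩
  · have h2 : |((Ψ Z - Z).1 j).im| ≤ b :=
      (Complex.abs_im_le_norm _).trans ((norm_le_pi_norm (Ψ Z - Z).1 j).trans hg.1)
    have h3 : ((Ψ Z).1 j).im = (Z.1 j).im + ((Ψ Z - Z).1 j).im := by simp
    rw [h3]
    linarith [abs_add_le (Z.1 j).im ((Ψ Z - Z).1 j).im, hZ.1 j]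
  · have h2 : ‖(Ψ Z - Z).2 j‖ ≤ b * δ' := (norm_le_pi_norm (Ψ Z - Z).2 j).trans hg.2
    have h3 : (Ψ Z).2 j = Z.2 j + (Ψ Z - Z).2 j := by simp
    rw [h3]
    have := hZ.2 j
    nlinarith [norm_add_le (Z.2 j) ((Ψ Z - Z).2 j)]

lemma holo_err (hs : BState ω Λ V r δ b m Ψ h) (hV : FieldBound V r₀ δ₀ CV) (hr : 0 < r)
    (hδ : 0 < δ) (hb0 : 0 ≤ b) (hb : b ≤ 1 / 2) (hr₀ : r + b ≤ r₀) (hδ₀ : 2 * δ ≤ δ₀) :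
    Holo r δ (err ω Λ V Ψ h) := by
  have h1 := hV.holo.comp_map hs.holo_map fun Z hZ =>
    domain_mono le_rfl hδ₀ (hs.mapsTo hr hb0 hb hδ le_rfl hr₀ hZ)
  exact ((hs.holo_fun.comp₁ Complex.differentiable_exp).smul h1).sub
    ((hs.holo_fderiv hr hδ).clm_apply (holo_quasilinear ω Λ r δ))

lemma gn_err_le (hs : BState ω Λ V r δ b m Ψ h) (hV : FieldBound V r₀ δ₀ CV) (hr : 0 < r)
    (hδ : 0 < δ) (hb0 : 0 ≤ b) (hb : b ≤ 1 / 2) (hr₀ : r + b ≤ r₀) (hδ₀ : 2 * δ ≤ δ₀)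
    {Z : Phase d n} (hZ : Z ∈ domain d n r δ) :
    gn δ (err ω Λ V Ψ h Z) ≤ 6 * CV + 2 * (‖ω‖ + ‖Λ‖) := by
  have h1 := hV.bound (2 * δ) (by positivity) hδ₀ _ (hs.mapsTo hr hb0 hb hδ le_rfl hr₀ hZ)
  have h2 := gn_le_mul (c := 2) hδ le_rfl (by norm_num) (by positivity) (V (Ψ Z))
  have h3 : ‖Complex.exp (h Z)‖ ≤ 3 := by
    have hh := hs.bound_fun.norm_le hr hb0 hs.holo_fun hs.ord_fun hδ hZ
    rw [Complex.norm_exp]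
    have h4 : (h Z).re ≤ 1 := (Complex.re_le_norm _).trans (by linarith)
    exact (Real.exp_le_exp.2 h4).trans (Real.exp_one_lt_d9.le.trans (by norm_num))
  have h5 := hs.gn_fderiv_le hb hδ le_rfl hZ (quasilinear ω Λ Z)
  have h6 := gn_quasilinear_le ω Λ hδ hZ
  have h7 := gn_nonneg δ (V (Ψ Z))
  refine (gn_sub_le hδ _ _).trans ?_
  rw [gn_smul, LS]
  nlinarith

end BState

end Analytic

/-! ### Solving the linearized equation with estimates -/

section Solve

variable {ω : Fin d → ℝ} {Λ : Fin n → ℂ} {V Ψ : Phase d n → Phase d n} {h : Phase d n → ℂ}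
  {r δ b r₀ δ₀ CV G ε κ σ : ℝ} {m : ℕ} {L₀ : Fin d ⊕ Fin n}

lemma wt_mul_le {δ σ κ : ℝ} (hδ : 0 < δ) (hσ0 : 0 < σ) (hσ1 : σ ≤ 1) (hκ : κ ≤ 1 / 2)
    (L : Fin d ⊕ Fin n) : wt δ L * σ ≤ 2 * wt ((1 - κ) * (σ * δ)) L := by
  cases L with
  | inl j => simp only [wt, Sum.elim_inl]; linarith
  | inr j =>
    simp only [wt, Sum.elim_inr]
    have : 0 < σ * δ := by positivity
    nlinarith

lemma one_le_geom (hκ0 : 0 < κ) (hκ : κ ≤ 1 / 2) (N : ℕ) : 1 ≤ (4 / κ) ^ N :=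
  one_le_pow₀ ((one_le_div hκ0).2 (by linarith))

lemma evalV_hasCoef {F : FormalVF d n} {ρ s : ℝ} (hρ : 0 < ρ) (hs : 0 < s) {C : Fin d ⊕ Fin n → ℝ}
    (hF : ∀ L, Majorized ρ s (C L) (F L)) : coefV (evalV F) = F := by
  funext L
  have := ((hF L).hasCoef hρ hs).coef_eq
  simp only [coefV, comp_evalV]
  exact this

lemma BState.holo_pullErr (hs : BState ω Λ V r δ b m Ψ h) (hV : FieldBound V r₀ δ₀ CV) (hr : 0 < r)
    (hδ : 0 < δ) (hb0 : 0 ≤ b) (hb : b ≤ 1 / 2) (hr₀ : r + b ≤ r₀) (hδ₀ : 2 * δ ≤ δ₀) :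
    Holo r δ (pullErr ω Λ V Ψ h) :=
  ((hs.holo_fderiv hr hδ).inverse fun _ hZ => hs.isUnit_fderiv hb hδ hZ).clm_apply
    (hs.holo_err hV hr hδ hb0 hb hr₀ hδ₀)

lemma BState.gn_pullErr_le (hs : BState ω Λ V r δ b m Ψ h) (hV : FieldBound V r₀ δ₀ CV)
    (hr : 0 < r) (hδ : 0 < δ) (hb0 : 0 ≤ b) (hb : b ≤ 1 / 2) (hr₀ : r + b ≤ r₀)
    (hδ₀ : 2 * δ ≤ δ₀) {Z : Phase d n} (hZ : Z ∈ domain d n r δ) :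
    gn δ (pullErr ω Λ V Ψ h Z) ≤ 2 * (6 * CV + 2 * (‖ω‖ + ‖Λ‖)) := by
  have h1 := hs.gn_le_fderiv hb hδ le_rfl hZ (pullErr ω Λ V Ψ h Z)
  rw [pullErr, apply_inverse_apply (hs.isUnit_fderiv hb hδ hZ)] at h1
  have h2 := hs.gn_err_le hV hr hδ hb0 hb hr₀ hδ₀ hZ
  rw [pullErr]
  linarith

/-- The estimate of the correction. -/
lemma exists_correction {M : ℝ} (hm : 2 ≤ m) (hr : 0 < r) (hδ : 0 < δ)
    (hR : Holo r δ (pullErr ω Λ V Ψ h)) (hRo : Ord m (pullErr ω Λ V Ψ h)) (hM0 : 0 ≤ M)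
    (hM : ∀ Z ∈ domain d n r δ, gn δ (pullErr ω Λ V Ψ h Z) ≤ M)
    (hh : Holo r δ h) (hhb : SBound r δ 1 h) (hG : 1 ≤ G) (hε : 0 ≤ ε) (hκ0 : 0 < κ)
    (hκ : κ ≤ 1 / 2) (hσ0 : 0 < σ) (hσ1 : σ ≤ 1) (hdiv : DivBound ω Λ m G ε)
    (hrad : 0 < r - 2 * ε - 2 * κ) :
    ∃ w₀ f β, Correction ω Λ V m Ψ h L₀ w₀ f β ∧
      Holo (r - 2 * ε - 2 * κ) ((1 - κ) * ((1 - κ) * (σ * δ))) w₀ ∧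
      Holo (r - 2 * ε - 2 * κ) ((1 - κ) * ((1 - κ) * (σ * δ))) f ∧
      Holo (r - 2 * ε - 2 * κ) ((1 - κ) * ((1 - κ) * (σ * δ))) β ∧
      ∀ Z ∈ domain d n (r - 2 * ε - 2 * κ) ((1 - κ) * ((1 - κ) * (σ * δ))),
        gn ((1 - κ) * ((1 - κ) * (σ * δ))) (w₀ Z + f Z • quasilinear ω Λ Z) ≤
          (2 + (‖ω‖ + ‖Λ‖)) * (2 * M * G ^ 2 * ((4 / κ) ^ (d + n)) ^ 2 * σ ^ (m - 1)) ∧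
        ‖β Z‖ ≤ (1 + 1 / ‖sCoef ω Λ L₀‖) *
          (2 * M * G ^ 2 * ((4 / κ) ^ (d + n)) ^ 2 * σ ^ (m - 1)) ∧ LS ω Λ β Z = 0 := by
  classical
  set B := (4 / κ) ^ (d + n) with hB
  have hB1 : 1 ≤ B := one_le_geom hκ0 hκ _
  have hk : 0 < 1 - κ := by linarith
  set δ₁ := (1 - κ) * (σ * δ) with hδ₁
  have hσδ : 0 < σ * δ := by positivity
  have hδ₁0 : 0 < δ₁ := by positivity
  have hσδδ : σ * δ ≤ δ := mul_le_of_le_one_left hδ.le hσ1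
  have hδ₁σ : δ₁ ≤ σ * δ := mul_le_of_le_one_left hσδ.le (by linarith)
  have hδ₁δ : δ₁ ≤ δ := hδ₁σ.trans hσδδ
  have hδ₂0 : 0 < (1 - κ) * δ₁ := by positivity
  have hδ₂1 : (1 - κ) * δ₁ ≤ δ₁ := mul_le_of_le_one_left hδ₁0.le (by linarith)
  set Rc := coefV (pullErr ω Λ V Ψ h) with hRc
  have hRg : Germ (pullErr ω Λ V Ψ h) := hR.germ hr hδ
  have hRord : ∀ L, HasOrder m (Rc L) := hRg.ord_iffV.1 hRo
  have hRmaj : ∀ L, Majorized r (σ * δ) (M * wt δ L * σ ^ m) (Rc L) := fun L =>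
    ((hR.comp_of L).majorized_coef hr hδ fun Z hZ =>
      (gn_le_iff_comp hδ hM0).1 (hM Z hZ) L).1.shrink hδ (hRord L) hσ0 hσ1
  -- the part inverting the bracket
  set W : FormalVF d n := fun L p =>
    if degQ p.2 < 2 * m - 1 ∧ divL ω Λ L p ≠ 0 then Rc L p / divL ω Λ L p else 0 with hW
  have hWmaj : ∀ L, Majorized (r - ε) (σ * δ) (M * wt δ L * σ ^ m * G) (W L) := by
    intro L
    refine (hRmaj L).mul_exp (ε := ε) hσδ.le (by linarith) fun p => ?_
    simp only [hW]
    split_ifs with hp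
    · by_cases hpm : degQ p.2 < m
      · rw [hRord L p hpm]
        simp
      · rw [norm_div, div_eq_mul_inv]
        gcongr
        exact hdiv.divL_le hm (not_lt.1 hpm) hp.1 hp.2
    · rw [norm_zero]
      positivity
  have hrε : 0 < r - ε := by linarith
  have hWcoef : coefV (evalV W) = W := evalV_hasCoef hrε hσδ hWmaj
  have hWholo : Holo (r - ε) (σ * δ) (evalV W) := holo_of_comp fun L => by
    simp only [comp_evalV]
    exact (hWmaj L).holo hσδ
  set c₀ := 2 * M * G * B * σ ^ (m - 1) with hc₀
  have hc₀0 : 0 ≤ c₀ := by positivity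
  have hσm : σ ^ m = σ ^ (m - 1) * σ := by rw [← pow_succ]; congr 1; omega
  have hWbound : ∀ Z ∈ domain d n (r - ε - κ) δ₁, gn δ₁ (evalV W Z) ≤ c₀ := by
    intro Z hZ
    rw [gn_le_iff_comp hδ₁0 hc₀0]
    intro L
    rw [comp_evalV]
    refine ((hWmaj L).norm_eval_le hσδ hκ0 (by linarith) hZ).trans ?_
    have hw := wt_mul_le hδ hσ0 hσ1 hκ L
    have hA : 0 ≤ M * G * B * σ ^ (m - 1) := by positivity
    calc M * wt δ L * σ ^ m * G * B = (M * G * B * σ ^ (m - 1)) * (wt δ L * σ) := by rw [hσm]; ring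
      _ ≤ (M * G * B * σ ^ (m - 1)) * (2 * wt δ₁ L) := mul_le_mul_of_nonneg_left hw hA
      _ = c₀ * wt δ₁ L := by rw [hc₀]; ring
  -- the derivative of `h` along it
  set η : Phase d n → ℂ := fun Z => fderiv ℂ h Z (evalV W Z) with hη
  have hrκ : 0 < r - ε - κ := by linarith
  have hηholo : Holo (r - ε - κ) δ₁ η :=
    ((hh.fderiv hr hδ).mono (by linarith) hδ₁δ).clm_apply (hWholo.mono (by linarith) hδ₁σ)
  have hηbound : ∀ Z ∈ domain d n (r - ε - κ) δ₁, ‖η Z‖ ≤ c₀ := by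
    intro Z hZ
    have h1 := hhb δ₁ hδ₁0 hδ₁δ Z (domain_mono (by linarith) le_rfl hZ) (evalV W Z)
    rw [one_mul] at h1
    exact h1.trans (hWbound Z hZ)
  have hηmaj : Majorized (r - ε - κ) δ₁ c₀ (coef η) := (hηholo.majorized_coef hrκ hδ₁0 hηbound).1
  -- the correction along `S`
  set Fs : Series d n := fun p =>
    if degQ p.2 < 2 * m - 1 ∧ div ω Λ p ≠ 0 then -coef η p / div ω Λ p else 0 with hFs
  have hFmaj : Majorized (r - ε - κ - ε) δ₁ (c₀ * G) Fs := by
    refine hηmaj.mul_exp hδ₁0.le (by linarith) fun p => ?_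
    simp only [hFs]
    split_ifs with hp
    · rw [norm_div, norm_neg, div_eq_mul_inv]
      gcongr
      exact hdiv.div_le hp.1 hp.2
    · rw [norm_zero]
      positivity
  have hrad' : r - ε - κ - ε - κ = r - 2 * ε - 2 * κ := by ring
  have hFbound : ∀ Z ∈ domain d n (r - 2 * ε - 2 * κ) ((1 - κ) * δ₁), ‖eval Fs Z‖ ≤ c₀ * G * B := by
    intro Z hZ
    rw [← hrad'] at hZ
    exact hFmaj.norm_eval_le hδ₁0 hκ0 (by linarith) hZ
  -- the correction of `h`
  set s := ‖sCoef ω Λ L₀‖ with hs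
  set Bs : Series d n := fun p => if degQ (addE L₀ p).2 < 2 * m - 1 ∧ div ω Λ p = 0 then
    coef η p - Rc L₀ (addE L₀ p) / sCoef ω Λ L₀ else 0 with hBs
  have hMc₀ : M * σ ^ (m - 1) ≤ c₀ := by
    have h1 : 1 ≤ 2 * G * B := by nlinarith
    have h2 : 0 ≤ M * σ ^ (m - 1) := by positivity
    calc M * σ ^ (m - 1) ≤ (M * σ ^ (m - 1)) * (2 * G * B) := le_mul_of_one_le_right h2 h1
      _ = c₀ := by rw [hc₀]; ring
  have hRshift : ∀ p : Idx d n, ‖Rc L₀ (addE L₀ p)‖ * Real.exp ((r - ε - κ) * absP p.1) *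
      δ₁ ^ degQ p.2 ≤ c₀ := by
    intro p
    have h1 := hRmaj L₀ (addE L₀ p)
    have h2 : (addE L₀ p).1 = p.1 := by cases L₀ <;> rfl
    have h3 : (σ * δ) ^ degQ (addE L₀ p).2 = (σ * δ) ^ degQ p.2 * wt (σ * δ) L₀ := by
      cases L₀ with
      | inl j => simp [addE, wt]
      | inr j => simp [addE, wt, degQ_add_single, pow_succ]
    have h4 : wt δ L₀ * σ ≤ wt (σ * δ) L₀ := by
      cases L₀ with
      | inl j => simpa [wt] using hσ1
      | inr j => simp [wt, mul_comm]
    have h5 := wt_pos hσδ L₀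
    rw [h2, h3] at h1
    have h6 : ‖Rc L₀ (addE L₀ p)‖ * Real.exp (r * absP p.1) * (σ * δ) ^ degQ p.2 ≤
        M * σ ^ (m - 1) := by
      refine le_of_mul_le_mul_right ?_ h5
      calc ‖Rc L₀ (addE L₀ p)‖ * Real.exp (r * absP p.1) * (σ * δ) ^ degQ p.2 * wt (σ * δ) L₀
          = ‖Rc L₀ (addE L₀ p)‖ * Real.exp (r * absP p.1) *
            ((σ * δ) ^ degQ p.2 * wt (σ * δ) L₀) := by ring
        _ ≤ M * wt δ L₀ * σ ^ m := h1
        _ = M * σ ^ (m - 1) * (wt δ L₀ * σ) := by rw [hσm]; ring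
        _ ≤ M * σ ^ (m - 1) * wt (σ * δ) L₀ := by gcongr
    refine le_trans ?_ (h6.trans hMc₀)
    gcongr
    linarith
  have hBmaj : Majorized (r - ε - κ) δ₁ (c₀ * (1 + 1 / s)) Bs := by
    intro p
    simp only [hBs]
    split_ifs with hp
    · calc ‖coef η p - Rc L₀ (addE L₀ p) / sCoef ω Λ L₀‖ * Real.exp ((r - ε - κ) * absP p.1) *
            δ₁ ^ degQ p.2
          ≤ (‖coef η p‖ + ‖Rc L₀ (addE L₀ p)‖ / s) * Real.exp ((r - ε - κ) * absP p.1) *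
            δ₁ ^ degQ p.2 := by
            gcongr
            refine (norm_sub_le _ _).trans ?_
            rw [norm_div]
        _ = ‖coef η p‖ * Real.exp ((r - ε - κ) * absP p.1) * δ₁ ^ degQ p.2 +
            (‖Rc L₀ (addE L₀ p)‖ * Real.exp ((r - ε - κ) * absP p.1) * δ₁ ^ degQ p.2) * (1 / s) := by
            ring
        _ ≤ c₀ + c₀ * (1 / s) := by
            gcongr
            · exact hηmaj p
            · exact hRshift p
        _ = c₀ * (1 + 1 / s) := by ring
    · rw [norm_zero, zero_mul, zero_mul]
      positivity
  have hsubd : domain d n (r - 2 * ε - 2 * κ) ((1 - κ) * δ₁) ⊆ domain d n (r - ε - κ) δ₁ :=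
    domain_mono (by linarith) hδ₂1
  refine ⟨evalV W, eval Fs, eval Bs, ⟨hWholo.germ hrε hσδ, fun L p => ?_,
    (hFmaj.holo hδ₁0).germ (by linarith) hδ₁0, fun p => ?_, (hBmaj.holo hδ₁0).germ hrκ hδ₁0,
    fun p => ?_⟩, hWholo.mono (by linarith) (hδ₂1.trans hδ₁σ),
    (hFmaj.holo hδ₁0).mono (by linarith) hδ₂1, (hBmaj.holo hδ₁0).mono (by linarith) hδ₂1,
    fun Z hZ => ⟨?_, ?_, ?_⟩⟩
  · rw [hWcoef]
  · rw [(hFmaj.hasCoef (by linarith) hδ₁0).coef_eq]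
  · rw [(hBmaj.hasCoef hrκ hδ₁0).coef_eq]
  · have h1 := hWbound Z (hsubd hZ)
    have h2 := gn_le_mul (c := 2) (δ' := (1 - κ) * δ₁) (δ := δ₁) hδ₂0 (by nlinarith) (by norm_num)
      hδ₁0 (evalV W Z)
    have h3 := hFbound Z hZ
    have h4 := gn_quasilinear_le ω Λ hδ₂0 hZ
    have h5 := gn_add_le hδ₂0 (evalV W Z) (eval Fs Z • quasilinear ω Λ Z)
    rw [gn_smul] at h5
    have h6 : ‖eval Fs Z‖ * gn ((1 - κ) * δ₁) (quasilinear ω Λ Z) ≤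
        c₀ * G * B * (‖ω‖ + ‖Λ‖) :=
      mul_le_mul h3 h4 (gn_nonneg _ _) (by positivity)
    have h7 : c₀ ≤ c₀ * G * B := by
      have : 1 ≤ G * B := by nlinarith
      calc c₀ ≤ c₀ * (G * B) := le_mul_of_one_le_right hc₀0 this
        _ = c₀ * G * B := by ring
    calc gn ((1 - κ) * δ₁) (evalV W Z + eval Fs Z • quasilinear ω Λ Z)
        ≤ 2 * (c₀ * G * B) + c₀ * G * B * (‖ω‖ + ‖Λ‖) := by linarith
      _ = _ := by rw [hc₀]; ring
  · have hZ' : Z ∈ domain d n (r - ε - κ - κ) ((1 - κ) * δ₁) := domain_mono (by linarith) le_rfl hZ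
    refine (hBmaj.norm_eval_le hδ₁0 hκ0 (by linarith) hZ').trans ?_
    have hs0 : 0 ≤ 1 + 1 / s := by positivity
    calc c₀ * (1 + 1 / s) * B ≤ (c₀ * (1 + 1 / s) * B) * G :=
          le_mul_of_one_le_right (by positivity) hG
      _ = _ := by rw [hc₀]; ring
  · rw [hBmaj.LS_eval ω Λ hδ₁0 (hsubd hZ), eval]
    refine (tsum_congr fun p => ?_).trans tsum_zero
    simp only [hBs]
    split_ifs with hp
    · rw [hp.2, zero_mul, zero_mul]
    · rw [mul_zero, zero_mul]

end Solve

/-! ### One step of the iteration -/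

section OneStep

variable {ω : Fin d → ℝ} {Λ : Fin n → ℂ} {V Ψ : Phase d n → Phase d n} {h : Phase d n → ℂ}
  {r δ b r₀ δ₀ CV G ε κ σ : ℝ} {m : ℕ} {L₀ : Fin d ⊕ Fin n}

lemma DBound.add {u v : Phase d n → Phase d n} {b' : ℝ} (hu : DBound r δ b u) (hv : DBound r δ b' v)
    (hu' : DifferentiableOn ℂ u (domain d n r δ)) (hv' : DifferentiableOn ℂ v (domain d n r δ)) :
    DBound r δ (b + b') fun Z => u Z + v Z := by
  intro δ' h0 h1 Z hZ w
  have hZ' := (isOpen_domain r δ).mem_nhds (domain_mono le_rfl h1 hZ)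
  rw [fderiv_fun_add (hu'.differentiableAt hZ') (hv'.differentiableAt hZ'), add_mul]
  exact (gn_add_le h0 _ _).trans (add_le_add (hu δ' h0 h1 Z hZ w) (hv δ' h0 h1 Z hZ w))

lemma SBound.add {u v : Phase d n → ℂ} {b' : ℝ} (hu : SBound r δ b u) (hv : SBound r δ b' v)
    (hu' : DifferentiableOn ℂ u (domain d n r δ)) (hv' : DifferentiableOn ℂ v (domain d n r δ)) :
    SBound r δ (b + b') fun Z => u Z + v Z := by
  intro δ' h0 h1 Z hZ w
  have hZ' := (isOpen_domain r δ).mem_nhds (domain_mono le_rfl h1 hZ)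
  rw [fderiv_fun_add (hu'.differentiableAt hZ') (hv'.differentiableAt hZ'), add_mul]
  exact (norm_add_le _ _).trans (add_le_add (hu δ' h0 h1 Z hZ w) (hv δ' h0 h1 Z hZ w))

/-- The constant of the estimate of a step. -/
def stepConst (ω : Fin d → ℝ) (Λ : Fin n → ℂ) (L₀ : Fin d ⊕ Fin n) (CV : ℝ) : ℝ :=
  16 * (2 * (2 + (‖ω‖ + ‖Λ‖)) + (1 + 1 / ‖sCoef ω Λ L₀‖)) * (2 * (6 * CV + 2 * (‖ω‖ + ‖Λ‖)))

lemma BState.step (hs : BState ω Λ V r δ b m Ψ h) (hV : FieldBound V r₀ δ₀ CV) (hCV : 0 ≤ CV)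
    (hδ : 0 < δ) (hb0 : 0 ≤ b) (hb : b ≤ 1 / 2) (hr₀ : r + b ≤ r₀) (hδ₀ : 2 * δ ≤ δ₀) (hm : 2 ≤ m)
    (hL : sCoef ω Λ L₀ ≠ 0) (hL' : ∀ j, L₀ = Sum.inr j → ω = 0) (hG : 1 ≤ G) (hε : 0 ≤ ε)
    (hκ0 : 0 < κ) (hκ : κ ≤ 1 / 2) (hσ0 : 0 < σ) (hσ1 : σ ≤ 1) (hdiv : DivBound ω Λ m G ε)
    (hrad : 0 < r - 2 * ε - 4 * κ) {δ' X : ℝ} (hδ' : δ' ≤ (1 - κ) ^ 4 * σ * δ)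
    (hX : stepConst ω Λ L₀ CV * G ^ 2 * ((4 / κ) ^ (d + n)) ^ 3 * σ ^ (m - 1) / κ ≤ X) :
    ∃ Ψ' h', BState ω Λ V (r - 2 * ε - 4 * κ) δ' (b + X) (2 * m - 1) Ψ' h' ∧
      Holo (r - 2 * ε - 4 * κ) δ' (fun Z => Ψ' Z - Ψ Z) ∧
      DBound (r - 2 * ε - 4 * κ) δ' X (fun Z => Ψ' Z - Ψ Z) ∧ Ord 1 (fun Z => Ψ' Z - Ψ Z) ∧
      Holo (r - 2 * ε - 4 * κ) δ' (fun Z => h' Z - h Z) ∧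
      SBound (r - 2 * ε - 4 * κ) δ' X (fun Z => h' Z - h Z) ∧ Ord 1 (fun Z => h' Z - h Z) := by
  set M := 2 * (6 * CV + 2 * (‖ω‖ + ‖Λ‖)) with hM
  have hM0 : 0 ≤ M := by positivity
  have hr : 0 < r := by linarith
  have hnear := hs.near hr hδ
  have hhg : Germ h := hs.holo_fun.germ hr hδ
  have hVg : Germ V := hV.holo.germ (by linarith) (by linarith)
  have hRholo := hs.holo_pullErr hV hr hδ hb0 hb hr₀ hδ₀
  have hRo := hs.conj.ord_pullErr hVg hnear hhg hm hL
  obtain ⟨w₀, f, β, hC, hw₀, hf, hβ, hbd⟩ := exists_correction (L₀ := L₀) hm hr hδ hRholo hRo hM0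
    (fun Z hZ => hs.gn_pullErr_le hV hr hδ hb0 hb hr₀ hδ₀ hZ) hs.holo_fun
    (hs.bound_fun.mono le_rfl le_rfl (by linarith)) hG hε hκ0 hκ hσ0 hσ1 hdiv (by linarith)
  set δ₂ := (1 - κ) * ((1 - κ) * (σ * δ)) with hδ₂
  set r₂ := r - 2 * ε - 2 * κ with hr₂
  set B := (4 / κ) ^ (d + n) with hB
  have hk : 0 < 1 - κ := by linarith
  have hk1 : 1 - κ ≤ 1 := by linarith
  have hδ₂0 : 0 < δ₂ := by positivity
  have hσδ : σ * δ ≤ δ := mul_le_of_le_one_left hδ.le hσ1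
  have hδ₂δ : δ₂ ≤ δ := by
    have : 0 < σ * δ := by positivity
    calc δ₂ ≤ 1 * (1 * (σ * δ)) := by rw [hδ₂]; gcongr
      _ ≤ δ := by linarith
  have hr₂0 : 0 < r₂ := by rw [hr₂]; linarith
  set A := 2 * M * G ^ 2 * B ^ 2 * σ ^ (m - 1) with hA
  have hA0 : 0 ≤ A := by positivity
  set Q := 2 * (2 + (‖ω‖ + ‖Λ‖)) + (1 + 1 / ‖sCoef ω Λ L₀‖) with hQ
  have hs0 : 0 ≤ 1 / ‖sCoef ω Λ L₀‖ := by positivity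
  set w : Phase d n → Phase d n := fun Z => w₀ Z + f Z • quasilinear ω Λ Z with hw
  have hwholo : Holo r₂ δ₂ w := hw₀.add (hf.smul (holo_quasilinear ω Λ _ _))
  have hDΨ := (hs.holo_fderiv hr hδ).mono (r' := r₂) (by rw [hr₂]; linarith) hδ₂δ
  set g : Phase d n → Phase d n := fun Z => fderiv ℂ Ψ Z (w Z) with hg
  have hgholo : Holo r₂ δ₂ g := hDΨ.clm_apply hwholo
  have hwo : Ord m w := by
    have h1 := hC.ord_w (germ_pullErr hVg hnear hhg) hRo
    have h2 := (hC.ord_f hhg h1).smul (germ_quasilinear ω Λ).ord_zero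
    exact h1.add h2
  have hgo : Ord m g := hnear.germ_fderiv.clm_ord hwo
  have hβo : Ord (m - 1) β := hC.ord_β hhg (hC.ord_w (germ_pullErr hVg hnear hhg) hRo)
    (germ_pullErr hVg hnear hhg) hRo
  have hgbd : ∀ Z ∈ domain d n r₂ δ₂, gn δ₂ (g Z) ≤ Q * A := by
    intro Z hZ
    have h1 := hs.gn_fderiv_le hb hδ₂0 hδ₂δ (Z := Z) (domain_mono (by rw [hr₂]; linarith) le_rfl hZ)
      (w Z)
    have h2 := (hbd Z hZ).1
    have h3 : 0 ≤ (1 + 1 / ‖sCoef ω Λ L₀‖) * A := by positivity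
    calc gn δ₂ (g Z) ≤ 2 * ((2 + (‖ω‖ + ‖Λ‖)) * A) := h1.trans (by linarith)
      _ ≤ Q * A := by rw [hQ, add_mul]; linarith
  have hβbd : ∀ Z ∈ domain d n r₂ δ₂, ‖β Z‖ ≤ Q * A := by
    intro Z hZ
    have h2 := (hbd Z hZ).2.1
    have h3 : 0 ≤ 2 * (2 + (‖ω‖ + ‖Λ‖)) * A := by positivity
    rw [hQ, add_mul]
    linarith
  have hXeq : 8 * (Q * A) * B / κ ≤ X := by
    refine le_trans (le_of_eq ?_) hX
    rw [stepConst, ← hQ, ← hM, hA]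
    ring
  have hδ'2 : δ' ≤ (1 - κ) * ((1 - κ) * δ₂) := by
    refine hδ'.trans (le_of_eq ?_)
    rw [hδ₂]
    ring
  have hrr : r₂ - 2 * κ = r - 2 * ε - 4 * κ := by rw [hr₂]; ring
  have hgD : DBound (r - 2 * ε - 4 * κ) δ' X g :=
    (hgholo.dBound hr₂0 hδ₂0 (hgo.mono (by omega)) hgbd hκ0 hκ).mono hrr.ge hδ'2 hXeq
  have hβD : SBound (r - 2 * ε - 4 * κ) δ' X β :=
    (hβ.sBound hr₂0 hδ₂0 (hβo.mono (by omega)) hβbd hκ0 hκ).mono hrr.ge hδ'2 hXeq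
  have hδ'δ₂ : δ' ≤ δ₂ := by
    refine hδ'2.trans ?_
    calc (1 - κ) * ((1 - κ) * δ₂) ≤ 1 * (1 * δ₂) := by gcongr
      _ = δ₂ := by ring
  have hr'₂ : r - 2 * ε - 4 * κ ≤ r₂ := by rw [hr₂]; linarith
  have hgholo' := hgholo.mono hr'₂ hδ'δ₂
  have hβholo' := hβ.mono hr'₂ hδ'δ₂
  have hψ' := hs.holo_map.mono (r' := r - 2 * ε - 4 * κ) (δ' := δ') (by linarith) (hδ'δ₂.trans hδ₂δ)
  have hh' := hs.holo_fun.mono (r' := r - 2 * ε - 4 * κ) (δ' := δ') (by linarith) (hδ'δ₂.trans hδ₂δ)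
  have e1 : (fun Z => Ψ Z + g Z - Ψ Z) = g := by funext Z; abel
  have e2 : (fun Z => h Z + β Z - h Z) = β := by funext Z; ring
  have e3 : (fun Z => Ψ Z + g Z - Z) = fun Z => (Ψ Z - Z) + g Z := by funext Z; abel
  have hLS : LS ω Λ h =ᶠ[nT d n] 0 := by
    filter_upwards [domain_mem_nT hr hδ] with Z hZ using hs.LS_fun Z hZ
  refine ⟨fun Z => Ψ Z + g Z, fun Z => h Z + β Z, ⟨?_, ?_, ?_, hh'.add hβholo', ?_, ?_, ?_, ?_⟩, ?_⟩
  · rw [e3]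
    exact hψ'.add hgholo'
  · rw [e3]
    exact hs.ord_map.add (hgo.mono hm)
  · rw [e3]
    exact (hs.bound_map.mono (by linarith) (hδ'δ₂.trans hδ₂δ) le_rfl).add hgD hψ'.1 hgholo'.1
  · exact hs.ord_fun.add (hβo.mono (by omega))
  · exact (hs.bound_fun.mono (by linarith) (hδ'δ₂.trans hδ₂δ) le_rfl).add hβD hh'.1 hβholo'.1
  · intro Z hZ
    have hZ' := (isOpen_domain (r - 2 * ε - 4 * κ) δ').mem_nhds hZ
    rw [LS_add ω Λ (hh'.1.differentiableAt hZ') (hβholo'.1.differentiableAt hZ'),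
      hs.LS_fun Z (domain_mono (by linarith) (hδ'δ₂.trans hδ₂δ) hZ),
      (hbd Z (domain_mono hr'₂ hδ'δ₂ hZ)).2.2, add_zero]
  · exact hs.conj.step hVg hnear hhg hs.ord_fun hLS hm hL hL' hC
  · rw [e1, e2]
    exact ⟨hgholo', hgD, hgo.mono (by omega), hβholo', hβD, hβo.mono (by omega)⟩

end OneStep

/-! ### The iteration and its limit -/

lemma exists_seq {α : Type*} {P : ℕ → α → Prop} {R : ℕ → α → α → Prop} {a : α} (h0 : P 0 a)
    (hs : ∀ l x, P l x → ∃ y, P (l + 1) y ∧ R l x y) :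
    ∃ x : ℕ → α, x 0 = a ∧ ∀ l, P l (x l) ∧ R l (x l) (x (l + 1)) := by
  choose! f hf using hs
  let x : ℕ → α := fun l => Nat.rec a (fun l y => f l y) l
  have hx : ∀ l, P l (x l) := fun l => by
    induction l with
    | zero => exact h0
    | succ l ih => exact (hf l _ ih).1
  exact ⟨x, rfl, fun l => ⟨hx l, (hf l _ (hx l)).2⟩⟩

lemma exists_tendsto_fderiv {E F : Type*} [NormedAddCommGroup E] [NormedSpace ℂ E]
    [NormedAddCommGroup F] [NormedSpace ℂ F] [CompleteSpace F] {f : ℕ → E → F} {s : Set E}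
    (hs : IsOpen s) {b : ℕ → ℝ} (hb : Summable b) (hf : ∀ l, DifferentiableOn ℂ (f l) s)
    (hfb : ∀ l, ∀ x ∈ s, ‖f (l + 1) x - f l x‖ ≤ b l) :
    ∃ g : E → F, DifferentiableOn ℂ g s ∧ ∀ x ∈ s, Tendsto (fun l => f l x) atTop (𝓝 (g x)) ∧
      Tendsto (fun l => fderiv ℂ (f l) x) atTop (𝓝 (fderiv ℂ g x)) := by
  set u : ℕ → E → F := fun l x => f (l + 1) x - f l x with hu
  have hud : ∀ l, DifferentiableOn ℂ (u l) s := fun l => (hf (l + 1)).sub (hf l)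
  have hder : ∀ x ∈ s, HasFDerivAt (fun y => f 0 y + ∑' l, u l y)
      (fderiv ℂ (f 0) x + ∑' l, fderiv ℂ (u l) x) x := fun x hx =>
    ((hf 0).differentiableAt (hs.mem_nhds hx)).hasFDerivAt.add
      (hasFDerivAt_tsum_of_norm_le hs hb hud hfb hx)
  have htel : ∀ N x, f N x = f 0 x + ∑ l ∈ Finset.range N, u l x := fun N x => by
    rw [Finset.sum_range_sub (fun l => f l x)]; abel
  refine ⟨fun y => f 0 y + ∑' l, u l y,
    fun x hx => (hder x hx).differentiableAt.differentiableWithinAt, fun x hx => ⟨?_, ?_⟩⟩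
  · have h1 : Summable fun l => u l x := Summable.of_norm_bounded hb fun l => hfb l x hx
    refine Tendsto.congr (fun N => (htel N x).symm) ?_
    exact h1.hasSum.tendsto_sum_nat.const_add _
  · obtain ⟨ρ, hρ, hball⟩ := Metric.isOpen_iff.1 hs x hx
    have h1 : Summable fun l => fderiv ℂ (u l) x :=
      Summable.of_norm_bounded ((hb.mul_left 2).div_const ρ) fun l =>
        norm_fderiv_le_of_norm_le_ball hρ ((hud l).mono hball) fun z hz => hfb l z (hball hz)
    rw [(hder x hx).fderiv]
    have h2 : ∀ N, fderiv ℂ (f N) x =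
        fderiv ℂ (f 0) x + ∑ l ∈ Finset.range N, fderiv ℂ (u l) x := fun N => by
      have h3 : ∀ l, fderiv ℂ (u l) x = fderiv ℂ (f (l + 1)) x - fderiv ℂ (f l) x := fun l =>
        fderiv_fun_sub ((hf (l + 1)).differentiableAt (hs.mem_nhds hx))
          ((hf l).differentiableAt (hs.mem_nhds hx))
      simp only [h3]
      rw [Finset.sum_range_sub (fun l => fderiv ℂ (f l) x)]; abel
    refine Tendsto.congr (fun N => (h2 N).symm) ?_
    exact h1.hasSum.tendsto_sum_nat.const_add _

/-- Parameters of the iteration: the losses in the widths are summable, and the increments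
decrease geometrically. -/
lemma exists_parameters {ω : Fin d → ℝ} {Λ : Fin n → ℂ} (hS : BrjunoGammaOmega ω Λ) (K : ℝ)
    {b r : ℝ} (hb : 0 < b) (hb1 : b ≤ 1) (hr : 0 < r) :
    ∃ G ε κ σ s : ℕ → ℝ, (∀ l, 1 ≤ G l ∧ 0 ≤ ε l ∧ 0 < κ l ∧ κ l ≤ 1 / 2 ∧ 0 < σ l ∧ σ l ≤ 1 ∧
      DivBound ω Λ (2 ^ l + 1) (G l) (ε l) ∧
      K * G l ^ 2 * ((4 / κ l) ^ (d + n)) ^ 3 * σ l ^ 2 ^ l / κ l ≤ b / 2 / 2 ^ l ∧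
      Real.exp (-s l) ≤ (1 - κ l) ^ 4 * σ l ∧ 0 ≤ s l) ∧
      (∀ N, ∑ l ∈ Finset.range N, (2 * ε l + 4 * κ l) ≤ r / 2) ∧ Summable s := by
  obtain ⟨G, ε, hG, hε, hdiv, hsum, hεs⟩ := exists_divisor_bounds hS (τ := r / 8) (by positivity)
  set k := min (1 / 2) (r / 32) with hk
  have hk0 : 0 < k := by positivity
  have hkh : k ≤ 1 / 2 := min_le_left _ _
  set κ : ℕ → ℝ := fun l => k / 2 ^ l with hκ
  have hκ0 : ∀ l, 0 < κ l := fun l => by positivity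
  have hκk : ∀ l, κ l ≤ k := fun l => div_le_self hk0.le (one_le_pow₀ one_le_two)
  have hκ1 : ∀ l, κ l ≤ 1 / 2 := fun l => (hκk l).trans hkh
  set K₁ := max 1 K with hK₁
  have hK1 : 1 ≤ K₁ := le_max_left _ _
  set T : ℕ → ℝ := fun l =>
    K₁ * G l ^ 2 * ((4 / κ l) ^ (d + n)) ^ 3 / κ l * (2 * 2 ^ l / b) with hT
  have hG0 : ∀ l, 0 < G l := fun l => one_pos.trans_le (hG l)
  have hT0 : ∀ l, 0 < T l := fun l => by
    have := hκ0 l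
    have := hG0 l
    positivity
  have hT1 : ∀ l, 1 ≤ T l := fun l => by
    have h1 : 1 ≤ 4 / κ l := by rw [le_div_iff₀ (hκ0 l)]; linarith [hκ1 l]
    have h2 : 1 ≤ K₁ * G l ^ 2 * ((4 / κ l) ^ (d + n)) ^ 3 :=
      one_le_mul_of_one_le_of_one_le
        (one_le_mul_of_one_le_of_one_le hK1 (one_le_pow₀ (hG l))) (one_le_pow₀ (one_le_pow₀ h1))
    refine one_le_mul_of_one_le_of_one_le ?_ ?_
    · rw [le_div_iff₀ (hκ0 l)]; linarith [hκ1 l]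
    · rw [le_div_iff₀ hb]
      have : (1 : ℝ) ≤ 2 ^ l := one_le_pow₀ one_le_two
      linarith
  set c : ℝ := Real.log K₁ + 3 * (d + n) * Real.log (4 / k) - Real.log k + Real.log (2 / b) with hc
  have hlogT : ∀ l, Real.log (T l) =
      2 * Real.log (G l) + (c + (3 * (d + n) + 2) * Real.log 2 * l) := fun l => by
    have e1 : T l = K₁ * G l ^ 2 * (4 / k * 2 ^ l) ^ ((d + n) * 3) * (2 ^ l / k)
        * (2 / b * 2 ^ l) := by
      simp only [hT, hκ]
      rw [pow_mul]
      have : (2 : ℝ) ^ l ≠ 0 := by positivity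
      field_simp
    have hg := (hG0 l).ne'
    have hK0 : K₁ ≠ 0 := by linarith
    have h2 : (2 : ℝ) ^ l ≠ 0 := by positivity
    have h4 : (4 : ℝ) / k ≠ 0 := by positivity
    have hb' : (2 : ℝ) / b ≠ 0 := by positivity
    rw [e1, Real.log_mul (by positivity) (by positivity), Real.log_mul (by positivity)
      (by positivity), Real.log_mul (by positivity) (by positivity), Real.log_mul (by positivity)
      (by positivity), Real.log_pow, Real.log_pow, Real.log_mul h4 h2, Real.log_div h2 hk0.ne',
      Real.log_mul hb' h2, Real.log_pow, hc]
    push_cast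
    ring
  have hκs : Summable κ := by
    have := (summable_geometric_two).mul_left k
    refine this.congr fun l => ?_
    simp only [hκ, one_div, inv_pow]; rfl
  have hlog2 : Summable fun l => Real.log (T l) / 2 ^ l := by
    have h1 : Summable fun l : ℕ => (l : ℝ) ^ 1 * (1 / 2 : ℝ) ^ l :=
      summable_pow_mul_geometric_of_norm_lt_one 1 (by norm_num)
    have h2 := ((hsum.mul_left 2).add (summable_geometric_two.mul_left c)).add
      (h1.mul_left ((3 * (d + n) + 2) * Real.log 2))
    refine h2.congr fun l => ?_
    rw [hlogT, one_div, inv_pow]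
    field_simp
    ring
  refine ⟨G, ε, κ, fun l => Real.exp (-(Real.log (T l) / 2 ^ l)),
    fun l => Real.log (T l) / 2 ^ l + 8 * κ l, fun l => ⟨hG l, hε l, hκ0 l, hκ1 l,
    Real.exp_pos _, ?_, ?_, ?_, ?_, ?_⟩, ?_, hlog2.add (hκs.mul_left 8)⟩
  · have := Real.log_nonneg (hT1 l)
    rw [Real.exp_le_one_iff]
    have : 0 ≤ Real.log (T l) / 2 ^ l := by positivity
    linarith
  · intro P Q hQ hle hne
    refine hdiv l P Q hQ (hle.trans (le_of_eq ?_)) hne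
    push_cast
    ring
  · have h1 : Real.exp (-(Real.log (T l) / 2 ^ l)) ^ 2 ^ l = (T l)⁻¹ := by
      rw [← Real.exp_nat_mul]
      push_cast
      rw [mul_neg, mul_div_cancel₀ _ (by positivity), Real.exp_neg, Real.exp_log (hT0 l)]
    rw [h1]
    have hκl := hκ0 l
    have hGl := hG0 l
    have hKK : K ≤ K₁ := le_max_right _ _
    calc _ ≤ K₁ * G l ^ 2 * ((4 / κ l) ^ (d + n)) ^ 3 * (T l)⁻¹ / κ l := by
          have := (hT0 l)
          gcongr
      _ = b / 2 / 2 ^ l := by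
          simp only [hT]
          have : K₁ ≠ 0 := by linarith
          field_simp
  · have h1 : Real.exp (-(2 * κ l)) ≤ 1 - κ l := by
      rw [Real.exp_neg]
      have h2 := Real.add_one_le_exp (2 * κ l)
      have h3 := hκ0 l
      have h4 := hκ1 l
      rw [inv_le_comm₀ (Real.exp_pos _) (by linarith)]
      refine le_trans ?_ h2
      rw [inv_le_iff_one_le_mul₀ (by linarith)]
      nlinarith
    calc Real.exp (-(Real.log (T l) / 2 ^ l + 8 * κ l))
        = Real.exp (-(2 * κ l)) ^ 4 * Real.exp (-(Real.log (T l) / 2 ^ l)) := by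
          rw [← Real.exp_nat_mul, ← Real.exp_add]; congr 1; push_cast; ring
      _ ≤ _ := by gcongr
  · have := Real.log_nonneg (hT1 l)
    have := hκ0 l
    positivity
  · intro N
    have h1 : ∑ l ∈ Finset.range N, κ l ≤ r / 16 := by
      refine (hκs.sum_le_tsum _ fun l _ => (hκ0 l).le).trans ?_
      have h2 : κ = fun l => k * (1 / 2) ^ l := by
        funext l; simp only [hκ, one_div, inv_pow]; rfl
      rw [h2, tsum_mul_left, tsum_geometric_two]
      have : k ≤ r / 32 := min_le_right _ _
      linarith
    rw [Finset.sum_add_distrib, ← Finset.mul_sum, ← Finset.mul_sum]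
    linarith [hεs N]

section Limit

variable {ω : Fin d → ℝ} {Λ : Fin n → ℂ} {V Ψ₀ : Phase d n → Phase d n} {h₀ : Phase d n → ℂ}
  {r δ b r₀ δ₀ CV : ℝ} {L₀ : Fin d ⊕ Fin n}

/-- A sequence of approximate conjugacies of increasing orders on a common domain. -/
lemma exists_bState_seq (hS : BrjunoGammaOmega ω Λ) (hV : FieldBound V r₀ δ₀ CV) (hCV : 0 ≤ CV)
    (hs : BState ω Λ V r δ b 2 Ψ₀ h₀) (hr : 0 < r) (hδ : 0 < δ) (hb0 : 0 < b) (hb : b ≤ 1 / 4)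
    (hr₀ : r + 2 * b ≤ r₀) (hδ₀ : 2 * δ ≤ δ₀) (hL : sCoef ω Λ L₀ ≠ 0)
    (hL' : ∀ j, L₀ = Sum.inr j → ω = 0) :
    ∃ δ₁ > 0, δ₁ ≤ δ ∧ ∃ (Ψ : ℕ → Phase d n → Phase d n) (h : ℕ → Phase d n → ℂ),
      (∀ l, BState ω Λ V (r / 2) δ₁ (2 * b) (2 ^ l + 1) (Ψ l) (h l)) ∧
      ∀ l, ∀ Z ∈ domain d n (r / 2) δ₁, ‖Ψ (l + 1) Z - Ψ l Z‖ ≤ b / 2 / 2 ^ l * (1 + δ₁) ∧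
        ‖h (l + 1) Z - h l Z‖ ≤ b / 2 / 2 ^ l := by
  obtain ⟨G, ε, κ, σ, s, hpar, hloss, hsum⟩ :=
    exists_parameters hS (stepConst ω Λ L₀ CV) hb0 (by linarith) hr
  set R : ℕ → ℝ := fun l => r - ∑ i ∈ Finset.range l, (2 * ε i + 4 * κ i) with hR
  set D : ℕ → ℝ := fun l => δ * Real.exp (-∑ i ∈ Finset.range l, s i) with hD
  set B : ℕ → ℝ := fun l => 2 * b - b / 2 ^ l with hB
  have hRr : ∀ l, r / 2 ≤ R l := fun l => by have := hloss l; simp only [hR]; linarith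
  have hRle : ∀ l, R l ≤ r := fun l => by
    have : 0 ≤ ∑ i ∈ Finset.range l, (2 * ε i + 4 * κ i) := Finset.sum_nonneg fun i _ => by
      have := (hpar i).2.1; have := (hpar i).2.2.1; positivity
    simp only [hR]; linarith
  have hD0 : ∀ l, 0 < D l := fun l => by positivity
  have hDle : ∀ l, D l ≤ δ := fun l => by
    refine mul_le_of_le_one_right hδ.le ?_
    rw [Real.exp_le_one_iff, neg_nonpos]
    exact Finset.sum_nonneg fun i _ => (hpar i).2.2.2.2.2.2.2.2.2
  set δ₁ := δ * Real.exp (-∑' i, s i) with hδ₁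
  have hδ₁0 : 0 < δ₁ := by positivity
  have hδ₁D : ∀ l, δ₁ ≤ D l := fun l => by
    simp only [hD, hδ₁]
    gcongr
    exact hsum.sum_le_tsum _ fun i _ => (hpar i).2.2.2.2.2.2.2.2.2
  have hBb : ∀ l, B l ≤ 2 * b := fun l => by
    have : 0 < b / 2 ^ l := by positivity
    simp only [hB]; linarith
  have hB0 : ∀ l, 0 ≤ B l := fun l => by
    have : b / 2 ^ l ≤ b := div_le_self hb0.le (one_le_pow₀ one_le_two)
    simp only [hB]; linarith
  have hstep : ∀ (l : ℕ) (x : (Phase d n → Phase d n) × (Phase d n → ℂ)),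
      BState ω Λ V (R l) (D l) (B l) (2 ^ l + 1) x.1 x.2 →
      ∃ y : (Phase d n → Phase d n) × (Phase d n → ℂ),
        BState ω Λ V (R (l + 1)) (D (l + 1)) (B (l + 1)) (2 ^ (l + 1) + 1) y.1 y.2 ∧
        ∀ Z ∈ domain d n (r / 2) δ₁, ‖y.1 Z - x.1 Z‖ ≤ b / 2 / 2 ^ l * (1 + δ₁) ∧
          ‖y.2 Z - x.2 Z‖ ≤ b / 2 / 2 ^ l := by
    intro l x hx
    obtain ⟨hG, hε, hκ0, hκ, hσ0, hσ1, hdiv, hX, hexp, hs0⟩ := hpar l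
    have hR1 : R (l + 1) = R l - 2 * ε l - 4 * κ l := by
      simp only [hR, Finset.sum_range_succ]; ring
    have hD1 : D (l + 1) = Real.exp (-s l) * D l := by
      simp only [hD, Finset.sum_range_succ, neg_add, Real.exp_add]; ring
    have hB1 : B (l + 1) = B l + b / 2 / 2 ^ l := by
      simp only [hB, pow_succ]; field_simp; ring
    have hm1 : 2 ^ (l + 1) + 1 = 2 * (2 ^ l + 1) - 1 := by rw [pow_succ]; omega
    have h2 : 2 ≤ 2 ^ l + 1 := by have := Nat.one_le_two_pow (n := l); omega
    have hRpos : 0 < R l - 2 * ε l - 4 * κ l := by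
      rw [← hR1]; linarith [hRr (l + 1)]
    obtain ⟨Ψ', h', hst, g1, g2, g3, k1, k2, k3⟩ := hx.step (δ' := D (l + 1)) hV hCV (hD0 l) (hB0 l)
      (by linarith [hBb l]) (by linarith [hBb l, hRle l]) (by linarith [hDle l]) h2 hL hL' hG hε hκ0
      hκ hσ0 hσ1 hdiv hRpos (by rw [hD1]; exact mul_le_mul_of_nonneg_right hexp (hD0 l).le)
      (by simpa using hX)
    refine ⟨(Ψ', h'), ?_, fun Z hZ => ?_⟩
    · rw [hR1, hB1, hm1]; exact hst
    · rw [← hR1] at g1 g2 k1 k2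
      have hX0 : 0 ≤ b / 2 / 2 ^ l := by positivity
      have hZ' := domain_mono (hRr (l + 1)) le_rfl hZ
      have hR0 : 0 < R (l + 1) := by linarith [hRr (l + 1)]
      refine ⟨?_, ?_⟩
      · refine (norm_le_gn hδ₁0 _).trans ?_
        gcongr
        exact g2.gn_le hR0 hX0 g1 g3 hδ₁0 (hδ₁D _) hZ'
      · exact k2.norm_le hR0 hX0 k1 k3 (hD0 _) (domain_mono le_rfl (hδ₁D _) hZ')
  obtain ⟨x, -, hx⟩ := exists_seq (a := (Ψ₀, h₀)) (R := fun l x y =>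
        ∀ Z ∈ domain d n (r / 2) δ₁, ‖y.1 Z - x.1 Z‖ ≤ b / 2 / 2 ^ l * (1 + δ₁) ∧
          ‖y.2 Z - x.2 Z‖ ≤ b / 2 / 2 ^ l)
    (P := fun l x => BState ω Λ V (R l) (D l) (B l) (2 ^ l + 1) x.1 x.2)
    (by
      have e1 : R 0 = r := by simp [hR]
      have e2 : D 0 = δ := by simp [hD]
      have e3 : B 0 = b := by simp only [hB]; norm_num; ring
      simp only [e1, e2, e3]
      exact hs) hstep
  refine ⟨δ₁, hδ₁0, (hδ₁D 0).trans (hDle 0), fun l => (x l).1, fun l => (x l).2, fun l => ?_,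
    fun l => (hx l).2⟩
  have h := (hx l).1
  exact ⟨h.holo_map.mono (hRr l) (hδ₁D l), h.ord_map, h.bound_map.mono (hRr l) (hδ₁D l) (hBb l),
    h.holo_fun.mono (hRr l) (hδ₁D l), h.ord_fun, h.bound_fun.mono (hRr l) (hδ₁D l) (hBb l),
    fun Z hZ => h.LS_fun Z (domain_mono (hRr l) (hδ₁D l) hZ), h.conj⟩

/-- The limit of the iteration is a holomorphic conjugacy. -/
theorem exists_conjugacy (hS : BrjunoGammaOmega ω Λ) (hV : FieldBound V r₀ δ₀ CV) (hCV : 0 ≤ CV)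
    (hs : BState ω Λ V r δ b 2 Ψ₀ h₀) (hr : 0 < r) (hδ : 0 < δ) (hb0 : 0 < b) (hb : b ≤ 1 / 4)
    (hr₀ : r + 2 * b ≤ r₀) (hδ₀ : 2 * δ ≤ δ₀) (hL : sCoef ω Λ L₀ ≠ 0)
    (hL' : ∀ j, L₀ = Sum.inr j → ω = 0) :
    ∃ ρ > 0, ∃ (Ψ : Phase d n → Phase d n) (h : Phase d n → ℂ),
      Holo ρ ρ (fun Z => Ψ Z - Z) ∧ DBound ρ ρ (1 / 2) (fun Z => Ψ Z - Z) ∧ Holo ρ ρ h ∧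
      (∀ Z ∈ domain d n ρ ρ, LS ω Λ h Z = 0) ∧
      (∀ Z ∈ domain d n ρ ρ, Z.2 = 0 → Ψ Z = Z ∧ h Z = 0) ∧
      MapsTo Ψ (domain d n ρ ρ) (domain d n r₀ δ₀) ∧
      ∀ Z ∈ domain d n ρ ρ, Complex.exp (h Z) • V (Ψ Z) = fderiv ℂ Ψ Z (quasilinear ω Λ Z) := by
  obtain ⟨δ₁, hδ₁, hδ₁δ, Ψ, h, hst, hinc⟩ :=
    exists_bState_seq hS hV hCV hs hr hδ hb0 hb hr₀ hδ₀ hL hL'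
  have hsum : Summable fun l : ℕ => b / 2 / 2 ^ l := summable_geometric_two' b
  have hop := isOpen_domain (d := d) (n := n) (r / 2) δ₁
  have hr2 : 0 < r / 2 := by positivity
  have hb2 : 2 * b ≤ 1 / 2 := by linarith
  have hb20 : 0 ≤ 2 * b := by linarith
  have hrb : r / 2 + 2 * b ≤ r₀ := by linarith
  have hδδ : 2 * δ₁ ≤ δ₀ := by linarith
  obtain ⟨ψ, hψd, hψ⟩ := exists_tendsto_fderiv (f := fun l Z => Ψ l Z - Z) hop
    (hsum.mul_right (1 + δ₁)) (fun l => (hst l).holo_map.1) (fun l Z hZ => by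
      rw [show Ψ (l + 1) Z - Z - (Ψ l Z - Z) = Ψ (l + 1) Z - Ψ l Z by abel]
      exact (hinc l Z hZ).1)
  obtain ⟨η, hηd, hη⟩ := exists_tendsto_fderiv (f := h) hop hsum (fun l => (hst l).holo_fun.1)
    fun l Z hZ => (hinc l Z hZ).2
  have hψholo : Holo (r / 2) δ₁ ψ := ⟨hψd, fun Z hZ P =>
    tendsto_nhds_unique (hψ _ (shift_mem_domain hZ P)).1
      ((hψ Z hZ).1.congr fun l => ((hst l).holo_map.2 Z hZ P).symm)⟩
  have hηholo : Holo (r / 2) δ₁ η := ⟨hηd, fun Z hZ P =>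
    tendsto_nhds_unique (hη _ (shift_mem_domain hZ P)).1
      ((hη Z hZ).1.congr fun l => ((hst l).holo_fun.2 Z hZ P).symm)⟩
  have hgnc : ∀ δ' : ℝ, Continuous fun v : Phase d n => gn δ' v := fun δ' => by
    unfold gn; fun_prop
  have happ : ∀ (v : Phase d n), Continuous fun A : Phase d n →L[ℂ] Phase d n => A v := fun v =>
    (ContinuousLinearMap.apply ℂ (Phase d n) v).continuous
  have hψD : DBound (r / 2) δ₁ (2 * b) ψ := fun δ' h0 h1 Z hZ v => by
    have h2 := (hψ Z (domain_mono le_rfl h1 hZ)).2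
    exact le_of_tendsto' (((hgnc δ').tendsto _).comp (((happ v).tendsto _).comp h2)) fun l =>
      (hst l).bound_map δ' h0 h1 Z hZ v
  have hψb : ∀ Z ∈ domain d n (r / 2) δ₁, gn δ₁ (ψ Z) ≤ 2 * b := fun Z hZ =>
    le_of_tendsto' (((hgnc δ₁).tendsto _).comp (hψ Z hZ).1) fun l =>
      (hst l).bound_map.gn_le hr2 hb20 (hst l).holo_map ((hst l).ord_map.mono one_le_two) hδ₁ le_rfl
        hZ
  have hmaps : MapsTo (fun Z => ψ Z + Z) (domain d n (r / 2) δ₁) (domain d n r₀ δ₀) := by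
    intro Z hZ
    have h1 := (gn_le_iff_comp hδ₁ hb20).1 (hψb Z hZ)
    refine ⟨fun j => ?_, fun j => ?_⟩
    · have h2 := h1 (Sum.inl j)
      simp only [comp, Sum.elim_inl, wt, mul_one] at h2
      have h3 := Complex.abs_im_le_norm ((ψ Z).1 j)
      have h4 := hZ.1 j
      simp only [Prod.fst_add, Pi.add_apply, Complex.add_im]
      have h5 := abs_add_le ((ψ Z).1 j).im (Z.1 j).im
      linarith
    · have h2 := h1 (Sum.inr j)
      simp only [comp, Sum.elim_inr, wt] at h2
      have h4 := hZ.2 j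
      simp only [Prod.snd_add, Pi.add_apply]
      have h5 := norm_add_le ((ψ Z).2 j) (Z.2 j)
      nlinarith
  set κ := min (r / 4) (1 / 2) with hκ
  have hκ0 : 0 < κ := by positivity
  have hκ1 : κ ≤ 1 / 2 := min_le_right _ _
  have hκr : κ ≤ r / 4 := min_le_left _ _
  have hVg : Germ V := hV.holo.germ (by linarith) (by linarith)
  have herr : ∀ Z ∈ domain d n (r / 4) (δ₁ / 4),
      Tendsto (fun l => err ω Λ V (Ψ l) (h l) Z) atTop (𝓝 0) := by
    intro Z hZ
    set C := 6 * CV + 2 * (‖ω‖ + ‖Λ‖) with hC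
    have hC0 : 0 ≤ C := by positivity
    have hbd : ∀ l L, ‖comp (err ω Λ V (Ψ l) (h l) Z) L‖ ≤
        C * (1 + δ₁) * (1 / 2) ^ (2 ^ l + 1) * (4 / κ) ^ (d + n) := by
      intro l L
      have h2 : 2 ≤ 2 ^ l + 1 := by have := Nat.one_le_two_pow (n := l); omega
      have ho := (hst l).conj.ord_err hVg ((hst l).near hr2 hδ₁) ((hst l).holo_fun.germ hr2 hδ₁) h2
        hL
      have hh := (hst l).holo_err hV hr2 hδ₁ hb20 hb2 hrb hδδ
      refine Holo.norm_le_of_ord (u := fun Z => comp (err ω Λ V (Ψ l) (h l) Z) L) (r := r / 2)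
        (δ := δ₁) hr2 hδ₁ (hh.comp_of L) (fun W hW => ?_) (ho.comp_of L) hκ0 (by linarith)
        (by norm_num) (by norm_num) (domain_mono (by linarith) (by nlinarith) hZ)
      have h3 := (gn_le_iff_comp hδ₁ hC0).1
        ((hst l).gn_err_le hV hr2 hδ₁ hb20 hb2 hrb hδδ hW) L
      refine h3.trans ?_
      gcongr
      rcases L with j | j <;> simp only [wt, Sum.elim_inl, Sum.elim_inr] <;> linarith
    have hlim : Tendsto (fun l : ℕ => C * (1 + δ₁) * (1 / 2) ^ (2 ^ l + 1) * (4 / κ) ^ (d + n)) atTop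
        (𝓝 0) := by
      have h1 : Tendsto (fun l : ℕ => 2 ^ l + 1) atTop atTop :=
        tendsto_atTop_mono (fun l => (Nat.lt_two_pow_self (n := l)).le.trans (Nat.le_succ _))
          tendsto_id
      have h2 := (tendsto_pow_atTop_nhds_zero_of_lt_one (r := (1 / 2 : ℝ)) (by norm_num)
        (by norm_num)).comp h1
      have h3 := (h2.const_mul (C * (1 + δ₁))).mul_const ((4 / κ) ^ (d + n))
      simpa using h3
    have hcomp : ∀ L, Tendsto (fun l => comp (err ω Λ V (Ψ l) (h l) Z) L) atTop (𝓝 0) := fun L =>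
      squeeze_zero_norm (fun l => hbd l L) hlim
    rw [show (0 : Phase d n) = ((0 : Fin d → ℂ), (0 : Fin n → ℂ)) from rfl, nhds_prod_eq]
    exact (tendsto_pi_nhds.2 fun j => hcomp (Sum.inl j)).prodMk
      (tendsto_pi_nhds.2 fun j => hcomp (Sum.inr j))
  set ρ := min (r / 4) (δ₁ / 4) with hρ
  have hρ0 : 0 < ρ := by positivity
  have hρr : ρ ≤ r / 4 := min_le_left _ _
  have hρδ : ρ ≤ δ₁ / 4 := min_le_right _ _
  have hρr' : ρ ≤ r / 2 := by linarith
  have hρδ' : ρ ≤ δ₁ := by linarith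
  have hsub := domain_mono (d := d) (n := n) hρr' hρδ'
  have e1 : (fun Z => ψ Z + Z - Z) = ψ := by funext Z; abel
  refine ⟨ρ, hρ0, fun Z => ψ Z + Z, η, ?_, ?_, hηholo.mono hρr' hρδ', ?_, ?_,
    hmaps.mono_left hsub, ?_⟩
  · rw [e1]; exact hψholo.mono hρr' hρδ'
  · rw [e1]; exact hψD.mono hρr' hρδ' hb2
  · intro Z hZ
    refine tendsto_nhds_unique ?_ tendsto_const_nhds (f := fun _ : ℕ => (0 : ℂ)) (l := atTop)
    have h1 := (((ContinuousLinearMap.apply ℂ ℂ (quasilinear ω Λ Z)).continuous.tendsto _).comp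
      (hη Z (hsub hZ)).2)
    exact h1.congr fun l => (hst l).LS_fun Z (hsub hZ)
  · intro Z hZ hZ2
    have h1 : ∀ l, Ψ l Z - Z = 0 := fun l => by
      have h2 : ∀ L, comp (Ψ l Z - Z) L = 0 := fun L =>
        Holo.eq_zero_of_snd (u := fun Z => comp (Ψ l Z - Z) L) hr2 hδ₁ ((hst l).holo_map.comp_of L)
          (((hst l).ord_map.mono one_le_two).comp_of L) (hsub hZ) hZ2
      exact Prod.ext (funext fun j => h2 (Sum.inl j)) (funext fun j => h2 (Sum.inr j))
    have h3 : ψ Z = 0 := tendsto_nhds_unique (hψ Z (hsub hZ)).1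
      (tendsto_const_nhds.congr fun l => (h1 l).symm)
    have h4 : η Z = 0 := tendsto_nhds_unique (hη Z (hsub hZ)).1
      (tendsto_const_nhds.congr fun l =>
        (Holo.eq_zero_of_snd hr2 hδ₁ (hst l).holo_fun (hst l).ord_fun (hsub hZ) hZ2).symm)
    simp [h3, h4]
  · intro Z hZ
    have hZ1 := hsub hZ
    have hfd : fderiv ℂ (fun Z => ψ Z + Z) Z =
        ContinuousLinearMap.id ℂ (Phase d n) + fderiv ℂ ψ Z := by
      have := ((hψd.differentiableAt (hop.mem_nhds hZ1)).hasFDerivAt.add (hasFDerivAt_id Z)).fderiv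
      rw [add_comm]
      exact this
    have hΨlim : Tendsto (fun l => Ψ l Z) atTop (𝓝 (ψ Z + Z)) :=
      ((hψ Z hZ1).1.add_const Z).congr fun l => by abel
    have hVlim := ((hV.holo.1.differentiableAt
      ((isOpen_domain r₀ δ₀).mem_nhds (hmaps hZ1))).continuousAt.tendsto).comp hΨlim
    have h1 := ((Complex.continuous_exp.tendsto _).comp (hη Z hZ1).1).smul hVlim
    have h2 := ((happ (quasilinear ω Λ Z)).tendsto _).comp ((hψ Z hZ1).2.const_add
      (ContinuousLinearMap.id ℂ (Phase d n)))
    have h3 := tendsto_nhds_unique (herr Z (domain_mono hρr hρδ hZ)) ((h1.sub h2).congr fun l => by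
      simp only [Function.comp_apply, err, LS, ((hst l).hasFDerivAt hZ1).fderiv])
    rw [hfd]
    exact (sub_eq_zero.1 h3.symm)

end Limit

/-! ### Reduction to maps tangent to the identity -/

lemma nearId_id : NearId fun Z : Phase d n => Z :=
  ⟨by simpa using Germ.const 0, by simpa using ord_zero_fun⟩

/-- Germs of diffeomorphisms preserving the torus. -/
structure GermDiffeo (Φ : Phase d n → Phase d n) : Prop where
  germ : Germ fun Z => Φ Z - Z
  tendsto : Tendsto Φ (nT d n) (nT d n)
  isUnit : ∀ᶠ Z in nT d n, IsUnit (fderiv ℂ Φ Z)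

lemma eventually_hasFDerivAt_of_germ {Φ : Phase d n → Phase d n} (h : Germ fun Z => Φ Z - Z) :
    ∀ᶠ Z in nT d n,
      HasFDerivAt Φ (ContinuousLinearMap.id ℂ _ + fderiv ℂ (fun Z => Φ Z - Z) Z) Z := by
  filter_upwards [h.eventually_differentiableAt] with Z hZ
  have := (hasFDerivAt_id Z).add hZ.hasFDerivAt
  simpa [Pi.add_def] using this

lemma oEq_LS_of_germ (ω : Fin d → ℝ) (Λ : Fin n → ℂ) {Φ Ψ : Phase d n → Phase d n} {m : ℕ}
    (hΦ : Germ fun Z => Φ Z - Z) (hΨ : Germ fun Z => Ψ Z - Z) (h : OEq m Φ Ψ) :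
    OEq m (LS ω Λ Φ) (LS ω Λ Ψ) := by
  have hg : Germ fun Z => Φ Z - Ψ Z := by simpa using hΦ.sub hΨ
  refine (Ord.LS_phase ω Λ hg h).congr ?_
  filter_upwards [eventually_hasFDerivAt_of_germ hΦ, eventually_hasFDerivAt_of_germ hΨ]
    with Z h1 h2
  exact (LS_sub ω Λ h1.differentiableAt h2.differentiableAt).symm

namespace GermDiffeo

variable {Φ Θ G : Phase d n → Phase d n} {w : Phase d n → Phase d n} {m : ℕ}

lemma eventually_differentiableAt (h : GermDiffeo Φ) : ∀ᶠ Z in nT d n, DifferentiableAt ℂ Φ Z :=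
  (eventually_hasFDerivAt_of_germ h.germ).mono fun _ hZ => hZ.differentiableAt

lemma germ_fderiv (h : GermDiffeo Φ) : Germ (fderiv ℂ Φ) :=
  ((Germ.const _).add h.germ.fderiv).congr
    ((eventually_hasFDerivAt_of_germ h.germ).mono fun _ hZ => hZ.fderiv)

lemma germ_inverse (h : GermDiffeo Φ) : Germ fun Z => Ring.inverse (fderiv ℂ Φ Z) :=
  h.germ_fderiv.inverse h.isUnit

lemma eventually_fderiv_comp (h : GermDiffeo Φ) (hΘ : NearId Θ) : ∀ᶠ Z in nT d n,
    fderiv ℂ (fun Z => Φ (Θ Z)) Z = (fderiv ℂ Φ (Θ Z)).comp (fderiv ℂ Θ Z) := by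
  filter_upwards [hΘ.tendsto.eventually h.eventually_differentiableAt,
    hΘ.eventually_differentiableAt] with Z h1 h2
  exact fderiv_comp Z h1 h2

lemma comp_nearId (h : GermDiffeo Φ) (hΘ : NearId Θ) : GermDiffeo fun Z => Φ (Θ Z) := by
  refine ⟨?_, h.tendsto.comp hΘ.tendsto, ?_⟩
  · have := (h.germ.comp_map hΘ.tendsto hΘ.germ).add hΘ.germ
    simpa using this
  · filter_upwards [h.eventually_fderiv_comp hΘ, hΘ.tendsto.eventually h.isUnit,
      hΘ.eventually_isUnit] with Z h1 h2 h3
    rw [h1]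
    exact h2.mul h3

lemma increment₂ (h : GermDiffeo G) (hw : Ord m w) (hm : 1 ≤ m) :
    OEq (2 * m) (fun Z => G (Z + w Z)) (fun Z => G Z + fderiv ℂ G Z (w Z)) := by
  refine (Ord.increment₂ h.germ hw hm).congr ?_
  filter_upwards [eventually_hasFDerivAt_of_germ h.germ] with Z hZ
  rw [hZ.fderiv]
  simp only [FunLike.coe_add, Pi.add_apply, ContinuousLinearMap.coe_id', id_eq]
  abel

/-- A map which agrees with `G` to order two factors through `G` to any order. -/
lemma exists_factor (h : GermDiffeo G) (hΦ : Germ fun Z => Φ Z - Z) (h2 : OEq 2 Φ G) (K : ℕ) :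
    ∃ Θ, NearId Θ ∧ OEq K (fun Z => G (Θ Z)) Φ := by
  induction K with
  | zero =>
    exact ⟨fun Z => Z, nearId_id, h2.symm.mono (by norm_num)⟩
  | succ K ih =>
    by_cases hK : K + 1 ≤ 2
    · exact ⟨fun Z => Z, nearId_id, h2.symm.mono hK⟩
    · obtain ⟨Θ, hΘ, ho⟩ := ih
      have hG := h.comp_nearId hΘ
      set w : Phase d n → Phase d n :=
        fun Z => Ring.inverse (fderiv ℂ (fun Z => G (Θ Z)) Z) (Φ Z - G (Θ Z)) with hw
      have hgd : Germ fun Z => Φ Z - G (Θ Z) := by simpa using hΦ.sub hG.germ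
      have hwg : Germ w := hG.germ_inverse.clm_apply hgd
      have hwo : Ord K w := hG.germ_inverse.clm_ord ho.symm
      have hT : NearId fun Z => Z + w Z := NearId.id_add hwg (hwo.mono (by omega))
      refine ⟨fun Z => Θ (Z + w Z), hΘ.comp hT, ?_⟩
      refine ((hG.increment₂ hwo (by omega)).trans (OEq.of_eventuallyEq ?_)).mono (by omega)
      filter_upwards [hG.isUnit] with Z hZ
      simp only [hw]
      rw [apply_inverse_apply hZ]
      abel

end GermDiffeo

section PullBack

variable {ω : Fin d → ℝ} {Λ : Fin n → ℂ} {V Φ Φ₁ : Phase d n → Phase d n} {k k₁ : Phase d n → ℂ}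

/-- The pull back of a vector field. -/
def pullField (Φ V : Phase d n → Phase d n) (Z : Phase d n) : Phase d n :=
  Ring.inverse (fderiv ℂ Φ Z) (V (Φ Z))

lemma GermDiffeo.germ_pullField (h : GermDiffeo Φ₁) (hV : Germ V) : Germ (pullField Φ₁ V) :=
  h.germ_inverse.clm_apply (hV.comp_map h.tendsto h.germ)

lemma GermDiffeo.exists_formalConj (h : GermDiffeo Φ₁) (hV : Germ V) {K : ℕ} (hK : 2 ≤ K)
    (hΦ : Germ fun Z => Φ Z - Z) (h2 : OEq 2 Φ Φ₁) (hk : Germ k) (hkS : LS ω Λ k =ᶠ[nT d n] 0)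
    (hc : OEq K (LS ω Λ Φ) fun Z => Complex.exp (k Z) • V (Φ Z)) :
    ∃ Θ, FormalConj ω Λ (pullField Φ₁ V) K Θ k := by
  obtain ⟨Θ, hΘ, ho⟩ := h.exists_factor hΦ h2 K
  have hG := h.comp_nearId hΘ
  refine ⟨Θ, hΘ, hk, hkS, ?_⟩
  have h1 : OEq K (LS ω Λ fun Z => Φ₁ (Θ Z)) (LS ω Λ Φ) := oEq_LS_of_germ ω Λ hG.germ hΦ ho
  have h3 : OEq K (fun Z => V (Φ Z)) (fun Z => V (Φ₁ (Θ Z))) :=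
    Ord.comp_sub hV hG.tendsto (by omega) ho.symm
  have h4 := (h1.trans hc).trans (h3.smul_left hk.exp)
  have hinv : Germ fun Z => Ring.inverse (fderiv ℂ Φ₁ (Θ Z)) :=
    h.germ_inverse.comp_map hΘ.tendsto hΘ.germ
  refine (h4.clm_left hinv).congr ?_
  filter_upwards [h.eventually_fderiv_comp hΘ, hΘ.tendsto.eventually h.isUnit] with Z h5 h6
  simp only [LS, h5, pullField, map_smul]
  rw [ContinuousLinearMap.comp_apply, inverse_apply_apply h6]

lemma GermDiffeo.conjugable (h : GermDiffeo Φ₁) (hV : Germ V)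
    (hc : ∀ K, ∃ Φ k, Germ (fun Z => Φ Z - Z) ∧ OEq 2 Φ Φ₁ ∧ Germ k ∧ LS ω Λ k =ᶠ[nT d n] 0 ∧
      OEq K (LS ω Λ Φ) (fun Z => Complex.exp (k Z) • V (Φ Z)) ∧
      Ord 2 fun Z => (k Z - k₁ Z) • quasilinear ω Λ Z) :
    Conjugable ω Λ (pullField Φ₁ V) 2 (fun Z => Z) k₁ := by
  intro K
  obtain ⟨Φ, k, h1, h2, h3, h4, h5, h6⟩ := hc (max K 2)
  obtain ⟨Θ, hΘ⟩ := h.exists_formalConj hV (le_max_right _ _) h1 h2 h3 h4 h5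
  exact ⟨Θ, k, ⟨hΘ.near, hΘ.germ, hΘ.LS_eq, hΘ.conj.mono (le_max_left _ _)⟩, hΘ.near.ord, h6⟩

lemma Conjugable.ord_snd (hc : Conjugable ω Λ V 2 (fun Z => Z) k) (hV : Germ V) (hk : Germ k)
    {L₀ : Fin d ⊕ Fin n} (hL : sCoef ω Λ L₀ ≠ 0) : Ord 1 fun Z => (V Z).2 := by
  have h1 := (hc.ord_err hV nearId_id hk le_rfl hL).mono one_le_two
  have h2 : Ord 1 fun Z : Phase d n => (quasilinear ω Λ Z).2 := by
    refine (TorusNF.ord_snd (d := d) (n := n)).clm_const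
      (ContinuousLinearMap.pi fun j => Λ j • ContinuousLinearMap.proj j) |>.congr ?_
    exact Eventually.of_forall fun Z => funext fun j => rfl
  have h3 : Ord 1 fun Z => Complex.exp (-k Z) • ((err ω Λ V (fun Z => Z) k Z).2
      + (quasilinear ω Λ Z).2) := hk.neg.exp.smul_ord (h1.snd.add h2)
  refine h3.congr (Eventually.of_forall fun Z => ?_)
  simp only [err, LS_id, Prod.snd_sub, Prod.smul_snd, sub_add_cancel, smul_smul]
  rw [← Complex.exp_add, neg_add_cancel, Complex.exp_zero, one_smul]

/-- A holomorphic conjugacy, for a vector field which is conjugate to a multiple of `S` to any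
order. -/
theorem exists_conjugacy_of_conjugable (hS : BrjunoGammaOmega ω Λ) (hV : Germ V) (hk : Germ k)
    (hk1 : Ord 1 k) (hkS : LS ω Λ k =ᶠ[nT d n] 0) (hc : Conjugable ω Λ V 2 (fun Z => Z) k)
    {L₀ : Fin d ⊕ Fin n} (hL : sCoef ω Λ L₀ ≠ 0) (hL' : ∀ j, L₀ = Sum.inr j → ω = 0) {ρ₀ : ℝ}
    (hρ₀ : 0 < ρ₀) :
    ∃ ρ > 0, ∃ (Ψ : Phase d n → Phase d n) (h : Phase d n → ℂ),
      Holo ρ ρ (fun Z => Ψ Z - Z) ∧ DBound ρ ρ (1 / 2) (fun Z => Ψ Z - Z) ∧ Holo ρ ρ h ∧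
      (∀ Z ∈ domain d n ρ ρ, LS ω Λ h Z = 0) ∧
      (∀ Z ∈ domain d n ρ ρ, Z.2 = 0 → Ψ Z = Z ∧ h Z = 0) ∧
      MapsTo Ψ (domain d n ρ ρ) (domain d n ρ₀ ρ₀) ∧
      ∀ Z ∈ domain d n ρ ρ, Complex.exp (h Z) • V (Ψ Z) = fderiv ℂ Ψ Z (quasilinear ω Λ Z) := by
  obtain ⟨C₁, hC₁, ρ₁, hρ₁, hb₁⟩ := hV.ord_zero.exists_bound
  obtain ⟨C₂, hC₂, ρ₂, hρ₂, hb₂⟩ := (hc.ord_snd hV hk hL).exists_bound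
  obtain ⟨C₃, hC₃, ρ₃, hρ₃, hb₃⟩ := hk1.exists_bound
  obtain ⟨ρ₄, hρ₄, hV4, hk4⟩ := hV.common hk
  obtain ⟨ρ₅, hρ₅, hLS⟩ := eventually_nT.1 hkS
  set R := min (min ρ₀ ρ₁) (min (min ρ₂ ρ₃) (min ρ₄ ρ₅)) with hR
  have hR0 : 0 < R := by positivity
  have e0 : R ≤ ρ₀ := (min_le_left _ _).trans (min_le_left _ _)
  have e1 : R ≤ ρ₁ := (min_le_left _ _).trans (min_le_right _ _)
  have e2 : R ≤ ρ₂ := (min_le_right _ _).trans ((min_le_left _ _).trans (min_le_left _ _))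
  have e3 : R ≤ ρ₃ := (min_le_right _ _).trans ((min_le_left _ _).trans (min_le_right _ _))
  have e4 : R ≤ ρ₄ := (min_le_right _ _).trans ((min_le_right _ _).trans (min_le_left _ _))
  have e5 : R ≤ ρ₅ := (min_le_right _ _).trans ((min_le_right _ _).trans (min_le_right _ _))
  have hF : FieldBound V R R (C₁ + C₂) := by
    refine ⟨hV4.mono e4 e4, fun δ' h0 h1 Z hZ => ?_⟩
    have hZR := domain_mono (d := d) (n := n) le_rfl h1 hZ
    rw [gn_le_iff h0]
    have hZ2 : ‖Z.2‖ ≤ δ' := (pi_norm_le_iff_of_nonneg h0.le).2 fun j => (hZ.2 j).le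
    refine ⟨?_, ?_⟩
    · have h2 := hb₁ Z (domain_mono e1 e1 hZR)
      rw [pow_zero, mul_one] at h2
      linarith [norm_fst_le (V Z)]
    · have h2 := hb₂ Z (domain_mono e2 e2 hZR)
      rw [pow_one] at h2
      refine h2.trans ?_
      have : 0 ≤ C₁ * δ' := by positivity
      nlinarith
  set κ := min (1 / 2) (R / 4) with hκ
  have hκ0 : 0 < κ := by positivity
  have hκ1 : κ ≤ 1 / 2 := min_le_left _ _
  have hκR : κ ≤ R / 4 := min_le_right _ _
  set A := 8 * (4 / κ) ^ (d + n) / κ with hA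
  have hA0 : 0 < A := by positivity
  set b := min (1 / 4) (R / 4) with hb
  have hb0 : 0 < b := by positivity
  set δ := min R (b / (C₃ * A)) with hδ
  have hδ0 : 0 < δ := by positivity
  have hδR : δ ≤ R := min_le_left _ _
  have hδb : C₃ * δ * A ≤ b := by
    have : δ ≤ b / (C₃ * A) := min_le_right _ _
    rw [le_div_iff₀ (by positivity)] at this
    linarith
  have hkh : Holo R δ k := hk4.mono e4 (hδR.trans e4)
  have hkb : ∀ Z ∈ domain d n R δ, ‖k Z‖ ≤ C₃ * δ := fun Z hZ => by
    have h1 := hb₃ Z (domain_mono e3 (hδR.trans e3) hZ)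
    rw [pow_one] at h1
    refine h1.trans ?_
    gcongr
    exact (pi_norm_le_iff_of_nonneg hδ0.le).2 fun j => (hZ.2 j).le
  have hsb : SBound (R / 2) (δ / 4) b k := by
    have h4 : δ / 4 ≤ (1 - κ) * ((1 - κ) * δ) := by
      have h5 : 1 / 2 ≤ 1 - κ := by linarith
      calc δ / 4 = 1 / 2 * (1 / 2 * δ) := by ring
        _ ≤ _ := by gcongr
    refine (hkh.sBound hR0 hδ0 hk1 hkb hκ0 hκ1).mono (by linarith) h4 ?_
    calc _ = C₃ * δ * A := by rw [hA]; ring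
      _ ≤ b := hδb
  have hst : BState ω Λ V (R / 2) (δ / 4) b 2 (fun Z => Z) k := by
    refine ⟨?_, nearId_id.ord, ?_, hkh.mono (by linarith) (by linarith), hk1, hsb, fun Z hZ => ?_, hc⟩
    · simpa using Holo.const (0 : Phase d n)
    · intro δ' h0 h1 Z hZ v
      have : fderiv ℂ (fun Z : Phase d n => Z - Z) Z v = 0 := by simp
      rw [this]
      have h2 := gn_nonneg δ' v
      have : gn δ' (0 : Phase d n) = 0 := by simp [gn]
      rw [this]
      positivity
    · exact hLS Z (domain_mono (by linarith) (by linarith) hZ)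
  obtain ⟨ρ, hρ, Ψ, h, g1, g2, g3, g4, g5, g6, g7⟩ := exists_conjugacy hS hF (by positivity) hst
    (by positivity) (by positivity) hb0 (min_le_left _ _)
    (by have : b ≤ R / 4 := min_le_right _ _; linarith) (by linarith) hL hL'
  exact ⟨ρ, hρ, Ψ, h, g1, g2, g3, g4, g5, g6.mono_right (domain_mono e0 e0), g7⟩

end PullBack

/-! ### From conjugacies of germs to normalizations -/

lemma Germ.exists_lipschitz {E : Type*} [NormedAddCommGroup E] [NormedSpace ℂ E]
    [FiniteDimensional ℂ E] {u : Phase d n → E} (hu : Germ u) :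
    ∃ ρ > 0, ∃ C > 0, ∀ Z ∈ domain d n ρ ρ, ∀ W ∈ domain d n ρ ρ, ‖u W - u Z‖ ≤ C * ‖W - Z‖ := by
  obtain ⟨C, hC, ρ₁, hρ₁, hb⟩ := hu.fderiv.ord_zero.exists_bound
  obtain ⟨ρ₂, hρ₂, hd⟩ := eventually_nT.1 hu.eventually_differentiableAt
  refine ⟨min ρ₁ ρ₂, by positivity, C, hC, fun Z hZ W hW => ?_⟩
  refine (convex_domain (min ρ₁ ρ₂) (min ρ₁ ρ₂)).norm_image_sub_le_of_norm_fderiv_le (𝕜 := ℂ)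
    (fun U hU => hd U (domain_mono (min_le_right _ _) (min_le_right _ _) hU)) (fun U hU => ?_) hZ hW
  simpa using hb U (domain_mono (min_le_left _ _) (min_le_left _ _) hU)

lemma Germ.ord_one {E : Type*} [NormedAddCommGroup E] [NormedSpace ℂ E]
    [FiniteDimensional ℂ E] {u : Phase d n → E} (hu : Germ u)
    (h : ∀ᶠ Z in nT d n, Z.2 = 0 → u Z = 0) : Ord 1 u := by
  obtain ⟨ρ, hρ, C, hC, hb⟩ := hu.exists_lipschitz
  obtain ⟨ρ₂, hρ₂, h0⟩ := eventually_nT.1 h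
  refine Ord.of_bound (C := C) ?_
  filter_upwards [domain_mem_nT hρ hρ, domain_mem_nT hρ₂ hρ₂] with Z hZ hZ2
  have h1 := hb _ (fst_mem_domain hρ hZ) Z hZ
  rw [h0 _ (fst_mem_domain hρ₂ hZ2) rfl, sub_zero] at h1
  have h2 : ‖Z - ((Z.1, 0) : Phase d n)‖ = ‖Z.2‖ := by
    have : Z - ((Z.1, 0) : Phase d n) = (0, Z.2) := by ext <;> simp
    rw [this, Prod.norm_mk, norm_zero, max_eq_right (norm_nonneg _)]
  rwa [h2, ← pow_one ‖Z.2‖] at h1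

lemma tendsto_nT_of_mapsTo_torus {Φ : Phase d n → Phase d n} (hΦ : Germ fun Z => Φ Z - Z)
    (ht : MapsTo Φ (torus d n) (torus d n)) : Tendsto Φ (nT d n) (nT d n) := by
  obtain ⟨ρ, hρ, C, hC, hb⟩ := hΦ.exists_lipschitz
  rw [tendsto_nT_iff]
  have h0 : Tendsto (fun Z : Phase d n => (C + 1) * ‖transverse Z‖) (nT d n) (𝓝 0) := by
    have h1 : Tendsto (fun Z : Phase d n => ‖transverse Z‖) (nT d n) (𝓝 0) := by
      have := (tendsto_comap (f := transverse (d := d) (n := n)) (x := 𝓝 0)).norm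
      rwa [norm_zero] at this
    simpa using h1.const_mul (C + 1)
  refine squeeze_zero_norm' ?_ h0
  filter_upwards [domain_mem_nT hρ hρ] with Z hZ
  set W : Phase d n := (fun j => ((Z.1 j).re : ℂ), 0) with hW
  have hWt : W ∈ torus d n := ⟨fun j => by simp [hW], rfl⟩
  have hWd : W ∈ domain d n ρ ρ := ⟨fun j => by simp [hW, hρ], fun j => by simp [hW, hρ]⟩
  have h1 := hb W hWd Z hZ
  have h2 : transverse (Φ W) = 0 := by
    have h3 := ht hWt
    exact Prod.ext (funext fun j => h3.1 j) h3.2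
  have h4 : Φ Z = Φ W + ((Φ Z - Z - (Φ W - W)) + (Z - W)) := by abel
  have h5 : ‖Z - W‖ ≤ ‖transverse Z‖ := by
    rw [Prod.norm_def, Prod.norm_def]
    refine max_le_max ?_ (by simp [hW, transverse])
    rw [pi_norm_le_iff_of_nonneg (norm_nonneg _)]
    intro j
    have h6 : (Z - W).1 j = ((Z.1 j).im : ℂ) * Complex.I := by
      have := Complex.re_add_im (Z.1 j)
      simp only [hW, Prod.fst_sub, Pi.sub_apply]
      rw [sub_eq_iff_eq_add, add_comm]
      exact this.symm
    rw [h6, norm_mul, Complex.norm_I, mul_one, Complex.norm_real]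
    exact norm_le_pi_norm (transverse Z).1 j
  rw [h4, transverse_add, h2, zero_add]
  refine (norm_transverse_le _).trans ((norm_add_le _ _).trans ?_)
  nlinarith

lemma HasCoef.isDevelopment {u : Phase d n → ℂ} {f : Series d n} (h : HasCoef u f) :
    ∃ ρ > 0, ∀ ρ', 0 < ρ' → ρ' ≤ ρ → IsDevelopment ρ' ρ' u f := by
  obtain ⟨ρ, hρ, C, hf, hu⟩ := h
  refine ⟨ρ / 2, by positivity, fun ρ' h0 h1 => ⟨?_, fun Z hZ => ?_⟩⟩
  · set κ := min 1 ρ / 2 with hκ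
    have hκ0 : 0 < κ := by positivity
    have hκ1 : κ ≤ 1 / 2 := by have := min_le_left 1 ρ; rw [hκ]; linarith
    have hκρ : κ ≤ ρ / 2 := by have := min_le_right 1 ρ; rw [hκ]; linarith
    obtain ⟨A, hA, -⟩ := hasSum_geom_idx d n hκ0 (by linarith)
    refine Summable.tsum_ofReal_lt_top (Summable.of_nonneg_of_le (fun p => by positivity)
      (fun p => ?_) (hA.summable.mul_left C))
    calc ‖f p‖ * Real.exp (ρ' * absP p.1) * ρ' ^ degQ p.2
        ≤ ‖f p‖ * Real.exp ((ρ + -κ) * absP p.1) * (ρ * (1 - κ)) ^ degQ p.2 := by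
          gcongr
          · linarith
          · nlinarith
      _ = (‖f p‖ * Real.exp (ρ * absP p.1) * ρ ^ degQ p.2) *
          (Real.exp (-κ * absP p.1) * (1 - κ) ^ degQ p.2) := by
          rw [add_mul, Real.exp_add, mul_pow]; ring
      _ ≤ C * (Real.exp (-κ * absP p.1) * (1 - κ) ^ degQ p.2) := by
          have : 0 ≤ 1 - κ := by linarith
          gcongr
          exact hf p
  · have hZ' := domain_mono (d := d) (n := n) (r' := ρ) (δ' := ρ) (by linarith) (by linarith) hZ
    rw [← hu Z hZ']
    exact hf.hasSum hρ hZ'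

lemma majorized_of_wnorm_lt_top {r δ : ℝ} {f : Series d n} (h : wnorm r δ f < ⊤) :
    Majorized r δ (wnorm r δ f).toReal f := fun p => by
  rw [← ENNReal.ofReal_le_iff_le_toReal h.ne]
  exact ENNReal.le_tsum (f := fun p : Idx d n =>
    ENNReal.ofReal (‖f p‖ * Real.exp (r * absP p.1) * δ ^ degQ p.2)) p

lemma IsDevelopment.hasCoef {r δ : ℝ} {u : Phase d n → ℂ} {f : Series d n} (hr : 0 < r)
    (hδ : 0 < δ) (h : IsDevelopment r δ u f) : HasCoef u f :=
  Holo.hasCoef hr hδ (majorized_of_wnorm_lt_top h.1) fun Z hZ => (h.2 Z hZ).tsum_eq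

section

variable {ω : Fin d → ℝ} {Λ : Fin n → ℂ}

lemma isResonant_smulS {f : Series d n} (h : ∀ p, div ω Λ p * f p = 0) :
    IsResonant ω Λ (smulS ω Λ f) := by
  refine ⟨fun j p hp => ?_, fun j p hp => ?_⟩
  · exact (mul_eq_zero.1 (h p)).resolve_right (right_ne_zero_of_mul hp)
  · by_cases hj : p.2 j = 0
    · simp [smulS, hj] at hp
    · simp only [smulS, Sum.elim_inr, hj, if_false] at hp
      have h1 := (mul_eq_zero.1 (h _)).resolve_right (right_ne_zero_of_mul hp)
      have h2 := div_add_single ω Λ (p.1, p.2 - Pi.single j 1) j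
      rw [h1, sub_single_add hj, zero_add] at h2
      change div ω Λ p - Λ j = 0
      rw [h2, sub_self]

lemma mono_zero (Z : Phase d n) : mono 0 Z = 1 := by simp [mono]

lemma hasCoef_const (c : ℂ) : HasCoef (fun _ : Phase d n => c) (Pi.single 0 c) := by
  refine Holo.hasCoef (r := 1) (δ := 1) (C := ‖c‖) one_pos one_pos (fun p => ?_) fun Z _ => ?_
  · by_cases hp : p = 0
    · subst hp
      simp [absP, degQ]
    · simp [hp]
  · rw [eval, tsum_eq_single 0 fun p hp => by simp [hp], mono_zero]
    simp

lemma exp_neg_smul_smul {E : Type*} [AddCommGroup E] [Module ℂ E] (z : ℂ) (v : E) :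
    Complex.exp (-z) • Complex.exp z • v = v := by
  rw [smul_smul, ← Complex.exp_add, neg_add_cancel, Complex.exp_zero, one_smul]

/-- A holomorphic conjugacy of the pull back of `V` to a multiple of `S` normalizes `V`. -/
lemma normalizable_of_conjugacy {V Φ Ψ : Phase d n → Phase d n} {h : Phase d n → ℂ}
    {r δ ρ ρ₁ : ℝ} (hΦ : IsTorusDiffeo ρ₁ Φ)
    (hm : MapsTo Φ (domain d n ρ₁ ρ₁) (domain d n r δ)) (hρ : 0 < ρ)
    (hΨ : Holo ρ ρ fun Z => Ψ Z - Z) (hΨD : DBound ρ ρ (1 / 2) fun Z => Ψ Z - Z)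
    (hh : Holo ρ ρ h) (hhS : ∀ Z ∈ domain d n ρ ρ, LS ω Λ h Z = 0)
    (h0 : ∀ Z ∈ domain d n ρ ρ, Z.2 = 0 → Ψ Z = Z ∧ h Z = 0)
    (hΨm : MapsTo Ψ (domain d n ρ ρ) (domain d n ρ₁ ρ₁))
    (hc : ∀ Z ∈ domain d n ρ ρ,
      Complex.exp (h Z) • pullField Φ V (Ψ Z) = fderiv ℂ Ψ Z (quasilinear ω Λ Z)) :
    HolomorphicallyNormalizable ω Λ r δ V := by
  have hbg : Germ fun Z => Complex.exp (-h Z) := (hh.germ hρ hρ).neg.exp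
  have hcoef := hbg.hasCoef
  set β := coef fun Z => Complex.exp (-h Z) with hβ
  obtain ⟨ρ₂, hρ₂, hdev⟩ := hcoef.isDevelopment
  have hΨd : ∀ Z ∈ domain d n ρ ρ, HasFDerivAt Ψ
      (ContinuousLinearMap.id ℂ _ + fderiv ℂ (fun Z => Ψ Z - Z) Z) Z := fun Z hZ => by
    have := (hasFDerivAt_id Z).add
      (hΨ.1.differentiableAt ((isOpen_domain ρ ρ).mem_nhds hZ)).hasFDerivAt
    simpa [Pi.add_def] using this
  have hΦd : ∀ Z ∈ domain d n ρ₁ ρ₁, DifferentiableAt ℂ Φ Z := fun Z hZ =>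
    hΦ.holomorphic.differentiableAt ((isOpen_domain ρ₁ ρ₁).mem_nhds hZ)
  have hΨe : ∀ Z ∈ domain d n ρ ρ, ∀ P, Ψ (shift P Z) = shift P (Ψ Z) := fun Z hZ P => by
    have h1 : Ψ (shift P Z) - shift P Z = Ψ Z - Z := hΨ.2 Z hZ P
    rw [sub_eq_iff_eq_add] at h1
    rw [h1, shift_eq_add, shift_eq_add]
    abel
  have hcomp : ∀ Z ∈ domain d n ρ ρ, fderiv ℂ (fun Z => Φ (Ψ Z)) Z =
      (fderiv ℂ Φ (Ψ Z)).comp (fderiv ℂ Ψ Z) := fun Z hZ =>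
    fderiv_comp Z (hΦd _ (hΨm hZ)) (hΨd Z hZ).differentiableAt
  have hΨinj : ∀ Z ∈ domain d n ρ ρ, ∀ W ∈ domain d n ρ ρ, Ψ Z = Ψ W → Z = W := by
    intro Z hZ W hW hE
    have h1 := hΨD.gn_sub_le (by norm_num) hΨ.1 hρ le_rfl hZ hW
    have h2 : Ψ W - W - (Ψ Z - Z) = -(W - Z) := by rw [hE]; abel
    rw [h2, gn_neg] at h1
    have h3 := eq_zero_of_gn_le hρ (v := W - Z) (by linarith)
    exact (sub_eq_zero.1 h3).symm
  have hΨbij : ∀ Z ∈ domain d n ρ ρ, Function.Bijective (fderiv ℂ Ψ Z) := by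
    intro Z hZ
    have hinj : Function.Injective (fderiv ℂ Ψ Z) := by
      rw [injective_iff_map_eq_zero]
      intro v hv
      have h1 := hΨD ρ hρ le_rfl Z hZ v
      rw [(hΨd Z hZ).fderiv] at hv
      simp only [FunLike.coe_add, Pi.add_apply, ContinuousLinearMap.coe_id', id_eq] at hv
      rw [eq_neg_of_add_eq_zero_right hv, gn_neg] at h1
      exact eq_zero_of_gn_le hρ (by linarith)
    exact ⟨hinj, (LinearMap.injective_iff_surjective (f := (fderiv ℂ Ψ Z).toLinearMap)).1 hinj⟩
  set R := min ρ ρ₂ with hR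
  have hR0 : 0 < R := by positivity
  have hRρ : R ≤ ρ := min_le_left _ _
  have hsub := domain_mono (d := d) (n := n) hRρ hRρ
  refine ⟨R, hR0, fun Z => Φ (Ψ Z), fun Z => Complex.exp (-h Z), β, ⟨?_, ?_, ?_, ?_, ?_⟩, ?_,
    hdev R hR0 (min_le_right _ _), ?_, ?_, ?_⟩
  · exact fun Z hZ => ((hΦd _ (hΨm (hsub hZ))).comp Z
      (hΨd Z (hsub hZ)).differentiableAt).differentiableWithinAt
  · intro Z hZ P
    rw [hΨe Z (hsub hZ), hΦ.equivariant _ (hΨm (hsub hZ))]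
  · intro Z hZ Z' hZ' P hE
    obtain ⟨P', hP'⟩ := hΦ.injective _ (hΨm (hsub hZ)) _ (hΨm (hsub hZ')) P hE
    rw [← hΨe Z (hsub hZ)] at hP'
    exact ⟨P', hΨinj _ (hsub hZ') _ (shift_mem_domain (hsub hZ) P') hP'⟩
  · intro Z hZ
    rw [hcomp Z (hsub hZ)]
    exact (hΦ.deriv_bijective _ (hΨm (hsub hZ))).comp (hΨbij Z (hsub hZ))
  · intro Z hZ
    have hZd : Z ∈ domain d n ρ ρ := ⟨fun j => by simp [hZ.1 j, hρ], fun j => by simp [hZ.2, hρ]⟩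
    simp only
    rw [(h0 Z hZd hZ.2).1]
    exact hΦ.torus_mapsTo hZ
  · exact fun Z hZ => hm (hΨm (hsub hZ))
  · have h1 : Ord 1 fun Z => Complex.exp (-h Z) - 1 := by
      refine (hbg.sub (Germ.const 1)).ord_one ?_
      filter_upwards [domain_mem_nT hρ hρ] with Z hZ hZ2
      simp [(h0 Z hZ hZ2).2]
    have h2 := (hcoef.sub (hasCoef_const 1)).hasOrder h1 0 (by simp [degQ])
    simpa [sub_eq_zero] using h2
  · refine isResonant_smulS fun p => ?_
    have h1 : LS ω Λ (fun Z => Complex.exp (-h Z)) =ᶠ[nT d n] fun _ => 0 := by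
      filter_upwards [domain_mem_nT hρ hρ] with Z hZ
      have h2 := ((hh.1.differentiableAt ((isOpen_domain ρ ρ).mem_nhds hZ)).hasFDerivAt.neg).cexp
      have h3 := hhS Z hZ
      simp only [LS] at h3 ⊢
      rw [show (fun Z => Complex.exp (-h Z)) = fun Z => Complex.exp ((-h) Z) from rfl, h2.fderiv]
      simp [h3]
    exact congrFun ((hcoef.LS ω Λ).unique (hasCoef_zero.congr h1)) p
  · intro Z hZ
    have hZ' := hsub hZ
    have hu : IsUnit (fderiv ℂ Φ (Ψ Z)) :=
      ContinuousLinearMap.isUnit_iff_bijective.2 (hΦ.deriv_bijective _ (hΨm hZ'))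
    rw [hcomp Z hZ', ContinuousLinearMap.comp_apply, map_smul, ← hc Z hZ', exp_neg_smul_smul,
      pullField, apply_inverse_apply hu]

/-- A vector field with conjugacies to multiples of `S` to any order is normalizable. -/
theorem normalizable_of_approximations (hS : BrjunoGammaOmega ω Λ) {V Φ₁ : Phase d n → Phase d n}
    {k₁ : Phase d n → ℂ} {r δ ρ₁ : ℝ} (hV : Germ V) (hρ₁ : 0 < ρ₁) (hΦ : IsTorusDiffeo ρ₁ Φ₁)
    (hm : MapsTo Φ₁ (domain d n ρ₁ ρ₁) (domain d n r δ)) (hk : Germ k₁) (hk1 : Ord 1 k₁)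
    (hkS : LS ω Λ k₁ =ᶠ[nT d n] 0)
    (hc : ∀ K, ∃ Φ k, Germ (fun Z => Φ Z - Z) ∧ OEq 2 Φ Φ₁ ∧ Germ k ∧ LS ω Λ k =ᶠ[nT d n] 0 ∧
      OEq K (LS ω Λ Φ) (fun Z => Complex.exp (k Z) • V (Φ Z)) ∧
      Ord 2 fun Z => (k Z - k₁ Z) • quasilinear ω Λ Z)
    {L₀ : Fin d ⊕ Fin n} (hL : sCoef ω Λ L₀ ≠ 0) (hL' : ∀ j, L₀ = Sum.inr j → ω = 0) :
    HolomorphicallyNormalizable ω Λ r δ V := by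
  have hΦg : Germ fun Z => Φ₁ Z - Z := by
    refine ⟨ρ₁, hρ₁, hΦ.holomorphic.sub differentiableOn_id, fun Z hZ P => ?_⟩
    simp only
    rw [hΦ.equivariant Z hZ, shift_eq_add, shift_eq_add]
    abel
  have hG : GermDiffeo Φ₁ := by
    refine ⟨hΦg, tendsto_nT_of_mapsTo_torus hΦg hΦ.torus_mapsTo, ?_⟩
    filter_upwards [domain_mem_nT hρ₁ hρ₁] with Z hZ
    exact ContinuousLinearMap.isUnit_iff_bijective.2 (hΦ.deriv_bijective Z hZ)
  obtain ⟨ρ, hρ, Ψ, h, g1, g2, g3, g4, g5, g6, g7⟩ := exists_conjugacy_of_conjugable hS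
    (hG.germ_pullField hV) hk hk1 hkS (hG.conjugable hV hc) hL hL' hρ₁
  exact normalizable_of_conjugacy hΦ hm hρ g1 g2 g3 g4 g5 g6 g7

end

/-! ### Products of series -/

open scoped Classical in
/-- The terms of the Cauchy product. -/
def cauchyTerm (f g : Series d n) (r p : Idx d n) : ℂ := if p.2 ≤ r.2 then f p * g (r - p) else 0

lemma mul_eq_tsum {f g : Series d n} {r : Idx d n} (hs : Summable (cauchyTerm f g r)) :
    mul f g r = ∑' p, cauchyTerm f g r p := by
  have h1 : Summable fun x : (Fin n → ℕ) × (Fin d → ℤ) => cauchyTerm f g r x.swap :=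
    (Equiv.prodComm _ _).summable_iff.2 hs
  rw [← (Equiv.prodComm (Fin n → ℕ) (Fin d → ℤ)).tsum_eq (cauchyTerm f g r)]
  change _ = ∑' x : (Fin n → ℕ) × (Fin d → ℤ), cauchyTerm f g r x.swap
  rw [h1.tsum_prod, tsum_eq_sum (s := Finset.Iic r.2), mul]
  · refine Finset.sum_congr rfl fun Q hQ => tsum_congr fun P => ?_
    rw [Finset.mem_Iic] at hQ
    rw [cauchyTerm, if_pos (show (Prod.swap (Q, P)).2 ≤ r.2 from hQ)]
    rfl
  · intro Q hQ
    rw [Finset.mem_Iic] at hQ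
    exact (tsum_congr fun P => if_neg (show ¬ (Prod.swap (Q, P)).2 ≤ r.2 from hQ)).trans tsum_zero

lemma mul_congr {f g g' : Series d n} {p : Idx d n}
    (h : ∀ q : Idx d n, degQ q.2 ≤ degQ p.2 → g q = g' q) : mul f g p = mul f g' p := by
  refine Finset.sum_congr rfl fun Q _ => tsum_congr fun P => ?_
  rw [h]
  exact Finset.sum_le_sum fun j _ => Nat.sub_le _ _

/-- The injection `(p, q) ↦ (p + q, p)`. -/
def addFst (x : Idx d n × Idx d n) : Idx d n × Idx d n := (x.1 + x.2, x.1)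

lemma addFst_injective : Function.Injective (addFst (d := d) (n := n)) := by
  rintro ⟨p, q⟩ ⟨p', q'⟩ h
  simp only [addFst, Prod.mk.injEq] at h
  obtain ⟨h1, rfl⟩ := h
  rw [add_right_inj] at h1
  rw [h1]

lemma add_sub_self_idx (p q : Idx d n) : p + q - p = q := by
  refine Prod.ext (by simp) (funext fun j => ?_)
  simp

lemma exists_addFst {r p : Idx d n} (h : p.2 ≤ r.2) : addFst (p, r - p) = (r, p) := by
  refine Prod.ext (Prod.ext (by simp [addFst]) (funext fun j => ?_)) rfl
  have : p.2 j ≤ r.2 j := h j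
  simp only [addFst, Prod.snd_add, Prod.snd_sub, Pi.add_apply, Pi.sub_apply]
  omega

lemma le_add_snd (p q : Idx d n) : p.2 ≤ (p + q).2 := fun _ => Nat.le_add_right _ _

lemma mono_add (p q : Idx d n) (Z : Phase d n) : mono (p + q) Z = mono p Z * mono q Z := by
  simp only [mono, Prod.fst_add, Prod.snd_add, Pi.add_apply, Int.cast_add, add_mul,
    Finset.sum_add_distrib, mul_add, Complex.exp_add, pow_add, Finset.prod_mul_distrib]
  ring

lemma eq_zero_of_notMem_range {F : Idx d n × Idx d n → ℂ} (hF : ∀ r p, ¬ p.2 ≤ r.2 → F (r, p) = 0)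
    (x : Idx d n × Idx d n) (hx : x ∉ range (addFst (d := d) (n := n))) : F x = 0 :=
  hF x.1 x.2 fun h => hx ⟨_, exists_addFst h⟩

lemma cauchyTerm_of_not_le {f g : Series d n} {r p : Idx d n} (h : ¬ p.2 ≤ r.2) :
    cauchyTerm f g r p = 0 := if_neg h

lemma cauchyTerm_add (f g : Series d n) (p q : Idx d n) : cauchyTerm f g (p + q) p = f p * g q := by
  rw [cauchyTerm, if_pos (le_add_snd p q), add_sub_self_idx]

lemma hasSum_cauchyTerm_mono {f g : Series d n} {Z : Phase d n}
    (hf : Summable fun p => f p * mono p Z) (hg : Summable fun p => g p * mono p Z) :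
    HasSum (fun x : Idx d n × Idx d n => cauchyTerm f g x.1 x.2 * mono x.1 Z)
      ((∑' p, f p * mono p Z) * ∑' p, g p * mono p Z) := by
  have h0 : Summable fun x : Idx d n × Idx d n => (f x.1 * mono x.1 Z) * (g x.2 * mono x.2 Z) :=
    Summable.of_norm_bounded (g := fun x : Idx d n × Idx d n => ‖f x.1 * mono x.1 Z‖ *
      ‖g x.2 * mono x.2 Z‖) (hf.norm.mul_of_nonneg hg.norm (fun _ => norm_nonneg _)
      fun _ => norm_nonneg _) fun x => norm_mul_le _ _
  have h1 := hf.hasSum.mul hg.hasSum h0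
  have h2 : (fun x : Idx d n × Idx d n => (f x.1 * mono x.1 Z) * (g x.2 * mono x.2 Z)) =
      (fun x : Idx d n × Idx d n => cauchyTerm f g x.1 x.2 * mono x.1 Z) ∘ addFst := by
    funext x
    simp only [Function.comp_apply, addFst, cauchyTerm_add, mono_add]
    ring
  rw [h2] at h1
  refine (addFst_injective.hasSum_iff (eq_zero_of_notMem_range fun r p h => ?_)).1 h1
  simp only [cauchyTerm_of_not_le h, zero_mul]

open scoped Classical in
/-- Series whose coefficients are summable in `P`, locally uniformly in `Q`. -/
def LocSummable (f : Series d n) : Prop :=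
  ∀ q : Fin n → ℕ, Summable fun p : Idx d n => if p.2 ≤ q then ‖f p‖ else 0

/-- Series whose coefficients are bounded in `P`, locally uniformly in `Q`. -/
def LocBounded (f : Series d n) : Prop :=
  ∀ q : Fin n → ℕ, ∃ C, ∀ p : Idx d n, p.2 ≤ q → ‖f p‖ ≤ C

lemma LocSummable.bounded {f : Series d n} (hf : LocSummable f) : LocBounded f := fun q => by
  classical
  refine ⟨∑' p : Idx d n, if p.2 ≤ q then ‖f p‖ else 0, fun p hp => ?_⟩
  have := (hf q).le_tsum p fun x _ => by split_ifs <;> positivity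
  rwa [if_pos hp] at this

lemma IsFormal.locBounded {f : Series d n} (hf : IsFormal f) : LocBounded f := fun q => by
  have h1 : ∀ Q, ∃ C, ∀ P, ‖f (P, Q)‖ ≤ C := fun Q =>
    ⟨√(∑' P, ‖f (P, Q)‖ ^ 2), fun P => Real.le_sqrt_of_sq_le
      ((hf Q).le_tsum P fun _ _ => by positivity)⟩
  choose C hC using h1
  refine ⟨∑ Q ∈ Finset.Iic q, |C Q|, fun p hp => (hC p.2 p.1).trans ((le_abs_self _).trans ?_)⟩
  exact Finset.single_le_sum (f := fun Q => |C Q|) (fun _ _ => abs_nonneg _) (Finset.mem_Iic.2 hp)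

lemma sub_snd_le (r p : Idx d n) : (r - p).2 ≤ r.2 := fun _ => Nat.sub_le _ _

lemma summable_cauchyTerm {f g : Series d n} (hf : LocSummable f) (hg : LocBounded g)
    (r : Idx d n) : Summable (cauchyTerm f g r) := by
  obtain ⟨C, hC⟩ := hg r.2
  refine Summable.of_norm_bounded ((hf r.2).mul_right C) fun p => ?_
  rw [cauchyTerm]
  split_ifs with h
  · rw [norm_mul]
    gcongr
    exact hC _ (sub_snd_le r p)
  · simp

lemma mul_sum_right {ι : Type*} (s : Finset ι) {f : Series d n} {g : ι → Series d n}
    (hf : LocSummable f) (hg : ∀ i, LocBounded (g i)) (p : Idx d n) :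
    mul f (fun q => ∑ i ∈ s, g i q) p = ∑ i ∈ s, mul f (g i) p := by
  have h1 : ∀ q, cauchyTerm f (fun q => ∑ i ∈ s, g i q) p q = ∑ i ∈ s, cauchyTerm f (g i) p q := by
    intro q
    simp only [cauchyTerm]
    split_ifs
    · rw [Finset.mul_sum]
    · simp
  have h2 : ∀ i ∈ s, Summable (cauchyTerm f (g i) p) := fun i _ => summable_cauchyTerm hf (hg i) p
  rw [mul_eq_tsum ((summable_sum h2).congr fun q => (h1 q).symm), tsum_congr h1,
    Summable.tsum_finsetSum h2]
  exact Finset.sum_congr rfl fun i hi => (mul_eq_tsum (h2 i hi)).symm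

lemma mul_sum_left {ι : Type*} (s : Finset ι) {f : ι → Series d n} {g : Series d n}
    (hf : ∀ i, LocSummable (f i)) (hg : LocBounded g) (p : Idx d n) :
    mul (fun q => ∑ i ∈ s, f i q) g p = ∑ i ∈ s, mul (f i) g p := by
  have h1 : ∀ q, cauchyTerm (fun q => ∑ i ∈ s, f i q) g p q = ∑ i ∈ s, cauchyTerm (f i) g p q := by
    intro q
    simp only [cauchyTerm]
    split_ifs
    · rw [Finset.sum_mul]
    · simp
  have h2 : ∀ i ∈ s, Summable (cauchyTerm (f i) g p) := fun i _ => summable_cauchyTerm (hf i) hg p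
  rw [mul_eq_tsum ((summable_sum h2).congr fun q => (h1 q).symm), tsum_congr h1,
    Summable.tsum_finsetSum h2]
  exact Finset.sum_congr rfl fun i hi => (mul_eq_tsum (h2 i hi)).symm

lemma single_mul (c : ℂ) (g : Series d n) (p : Idx d n) : mul (Pi.single 0 c) g p = c * g p := by
  have h1 : ∀ q, q ≠ 0 → cauchyTerm (Pi.single 0 c) g p q = 0 := fun q hq => by
    simp [cauchyTerm, hq]
  rw [mul_eq_tsum (summable_of_ne_finset_zero (s := {0}) fun q hq => h1 q (by simpa using hq)),
    tsum_eq_single 0 h1, cauchyTerm, if_pos (by exact fun _ => Nat.zero_le _)]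
  simp

/-- Associativity of the product, for a locally bounded last factor. -/
lemma mul_assoc_series {f g h : Series d n} (hf : LocSummable f) (hg : LocSummable g)
    (hh : LocBounded h) (p : Idx d n) : mul f (mul g h) p = mul (mul f g) h p := by
  classical
  set T : Idx d n × Idx d n → ℂ := fun x =>
    if (x.1 + x.2).2 ≤ p.2 then f x.1 * g x.2 * h (p - (x.1 + x.2)) else 0 with hT
  obtain ⟨C, hC⟩ := hh p.2
  have hC0 : 0 ≤ C := (norm_nonneg _).trans (hC 0 fun _ => Nat.zero_le _)
  have hTs : Summable T := by
    refine Summable.of_norm_bounded (((hf p.2).mul_of_nonneg (hg p.2)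
      (fun q => by dsimp only; split_ifs <;> simp)
      (fun q => by dsimp only; split_ifs <;> simp)).mul_right C) fun x => ?_
    by_cases h1 : (x.1 + x.2).2 ≤ p.2
    · have h2 : x.1.2 ≤ p.2 := (le_add_snd x.1 x.2).trans h1
      have h3 : x.2.2 ≤ p.2 := fun j => (Nat.le_add_left _ _).trans (h1 j)
      simp only [hT, h1, h2, h3, if_true]
      rw [norm_mul, norm_mul]
      gcongr
      exact hC _ (sub_snd_le _ _)
    · simp only [hT, h1, if_false, norm_zero]
      exact mul_nonneg (mul_nonneg (by split_ifs <;> simp) (by split_ifs <;> simp)) hC0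
  -- the left-hand side
  have hL : ∀ x, cauchyTerm f (mul g h) p x = ∑' y, T (x, y) := by
    intro x
    by_cases hx : x.2 ≤ p.2
    · rw [cauchyTerm, if_pos hx, mul_eq_tsum (summable_cauchyTerm hg hh _), ← tsum_mul_left]
      refine tsum_congr fun y => ?_
      have h1 : y.2 ≤ (p - x).2 ↔ (x + y).2 ≤ p.2 := by
        refine forall_congr' fun j => ?_
        have : x.2 j ≤ p.2 j := hx j
        simp only [Prod.snd_sub, Prod.snd_add, Pi.sub_apply, Pi.add_apply]
        omega
      simp only [cauchyTerm, hT, h1]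
      split_ifs
      · rw [mul_assoc, show p - x - y = p - (x + y) from
          Prod.ext (sub_sub _ _ _) (funext fun j => Nat.sub_sub _ _ _)]
      · simp
    · rw [cauchyTerm_of_not_le hx]
      refine ((tsum_congr fun y => ?_).trans tsum_zero).symm
      exact if_neg fun h1 => hx ((le_add_snd x y).trans h1)
  have hLs : Summable (cauchyTerm f (mul g h) p) := hTs.prod.congr fun x => (hL x).symm
  -- the right-hand side
  set U : Idx d n × Idx d n → ℂ := fun x =>
    if x.1.2 ≤ p.2 then cauchyTerm f g x.1 x.2 * h (p - x.1) else 0 with hU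
  have hU0 : ∀ x ∉ range (addFst (d := d) (n := n)), U x = 0 :=
    eq_zero_of_notMem_range fun r q hq => by simp [hU, cauchyTerm_of_not_le hq]
  have hUT : ∀ x, U (addFst x) = T x := fun x => by
    simp only [hU, hT, addFst, cauchyTerm_add]
  have hUs : Summable U :=
    (addFst_injective.summable_iff hU0).1 (hTs.congr fun x => (hUT x).symm)
  have hR : ∀ z, cauchyTerm (mul f g) h p z = ∑' x, U (z, x) := by
    intro z
    by_cases hz : z.2 ≤ p.2
    · rw [cauchyTerm, if_pos hz, mul_eq_tsum (summable_cauchyTerm hf hg.bounded _),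
        ← tsum_mul_right]
      exact tsum_congr fun x => by simp only [hU, hz, if_true]
    · rw [cauchyTerm_of_not_le hz]
      exact ((tsum_congr fun x => by simp only [hU, hz, if_false]).trans tsum_zero).symm
  have hRs : Summable (cauchyTerm (mul f g) h p) := hUs.prod.congr fun z => (hR z).symm
  rw [mul_eq_tsum hLs, mul_eq_tsum hRs, tsum_congr hL, tsum_congr hR, ← hTs.tsum_prod,
    ← hUs.tsum_prod, ← addFst_injective.tsum_eq (Function.support_subset_iff'.2 hU0)]
  exact tsum_congr fun x => (hUT x).symm

lemma summable_of_wnorm_lt_top {r δ : ℝ} {f : Series d n} (hδ : 0 ≤ δ) (h : wnorm r δ f < ⊤) :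
    Summable fun p : Idx d n => ‖f p‖ * Real.exp (r * absP p.1) * δ ^ degQ p.2 := by
  refine (ENNReal.summable_toReal h.ne).congr fun p => ENNReal.toReal_ofReal (by positivity)

lemma HasCoef.exists_summable {u : Phase d n → ℂ} {f : Series d n} (h : HasCoef u f) :
    ∃ ρ > 0, ∀ ρ', 0 < ρ' → ρ' ≤ ρ →
      Summable fun p : Idx d n => ‖f p‖ * Real.exp (ρ' * absP p.1) * ρ' ^ degQ p.2 := by
  obtain ⟨ρ, hρ, h⟩ := h.isDevelopment
  exact ⟨ρ, hρ, fun ρ' h0 h1 => summable_of_wnorm_lt_top h0.le (h ρ' h0 h1).1⟩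

lemma degQ_mono {Q Q' : Fin n → ℕ} (h : Q ≤ Q') : degQ Q ≤ degQ Q' :=
  Finset.sum_le_sum fun j _ => h j

lemma HasCoef.locSummable {u : Phase d n → ℂ} {f : Series d n} (h : HasCoef u f) :
    LocSummable f := fun q => by
  classical
  obtain ⟨ρ, hρ, h⟩ := h.exists_summable
  have hs := h (min ρ 1) (by positivity) (min_le_left _ _)
  set t := min ρ 1 with ht
  have ht0 : 0 < t := by positivity
  have ht1 : t ≤ 1 := min_le_right _ _
  refine Summable.of_nonneg_of_le (fun p => by split_ifs <;> positivity) (fun p => ?_)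
    (hs.mul_right (t ^ degQ q)⁻¹)
  split_ifs with hp
  · rw [← div_eq_mul_inv, le_div_iff₀ (by positivity)]
    have h1 : t ^ degQ q ≤ t ^ degQ p.2 := pow_le_pow_of_le_one ht0.le ht1 (degQ_mono hp)
    have h2 : 1 ≤ Real.exp (t * absP p.1) := Real.one_le_exp (by positivity)
    calc ‖f p‖ * t ^ degQ q ≤ ‖f p‖ * 1 * t ^ degQ p.2 := by rw [mul_one]; gcongr
      _ ≤ _ := by gcongr
  · positivity

lemma absP_add_le (P P' : Fin d → ℤ) : absP (P + P') ≤ absP P + absP P' := by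
  rw [absP, absP, absP, ← Finset.sum_add_distrib]
  exact Finset.sum_le_sum fun j _ => Int.natAbs_add_le _ _

lemma degQ_add (Q Q' : Fin n → ℕ) : degQ (Q + Q') = degQ Q + degQ Q' := Finset.sum_add_distrib

lemma HasCoef.mul {u v : Phase d n → ℂ} {f g : Series d n} (hu : HasCoef u f) (hv : HasCoef v g) :
    HasCoef (fun Z => u Z * v Z) (TorusNF.mul f g) := by
  have hfs := hu.locSummable
  have hgs := hv.locSummable
  obtain ⟨ρ₁, hρ₁, hf⟩ := hu.exists_summable
  obtain ⟨ρ₂, hρ₂, hg⟩ := hv.exists_summable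
  obtain ⟨ρ₃, hρ₃, hfe⟩ := eventually_nT.1 hu.eventually_eval
  obtain ⟨ρ₄, hρ₄, hge⟩ := eventually_nT.1 hv.eventually_eval
  set ρ := min (min ρ₁ ρ₂) (min ρ₃ ρ₄) with hρ
  have hρ0 : 0 < ρ := by positivity
  have e1 : ρ ≤ ρ₁ := (min_le_left _ _).trans (min_le_left _ _)
  have e2 : ρ ≤ ρ₂ := (min_le_left _ _).trans (min_le_right _ _)
  have e3 : ρ ≤ ρ₃ := (min_le_right _ _).trans (min_le_left _ _)
  have e4 : ρ ≤ ρ₄ := (min_le_right _ _).trans (min_le_right _ _)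
  replace hf := hf ρ hρ0 e1
  replace hg := hg ρ hρ0 e2
  set B := ∑' p : Idx d n, ‖g p‖ * Real.exp (ρ * absP p.1) * ρ ^ degQ p.2 with hB
  have hgB : ∀ p, ‖g p‖ * Real.exp (ρ * absP p.1) * ρ ^ degQ p.2 ≤ B := fun p =>
    hg.le_tsum p fun _ _ => by positivity
  have hB0 : 0 ≤ B := le_trans (by positivity) (hgB 0)
  refine Holo.hasCoef (C := (∑' p : Idx d n, ‖f p‖ * Real.exp (ρ * absP p.1) * ρ ^ degQ p.2) * B)
    hρ0 hρ0 (fun r => ?_) fun Z hZ => ?_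
  · rw [mul_eq_tsum (summable_cauchyTerm hfs hgs.bounded r), mul_assoc]
    set w := Real.exp (ρ * absP r.1) * ρ ^ degQ r.2 with hw
    have hw0 : 0 ≤ w := by positivity
    have hterm : ∀ p, ‖cauchyTerm f g r p‖ * w ≤
        ‖f p‖ * Real.exp (ρ * absP p.1) * ρ ^ degQ p.2 * B := fun p => by
      by_cases hp : p.2 ≤ r.2
      · obtain ⟨q, hq⟩ : ∃ q, r = p + q := ⟨r - p, (congrArg Prod.fst (exists_addFst hp)).symm⟩
        have hwle : w ≤ (Real.exp (ρ * absP p.1) * ρ ^ degQ p.2) *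
            (Real.exp (ρ * absP q.1) * ρ ^ degQ q.2) := by
          rw [hw, hq, Prod.snd_add, degQ_add, pow_add, mul_mul_mul_comm, ← Real.exp_add, ← mul_add]
          gcongr
          exact_mod_cast absP_add_le p.1 q.1
        rw [hq, cauchyTerm_add, norm_mul]
        calc ‖f p‖ * ‖g q‖ * w ≤ ‖f p‖ * ‖g q‖ * ((Real.exp (ρ * absP p.1) * ρ ^ degQ p.2) *
            (Real.exp (ρ * absP q.1) * ρ ^ degQ q.2)) := by gcongr
          _ = ‖f p‖ * Real.exp (ρ * absP p.1) * ρ ^ degQ p.2 *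
            (‖g q‖ * Real.exp (ρ * absP q.1) * ρ ^ degQ q.2) := by ring
          _ ≤ _ := by gcongr; exact hgB q
      · rw [cauchyTerm_of_not_le hp, norm_zero, zero_mul]
        positivity
    have hs := (summable_cauchyTerm hfs hgs.bounded r).norm
    calc ‖∑' p, cauchyTerm f g r p‖ * w ≤ (∑' p, ‖cauchyTerm f g r p‖) * w := by
          gcongr
          exact norm_tsum_le_tsum_norm hs
      _ = ∑' p, ‖cauchyTerm f g r p‖ * w := (tsum_mul_right).symm
      _ ≤ ∑' p : Idx d n, ‖f p‖ * Real.exp (ρ * absP p.1) * ρ ^ degQ p.2 * B :=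
          (hs.mul_right w).tsum_le_tsum hterm (hf.mul_right B)
      _ = _ := tsum_mul_right
  · have h1 := hfe Z (domain_mono e3 e3 hZ)
    have h2 := hge Z (domain_mono e4 e4 hZ)
    have h3 := hasSum_cauchyTerm_mono h1.summable h2.summable
    rw [h1.tsum_eq, h2.tsum_eq] at h3
    have h4 : ∀ r, HasSum (fun p => cauchyTerm f g r p * TorusNF.mono r Z)
        (TorusNF.mul f g r * TorusNF.mono r Z) := fun r => by
      have hs := summable_cauchyTerm hfs hgs.bounded r
      rw [mul_eq_tsum hs]
      exact hs.hasSum.mul_right (TorusNF.mono r Z)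
    have h5 : HasSum (fun r => TorusNF.mul f g r * TorusNF.mono r Z) (u Z * v Z) :=
      h3.prod_fiberwise h4
    exact h5.tsum_eq

/-! ### Pull back of vector fields and formal series -/

/-- The standard basis of the phase space. -/
def eV (L : Fin d ⊕ Fin n) : Phase d n :=
  Sum.elim (fun j => (Pi.single j 1, 0)) (fun j => (0, Pi.single j 1)) L

lemma comp_eV (L L' : Fin d ⊕ Fin n) : comp (eV L') L = if L = L' then 1 else 0 := by
  rcases L with i | i <;> rcases L' with j | j <;> simp [comp, eV, Pi.single_apply]

lemma eq_sum_eV (v : Phase d n) : v = ∑ L, comp v L • eV L := by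
  rw [Fintype.sum_sum_type]
  refine Prod.ext (funext fun i => ?_) (funext fun i => ?_)
  · simp [comp, eV, Pi.single_apply, Prod.fst_sum, Finset.sum_apply]
  · simp [comp, eV, Pi.single_apply, Prod.snd_sum, Finset.sum_apply]

lemma comp_clm_apply (A : Phase d n →L[ℂ] Phase d n) (v : Phase d n) (L : Fin d ⊕ Fin n) :
    comp (A v) L = ∑ L', comp (A (eV L')) L * comp v L' := by
  conv_lhs => rw [eq_sum_eV v, map_sum, ← compCLM_apply, map_sum]
  refine Finset.sum_congr rfl fun L' _ => ?_
  rw [map_smul, map_smul, compCLM_apply, smul_eq_mul, mul_comm]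

lemma HasCoef.derivX {u : Phase d n → ℂ} {f : Series d n} (hu : HasCoef u f) (j : Fin d) :
    HasCoef (fun Z => fderiv ℂ u Z (eV (Sum.inl j))) (derivX j f) := by
  have h1 := hu.LS (Pi.single j 1) 0
  have h2 : (fun p => div (Pi.single j 1) 0 p * f p) = TorusNF.derivX j f := by
    funext p
    have h3 : ∑ i, (p.1 i : ℂ) * (((Pi.single j 1 : Fin d → ℝ) i : ℝ) : ℂ) = p.1 j := by
      rw [Finset.sum_eq_single j] <;> simp +contextual
    simp [div, divisor, TorusNF.derivX, h3]
  rw [h2] at h1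
  refine h1.congr (Eventually.of_forall fun Z => ?_)
  rw [TorusNF.LS]
  refine congrArg _ ?_
  refine Prod.ext (funext fun i => ?_) (funext fun i => ?_)
  · by_cases h : i = j <;> simp [quasilinear, eV, Pi.single_apply, h]
  · simp [quasilinear, eV]

lemma HasCoef.derivY {u : Phase d n → ℂ} {f : Series d n} (hu : HasCoef u f) (j : Fin n) :
    HasCoef (fun Z => fderiv ℂ u Z (eV (Sum.inr j))) (derivY j f) := by
  have hg : Germ fun Z => _root_.fderiv ℂ u Z (eV (Sum.inr j)) :=
    hu.germ.fderiv.clm_apply (Germ.const _)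
  have h1 := hu.LS 0 (Pi.single j 1)
  have h2 := (hg.hasCoef.mul_snd j).congr (v := TorusNF.LS 0 (Pi.single j 1) u)
    (Eventually.of_forall fun Z => by
      have h3 : quasilinear (0 : Fin d → ℝ) (Pi.single j 1) Z = Z.2 j • eV (Sum.inr j) := by
        refine Prod.ext (funext fun i => ?_) (funext fun i => ?_)
        · simp [quasilinear, eV]
        · by_cases h : i = j <;> simp [quasilinear, eV, Pi.single_apply, h]
      rw [TorusNF.LS, h3, map_smul, smul_eq_mul])
  have h4 := h2.unique h1
  have h5 : coef (fun Z => _root_.fderiv ℂ u Z (eV (Sum.inr j))) = TorusNF.derivY j f := by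
    funext p
    have h6 := congrFun h4 (p.1, p.2 + Pi.single j 1)
    rw [shiftY_add_single] at h6
    rw [h6]
    simp [div, divisor, TorusNF.derivY, Pi.single_apply]
  rw [← h5]
  exact hg.hasCoef

/-- The formal partial derivatives. -/
def partialD (L : Fin d ⊕ Fin n) (f : Series d n) : Series d n :=
  Sum.elim (fun j => derivX j f) (fun j => derivY j f) L

lemma HasCoef.partialD {u : Phase d n → ℂ} {f : Series d n} (hu : HasCoef u f)
    (L : Fin d ⊕ Fin n) : HasCoef (fun Z => fderiv ℂ u Z (eV L)) (partialD L f) := by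
  cases L with
  | inl j => exact hu.derivX j
  | inr j => exact hu.derivY j

/-- The coefficients of the Jacobian matrix of `Id + φ`. -/
def jacCoef (φ : FormalVF d n) (L L' : Fin d ⊕ Fin n) : Series d n := fun p =>
  (Pi.single 0 (if L = L' then 1 else 0) : Series d n) p + partialD L' (φ L) p

lemma idAdd_sub (φ : FormalVF d n) (Z : Phase d n) : idAdd φ Z - Z = evalV φ Z := by
  refine Prod.ext (funext fun j => ?_) (funext fun j => ?_) <;> simp [idAdd, evalV]

section Jacobian

variable {φ : FormalVF d n}

lemma germ_idAdd_sub (hφ : ∀ L, HasCoef (eval (φ L)) (φ L)) : Germ fun Z => idAdd φ Z - Z := by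
  simp only [idAdd_sub]
  refine germ_of_comp fun L => ?_
  simp only [comp_evalV]
  exact (hφ L).germ

lemma hasCoef_jacCoef (hφ : ∀ L, HasCoef (eval (φ L)) (φ L)) (L L' : Fin d ⊕ Fin n) :
    HasCoef (fun Z => comp (fderiv ℂ (idAdd φ) Z (eV L')) L) (jacCoef φ L L') := by
  refine ((hasCoef_const (if L = L' then 1 else 0)).add ((hφ L).partialD L')).congr ?_
  have hg := germ_idAdd_sub hφ
  filter_upwards [eventually_hasFDerivAt_of_germ hg, hg.eventually_differentiableAt] with Z h1 h2
  rw [h1.fderiv]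
  simp only [FunLike.coe_add, Pi.add_apply, ContinuousLinearMap.coe_id', id_eq]
  rw [← compCLM_apply, map_add, compCLM_apply, compCLM_apply, comp_eV, fderiv_comp_apply h2]
  simp only [idAdd_sub, comp_evalV]

lemma jacobianApply_eq (hφ : ∀ L, HasCoef (eval (φ L)) (φ L))
    {F : FormalVF d n} (hF : ∀ L, LocBounded (F L)) (L : Fin d ⊕ Fin n)
    (p : Idx d n) : jacobianApply φ F L p = ∑ L', mul (jacCoef φ L L') (F L') p := by
  have h1 : ∀ L', mul (jacCoef φ L L') (F L') p =
      (if L = L' then 1 else 0) * F L' p + mul (partialD L' (φ L)) (F L') p := by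
    intro L'
    have h2 := mul_sum_left (Finset.univ : Finset (Fin 2))
      (f := ![Pi.single 0 (if L = L' then 1 else 0), partialD L' (φ L)])
      (fun i => by
        fin_cases i
        · exact (hasCoef_const _).locSummable
        · exact ((hφ L).partialD L').locSummable) (hF L') p
    simp only [Fin.sum_univ_two, Matrix.cons_val_zero, Matrix.cons_val_one, single_mul] at h2
    exact h2
  simp only [h1, Finset.sum_add_distrib, ite_mul, one_mul, zero_mul, Finset.sum_ite_eq,
    Finset.mem_univ, if_true]
  rw [Fintype.sum_sum_type, ← add_assoc]
  rfl

end Jacobian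

lemma LocBounded.mul {f g : Series d n} (hf : LocSummable f) (hg : LocBounded g) :
    LocBounded (mul f g) := fun q => by
  classical
  obtain ⟨C, hC⟩ := hg q
  have hC0 : 0 ≤ C := (norm_nonneg _).trans (hC 0 fun _ => Nat.zero_le _)
  refine ⟨∑' p : Idx d n, (if p.2 ≤ q then ‖f p‖ else 0) * C, fun r hr => ?_⟩
  rw [mul_eq_tsum (summable_cauchyTerm hf hg r)]
  refine tsum_of_norm_bounded ((hf q).mul_right C).hasSum fun p => ?_
  rw [cauchyTerm]
  split_ifs with h1 h2 h3
  · rw [norm_mul]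
    gcongr
    exact hC _ ((sub_snd_le r p).trans hr)
  · exact absurd (h1.trans hr) h2
  · rw [norm_zero]; positivity
  · simp

/-- If `DΦ · F` agrees with the development of `W` up to degree `k`, then `F` agrees with that of
`(DΦ)⁻¹ W` up to degree `k`. -/
lemma eq_coefV_inverse {φ F c : FormalVF d n} (hφ : ∀ L, HasCoef (eval (φ L)) (φ L))
    (hu : ∀ᶠ Z in nT d n, IsUnit (fderiv ℂ (idAdd φ) Z)) (hF : ∀ L, LocBounded (F L))
    {W : Phase d n → Phase d n} (hW : ∀ L, HasCoef (fun Z => comp (W Z) L) (c L)) {k : ℕ}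
    (hc : ∀ L p, degQ p.2 ≤ k → jacobianApply φ F L p = c L p) (L : Fin d ⊕ Fin n) (p : Idx d n)
    (hp : degQ p.2 ≤ k) :
    F L p = coefV (fun Z => Ring.inverse (fderiv ℂ (idAdd φ) Z) (W Z)) L p := by
  have hD := hasCoef_jacCoef hφ
  have hDg : Germ (fderiv ℂ (idAdd φ)) :=
    ((Germ.const _).add (germ_idAdd_sub hφ).fderiv).congr
      ((eventually_hasFDerivAt_of_germ (germ_idAdd_sub hφ)).mono fun _ hZ => hZ.fderiv)
  have hI := hDg.inverse hu
  set J : Phase d n → Phase d n →L[ℂ] Phase d n := fun Z => Ring.inverse (fderiv ℂ (idAdd φ) Z)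
    with hJ
  have hE : ∀ L L', HasCoef (fun Z => comp (J Z (eV L')) L) (coef fun Z => comp (J Z (eV L')) L) :=
    fun L L' => ((hI.clm_apply (Germ.const (eV L'))).comp_of L).hasCoef
  set E : Fin d ⊕ Fin n → Fin d ⊕ Fin n → Series d n :=
    fun L L' => coef fun Z => comp (J Z (eV L')) L with hEdef
  have hED : ∀ L'', (fun q => ∑ L', mul (E L L') (jacCoef φ L' L'') q) =
      Pi.single 0 (if L = L'' then 1 else 0) := by
    intro L''
    refine (HasCoef.sum Finset.univ fun L' => (hE L L').mul (hD L' L'')).unique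
      ((hasCoef_const _).congr ?_)
    filter_upwards [hu] with Z hZ
    rw [← comp_clm_apply, hJ]
    simp only
    rw [inverse_apply_apply hZ, comp_eV]
  have hc' : coefV (fun Z => J Z (W Z)) L = fun q => ∑ L', mul (E L L') (c L') q := by
    refine HasCoef.coef_eq ((HasCoef.sum Finset.univ fun L' => (hE L L').mul (hW L')).congr ?_)
    exact Eventually.of_forall fun Z => comp_clm_apply _ _ _
  rw [hc']
  calc F L p = ∑ L'', mul (Pi.single 0 (if L = L'' then 1 else 0)) (F L'') p := by
        simp only [single_mul, ite_mul, one_mul, zero_mul, Finset.sum_ite_eq, Finset.mem_univ,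
          if_true]
    _ = ∑ L'', ∑ L', mul (mul (E L L') (jacCoef φ L' L'')) (F L'') p := by
        refine Finset.sum_congr rfl fun L'' _ => ?_
        rw [← hED L'', mul_sum_left _ (fun L' => ((hE L L').mul (hD L' L'')).locSummable) (hF L'')]
    _ = ∑ L', ∑ L'', mul (E L L') (mul (jacCoef φ L' L'') (F L'')) p := by
        rw [Finset.sum_comm]
        refine Finset.sum_congr rfl fun L' _ => Finset.sum_congr rfl fun L'' _ => ?_
        exact (mul_assoc_series (hE L L').locSummable (hD L' L'').locSummable (hF L'') p).symm
    _ = ∑ L', mul (E L L') (c L') p := by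
        refine Finset.sum_congr rfl fun L' _ => ?_
        rw [← mul_sum_right _ (hE L L').locSummable
          (fun L'' => LocBounded.mul (hD L' L'').locSummable (hF L''))]
        refine mul_congr fun q hq => ?_
        rw [← jacobianApply_eq hφ hF, hc L' q (hq.trans hp)]

lemma ord_one_of_torus {u : Phase d n → ℂ} (hu : Germ u) (h : ∀ Z ∈ torus d n, u Z = 0) :
    Ord 1 u := by
  obtain ⟨ρ₁, hρ₁, C, hC, hb⟩ := hu.exists_lipschitz
  have hcf := hu.hasCoef
  refine hcf.ord fun p hp => ?_
  obtain ⟨ρ₂, hρ₂, M, hf, he⟩ := hcf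
  have h0 : degQ p.2 = 0 := by omega
  set ρ := min ρ₁ ρ₂ with hρ
  have hρ0 : 0 < ρ := by positivity
  have key : ∀ s, 0 < s → s < ρ → ‖coef u p‖ ≤ C * s := by
    intro s hs hsρ
    have h1 := hf.norm_coeff_le hρ₂ hs (hsρ.trans_le (min_le_right _ _)) (M := C * s)
      (fun Z hZ1 hZ2 => by
        have hZ : Z ∈ domain d n ρ ρ := ⟨fun j => by rw [hZ1, abs_zero]; exact hρ0,
          fun j => by rw [hZ2]; exact hsρ⟩
        rw [he Z (domain_mono (min_le_right _ _) (min_le_right _ _) hZ)]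
        have hZ' := domain_mono (d := d) (n := n) (min_le_left ρ₁ ρ₂) (min_le_left _ _) hZ
        have h2 := hb _ (fst_mem_domain hρ₁ hZ') Z hZ'
        rw [h (Z.1, 0) ⟨hZ1, rfl⟩, sub_zero] at h2
        refine h2.trans ?_
        gcongr
        have : Z - ((Z.1, 0) : Phase d n) = (0, Z.2) := by ext <;> simp
        rw [this, Prod.norm_mk, norm_zero, max_eq_right (norm_nonneg _)]
        exact norm_snd_le_of_norm_eq hs.le hZ2) p
    rwa [h0, pow_zero, mul_one] at h1
  refine norm_le_zero_iff.1 (ge_of_tendsto (f := fun s : ℝ => C * s) (x := 𝓝[>] 0) ?_ ?_)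
  · have : Tendsto (fun s : ℝ => C * s) (𝓝 0) (𝓝 (C * 0)) := tendsto_id.const_mul C
    rw [mul_zero] at this
    exact this.mono_left nhdsWithin_le_nhds
  · filter_upwards [Ioo_mem_nhdsGT hρ0] with s hs using key s hs.1 hs.2

/-! ### The coefficient of a formal normal form -/

section Linear

variable {Φ : Phase d n → Phase d n}

lemma snd_eq_zero_of_ord {E : Type*} [NormedAddCommGroup E] [NormedSpace ℂ E] {u : Phase d n → E}
    (h : Ord 1 u) : ∀ᶠ Z in nT d n, Z.2 = 0 → u Z = 0 := by
  obtain ⟨C, hC, ρ, hρ, hb⟩ := h.exists_bound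
  filter_upwards [domain_mem_nT hρ hρ] with Z hZ h0
  have := hb Z hZ
  rw [h0, norm_zero, pow_one, mul_zero] at this
  exact norm_le_zero_iff.1 this

lemma ne_zero_of_block_triangular {B : Phase d n →L[ℂ] Phase d n} (hB : Function.Injective B)
    (h : ∀ x, (B (x, 0)).2 = 0) {y : Fin n → ℂ} (hy : y ≠ 0) : (B (0, y)).2 ≠ 0 := by
  intro h0
  set T : (Fin d → ℂ) →ₗ[ℂ] (Fin d → ℂ) :=
    (LinearMap.fst ℂ _ _).comp (B.toLinearMap.comp (LinearMap.inl ℂ _ _)) with hT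
  have hTx : ∀ x, T x = (B (x, 0)).1 := fun x => rfl
  have hTi : Function.Injective T := by
    intro x x' hx
    have : B (x, 0) = B (x', 0) := Prod.ext (by rw [← hTx, hx, hTx]) (by rw [h, h])
    exact congrArg Prod.fst (hB this)
  obtain ⟨x, hx⟩ := LinearMap.injective_iff_surjective.1 hTi (B (0, y)).1
  have : B (x, 0) = B (0, y) := Prod.ext (by rw [← hTx, hx]) (by rw [h, h0])
  exact hy (congrArg Prod.snd (hB this)).symm

lemma mem_nhds_add_smul {s : Set (Phase d n)} {Z : Phase d n} (hs : s ∈ 𝓝 Z) (v : Phase d n) :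
    ∀ᶠ t : ℂ in 𝓝 0, Z + t • v ∈ s := by
  have : Tendsto (fun t : ℂ => Z + t • v) (𝓝 0) (𝓝 (Z + (0 : ℂ) • v)) :=
    Continuous.tendsto (by fun_prop) 0
  rw [zero_smul, add_zero] at this
  exact this hs

lemma hasDerivAt_line {E : Type*} [NormedAddCommGroup E] [NormedSpace ℂ E] {u : Phase d n → E}
    {Z : Phase d n} (hu : DifferentiableAt ℂ u Z) (v : Phase d n) :
    HasDerivAt (fun t : ℂ => u (Z + t • v)) (fderiv ℂ u Z v) 0 := by
  have h1 : HasDerivAt (fun t : ℂ => Z + t • v) v 0 := by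
    simpa using ((hasDerivAt_id (0 : ℂ)).smul_const v).const_add Z
  have h2 : HasFDerivAt u (fderiv ℂ u Z) (Z + (0 : ℂ) • v) := by simpa using hu.hasFDerivAt
  exact h2.comp_hasDerivAt 0 h1

lemma fderiv_fst_snd_eq_zero {ρ : ℝ} (hd : DifferentiableOn ℂ Φ (domain d n ρ ρ))
    (h0 : ∀ Z ∈ domain d n ρ ρ, Z.2 = 0 → (Φ Z).2 = 0) {Z : Phase d n} (hZ : Z ∈ domain d n ρ ρ)
    (hZ2 : Z.2 = 0) (x : Fin d → ℂ) : (fderiv ℂ Φ Z (x, 0)).2 = 0 := by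
  have hn := (isOpen_domain ρ ρ).mem_nhds hZ
  have h1 := (hasDerivAt_line (hd.differentiableAt hn) (x, 0)).hasFDerivAt.snd.hasDerivAt
  have h2 : HasDerivAt (fun t : ℂ => (Φ (Z + t • (x, 0))).2) 0 0 := by
    refine (hasDerivAt_const (0 : ℂ) (0 : Fin n → ℂ)).congr_of_eventuallyEq ?_
    filter_upwards [mem_nhds_add_smul hn (x, 0)] with t ht
    exact h0 _ ht (by simp [hZ2])
  have h3 := h1.unique h2
  simpa using h3

/-- For `ω = 0`, the values of the coefficient on the torus are quotients of eigenvalues. -/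
lemma exists_mul_eq {Λ : Fin n → ℂ} {A : Phase d n → ℂ} (hG : GermDiffeo Φ)
    (ht : Ord 1 fun Z => (Φ Z).2) (hA : Germ A)
    (hF : OEq 2 (fun Z => A Z • (LS 0 Λ Φ Z).2) fun Z j => Λ j * (Φ Z).2 j) (i : Fin n) :
    ∀ᶠ Z in nT d n, Z.2 = 0 → ∃ j, A Z * Λ i = Λ j := by
  obtain ⟨C, hC, ρ₁, hρ₁, hb⟩ := Ord.exists_bound hF
  obtain ⟨ρ₂, hρ₂, h0⟩ := eventually_nT.1 (snd_eq_zero_of_ord ht)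
  obtain ⟨ρ₃, hρ₃, hd⟩ := eventually_nT.1 (((hG.eventually_differentiableAt.and
    hA.eventually_differentiableAt).and hG.germ_fderiv.eventually_differentiableAt).and hG.isUnit)
  set ρ := min ρ₁ (min ρ₂ ρ₃) with hρ
  have hρ0 : 0 < ρ := by positivity
  have e1 : domain d n ρ ρ ⊆ domain d n ρ₁ ρ₁ := domain_mono (min_le_left _ _) (min_le_left _ _)
  have e2 : domain d n ρ ρ ⊆ domain d n ρ₂ ρ₂ := domain_mono
    ((min_le_right _ _).trans (min_le_left _ _)) ((min_le_right _ _).trans (min_le_left _ _))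
  have e3 : domain d n ρ ρ ⊆ domain d n ρ₃ ρ₃ := domain_mono
    ((min_le_right _ _).trans (min_le_right _ _)) ((min_le_right _ _).trans (min_le_right _ _))
  filter_upwards [domain_mem_nT hρ0 hρ0] with Z hZ hZ2
  obtain ⟨⟨⟨dΦ, dA⟩, dD⟩, hu⟩ := hd Z (e3 hZ)
  have hn := (isOpen_domain (d := d) (n := n) ρ ρ).mem_nhds hZ
  set v : Phase d n := (0, Pi.single i 1) with hv
  set B := fderiv ℂ Φ Z with hB
  have hinj : Function.Injective B := (ContinuousLinearMap.isUnit_iff_bijective.1 hu).1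
  have hne := ne_zero_of_block_triangular hinj (fun x => fderiv_fst_snd_eq_zero
    (fun W hW => (hd W (e3 hW)).1.1.1.differentiableWithinAt) (fun W hW => h0 W (e2 hW)) hZ hZ2 x)
    (y := Pi.single i 1) (by simp)
  obtain ⟨j, hj⟩ := Function.ne_iff.1 hne
  refine ⟨j, mul_right_cancel₀ hj ?_⟩
  -- compare the first order terms along the line `Z + t v`
  have hline : Tendsto (fun t : ℂ => Z + t • v) (𝓝[≠] 0) (𝓝 Z) := by
    have : Tendsto (fun t : ℂ => Z + t • v) (𝓝 0) (𝓝 (Z + (0 : ℂ) • v)) :=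
      Continuous.tendsto (by fun_prop) 0
    rw [zero_smul, add_zero] at this
    exact this.mono_left nhdsWithin_le_nhds
  have hl1 : Tendsto (fun t : ℂ => A (Z + t • v) * Λ i * (fderiv ℂ Φ (Z + t • v) v).2 j) (𝓝[≠] 0)
      (𝓝 (A Z * Λ i * (B v).2 j)) := by
    have h1 := (dA.continuousAt.tendsto.comp hline).mul_const (Λ i)
    have h2 : Continuous fun T : Phase d n →L[ℂ] Phase d n => (T v).2 j := by fun_prop
    exact h1.mul ((h2.tendsto B).comp (dD.continuousAt.tendsto.comp hline))
  have hl2 : Tendsto (fun t : ℂ => Λ j * (t⁻¹ * (Φ (Z + t • v)).2 j)) (𝓝[≠] 0)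
      (𝓝 (Λ j * (B v).2 j)) := by
    have h1 := (hasDerivAt_pi.1 (hasDerivAt_line dΦ v).hasFDerivAt.snd.hasDerivAt j)
    have h2 := h1.tendsto_slope_zero
    refine Tendsto.const_mul _ ?_
    refine Tendsto.congr' ?_ (by simpa using h2)
    filter_upwards [self_mem_nhdsWithin] with t _
    simp [h0 Z (e2 hZ) hZ2]
  have hl3 : Tendsto (fun t : ℂ => A (Z + t • v) * Λ i * (fderiv ℂ Φ (Z + t • v) v).2 j -
      Λ j * (t⁻¹ * (Φ (Z + t • v)).2 j)) (𝓝[≠] 0) (𝓝 0) := by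
    have hlim : Tendsto (fun t : ℂ => C * ‖t‖) (𝓝[≠] 0) (𝓝 0) := by
      have : Tendsto (fun t : ℂ => C * ‖t‖) (𝓝 0) (𝓝 (C * ‖(0 : ℂ)‖)) :=
        Continuous.tendsto (by fun_prop) 0
      rw [norm_zero, mul_zero] at this
      exact this.mono_left nhdsWithin_le_nhds
    refine squeeze_zero_norm' ?_ hlim
    filter_upwards [self_mem_nhdsWithin,
      nhdsWithin_le_nhds (mem_nhds_add_smul hn v)] with t (ht0 : t ≠ 0) htd
    have h1 := hb _ (e1 htd)
    have hS : quasilinear (0 : Fin d → ℝ) Λ (Z + t • v) = (t * Λ i) • v := by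
      refine Prod.ext (funext fun l => ?_) (funext fun l => ?_)
      · simp [quasilinear, hv]
      · rcases eq_or_ne l i with rfl | hl
        · simp [quasilinear, hv, hZ2, mul_comm]
        · simp [quasilinear, hv, hZ2, hl]
    have hn2 : ‖(Z + t • v).2‖ = ‖t‖ := by
      simp [hv, hZ2, norm_smul, Pi.norm_single]
    rw [hn2] at h1
    have h2 := (norm_le_pi_norm _ j).trans h1
    simp only [LS, hS, map_smul, Prod.smul_snd, Pi.sub_apply, Pi.smul_apply, smul_eq_mul] at h2
    have h3 : A (Z + t • v) * (t * Λ i * (fderiv ℂ Φ (Z + t • v) v).2 j) -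
        Λ j * (Φ (Z + t • v)).2 j = t * (A (Z + t • v) * Λ i * (fderiv ℂ Φ (Z + t • v) v).2 j -
          Λ j * (t⁻¹ * (Φ (Z + t • v)).2 j)) := by
      field_simp
    rw [h3, norm_mul] at h2
    exact le_of_mul_le_mul_left (h2.trans (le_of_eq (by ring))) (norm_pos_iff.2 ht0)
  have := tendsto_nhds_unique hl3 (hl1.sub hl2)
  exact sub_eq_zero.1 this.symm

end Linear

section Log

variable {A A' : Phase d n → ℂ}

lemma eventually_mem_ball_one (h : Ord 1 fun Z => A Z - 1) :
    ∀ᶠ Z in nT d n, A Z ∈ Metric.ball (1 : ℂ) (1 / 2) := by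
  have := (h.tendsto_zero le_rfl).norm
  rw [norm_zero] at this
  filter_upwards [this.eventually (gt_mem_nhds (by norm_num : (0 : ℝ) < 1 / 2))] with Z hZ
  rwa [Metric.mem_ball, dist_eq_norm]

lemma ball_one_subset_slitPlane : Metric.ball (1 : ℂ) (1 / 2) ⊆ Complex.slitPlane :=
  (Metric.ball_subset_ball (by norm_num)).trans Complex.ball_one_subset_slitPlane

lemma germ_log (hA : Germ A) (h : Ord 1 fun Z => A Z - 1) : Germ fun Z => Complex.log (A Z) := by
  obtain ⟨ρ₁, hρ₁, hA⟩ := hA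
  obtain ⟨ρ₂, hρ₂, hb⟩ := eventually_nT.1 (eventually_mem_ball_one h)
  have hsub := domain_mono (d := d) (n := n) (min_le_left ρ₁ ρ₂) (min_le_left ρ₁ ρ₂)
  refine ⟨min ρ₁ ρ₂, by positivity, fun Z hZ => ?_, fun Z hZ P => by
    simp only [hA.2 Z (hsub hZ) P]⟩
  refine ((hA.1.mono hsub) Z hZ).clog (ball_one_subset_slitPlane (hb Z ?_))
  exact domain_mono (min_le_right _ _) (min_le_right _ _) hZ

lemma ord_log_sub {m : ℕ} (h : Ord 1 fun Z => A Z - 1) (h' : Ord 1 fun Z => A' Z - 1)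
    (hm : OEq m A A') : Ord m fun Z => Complex.log (A Z) - Complex.log (A' Z) := by
  refine IsBigO.trans (IsBigO.of_bound 2 ?_) hm
  filter_upwards [eventually_mem_ball_one h, eventually_mem_ball_one h'] with Z h1 h2
  refine (convex_ball (1 : ℂ) (1 / 2)).norm_image_sub_le_of_norm_deriv_le (𝕜 := ℂ)
    (fun x hx => Complex.differentiableAt_log (ball_one_subset_slitPlane hx)) (fun x hx => ?_) h2 h1
  rw [(Complex.hasDerivAt_log (ball_one_subset_slitPlane hx)).deriv, norm_inv]
  have h3 : 1 / 2 ≤ ‖x‖ := by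
    rw [Metric.mem_ball, dist_eq_norm] at hx
    have h4 := norm_sub_norm_le (1 : ℂ) x
    rw [norm_one, norm_sub_rev] at h4
    linarith
  rw [inv_le_comm₀ (by linarith) (by norm_num)]
  linarith

lemma LS_log_eq_zero (ω : Fin d → ℝ) (Λ : Fin n → ℂ) (hA : Germ A) (h : Ord 1 fun Z => A Z - 1)
    (hS : LS ω Λ A =ᶠ[nT d n] 0) : LS ω Λ (fun Z => -Complex.log (A Z)) =ᶠ[nT d n] 0 := by
  filter_upwards [eventually_mem_ball_one h, hA.eventually_differentiableAt, hS] with Z h1 h2 h3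
  have h4 := (h2.hasFDerivAt.clog (ball_one_subset_slitPlane h1)).neg
  rw [LS] at h3 ⊢
  rw [show (fun Z => -Complex.log (A Z)) = -(fun Z => Complex.log (A Z)) from rfl, h4.fderiv]
  simp [h3]

end Log

/-! ### Approximations extracted from a formal normal form -/

lemma IsTorusDiffeo.mono {ρ ρ' : ℝ} {Φ : Phase d n → Phase d n} (h : IsTorusDiffeo ρ Φ)
    (hρ : ρ' ≤ ρ) : IsTorusDiffeo ρ' Φ := by
  have hs := domain_mono (d := d) (n := n) hρ hρ
  exact ⟨h.holomorphic.mono hs, fun Z hZ => h.equivariant Z (hs hZ),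
    fun Z hZ Z' hZ' => h.injective Z (hs hZ) Z' (hs hZ'), fun Z hZ => h.deriv_bijective Z (hs hZ),
    h.torus_mapsTo⟩

lemma trunc_apply_of_le {k : ℕ} (F : FormalVF d n) (L : Fin d ⊕ Fin n) {p : Idx d n}
    (hp : degQ p.2 ≤ k) : trunc k F L p = F L p := by
  cases L with
  | inl j => simp [trunc, hp]
  | inr j => simp [trunc, hp.trans (Nat.le_succ k)]

/-- Truncated conjugacies of `V` to the formal vector field `a · S`. -/
structure Approx (ω : Fin d → ℝ) (Λ : Fin n → ℂ) (V : Phase d n → Phase d n) (a : Series d n)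
    (Φ : ℕ → Phase d n → Phase d n) : Prop where
  diffeo : ∀ k, GermDiffeo (Φ k)
  ord_snd : ∀ k, Ord 1 fun Z => (Φ k Z).2
  oEq : ∀ k l, k ≤ l → OEq (k + 1) (Φ l) (Φ k)
  coef : ∀ k L p, degQ p.2 ≤ k → smulS ω Λ a L p = coefV (pullField (Φ k) V) L p

variable {ω : Fin d → ℝ} {Λ : Fin n → ℂ}

lemma IsFormal.locBounded_smulS {a : Series d n} (ha : IsFormal a) (L : Fin d ⊕ Fin n) :
    LocBounded (smulS ω Λ a L) := fun q => by
  obtain ⟨C, hC⟩ := ha.locBounded q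
  have hC0 : 0 ≤ C := (norm_nonneg _).trans (hC 0 fun _ => Nat.zero_le _)
  refine ⟨‖sCoef ω Λ L‖ * C, fun p hp => ?_⟩
  rcases smulS_cases ω Λ L p with ⟨p', rfl⟩ | h0
  · rw [smulS_addE, norm_mul]
    refine mul_le_mul_of_nonneg_left (hC p' (le_trans ?_ hp)) (norm_nonneg _)
    cases L <;> simp [addE]
  · rw [h0, norm_zero]
    positivity

lemma exists_approx {r δ : ℝ} {V : Phase d n → Phase d n} {a : Series d n} (ha : IsFormal a)
    (h : FormallyConjugate r δ V (smulS ω Λ a)) :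
    ∃ Φ, Approx ω Λ V a Φ ∧ ∃ ρ > 0, IsTorusDiffeo ρ (Φ 1) ∧
      MapsTo (Φ 1) (domain d n ρ ρ) (domain d n r δ) := by
  obtain ⟨φ, hφ, hc⟩ := h
  have hco : ∀ k L, HasCoef (eval (trunc k φ L)) (trunc k φ L) := fun k L => by
    obtain ⟨ρ, hρ, hw, -⟩ := hφ k
    exact (majorized_of_wnorm_lt_top (hw L)).hasCoef hρ hρ
  have hg : ∀ k, Germ fun Z => idAdd (trunc k φ) Z - Z := fun k => germ_idAdd_sub (hco k)
  have hd : ∀ k, GermDiffeo (idAdd (trunc k φ)) := fun k => by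
    obtain ⟨ρ, hρ, -, ht⟩ := hφ k
    refine ⟨hg k, tendsto_nT_of_mapsTo_torus (hg k) ht.torus_mapsTo, ?_⟩
    filter_upwards [domain_mem_nT hρ hρ] with Z hZ
    exact ContinuousLinearMap.isUnit_iff_bijective.2 (ht.deriv_bijective Z hZ)
  refine ⟨fun k => idAdd (trunc k φ), ⟨hd, fun k => ?_, fun k l hkl => ?_, fun k L p hp => ?_⟩, ?_⟩
  · obtain ⟨ρ, hρ, -, ht⟩ := hφ k
    refine Asymptotics.isBigO_pi.2 fun j => ?_
    refine ord_one_of_torus ?_ fun Z hZ => congrFun (ht.torus_mapsTo hZ).2 j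
    have hs : Germ fun Z : Phase d n => Z.2 j :=
      ⟨1, one_pos, by fun_prop, fun Z _ P => rfl⟩
    have := ((hg k).comp_of (Sum.inr j)).add hs
    simpa [comp] using this
  · refine ord_of_comp fun L => ?_
    have h1 := (hco l L).sub (hco k L)
    refine (h1.ord fun p hp => ?_).congr (Eventually.of_forall fun Z => ?_)
    · rw [trunc_apply_of_le φ L (by omega), trunc_apply_of_le φ L (by omega), sub_self]
    · cases L <;> simp [comp, idAdd]
  · obtain ⟨ρ, hρ, -, c, hdev, he⟩ := hc k
    refine eq_coefV_inverse (hco k) (hd k).isUnit (fun L => ha.locBounded_smulS L)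
      (W := fun Z => V (idAdd (trunc k φ) Z)) (fun L => (hdev L).hasCoef hρ hρ)
      (fun L p hp => ?_) L p hp
    have := congrFun (congrFun he L) p
    rwa [trunc_apply_of_le _ L hp, trunc_apply_of_le _ L hp] at this
  · obtain ⟨ρ, hρ, -, ht⟩ := hφ 1
    obtain ⟨ρ', hρ', hm, -⟩ := hc 1
    exact ⟨min ρ ρ', by positivity, ht.mono (min_le_left _ _),
      hm.mono_left (domain_mono (min_le_right _ _) (min_le_right _ _))⟩

/-- Truncation of a series in the degree in `Y`. -/
def truncS (K : ℕ) (a : Series d n) : Series d n := fun p => if degQ p.2 ≤ K then a p else 0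

lemma Majorized.comp_addE {ρ C : ℝ} {f : Series d n} (hf : Majorized ρ ρ C f) (hρ : 0 < ρ)
    (L : Fin d ⊕ Fin n) : ∃ C', Majorized ρ ρ C' fun p => f (addE L p) := by
  cases L with
  | inl j => exact ⟨C, hf⟩
  | inr j =>
    refine ⟨C / ρ, fun p => ?_⟩
    have := hf (addE (Sum.inr j) p)
    simp only [addE, Sum.elim_inr, degQ_add_single, pow_succ] at this ⊢
    rw [le_div_iff₀ hρ]
    linarith

lemma div_mul_eq_zero {a : Series d n} (ha : IsResonant ω Λ (smulS ω Λ a)) {L : Fin d ⊕ Fin n}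
    (hL : sCoef ω Λ L ≠ 0) (p : Idx d n) : div ω Λ p * a p = 0 := by
  by_contra h
  have hne : smulS ω Λ a L (addE L p) ≠ 0 := by
    rw [smulS_addE]
    exact mul_ne_zero hL (right_ne_zero_of_mul h)
  refine left_ne_zero_of_mul h ?_
  cases L with
  | inl j => exact ha.1 j _ hne
  | inr j =>
    have h1 : div ω Λ (p.1, p.2 + Pi.single j 1) - Λ j = 0 := ha.2 j _ hne
    rwa [div_add_single, add_sub_cancel_right] at h1

namespace Approx

variable {V : Phase d n → Phase d n} {a : Series d n} {Φ : ℕ → Phase d n → Phase d n}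

section

variable {L₀ : Fin d ⊕ Fin n}

lemma hasCoef_truncS (h : Approx ω Λ V a Φ) (hV : Germ V) (hL : sCoef ω Λ L₀ ≠ 0) (K : ℕ) :
    HasCoef (eval (truncS K a)) (truncS K a) := by
  have hc := ((h.diffeo (K + 1)).germ_pullField hV).hasCoefV L₀
  obtain ⟨ρ, hρ, C, hf, -⟩ := hc
  obtain ⟨C', hC'⟩ := hf.comp_addE hρ L₀
  refine ((hC'.const_mul (sCoef ω Λ L₀)⁻¹).of_norm_le hρ.le fun p => ?_).hasCoef hρ hρ
  rw [truncS]
  split_ifs with hp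
  · rw [← h.coef (K + 1) L₀ (addE L₀ p) ((degQ_addE_le L₀ p).trans (by omega)), smulS_addE,
      inv_mul_cancel_left₀ hL]
  · rw [norm_zero]
    positivity

lemma oEq_pullField (h : Approx ω Λ V a Φ) (hV : Germ V) (hL : sCoef ω Λ L₀ ≠ 0) (K : ℕ) :
    OEq (K + 1) (pullField (Φ (K + 1)) V) fun Z => eval (truncS K a) Z • quasilinear ω Λ Z := by
  refine ord_of_comp fun L => ?_
  have h1 := (((h.diffeo (K + 1)).germ_pullField hV).hasCoefV L).sub
    (hasCoef_smulS ω Λ (h.hasCoef_truncS hV hL K) L)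
  refine (h1.ord fun p hp => ?_).congr (Eventually.of_forall fun Z => ?_)
  · rw [← h.coef (K + 1) L p (by omega), sub_eq_zero]
    rcases smulS_cases ω Λ L p with ⟨p', rfl⟩ | h0
    · have := le_degQ_addE L p'
      rw [smulS_addE, smulS_addE, truncS, if_pos (by omega)]
    · rw [h0, h0]
  · simp only [← compCLM_apply, map_sub]

lemma oEq_comp (h : Approx ω Λ V a Φ) (hV : Germ V) (hL : sCoef ω Λ L₀ ≠ 0) (K : ℕ) :
    OEq (K + 1) (fun Z => V (Φ (K + 1) Z))
      fun Z => eval (truncS K a) Z • LS ω Λ (Φ (K + 1)) Z := by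
  refine ((h.oEq_pullField hV hL K).clm_left (h.diffeo (K + 1)).germ_fderiv).congr ?_
  filter_upwards [(h.diffeo (K + 1)).isUnit] with Z hZ
  rw [pullField, apply_inverse_apply hZ, map_smul, LS]

lemma LS_eq_zero (h : Approx ω Λ V a Φ) (hV : Germ V) (hL : sCoef ω Λ L₀ ≠ 0)
    (ha : IsResonant ω Λ (smulS ω Λ a)) (K : ℕ) :
    LS ω Λ (eval (truncS K a)) =ᶠ[nT d n] 0 := by
  refine ((h.hasCoef_truncS hV hL K).LS ω Λ).eventuallyEq_zero fun p => ?_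
  rw [truncS]
  split_ifs
  · exact div_mul_eq_zero ha hL p
  · rw [mul_zero]

lemma ord_sub_one_inl (h : Approx ω Λ V a Φ) (hV : Germ V) {j : Fin d} (hj : ω j ≠ 0)
    (ha : IsResonant ω Λ (smulS ω Λ a)) (hR : Ord 1 fun Z => (V Z - quasilinear ω Λ Z).1)
    (K : ℕ) : Ord 1 fun Z => eval (truncS K a) Z - 1 := by
  have hL : sCoef ω Λ (Sum.inl j : Fin d ⊕ Fin n) ≠ 0 := by simpa [sCoef] using hj
  have hA := h.hasCoef_truncS hV hL K
  have hG := h.diffeo (K + 1)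
  set u : Phase d n → ℂ := fun Z => comp (Φ (K + 1) Z - Z) (Sum.inl j) with hu
  have hug : Germ u := hG.germ.comp_of _
  have h1 : Ord 1 fun Z => ω j * (eval (truncS K a) Z - 1) +
      LS ω Λ (fun Z => eval (truncS K a) Z * u Z) Z := by
    have h2 : Ord 1 fun Z => (V (Φ (K + 1) Z) - quasilinear ω Λ (Φ (K + 1) Z)).1 j :=
      (hR.comp_map hG.tendsto (h.ord_snd _)).clm_const (ContinuousLinearMap.proj j)
    have h3 := ((h.oEq_comp hV hL K).mono (k := 1) (by omega)).comp_of (Sum.inl j)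
    refine (h2.sub h3).congr ?_
    filter_upwards [h.LS_eq_zero hV hL ha K, hug.eventually_differentiableAt,
      hA.germ.eventually_differentiableAt, eventually_hasFDerivAt_of_germ hG.germ,
      hG.germ.eventually_differentiableAt] with Z g1 g2 g3 g4 g5
    have h4 : LS ω Λ (fun Z => eval (truncS K a) Z * u Z) Z = eval (truncS K a) Z * LS ω Λ u Z := by
      rw [LS] at g1 ⊢
      have h6 := (g3.hasFDerivAt.mul g2.hasFDerivAt).fderiv
      rw [show (fun Z => eval (truncS K a) Z * u Z) = eval (truncS K a) * u from rfl, h6]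
      simp [LS, g1]
    have h5 : (LS ω Λ (Φ (K + 1)) Z).1 j = ω j + LS ω Λ u Z := by
      have h7 := comp_LS ω Λ g5 (Sum.inl j)
      rw [← h7, LS, LS, g4.fderiv]
      simp [comp, quasilinear]
    rw [h4]
    simp only [comp, Sum.elim_inl, Prod.fst_sub, Prod.smul_fst, Pi.sub_apply, Pi.smul_apply,
      smul_eq_mul, h5, quasilinear]
    ring
  have hc := ((hA.sub (hasCoef_const 1)).const_mul (ω j)).add
    ((hA.mul hug.hasCoef).LS ω Λ)
  refine (hA.sub (hasCoef_const 1)).ord fun p hp => ?_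
  have h2 := hc.hasOrder h1 p hp
  by_cases hd : div ω Λ p = 0
  · simp only [hd, zero_mul, add_zero] at h2
    exact (mul_eq_zero.1 h2).resolve_left (by exact_mod_cast hj)
  · have hp0 : p ≠ 0 := by
      rintro rfl
      exact hd (by simp [div, divisor])
    have h3 := (mul_eq_zero.1 (div_mul_eq_zero ha hL p)).resolve_left hd
    simp [truncS, h3, hp0]

lemma ord_sub_one_inr (h : Approx 0 Λ V a Φ) (hV : Germ V) {i : Fin n} (hi : Λ i ≠ 0)
    (hR : Ord 2 fun Z => (V Z - quasilinear 0 Λ Z).2) (ha0 : a 0 = 1) {K : ℕ} (hK : 1 ≤ K) :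
    Ord 1 fun Z => eval (truncS K a) Z - 1 := by
  have hL : sCoef (0 : Fin d → ℝ) Λ (Sum.inr i) ≠ 0 := by simpa [sCoef] using hi
  have hA := h.hasCoef_truncS hV hL K
  have hG := h.diffeo (K + 1)
  have hF : OEq 2 (fun Z => eval (truncS K a) Z • (LS 0 Λ (Φ (K + 1)) Z).2)
      fun Z j => Λ j * (Φ (K + 1) Z).2 j := by
    have h2 := hR.comp_map hG.tendsto (h.ord_snd _)
    have h3 := Ord.snd ((h.oEq_comp hV hL K).mono (k := 2) (by omega))
    refine (h2.sub h3).congr (Eventually.of_forall fun Z => ?_)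
    funext j
    simp [quasilinear]
  obtain ⟨ρ, hρ, hb⟩ := eventually_nT.1 ((exists_mul_eq hG (h.ord_snd _) hA.germ hF i).and
    hA.germ.eventually_differentiableAt)
  set s : Set (Phase d n) := domain d n ρ ρ ∩ {Z | Z.2 = 0} with hs
  have hconv : Convex ℝ s := (convex_domain ρ ρ).inter fun Z hZ W hW x y _ _ _ => by
    simp only [mem_ofPred_eq] at hZ hW ⊢
    simp [hZ, hW]
  have hcont : ContinuousOn (eval (truncS K a)) s := fun Z hZ =>
    (hb Z hZ.1).2.continuousAt.continuousWithinAt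
  have hsub : (eval (truncS K a) '' s).Subsingleton := by
    by_contra hne
    refine (hconv.isPreconnected.image _ hcont).infinite_of_nontrivial
      (not_subsingleton_iff.1 hne) ((finite_range fun j => Λ j / Λ i).subset ?_)
    rintro _ ⟨Z, hZ, rfl⟩
    obtain ⟨j, hj⟩ := (hb Z hZ.1).1 hZ.2
    exact ⟨j, by simp only [← hj, mul_div_cancel_right₀ _ hi]⟩
  have h0 : (0 : Phase d n) ∈ s := ⟨⟨fun j => by simpa using hρ, fun j => by simpa using hρ⟩, rfl⟩
  have h1 : Ord 1 fun Z => eval (truncS K a) Z - eval (truncS K a) 0 := by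
    refine (hA.germ.sub (Germ.const _)).ord_one ?_
    filter_upwards [domain_mem_nT hρ hρ] with Z hZ hZ2
    exact sub_eq_zero.2 (hsub (mem_image_of_mem _ ⟨hZ, hZ2⟩) (mem_image_of_mem _ h0))
  have h2 := (hA.sub (hasCoef_const _)).hasOrder h1 0 (by simp [degQ])
  have h3 : eval (truncS K a) 0 = 1 := by
    simp only [Pi.single_eq_same] at h2
    rw [← sub_eq_zero.1 h2]
    simpa [truncS, degQ] using ha0
  rwa [h3] at h1

/-- A vector field with a formal normal form `a · S`, `S ≠ 0`, is normalizable. -/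
lemma normalizable (h : Approx ω Λ V a Φ) (hS : BrjunoGammaOmega ω Λ) (hV : Germ V)
    (hL : sCoef ω Λ L₀ ≠ 0) (hL' : ∀ j, L₀ = Sum.inr j → ω = 0)
    (ha : IsResonant ω Λ (smulS ω Λ a))
    (h1 : ∀ K, 1 ≤ K → Ord 1 fun Z => eval (truncS K a) Z - 1) {r δ ρ : ℝ} (hρ : 0 < ρ)
    (hΦ : IsTorusDiffeo ρ (Φ 1)) (hm : MapsTo (Φ 1) (domain d n ρ ρ) (domain d n r δ)) :
    HolomorphicallyNormalizable ω Λ r δ V := by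
  have hA := h.hasCoef_truncS hV hL
  have hlog : ∀ K, 1 ≤ K → Germ fun Z => -Complex.log (eval (truncS K a) Z) := fun K hK =>
    (germ_log (hA K).germ (h1 K hK)).neg
  have hLS : ∀ K, 1 ≤ K → LS ω Λ (fun Z => -Complex.log (eval (truncS K a) Z)) =ᶠ[nT d n] 0 :=
    fun K hK => LS_log_eq_zero ω Λ (hA K).germ (h1 K hK) (h.LS_eq_zero hV hL ha K)
  refine normalizable_of_approximations hS hV hρ hΦ hm (hlog 1 le_rfl) ?_ (hLS 1 le_rfl)
    (fun K => ?_) hL hL'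
  · have h2 := (ord_log_sub (A' := fun _ => 1) (h1 1 le_rfl) (by simpa using ord_zero_fun)
      (h1 1 le_rfl)).neg
    simpa using h2
  · have hM : 1 ≤ max K 1 := le_max_right _ _
    have hKM : K ≤ max K 1 := le_max_left _ _
    set M := max K 1
    refine ⟨Φ (M + 1), fun Z => -Complex.log (eval (truncS M a) Z), (h.diffeo _).germ,
      h.oEq 1 (M + 1) (by omega), hlog M hM, hLS M hM, ?_, ?_⟩
    · refine OEq.symm (((h.oEq_comp hV hL M).mono (k := K) (by omega)).smul_left (hlog M hM).exp
        |>.trans (OEq.of_eventuallyEq ?_))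
      filter_upwards [eventually_mem_ball_one (h1 M hM)] with Z hZ
      have hne := Complex.slitPlane_ne_zero (ball_one_subset_slitPlane hZ)
      rw [smul_smul, Complex.exp_neg, Complex.exp_log hne, inv_mul_cancel₀ hne, one_smul]
    · have h2 : OEq 2 (eval (truncS M a)) (eval (truncS 1 a)) := by
        refine ((hA M).sub (hA 1)).ord fun p hp => ?_
        simp only [truncS]
        rw [if_pos (by omega), if_pos (by omega), sub_self]
      have h3 := (ord_log_sub (h1 M hM) (h1 1 le_rfl) h2).neg.smul
        (germ_quasilinear ω Λ).ord_zero
      refine h3.congr (Eventually.of_forall fun Z => ?_)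
      simp only
      congr 1
      ring

end

/-- A vector field which is formally conjugate to `0` vanishes. -/
lemma comp_eventuallyEq_zero (h : Approx ω Λ V a Φ) (hV : Germ V)
    (hS : ∀ L : Fin d ⊕ Fin n, sCoef ω Λ L = 0) : (fun Z => V (Φ 1 Z)) =ᶠ[nT d n] 0 := by
  have h1 : ∀ k, Ord (k + 1) fun Z => V (Φ k Z) := fun k => by
    have h2 : Ord (k + 1) (pullField (Φ k) V) := by
      refine ((h.diffeo k).germ_pullField hV).ord_iffV.2 fun L p hp => ?_
      rw [← h.coef k L p (by omega)]
      rcases smulS_cases ω Λ L p with ⟨p', rfl⟩ | h0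
      · rw [smulS_addE, hS, zero_mul]
      · exact h0 a
    refine ((h.diffeo k).germ_fderiv.clm_ord h2).congr ?_
    filter_upwards [(h.diffeo k).isUnit] with Z hZ
    rw [pullField, apply_inverse_apply hZ]
  have hG := h.diffeo 1
  have hW : Germ fun Z => V (Φ 1 Z) := hV.comp_map hG.tendsto hG.germ
  have h2 : ∀ m, Ord m fun Z => V (Φ 1 Z) := fun m => by
    induction m with
    | zero => exact hW.ord_zero
    | succ m ih =>
      obtain ⟨Θ, hΘ, ho⟩ := hG.exists_factor (h.diffeo (m + 1)).germ (h.oEq 1 (m + 1) (by omega))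
        (m + 1)
      have h3 : Ord (m + 1) fun Z => V (Φ 1 (Θ Z)) :=
        OEq.ord (Ord.comp_sub hV (h.diffeo (m + 1)).tendsto (by omega) ho) ((h1 (m + 1)).mono
          (by omega))
      have h4 := (Ord.increment hW ih hΘ.ord le_rfl).mono (k := m + 1) (by omega)
      simpa using h3.sub h4
  refine eventuallyEq_of_comp fun L => ?_
  refine ((hW.comp_of L).hasCoef.eventuallyEq_zero fun p => ?_).trans ?_
  · exact congrFun ((hW.comp_of L).hasCoef.eq_zero fun k => (h2 k).comp_of L) p
  · exact Eventually.of_forall fun Z => by cases L <;> simp [comp]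

/-- A vector field with formal normal form `0` is normalizable. -/
lemma normalizable_of_zero (h : Approx ω Λ V a Φ) (hV : Germ V)
    (hS : ∀ L : Fin d ⊕ Fin n, sCoef ω Λ L = 0) {r δ ρ : ℝ} (hρ : 0 < ρ)
    (hΦ : IsTorusDiffeo ρ (Φ 1)) (hm : MapsTo (Φ 1) (domain d n ρ ρ) (domain d n r δ)) :
    HolomorphicallyNormalizable ω Λ r δ V := by
  obtain ⟨ρ', hρ', h0⟩ := eventually_nT.1 (h.comp_eventuallyEq_zero hV hS)
  have hq : ∀ Z, quasilinear ω Λ Z = 0 := fun Z => by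
    refine Prod.ext (funext fun j => hS (Sum.inl j)) (funext fun j => ?_)
    have : Λ j = 0 := hS (Sum.inr j)
    simp [quasilinear, this]
  refine normalizable_of_conjugacy (ρ := min ρ ρ') (Ψ := fun Z => Z) (h := fun _ => 0) hΦ hm
    (by positivity) (by simpa using Holo.const (0 : Phase d n)) (fun δ' h1 h2 Z hZ v => ?_)
    (Holo.const 0) (fun Z _ => by simp [LS]) (fun Z _ _ => ⟨rfl, rfl⟩)
    (domain_mono (min_le_left _ _) (min_le_left _ _)) fun Z hZ => ?_
  · have h3 : fderiv ℂ (fun Z : Phase d n => Z - Z) Z v = 0 := by simp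
    have h4 := gn_nonneg δ' v
    rw [h3, show gn δ' (0 : Phase d n) = 0 by simp [gn]]
    positivity
  · have h1 : V (Φ 1 Z) = 0 := h0 Z (domain_mono (min_le_right _ _) (min_le_right _ _) hZ)
    rw [pullField, h1, hq, map_zero, map_zero, smul_zero]

end Approx

/-- A perturbation of `S` which has a formal normal form `a · S` is normalizable. -/
theorem normalizable_of_brjunoA (hS : BrjunoGammaOmega ω Λ) {r δ : ℝ}
    {R : Phase d n → Phase d n} (hR : Germ R) (hR1 : Ord 1 fun Z => (R Z).1)
    (hR2 : Ord 2 fun Z => (R Z).2) (hA : BrjunoA ω Λ r δ fun Z => quasilinear ω Λ Z + R Z) :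
    HolomorphicallyNormalizable ω Λ r δ fun Z => quasilinear ω Λ Z + R Z := by
  obtain ⟨a, ha, ha0, har, hc⟩ := hA
  obtain ⟨Φ, hΦ, ρ, hρ, hd, hm⟩ := exists_approx ha hc
  have hV := (germ_quasilinear ω Λ).add hR
  by_cases hω : ω = 0
  · by_cases hΛ : Λ = 0
    · refine hΦ.normalizable_of_zero hV (fun L => ?_) hρ hd hm
      cases L <;> simp [sCoef, hω, hΛ]
    · obtain ⟨i, hi⟩ := Function.ne_iff.1 hΛ
      subst hω
      exact hΦ.normalizable (L₀ := Sum.inr i) hS hV hi (fun _ _ => rfl) har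
        (fun K hK => hΦ.ord_sub_one_inr hV hi (by simpa using hR2) ha0 hK) hρ hd hm
  · obtain ⟨j, hj⟩ := Function.ne_iff.1 hω
    refine hΦ.normalizable (L₀ := Sum.inl j) hS hV (by simpa [sCoef] using hj)
      (fun _ h => by simp at h) har
      (fun K _ => hΦ.ord_sub_one_inl hV hj har (by simpa using hR1) K) hρ hd hm

end

end TorusNF

theorem mainTheorem1 {d n : ℕ} (ω : Fin d → ℝ) (Λ : Fin n → ℂ)
    (hS : TorusNF.BrjunoGammaOmega ω Λ) :
    ∃ ζ₀ : ℝ, 0 < ζ₀ ∧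
      ∀ (r δ : ℝ), 0 < r → 0 < δ →
      ∀ (R : TorusNF.Phase d n → TorusNF.Phase d n) (c : TorusNF.FormalVF d n),
        (∀ L, TorusNF.IsDevelopment r δ (fun Z => TorusNF.comp (R Z) L) (c L)) →
        (∀ j, TorusNF.HasOrder 1 (c (Sum.inl j))) →
        (∀ j, TorusNF.HasOrder 2 (c (Sum.inr j))) →
        (∀ L, TorusNF.wnorm r δ (c L) ≤ ENNReal.ofReal ζ₀) →
        TorusNF.BrjunoA ω Λ r δ (fun Z => TorusNF.quasilinear ω Λ Z + R Z) →
        TorusNF.HolomorphicallyNormalizable ω Λ r δ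
          (fun Z => TorusNF.quasilinear ω Λ Z + R Z) := by
  refine ⟨1, one_pos, fun r δ hr hδ R c hc h1 h2 _ hA => ?_⟩
  have hco := fun L => (hc L).hasCoef hr hδ
  refine TorusNF.normalizable_of_brjunoA hS (TorusNF.germ_of_comp fun L => (hco L).germ) ?_ ?_ hA
  · exact Asymptotics.isBigO_pi.2 fun j => (hco (Sum.inl j)).ord (h1 j)
  · exact Asymptotics.isBigO_pi.2 fun j => (hco (Sum.inr j)).ord (h2 j)
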